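/- Let $0<\gamma<\pi/2$ with $\cos^2\gamma\neq\sin^2\gamma$, let $\nu_0,\kappa_0>0$, let $\chi\in C_c^\infty(\mathbb R)$ be real valued, and let $(k_0,m_0)\in\mathbb R^2$, $k_0\ne0$, satisfy the criticality relation $\frac{(k_0\cos\gamma-m_0\sin\gamma)^2}{k_0^2+m_0^2}=\sin^2\gamma$. For $\varepsilon>0$ put $\nu=\nu_0\varepsilon^6$, $\kappa=\kappa_0\varepsilon^6$. **Modes.** For real $\omega,k$ and $\lambda\in\mathbb C$ let $$A_{\omega,k}(\lambda)=\begin{pmatrix}-i\omega+\nu(k^2-\lambda^2)&0&-\sin\gamma&ik\\0&-i\omega+\nu(k^2-\lambda^2)&-\cos\gamma&-\lambda\\ \sin\gamma&\cos\gamma&-i\omega+\kappa(k^2-\lambda^2)&0\\ ik&-\lambda&0&0\end{pmatrix}.$$ Let $\lambda_2,\lambda_3,\lambda_5$ be the roots of $\det A_{\omega,k}$ with positive real part, ordered by increasing modulus, and set $U_\lambda=1$, $W_\lambda=\frac{ik}{\lambda}$, $B_\lambda=\frac{\sin\gamma+\frac{ik}{\lambda}\cos\gamma}{i\omega-\kappa(k^2-\lambda^2)}$.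 For $(\mathfrak u,\mathfrak w,\mathfrak b)\in\mathbb C^3$ the amplitudes lifting $(\mathfrak u,\mathfrak w,\mathfrak b)$ at $(\omega,k)$ are the solution $(a_2,a_3,a_5)$ of $$\sum_j a_j=\mathfrak u,\qquad \sum_j W_{\lambda_j}a_j=\mathfrak w,\qquad -\sum_j\lambda_jB_{\lambda_j}a_j=\mathfrak b .$$ **Incident packet and its layer.** Let $\omega_{k,m}=\pm\frac{k\cos\gamma-m\sin\gamma}{\sqrt{k^2+m^2}}$, with the sign for which $\partial_m\omega_{k,m}<0$ (group velocity directed towards $y=0$), and $\omega_0=\omega_{k_0,m_0}$. Denote by $\lambda_j(k,m)$, $(U,W,B)$ the rates and modes at $(\omega_{k,m},k)$, and by $a_j(k,m)$ the amplitudes lifting $\big(1,-\frac km,-\frac{k\cos\gamma-m\sin\gamma}{\omega_{k,m}}\big)$. Write $\omega=\omega_{k,m}$, $\omega'=\omega_{k',m'}$; $\lambda,a,U,W$ for the quantities of index $j$ at $(k,m)$, and $\lambda',a',U',B'$ for those of index $j'$ at $(k',m')$. **Type (a) source.** The quadratic interactions of the $\varepsilon^2$ boundary layer (modes $j=2,3$)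 with itself, and of the incident packet with the $\varepsilon^2$ boundary layer, generate on $y=0$ a trace of $(u,w,\partial_yb)$ with coefficients $$\begin{pmatrix}\mathfrak u_{(a)}\\\mathfrak w_{(a)}\\\mathfrak b_{(a)}\end{pmatrix}=\frac12\sum_{j,j'\in\{2,3\}}\sum_\pm aa'\frac{k'U+i\lambda'W}{-(\omega+\omega')\pm\sin\gamma}(U'\pm iB')\begin{pmatrix}1\\\frac{i(k+k')}{\lambda+\lambda'}\\\pm i(\lambda+\lambda')\end{pmatrix}+\frac\sigma2\sum_{j'\in\{2,3\}}\sum_\pm a'\frac{k'-i\lambda'\frac km}{-(\omega+\omega')\pm\sin\gamma}(U'\pm iB')\begin{pmatrix}1\\\frac{i(k+k')}{\lambda'-im}\\\pm i(\lambda'-im)\end{pmatrix},$$ where $\sigma=-1$ if the layer is counted with the minus sign with which it cancels the incident trace; the statement holds for both $\sigma=1$ and $\sigma=-1$. Let $$\mathcal A_{II}=\frac1{\varepsilon^4}\sum_{\eta=\pm1}\chi\Big(\tfrac{k+\eta k_0}{\varepsilon^2}\Big)\chi\Big(\tfrac{m+\eta m_0}{\varepsilon^2}\Big)\chi\Big(\tfrac{k'+\eta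 k_0}{\varepsilon^2}\Big)\chi\Big(\tfrac{m'+\eta m_0}{\varepsilon^2}\Big),$$ let $\Lambda_2,\Lambda_3,\Lambda_5$ be the rates at $(\omega+\omega',k+k')$, let $\alpha_2,\alpha_3,\alpha_5$ be the amplitudes lifting $(\mathfrak u_{(a)},\mathfrak w_{(a)},\mathfrak b_{(a)})$ at $(\omega+\omega',k+k')$, and $$\mathcal W_j(t,x,y)=\delta\int_{\mathbb R^4}\mathcal A_{II}\,\alpha_j\,e^{i((k+k')x-(\omega+\omega')t)-\Lambda_jy}\begin{pmatrix}U_{\Lambda_j}\\W_{\Lambda_j}\\B_{\Lambda_j}\end{pmatrix}dk\,dk'\,dm\,dm'.$$ The $\varepsilon^3$ boundary layer corrector is $\mathcal W_{BL}=\mathcal W_3+\mathcal W_5$ and the second harmonic is $\mathcal W_{II}=\mathcal W_2$. **Claim.** For all small $\varepsilon$ these objects are well defined: wherever $\mathcal A_{II}\ne0$, at each of $(\omega,k)$, $(\omega',k')$, $(\omega+\omega',k+k')$, there are exactly three roots with positive real part; $|\lambda_3|<|\lambda_5|$ at the first two and $|\Lambda_2|<|\Lambda_3|$ at the last; the linear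 systems are uniquely solvable; and the integrals converge absolutely for $y\ge0$. There are constants $C,c,\varepsilon_*>0$, depending only on $\gamma,\nu_0,\kappa_0,k_0,m_0,\chi,\sigma$, such that for all $0<\varepsilon<\varepsilon_*$, $\delta>0$ and $t\in\mathbb R$, with norms on $\mathbb R^2_+=\{(x,y):y>0\}$: 1. $\|\mathcal W_{BL}(t)\|_{L^2}\le C\delta\varepsilon^{1/2}$ and $\|\mathcal W_{BL}(t)\|_{L^\infty}\le C\delta$. 2. If $\sin\gamma>1/2$, the second harmonic is evanescent, $|\mathcal W_{II}(t,x,y)|\le C\delta\varepsilon^2e^{-cy}$ for all $x\in\mathbb R$, $y\ge0$, and $\|\mathcal W_{II}(t)\|_{L^2}\le C\delta\varepsilon$, $\|\mathcal W_{II}(t)\|_{L^\infty}\le C\delta\varepsilon^2$. 3. If $\sin\gamma<1/2$, the second harmonic is a wave packet propagating away from the boundary: there are $s\in\{\pm1\}$ and $M\in\mathbb R$ such that $\Omega(m)=s\frac{2k_0\cos\gamma-m\sin\gamma}{\sqrt{4k_0^2+m^2}}$ satisfies $\Omega(M)=2\omega_0$ and $\Omega'(M)>0$, and wherever $\mathcal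 A_{II}\ne0$ one has $0<\Re\Lambda_2\le C\varepsilon^4$ and, for some $\eta\in\{\pm1\}$, $|k+k'-2\eta k_0|+|\omega+\omega'-2\eta\omega_0|+|\Lambda_2+i\eta M|\le C\varepsilon^2$. Moreover $\|\mathcal W_{II}(t)\|_{L^2}\le C\delta$ and $\|\mathcal W_{II}(t)\|_{L^\infty}\le C\delta\varepsilon^2$. -/

import Mathlib

noncomputable section

namespace NearCritical

open MeasureTheory

/-- Values of the triple `(u, w, b)`. -/
abbrev State : Type := EuclideanSpace ℂ (Fin 3)

/-! ### Linear modes of the viscous system in the half-plane -/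

/-- The matrix of the linear viscous Boussinesq system acting on the amplitudes `(U, W, B, P)` of
a mode `exp (i (k x - ω t) - lam y)`. -/
def waveMatrix (γ ν κ ω k : ℝ) (lam : ℂ) : Matrix (Fin 4) (Fin 4) ℂ :=
  !![-Complex.I * ω + ν * ((k : ℂ) ^ 2 - lam ^ 2), 0, -(Real.sin γ : ℂ), Complex.I * k;
     0, -Complex.I * ω + ν * ((k : ℂ) ^ 2 - lam ^ 2), -(Real.cos γ : ℂ), -lam;
     (Real.sin γ : ℂ), (Real.cos γ : ℂ), -Complex.I * ω + κ * ((k : ℂ) ^ 2 - lam ^ 2), 0;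
     Complex.I * k, -lam, 0, 0]

/-- The decay rates: roots with positive real part of `det (waveMatrix lam)`. -/
def decayRates (γ ν κ ω k : ℝ) : Set ℂ :=
  {lam | 0 < lam.re ∧ (waveMatrix γ ν κ ω k lam).det = 0}

/-- `L` lists the decay rates, which are three in number, by increasing modulus. -/
def IsRateTriple (γ ν κ ω k : ℝ) (L : Fin 3 → ℂ) : Prop :=
  Function.Injective L ∧ Set.range L = decayRates γ ν κ ω k ∧ ‖L 0‖ ≤ ‖L 1‖ ∧ ‖L 1‖ ≤ ‖L 2‖

open Classical in
/-- The three decay rates `lam_2, lam_3, lam_5`, in this order, indexed by `0, 1, 2`. Near the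
critical frequency the first two have size `ε⁻²` and the last one has size `ε⁻³`; away from it the
first one has size `1` and the last two have size `ε⁻³`. -/
def rate (γ ν κ ω k : ℝ) : Fin 3 → ℂ :=
  if h : ∃ L, IsRateTriple γ ν κ ω k L then h.choose else 0

/-- The normal velocity `W` of the mode of rate `lam` normalized by `U = 1`. -/
def modeW (k : ℝ) (lam : ℂ) : ℂ := Complex.I * k / lam

/-- The buoyancy `B` of the mode of rate `lam` normalized by `U = 1`. -/
def modeB (γ κ ω k : ℝ) (lam : ℂ) : ℂ :=
  (Real.sin γ + Complex.I * k / lam * Real.cos γ) /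
    (Complex.I * ω - κ * ((k : ℂ) ^ 2 - lam ^ 2))

/-- The vector `(U, W, B)` of the mode of rate `lam` normalized by `U = 1`. -/
def mode (γ κ ω k : ℝ) (lam : ℂ) : State :=
  !₂[1, modeW k lam, modeB γ κ ω k lam]

/-- The matrix whose `j`-th column is the trace of `(u, w, ∂_y b)` at `y = 0` of the `j`-th mode. -/
def liftMatrix (γ ν κ ω k : ℝ) : Matrix (Fin 3) (Fin 3) ℂ :=
  Matrix.of ![fun _ => 1,
    fun j => modeW k (rate γ ν κ ω k j),
    fun j => -(rate γ ν κ ω k j) * modeB γ κ ω k (rate γ ν κ ω k j)]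

/-- The amplitudes of the three decaying modes whose sum has trace
`(u, w, ∂_y b) = d * exp (i (k x - ω t))` at `y = 0`. -/
def liftAmplitude (γ ν κ ω k : ℝ) (d : Fin 3 → ℂ) : Fin 3 → ℂ :=
  (liftMatrix γ ν κ ω k)⁻¹.mulVec d

/-! ### The incident packet and its boundary layer -/

/-- The inviscid frequency of the wave vector `(k, m)`, on the branch whose group velocity points
towards the boundary: the normal component of the group velocity of
`s (k cos γ - m sin γ) / |(k, m)|` is `- s k (m cos γ + k sin γ) / |(k, m)| ^ 3`. -/
def freq (γ k m : ℝ) : ℝ :=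
  Real.sign (k * (m * Real.cos γ + k * Real.sin γ)) *
    ((k * Real.cos γ - m * Real.sin γ) / √(k ^ 2 + m ^ 2))

/-- The rates of the boundary layer modes attached to the incident wave `(k, m)`. -/
def incRate (γ ν κ k m : ℝ) : Fin 3 → ℂ := rate γ ν κ (freq γ k m) k

/-- The trace of `(u, w, ∂_y b)` for the incident plane wave
`(1, -k/m, i (k cos γ - m sin γ) / (m ω)) exp (i (k x + m y - ω t))`. -/
def incTrace (γ k m : ℝ) : Fin 3 → ℂ :=
  ![1, -(k : ℂ) / m,
    -((k * Real.cos γ - m * Real.sin γ : ℝ) : ℂ) / (freq γ k m : ℂ)]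

/-- The amplitudes `a_j (k, m)`: the boundary layer of the incident packet is
`- ∫ Â(k, m) ∑_j a_j (k, m) exp (i (k x - ω t) - lam_j y) (U, W, B)_j dk dm`. -/
def incAmplitude (γ ν κ k m : ℝ) : Fin 3 → ℂ :=
  liftAmplitude γ ν κ (freq γ k m) k (incTrace γ k m)

/-! ### Type (a) interactions -/

/-- The contribution to the boundary trace of the interaction of a carrier
`(U, W) exp (i (k x - ω t) - μ y)` with the `j'`-th boundary layer mode of `(k', m')`. -/
def pairTrace (γ ν κ k m k' m' : ℝ) (μ W : ℂ) (j' : Fin 3) : Fin 3 → ℂ :=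
  let lam' := incRate γ ν κ k' m' j'
  let B' := modeB γ κ (freq γ k' m') k' lam'
  (1 / 2 : ℂ) • ∑ s ∈ ({1, -1} : Finset ℤ),
    (incAmplitude γ ν κ k' m' j' * ((k' + Complex.I * lam' * W) /
        (-((freq γ k m + freq γ k' m' : ℝ) : ℂ) + s * Real.sin γ)) *
        (1 + s * Complex.I * B')) •
      ![1, Complex.I * (k + k' : ℝ) / (μ + lam'), s * Complex.I * (μ + lam')]

/-- The coefficients `(𝔲, 𝔴, 𝔟)` of the boundary trace of `(u, w, ∂_y b)` generated by the type (a)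
interactions: the first sum comes from the interaction of the `ε²` boundary layer with itself, the
second one from the interaction of the incident packet with the `ε²` boundary layer. The `ε²`
boundary layer consists of the modes `0` and `1`. The number `σ` is the relative sign of the second
sum. -/
def sourceTrace (γ ν κ σ k m k' m' : ℝ) : Fin 3 → ℂ :=
  (∑ j ∈ ({0, 1} : Finset (Fin 3)), ∑ j' ∈ ({0, 1} : Finset (Fin 3)),
    incAmplitude γ ν κ k m j •
      pairTrace γ ν κ k m k' m' (incRate γ ν κ k m j) (modeW k (incRate γ ν κ k m j)) j') +
  (σ : ℂ) • ∑ j' ∈ ({0, 1} : Finset (Fin 3)),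
      pairTrace γ ν κ k m k' m' (-Complex.I * m) (-(k : ℂ) / m) j'

/-- The part of `Â(k, m) Â(k', m')` supported near `± (2 k₀, 2 m₀)` in `(k + k', m + m')`. -/
def weightII (k₀ m₀ : ℝ) (χ : ℝ → ℝ) (ε k m k' m' : ℝ) : ℝ :=
  1 / ε ^ 4 * ∑ η ∈ ({1, -1} : Finset ℤ),
    (χ ((k + η * k₀) / ε ^ 2) * χ ((m + η * m₀) / ε ^ 2)) *
      (χ ((k' + η * k₀) / ε ^ 2) * χ ((m' + η * m₀) / ε ^ 2))

/-- The rates `Λ_2, Λ_3, Λ_5` attached to the wave number `k + k'` and frequency `ω + ω'`. -/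
def rateII (γ ν κ k m k' m' : ℝ) : Fin 3 → ℂ :=
  rate γ ν κ (freq γ k m + freq γ k' m') (k + k')

/-- The amplitudes `α_2, α_3, α_5` lifting the trace generated by the type (a) interactions. -/
def amplitudeII (γ ν κ σ k m k' m' : ℝ) : Fin 3 → ℂ :=
  liftAmplitude γ ν κ (freq γ k m + freq γ k' m') (k + k') (sourceTrace γ ν κ σ k m k' m')

/-- The integrand, at `p = (k, k', m, m')`, of the `j`-th mode of the corrector, in the scaling
`ν = ν₀ ε⁶`, `κ = κ₀ ε⁶`. -/
def integrandII (γ ν₀ κ₀ k₀ m₀ : ℝ) (χ : ℝ → ℝ) (σ ε t x y : ℝ) (j : Fin 3)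
    (p : ℝ × ℝ × ℝ × ℝ) : State :=
  let k := p.1
  let k' := p.2.1
  let m := p.2.2.1
  let m' := p.2.2.2
  let ν := ν₀ * ε ^ 6
  let κ := κ₀ * ε ^ 6
  let ω := freq γ k m + freq γ k' m'
  let lam := rateII γ ν κ k m k' m' j
  ((weightII k₀ m₀ χ ε k m k' m' : ℂ) * amplitudeII γ ν κ σ k m k' m' j *
      Complex.exp (Complex.I * (((k + k') * x - ω * t : ℝ) : ℂ) - lam * y)) •
    mode γ κ ω (k + k') lam

/-- The `ε³` boundary layer corrector generated by the type (a) interactions at frequencies close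
to `± 2 ω₀`. -/
def layerII (γ ν₀ κ₀ k₀ m₀ : ℝ) (χ : ℝ → ℝ) (σ ε δ t x y : ℝ) : State :=
  δ • ∑ j ∈ ({1, 2} : Finset (Fin 3)), ∫ p, integrandII γ ν₀ κ₀ k₀ m₀ χ σ ε t x y j p

/-- The second harmonic generated by the type (a) interactions. -/
def secondHarmonic (γ ν₀ κ₀ k₀ m₀ : ℝ) (χ : ℝ → ℝ) (σ ε δ t x y : ℝ) : State :=
  δ • ∫ p, integrandII γ ν₀ κ₀ k₀ m₀ χ σ ε t x y 0 p

/-! ### Vocabulary of the estimates -/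

/-- Every object above is given by its defining equations on the support of the wave packet: there
are exactly three decay rates, the two groups of modes are separated by their moduli, and the
linear systems for the amplitudes are uniquely solvable. -/
def ModesWellDefined (γ ν₀ κ₀ k₀ m₀ : ℝ) (χ : ℝ → ℝ) (ε : ℝ) : Prop :=
  let ν := ν₀ * ε ^ 6
  let κ := κ₀ * ε ^ 6
  ∀ k m k' m' : ℝ, weightII k₀ m₀ χ ε k m k' m' ≠ 0 →
    (∀ q ∈ ({(k, m), (k', m')} : Set (ℝ × ℝ)),
      IsRateTriple γ ν κ (freq γ q.1 q.2) q.1 (incRate γ ν κ q.1 q.2) ∧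
      ‖incRate γ ν κ q.1 q.2 1‖ < ‖incRate γ ν κ q.1 q.2 2‖ ∧
      (liftMatrix γ ν κ (freq γ q.1 q.2) q.1).det ≠ 0) ∧
    IsRateTriple γ ν κ (freq γ k m + freq γ k' m') (k + k') (rateII γ ν κ k m k' m') ∧
    ‖rateII γ ν κ k m k' m' 0‖ < ‖rateII γ ν κ k m k' m' 1‖ ∧
    (liftMatrix γ ν κ (freq γ k m + freq γ k' m') (k + k')).det ≠ 0

/-- Lebesgue measure on the half-plane `{(x, y) | 0 < y}`. -/
def halfPlane : Measure (ℝ × ℝ) := (volume : Measure (ℝ × ℝ)).restrict {z | 0 < z.2}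

/-- The field `F` belongs to `L^p` of the half-plane, with norm at most `R`. -/
def NormLE (F : ℝ → ℝ → State) (p : ENNReal) (R : ℝ) : Prop :=
  AEStronglyMeasurable (fun z : ℝ × ℝ => F z.1 z.2) halfPlane ∧
    eLpNorm (fun z : ℝ × ℝ => F z.1 z.2) p halfPlane ≤ ENNReal.ofReal R

/-- The second harmonic is, up to `O(ε²)` in the wave vectors and frequencies, made of plane waves
`exp (± i (2 k₀ x + M y - 2 ω₀ t))` with a real `M` satisfying the inviscid dispersion relation
`2 ω₀ = s (2 k₀ cos γ - M sin γ) / |(2 k₀, M)|`, whose group velocity has normal component `v > 0`,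
and the decay rate of its modes in `y` is `O(ε⁴)`. -/
def IsOutgoingPacket (γ ν₀ κ₀ k₀ m₀ : ℝ) (χ : ℝ → ℝ) : Prop :=
  ∃ s M v : ℝ, (s = 1 ∨ s = -1) ∧ 0 < v ∧
    s * ((2 * k₀ * Real.cos γ - M * Real.sin γ) / √((2 * k₀) ^ 2 + M ^ 2)) =
      2 * freq γ k₀ m₀ ∧
    HasDerivAt
      (fun n : ℝ => s * ((2 * k₀ * Real.cos γ - n * Real.sin γ) / √((2 * k₀) ^ 2 + n ^ 2))) v M ∧
    ∃ C > 0, ∃ ε₀ > 0, ∀ ε : ℝ, 0 < ε → ε < ε₀ → ∀ k m k' m' : ℝ,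
      weightII k₀ m₀ χ ε k m k' m' ≠ 0 →
      let lam := rateII γ (ν₀ * ε ^ 6) (κ₀ * ε ^ 6) k m k' m' 0
      0 < lam.re ∧ lam.re ≤ C * ε ^ 4 ∧
      ∃ η : ℝ, (η = 1 ∨ η = -1) ∧
        |k + k' - η * (2 * k₀)| ≤ C * ε ^ 2 ∧
        |freq γ k m + freq γ k' m' - η * (2 * freq γ k₀ m₀)| ≤ C * ε ^ 2 ∧
        ‖lam - -(Complex.I * (η * M : ℝ))‖ ≤ C * ε ^ 2

end NearCritical

end

/-!
The corrector is a superposition of the modes `exp (i K x - i Ω t - Λ y)`, with `Ω = ω + ω'` and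
`K = k + k'`, on two boxes of size `ε²` around `± (k₀, k₀, m₀, m₀)`. The theorem follows from the
sizes of the rates `Λ` and of the amplitudes as `ε` tends to `0`, uniformly on the boxes, and from
Plancherel estimates for oscillating integrals.

**Rates.** The characteristic polynomial has degree six and a nonzero imaginary part on the
imaginary axis, so the variation of its argument along this axis vanishes, and it has exactly
three roots of positive real part (`card_re_pos_eq_card_re_neg`, `exists_symb_eq_prod_three`). Its
asymptotics are computed as limits along ultrafilters: if a product `∏ (z - r j)` converges for
all `z`, then each root converges (`exists_tendsto_roots`). At the critical frequency
`|ω₀| = sin γ`, two decay rates have size `ε⁻²` and the third one has size `ε⁻³`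
(`exists_tendsto_critical_rates`). At the doubled frequency, one rate converges to a root of the
inviscid equation, and two have size `ε⁻³` (`exists_tendsto_supercritical_rates`).

**Amplitudes.** A scaling of the rows and of the columns gives the lifting matrices invertible
limits. The amplitudes of the `ε²` boundary layer have size `ε⁻²` (`tendsto_critical_amplitude`),
the trace `(u, w, ∂_y b)` of the source has size `(ε⁻⁴, ε⁻², ε⁻⁶)` (`tendsto_srcTrace`), and the
amplitudes of the corrector have sizes `ε⁻²`, `ε⁻⁴`, `ε⁻⁴` (`tendsto_supercritical_amplitude`). A
function which has a finite limit along every ultrafilter finer than a given filter is bounded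
along this filter (`exists_eventually_norm_le`), and this makes the estimates uniform on the boxes
(`boxFilter`).

**Measurability.** The rates are chosen as an ordered triple, and the order of the first two rates
of the incident layer need not depend continuously on the wave vector. The source is symmetric in
these two rates (`srcTrace_swap`), so the amplitudes of the corrector are continuous all the same
(`IsRegularPair.continuousOn`).

**Estimates.** The bounds in `L^∞` come from the volume `ε⁸` of the boxes and the size `ε⁻⁴` of
the weight. For the bounds in `L²`, the square is expanded against a Gaussian weight, whose
Fourier transform is integrated over the box (`lintegral_sq_exp_le`, `lintegral_sq_exp_le₂`). For
the boundary layers and the evanescent harmonic, the orthogonality in `x` and the decay in `y` are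
enough (`normLE_integral`).

If `sin γ < 1 / 2`, then `|2 ω₀| < 1` and the rate of the second harmonic satisfies
`Λ = i μ + ρ ε⁶ + O(ε⁸)`, where `μ` is a root of the dispersion relation and `ρ > 0` does not
depend on the wave vectors (`IsNear.exists_isBigO_rate`). Among the two roots `μ`, the positivity
of `Re Λ` selects the one whose group velocity points away from the boundary
(`exists_hasDerivAt_dispersion`). The decay is then too weak for an estimate by the decay alone,
but `μ` varies at first order with `m'` (`IsNear.exists_le_waveNum_sub`), so the main term is
orthogonal in both variables `x` and `y`, and the remainder gains the factor `ε²`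
(`normLE_packet_of_dispersive`).
-/

noncomputable section

namespace NearCritical

open MeasureTheory Filter Topology Complex

/-! ### The characteristic polynomial and the number of decay rates -/

/-- The characteristic polynomial of the viscous modes, with `s` and `c` in place of `sin γ` and
`cos γ`. -/
def symb (s c ν κ ω k : ℝ) (z : ℂ) : ℂ :=
  (-I * ω + ν * ((k : ℂ) ^ 2 - z ^ 2)) * (-I * ω + κ * ((k : ℂ) ^ 2 - z ^ 2)) *
    ((k : ℂ) ^ 2 - z ^ 2) - (s * z + I * c * k) ^ 2

theorem det_waveMatrix (γ ν κ ω k : ℝ) (z : ℂ) :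
    (waveMatrix γ ν κ ω k z).det = symb (Real.sin γ) (Real.cos γ) ν κ ω k z := by
  unfold waveMatrix symb
  rw [Matrix.det_succ_row_zero]
  simp [Fin.sum_univ_succ, Matrix.det_fin_three, Fin.succAbove]
  ring_nf
  simp only [I_sq, I_pow_three, I_pow_four]
  ring

/-- The characteristic polynomial does not vanish on the imaginary axis, because its imaginary part
has a constant sign there. -/
theorem symb_I_mul_im (s c ν κ ω k μ : ℝ) :
    (symb s c ν κ ω k (I * μ)).im = -(ω * (ν + κ) * (k ^ 2 + μ ^ 2) ^ 2) := by
  have h : symb s c ν κ ω k (I * μ) =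
      ((-ω ^ 2 + ν * κ * (k ^ 2 + μ ^ 2) ^ 2) * (k ^ 2 + μ ^ 2) + (s * μ + c * k) ^ 2 : ℝ) +
      (-(ω * (ν + κ) * (k ^ 2 + μ ^ 2) ^ 2) : ℝ) * I := by
    unfold symb
    have h5 : I ^ 5 = I := by rw [pow_succ, I_pow_four, one_mul]
    have h6 : I ^ 6 = -1 := by rw [pow_succ, h5, I_mul_I]
    push_cast
    ring_nf
    simp only [I_sq, I_pow_three, I_pow_four, h5, h6]
    ring_nf
  rw [h, add_im, ofReal_im, im_ofReal_mul, I_im, zero_add, mul_one]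

/-- A root of positive real part contributes `π` to the variation of the argument along the
imaginary axis, a root of negative real part contributes `-π`. If the product of the six factors
has a nonzero imaginary part everywhere, then its argument has no variation, and hence the roots
are equally distributed. -/
theorem card_re_pos_eq_card_re_neg {r : Fin 6 → ℂ} (hr : ∀ i, (r i).re ≠ 0)
    (him : ∀ μ : ℝ, (∏ i, ((μ : ℂ) + I * r i)).im ≠ 0) :
    (Finset.univ.filter fun i => 0 < (r i).re).card =
      (Finset.univ.filter fun i => (r i).re < 0).card := by
  set p : ℝ → ℂ := fun μ => ∏ i, ((μ : ℂ) + I * r i) with hp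
  have hpc : Continuous p := by fun_prop
  have him' : ∀ i (μ : ℝ), ((μ : ℂ) + I * r i).im ≠ 0 := fun i μ => by simpa using hr i
  set S : ℝ → ℝ := fun μ => ∑ i, arg ((μ : ℂ) + I * r i) with hS
  have hSc : Continuous S := by
    refine continuous_finsetSum _ fun i _ => continuous_iff_continuousAt.2 fun μ => ?_
    refine ContinuousAt.comp (f := fun μ : ℝ => (μ : ℂ) + I * r i)
      (continuousAt_arg (Or.inr (him' i μ))) (by fun_prop)
  have hac : Continuous fun μ => arg (p μ) :=
    continuous_iff_continuousAt.2 fun μ => ContinuousAt.comp (f := p)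
      (continuousAt_arg (Or.inr (him μ))) hpc.continuousAt
  -- the sum `S` of the arguments of the factors is a continuous determination of the argument of
  -- `p`, so it differs from `arg (p μ)` by a constant multiple of `2π`
  have hint : ∀ μ, ∃ n : ℤ, S μ - arg (p μ) = n * (2 * Real.pi) := by
    intro μ
    have h1 : (‖p μ‖ : ℂ) * exp (S μ * I) = p μ := by
      simp only [hS, hp, norm_prod]
      push_cast
      rw [Finset.sum_mul, exp_sum, ← Finset.prod_mul_distrib]
      exact Finset.prod_congr rfl fun i _ => norm_mul_exp_arg_mul_I _
    have h2 := norm_mul_exp_arg_mul_I (p μ)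
    have h0 : (‖p μ‖ : ℂ) ≠ 0 := by
      have : p μ ≠ 0 := fun h => him μ (by
        rw [show (∏ i, ((μ : ℂ) + I * r i)) = p μ from rfl, h]
        simp)
      simpa using this
    have h3 := mul_left_cancel₀ h0 (h1.trans h2.symm)
    obtain ⟨n, hn⟩ := Complex.exp_eq_exp_iff_exists_int.1 h3
    refine ⟨n, ?_⟩
    have h4 : ((S μ - arg (p μ) : ℝ) : ℂ) * I = ((n * (2 * Real.pi) : ℝ) : ℂ) * I := by
      push_cast
      linear_combination hn
    exact_mod_cast mul_right_cancel₀ I_ne_zero h4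
  choose N hN using hint
  have hNc : Continuous N := by
    rw [Int.isClosedEmbedding_coe_real.isInducing.continuous_iff]
    have : (Int.cast ∘ N : ℝ → ℝ) = fun μ => (S μ - arg (p μ)) / (2 * Real.pi) := by
      funext μ
      rw [Function.comp_apply, hN, mul_div_cancel_right₀ _ Real.two_pi_pos.ne']
    exact this ▸ (hSc.sub hac).div_const _
  have hconst : ∀ μ, N μ = N 0 := fun μ =>
    isPreconnected_univ.constant hNc.continuousOn (Set.mem_univ _) (Set.mem_univ _)
  -- normalized factors tend to `1` at both ends
  have hfac : ∀ (l : Filter ℝ), Tendsto (fun μ : ℝ => (μ : ℂ)⁻¹) l (𝓝 0) →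
      (∀ᶠ μ : ℝ in l, μ ≠ 0) →
      ∀ i, Tendsto (fun μ : ℝ => ((μ : ℂ)⁻¹ * ((μ : ℂ) + I * r i))) l (𝓝 1) := by
    intro l hl hne i
    have : Tendsto (fun μ : ℝ => 1 + (μ : ℂ)⁻¹ * (I * r i)) l (𝓝 (1 + 0 * (I * r i))) :=
      tendsto_const_nhds.add (hl.mul_const _)
    rw [zero_mul, add_zero] at this
    refine this.congr' ?_
    filter_upwards [hne] with μ hμ
    have : (μ : ℂ) ≠ 0 := by exact_mod_cast hμ
    field_simp
  have harg1 : ∀ (l : Filter ℝ) (f : ℝ → ℂ), Tendsto f l (𝓝 1) →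
      Tendsto (fun μ => arg (f μ)) l (𝓝 0) := by
    intro l f hf
    have := (continuousAt_arg (x := 1) (by simp)).tendsto.comp hf
    simpa [Function.comp_def] using this
  have hparg : ∀ (l : Filter ℝ), Tendsto (fun μ : ℝ => (μ : ℂ)⁻¹) l (𝓝 0) →
      (∀ᶠ μ : ℝ in l, μ ≠ 0) → Tendsto (fun μ => arg (p μ)) l (𝓝 0) := by
    intro l hl hne
    have h1 : Tendsto (fun μ : ℝ => ∏ i, ((μ : ℂ)⁻¹ * ((μ : ℂ) + I * r i))) l
        (𝓝 (∏ _i : Fin 6, 1)) :=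
      tendsto_finsetProd _ fun i _ => hfac l hl hne i
    rw [Finset.prod_const_one] at h1
    refine (harg1 l _ h1).congr' ?_
    filter_upwards [hne] with μ hμ
    rw [Finset.prod_mul_distrib, Finset.prod_const, Finset.card_univ, Fintype.card_fin]
    have : ((μ : ℂ)⁻¹) ^ 6 = (((μ⁻¹) ^ 6 : ℝ) : ℂ) := by push_cast; rfl
    rw [this, arg_real_mul _ (by positivity)]
  have htop0 : Tendsto (fun μ : ℝ => (μ : ℂ)⁻¹) atTop (𝓝 0) := by
    have := (continuous_ofReal.tendsto 0).comp tendsto_inv_atTop_zero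
    simpa [Function.comp_def] using this
  have hbot0 : Tendsto (fun μ : ℝ => (μ : ℂ)⁻¹) atBot (𝓝 0) := by
    have := (continuous_ofReal.tendsto 0).comp tendsto_inv_atBot_zero
    simpa [Function.comp_def] using this
  have hStop : Tendsto S atTop (𝓝 0) := by
    have : Tendsto S atTop (𝓝 (∑ _i : Fin 6, (0 : ℝ))) := by
      refine tendsto_finsetSum _ fun i _ => ?_
      refine (harg1 _ _ (hfac _ htop0 (eventually_ne_atTop 0) i)).congr' ?_
      filter_upwards [eventually_gt_atTop 0] with μ hμ
      rw [← ofReal_inv, arg_real_mul _ (inv_pos.2 hμ)]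
    simpa using this
  have hSbot : Tendsto S atBot (𝓝 (∑ i, if 0 < (r i).re then Real.pi else -Real.pi)) := by
    refine tendsto_finsetSum _ fun i _ => ?_
    have h0 := harg1 _ _ (hfac _ hbot0 (eventually_ne_atBot 0) i)
    split_ifs with hi
    · have := h0.add_const Real.pi
      rw [zero_add] at this
      refine this.congr' ?_
      filter_upwards [eventually_lt_atBot 0] with μ hμ
      rw [← ofReal_inv, show ((μ⁻¹ : ℝ) : ℂ) * ((μ : ℂ) + I * r i) =
        ((-μ⁻¹ : ℝ) : ℂ) * (-((μ : ℂ) + I * r i)) by push_cast; ring,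
        arg_real_mul _ (by simpa using hμ), arg_neg_eq_arg_sub_pi_of_im_pos (by simpa using hi)]
      ring
    · have hi' : (r i).re < 0 := lt_of_le_of_ne (not_lt.1 hi) (hr i)
      have := h0.sub_const Real.pi
      rw [zero_sub] at this
      refine this.congr' ?_
      filter_upwards [eventually_lt_atBot 0] with μ hμ
      rw [← ofReal_inv, show ((μ⁻¹ : ℝ) : ℂ) * ((μ : ℂ) + I * r i) =
        ((-μ⁻¹ : ℝ) : ℂ) * (-((μ : ℂ) + I * r i)) by push_cast; ring,
        arg_real_mul _ (by simpa using hμ), arg_neg_eq_arg_add_pi_of_im_neg (by simpa using hi')]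
      ring
  -- compare the limits of `S - arg p` at `+∞` and at `-∞`
  have hD : ∀ μ, S μ - arg (p μ) = N 0 * (2 * Real.pi) := fun μ => by rw [hN, hconst]
  have e1 := tendsto_nhds_unique (tendsto_const_nhds.congr fun μ => (hD μ).symm)
    (hStop.sub (hparg _ htop0 (eventually_ne_atTop 0)))
  have e2 := tendsto_nhds_unique (tendsto_const_nhds.congr fun μ => (hD μ).symm)
    (hSbot.sub (hparg _ hbot0 (eventually_ne_atBot 0)))
  rw [e1, sub_zero, sub_zero, Finset.sum_ite, Finset.sum_const, Finset.sum_const, nsmul_eq_mul,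
    nsmul_eq_mul] at e2
  have hneg : (Finset.univ.filter fun i => ¬ 0 < (r i).re) =
      Finset.univ.filter fun i => (r i).re < 0 :=
    Finset.filter_congr fun i _ => ⟨fun h => lt_of_le_of_ne (not_lt.1 h) (hr i), fun h => h.not_gt⟩
  rw [hneg] at e2
  have hpi := Real.pi_pos
  have : ((Finset.univ.filter fun i => 0 < (r i).re).card : ℝ) =
      ((Finset.univ.filter fun i => (r i).re < 0).card : ℝ) := by
    apply mul_right_cancel₀ hpi.ne'
    linarith
  exact_mod_cast this

/-- Rearranges a triple by increasing modulus. -/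
theorem exists_perm_norm_le (u : Fin 3 → ℂ) :
    ∃ σ : Equiv.Perm (Fin 3), ‖u (σ 0)‖ ≤ ‖u (σ 1)‖ ∧ ‖u (σ 1)‖ ≤ ‖u (σ 2)‖ := by
  have h := Tuple.monotone_sort fun i => ‖u i‖
  exact ⟨Tuple.sort fun i => ‖u i‖, h (by decide), h (by decide)⟩

open Polynomial in
/-- A complete factorization of the characteristic polynomial into six linear factors. -/
theorem exists_symb_eq_prod (s c : ℝ) {ν κ : ℝ} (ω k : ℝ) (hν : ν ≠ 0) (hκ : κ ≠ 0) :
    ∃ r : Fin 6 → ℂ, ∀ z, symb s c ν κ ω k z = -(ν * κ : ℂ) * ∏ i, (z - r i) := by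
  set q : ℂ[X] := (C (-I * ω + ν * (k : ℂ) ^ 2) - C (ν : ℂ) * X ^ 2) *
    (C (-I * ω + κ * (k : ℂ) ^ 2) - C (κ : ℂ) * X ^ 2) * (C ((k : ℂ) ^ 2) - X ^ 2) -
    (C (s : ℂ) * X + C (I * c * k)) ^ 2 with hq
  have hev : ∀ z, q.eval z = symb s c ν κ ω k z := fun z => by
    simp only [hq, symb, eval_sub, eval_mul, eval_pow, eval_add, eval_C, eval_X]
    ring
  have hlead : -(ν * κ : ℂ) ≠ 0 := by simp [hν, hκ]
  have hq' : q = C (-(ν * κ : ℂ)) * X ^ 6 +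
      (C (-I * ω * (ν + κ) + 3 * (ν * κ) * k ^ 2) * X ^ 4 +
      C (ω ^ 2 + 2 * I * ω * (ν + κ) * k ^ 2 - 3 * (ν * κ) * k ^ 4 - s ^ 2) * X ^ 2 +
      C (-2 * I * s * c * k) * X +
      C (-ω ^ 2 * k ^ 2 - I * ω * (ν + κ) * k ^ 4 + ν * κ * k ^ 6 + c ^ 2 * k ^ 2)) := by
    apply Polynomial.funext
    intro z
    simp only [hq, eval_sub, eval_mul, eval_pow, eval_add, eval_C, eval_X]
    ring_nf
    simp only [I_sq]
    ring
  have hdeg : q.natDegree = 6 := by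
    rw [hq']
    compute_degree!
  have hlc : q.leadingCoeff = -(ν * κ : ℂ) := by
    rw [leadingCoeff, hdeg, hq']
    compute_degree!
  have hsplit := IsAlgClosed.splits q
  have hcard : q.roots.card = 6 := by rw [← hsplit.natDegree_eq_card_roots, hdeg]
  have hlen : q.roots.toList.length = 6 := by rw [Multiset.length_toList, hcard]
  refine ⟨fun i => q.roots.toList.get (i.cast hlen.symm), fun z => ?_⟩
  rw [← hev, hsplit.eval_eq_prod_roots, hlc]
  congr 1
  conv_lhs => rw [← Multiset.coe_toList q.roots, Multiset.map_coe, Multiset.prod_coe]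
  rw [← Fin.prod_univ_getElem]
  refine Fintype.prod_equiv (finCongr (by simp [hcard])) _ _ fun i => ?_
  simp

/-- The characteristic polynomial has three roots in each open half-plane. -/
theorem exists_symb_eq_prod_three (s c : ℝ) {ν κ ω k : ℝ} (hν : 0 < ν) (hκ : 0 < κ) (hω : ω ≠ 0)
    (hk : k ≠ 0) :
    ∃ u v : Fin 3 → ℂ,
      (∀ z, symb s c ν κ ω k z = -(ν * κ : ℂ) * ((∏ i, (z - u i)) * ∏ i, (z - v i))) ∧
      (∀ i, 0 < (u i).re) ∧ (∀ i, (v i).re < 0) ∧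
      (‖u 0‖ ≤ ‖u 1‖ ∧ ‖u 1‖ ≤ ‖u 2‖) ∧ ‖v 0‖ ≤ ‖v 1‖ ∧ ‖v 1‖ ≤ ‖v 2‖ := by
  obtain ⟨r, hr⟩ := exists_symb_eq_prod s c ω k hν.ne' hκ.ne'
  have hax : ∀ μ : ℝ, (symb s c ν κ ω k (I * μ)).im ≠ 0 := by
    intro μ
    rw [symb_I_mul_im]
    have : 0 < k ^ 2 + μ ^ 2 := by positivity
    exact neg_ne_zero.2 (mul_ne_zero (mul_ne_zero hω (by positivity)) (by positivity))
  have hre : ∀ i, (r i).re ≠ 0 := by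
    intro i h
    apply hax (r i).im
    have : I * ((r i).im : ℂ) = r i := by
      apply Complex.ext <;> simp [h]
    rw [this, hr, Finset.prod_eq_zero (Finset.mem_univ i) (sub_self _)]
    simp
  have him : ∀ μ : ℝ, (∏ i, ((μ : ℂ) + I * r i)).im ≠ 0 := by
    intro μ h
    apply hax μ
    have h1 : (∏ i, (I * (μ : ℂ) - r i)) = -∏ i, ((μ : ℂ) + I * r i) := by
      have : ∀ i, I * (μ : ℂ) - r i = I * ((μ : ℂ) + I * r i) := fun i => by
        linear_combination (-r i) * I_sq
      simp only [this, Finset.prod_mul_distrib, Finset.prod_const, Finset.card_univ,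
        Fintype.card_fin]
      rw [show I ^ 6 = -1 by rw [show 6 = 2 * 3 by norm_num, pow_mul, I_sq]; norm_num]
      ring
    rw [hr, h1, show -(ν * κ : ℂ) * -∏ i, ((μ : ℂ) + I * r i) =
      ((ν * κ : ℝ) : ℂ) * ∏ i, ((μ : ℂ) + I * r i) by push_cast; ring, im_ofReal_mul, h, mul_zero]
  have hc := card_re_pos_eq_card_re_neg hre him
  set P := Finset.univ.filter fun i => 0 < (r i).re with hP
  set Q := Finset.univ.filter fun i => (r i).re < 0 with hQ
  -- the two index sets are complementary and have the same cardinality: three elements each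
  have hQP : Q = Pᶜ := by
    ext i
    simp only [hQ, hP, Finset.mem_filter, Finset.mem_univ, true_and, Finset.mem_compl, not_lt]
    exact ⟨le_of_lt, fun h => lt_of_le_of_ne h (hre i)⟩
  have h3 : P.card = 3 := by
    have := Finset.card_compl P
    rw [← hQP, ← hc, Fintype.card_fin] at this
    have h6 : P.card ≤ 6 := by simpa using Finset.card_le_univ P
    omega
  have h3' : Q.card = 3 := hc ▸ h3
  have key : ∀ T : Finset (Fin 6), T.card = 3 → ∃ u : Fin 3 → ℂ,
      (∀ z, ∏ i ∈ T, (z - r i) = ∏ i, (z - u i)) ∧ (∀ i, ∃ j ∈ T, u i = r j) ∧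
      ‖u 0‖ ≤ ‖u 1‖ ∧ ‖u 1‖ ≤ ‖u 2‖ := by
    intro T hT
    set e := T.equivFinOfCardEq hT with he
    obtain ⟨σ, hσ⟩ := exists_perm_norm_le fun i => r (e.symm i)
    refine ⟨fun i => r (e.symm (σ i)), fun z => ?_, fun i => ⟨_, (e.symm (σ i)).2, rfl⟩, hσ⟩
    rw [Equiv.prod_comp σ fun i => z - r (e.symm i), Equiv.prod_comp e.symm fun i => z - r i,
      Finset.prod_coe_sort T fun i => z - r i]
  obtain ⟨u, hu, hu', hus⟩ := key P h3
  obtain ⟨v, hv, hv', hvs⟩ := key Q h3'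
  refine ⟨u, v, fun z => ?_, fun i => ?_, fun i => ?_, hus, hvs⟩
  · rw [hr, ← hu, ← hv, hQP, Finset.prod_mul_prod_compl]
  · obtain ⟨j, hj, h⟩ := hu' i
    rw [h]
    exact (Finset.mem_filter.1 hj).2
  · obtain ⟨j, hj, h⟩ := hv' i
    rw [h]
    exact (Finset.mem_filter.1 hj).2

/-! ### Limits along ultrafilters -/

theorem exists_tendsto_of_norm_le {ι E : Type*} [NormedAddCommGroup E] [ProperSpace E]
    (l : Ultrafilter ι) {g : ι → E} {C : ℝ} (h : ∀ᶠ i in (l : Filter ι), ‖g i‖ ≤ C) :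
    ∃ y, ‖y‖ ≤ C ∧ Tendsto g l (𝓝 y) := by
  have hc : IsCompact (Metric.closedBall (0 : E) C) := isCompact_closedBall 0 C
  obtain ⟨y, hy, hl⟩ := hc.ultrafilter_le_nhds (l.map g) (by
    rw [le_principal_iff, Ultrafilter.mem_coe, Ultrafilter.mem_map]
    filter_upwards [h] with i hi
    simpa using hi)
  exact ⟨y, by simpa using hy, hl⟩

theorem exists_tendsto_or_tendsto_norm_atTop {ι E : Type*} [NormedAddCommGroup E] [ProperSpace E]
    (l : Ultrafilter ι) (g : ι → E) :
    (∃ y, Tendsto g l (𝓝 y)) ∨ Tendsto (fun i => ‖g i‖) l atTop := by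
  by_cases h : ∃ C, ∀ᶠ i in (l : Filter ι), ‖g i‖ ≤ C
  · obtain ⟨C, hC⟩ := h
    obtain ⟨y, -, hy⟩ := exists_tendsto_of_norm_le l hC
    exact Or.inl ⟨y, hy⟩
  · right
    push Not at h
    refine tendsto_atTop.2 fun C => ?_
    filter_upwards [h C] with i hi
    exact hi.le

theorem eventually_of_ultrafilter {ι : Type*} {f : Filter ι} {p : ι → Prop}
    (h : ∀ l : Ultrafilter ι, (l : Filter ι) ≤ f → ∀ᶠ i in (l : Filter ι), p i) :
    ∀ᶠ i in f, p i :=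
  mem_iff_ultrafilter.2 h

/-- A function that has a finite limit along every ultrafilter finer than `f` is bounded along
`f`. -/
theorem exists_eventually_norm_le {ι E : Type*} [NormedAddCommGroup E] {f : Filter ι} {g : ι → E}
    (h : ∀ l : Ultrafilter ι, (l : Filter ι) ≤ f → ∃ y, Tendsto g l (𝓝 y)) :
    ∃ C > 0, ∀ᶠ i in f, ‖g i‖ ≤ C := by
  by_contra hcon
  push Not at hcon
  have hne : NeBot (f ⊓ comap (fun i => ‖g i‖) atTop) := by
    rw [inf_neBot_iff]
    intro s hs t ht
    obtain ⟨u, hu, hut⟩ := mem_comap.1 ht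
    obtain ⟨C, hC⟩ := mem_atTop_sets.1 hu
    have h1 := hcon (max C 1) (by positivity)
    have h2 := (h1.and_eventually hs).exists
    obtain ⟨i, hi, his⟩ := h2
    exact ⟨i, his, hut (hC _ ((le_max_left C 1).trans hi.le))⟩
  obtain ⟨y, hy⟩ := h (Ultrafilter.of (f ⊓ comap (fun i => ‖g i‖) atTop))
    ((Ultrafilter.of_le _).trans inf_le_left)
  have h2 : Tendsto (fun i => ‖g i‖)
      (Ultrafilter.of (f ⊓ comap (fun i => ‖g i‖) atTop) : Filter ι) atTop :=
    tendsto_comap.mono_left ((Ultrafilter.of_le _).trans inf_le_right)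
  exact not_tendsto_atTop_of_tendsto_nhds hy.norm h2

/-- A function that has a positive limit along every ultrafilter finer than `f` is bounded below by
a positive constant along `f`. -/
theorem exists_eventually_le {ι : Type*} {f : Filter ι} {g : ι → ℝ}
    (h : ∀ l : Ultrafilter ι, (l : Filter ι) ≤ f → ∃ y > 0, Tendsto g l (𝓝 y)) :
    ∃ c > 0, ∀ᶠ i in f, c ≤ g i := by
  obtain ⟨C, hC, h1⟩ := exists_eventually_norm_le (g := fun i => (g i)⁻¹) (f := f) fun l hl => by
    obtain ⟨y, hy, hg⟩ := h l hl
    exact ⟨_, hg.inv₀ hy.ne'⟩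
  have h2 : ∀ᶠ i in f, 0 < g i := eventually_of_ultrafilter fun l hl => by
    obtain ⟨y, hy, hg⟩ := h l hl
    exact hg.eventually_const_lt hy
  refine ⟨C⁻¹, inv_pos.2 hC, ?_⟩
  filter_upwards [h1, h2] with i hi hi'
  rw [Real.norm_of_nonneg (inv_nonneg.2 hi'.le)] at hi
  exact inv_le_of_inv_le₀ hi' hi

/-- If monic polynomials converge pointwise, then their roots converge. -/
theorem exists_tendsto_roots {ι J : Type*} [Fintype J] (l : Ultrafilter ι) (r : J → ι → ℂ)
    (q : ℂ → ℂ) (h : ∀ z, Tendsto (fun i => ∏ j, (z - r j i)) l (𝓝 (q z))) :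
    ∃ ρ : J → ℂ, (∀ j, Tendsto (r j) l (𝓝 (ρ j))) ∧ ∀ z, q z = ∏ j, (z - ρ j) := by
  classical
  have key : ∀ j, ∃ y, Tendsto (r j) l (𝓝 y) := by
    set ρ : J → ℂ := fun j => if h : ∃ y, Tendsto (r j) l (𝓝 y) then h.choose else 0 with hρ
    -- evaluate the products at a point different from all the finite limits
    obtain ⟨z, hz⟩ := Infinite.exists_notMem_finset (Finset.univ.image ρ)
    have hz' : ∀ j, z - ρ j ≠ 0 := fun j hj =>
      hz (Finset.mem_image.2 ⟨j, Finset.mem_univ _, (sub_eq_zero.1 hj).symm⟩)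
    have hinv : ∀ j, ∃ w, Tendsto (fun i => (z - r j i)⁻¹) l (𝓝 w) ∧
        ((¬ ∃ y, Tendsto (r j) l (𝓝 y)) → w = 0) ∧ ∀ᶠ i in (l : Filter ι), z - r j i ≠ 0 := by
      intro j
      by_cases hj : ∃ y, Tendsto (r j) l (𝓝 y)
      · have h1 : Tendsto (r j) l (𝓝 (ρ j)) := by
          simp only [hρ, dif_pos hj]
          exact hj.choose_spec
        have h2 := tendsto_const_nhds (x := z).sub h1
        exact ⟨_, h2.inv₀ (hz' j), fun h => absurd hj h, h2.eventually_ne (hz' j)⟩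
      · have h1 := (exists_tendsto_or_tendsto_norm_atTop l (r j)).resolve_left hj
        have h2 : Tendsto (fun i => ‖z - r j i‖) l atTop := by
          refine tendsto_atTop_mono (fun i => ?_) (tendsto_atTop_add_const_right _ (-‖z‖) h1)
          have := norm_sub_norm_le (r j i) z
          rw [norm_sub_rev] at this
          linarith
        refine ⟨0, ?_, fun _ => rfl, ?_⟩
        · exact tendsto_inv₀_cobounded.comp (tendsto_norm_atTop_iff_cobounded.1 h2)
        · filter_upwards [h2.eventually_gt_atTop 0] with i hi
          exact norm_pos_iff.1 hi
    choose w hw hw0 hwn using hinv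
    intro j
    by_contra hj
    -- a root tending to infinity makes the product of the inverses tend to `0`, although the
    -- product itself has a finite limit
    have h1 := (h z).mul (tendsto_finsetProd Finset.univ fun j _ => hw j)
    have h2 : Tendsto (fun i => (∏ j, (z - r j i)) * ∏ j, (z - r j i)⁻¹) l (𝓝 1) := by
      refine tendsto_const_nhds.congr' ?_
      filter_upwards [eventually_all.2 hwn] with i hi
      rw [← Finset.prod_mul_distrib]
      exact (Finset.prod_eq_one fun j _ => mul_inv_cancel₀ (hi j)).symm
    have h3 := tendsto_nhds_unique h1 h2
    rw [Finset.prod_eq_zero (Finset.mem_univ j) (hw0 j hj), mul_zero] at h3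
    exact zero_ne_one h3
  choose ρ hρ using key
  exact ⟨ρ, hρ, fun z => tendsto_nhds_unique (h z)
    (tendsto_finsetProd _ fun j _ => tendsto_const_nhds.sub (hρ j))⟩

open Polynomial in
/-- Two multisets of complex numbers are equal if their monic polynomials take the same values. -/
theorem multiset_eq_of_prod_sub_eq {A B : Multiset ℂ}
    (h : ∀ z : ℂ, (A.map fun a => z - a).prod = (B.map fun a => z - a).prod) : A = B := by
  have : (A.map fun a => X - C a).prod = (B.map fun a => (X - C a : ℂ[X])).prod := by
    apply Polynomial.funext
    intro z
    simpa [eval_multiset_prod, Multiset.map_map, Function.comp_def] using h z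
  rw [← roots_multiset_prod_X_sub_C A, this, roots_multiset_prod_X_sub_C]

/-! ### Roots of size `ε⁻³` -/

/-- The characteristic polynomial has the roots `u` in the right half-plane and `v` in the left
half-plane, both listed with multiplicity and by increasing modulus. -/
structure IsFactorization (s c ν κ ω k : ℝ) (u v : Fin 3 → ℂ) : Prop where
  eq_prod : ∀ z, symb s c ν κ ω k z = -(ν * κ : ℂ) * ((∏ i, (z - u i)) * ∏ i, (z - v i))
  re_pos : ∀ i, 0 < (u i).re
  re_neg : ∀ i, (v i).re < 0
  le₁ : ‖u 0‖ ≤ ‖u 1‖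
  le₂ : ‖u 1‖ ≤ ‖u 2‖
  le₁' : ‖v 0‖ ≤ ‖v 1‖
  le₂' : ‖v 1‖ ≤ ‖v 2‖

theorem exists_isFactorization (s c : ℝ) {ν κ ω k : ℝ} (hν : 0 < ν) (hκ : 0 < κ) (hω : ω ≠ 0)
    (hk : k ≠ 0) : ∃ u v, IsFactorization s c ν κ ω k u v := by
  obtain ⟨u, v, h1, h2, h3, h4, h5⟩ := exists_symb_eq_prod_three s c hν hκ hω hk
  exact ⟨u, v, h1, h2, h3, h4.1, h4.2, h5.1, h5.2⟩

theorem IsFactorization.symb_eq_zero {s c ν κ ω k : ℝ} {u v : Fin 3 → ℂ}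
    (h : IsFactorization s c ν κ ω k u v) (i : Fin 3) : symb s c ν κ ω k (u i) = 0 := by
  rw [h.eq_prod, Finset.prod_eq_zero (Finset.mem_univ i) (sub_self _)]
  simp

theorem tendsto_ofReal {ι : Type*} {l : Filter ι} {f : ι → ℝ} {x : ℝ} (h : Tendsto f l (𝓝 x)) :
    Tendsto (fun i => (f i : ℂ)) l (𝓝 (x : ℂ)) :=
  (continuous_ofReal.tendsto x).comp h

theorem tendsto_re {ι : Type*} {l : Filter ι} {f : ι → ℂ} {x : ℂ} (h : Tendsto f l (𝓝 x)) :
    Tendsto (fun i => (f i).re) l (𝓝 x.re) :=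
  (continuous_re.tendsto x).comp h

theorem tendsto_im {ι : Type*} {l : Filter ι} {f : ι → ℂ} {x : ℂ} (h : Tendsto f l (𝓝 x)) :
    Tendsto (fun i => (f i).im) l (𝓝 x.im) :=
  (continuous_im.tendsto x).comp h

theorem re_ofReal_pow_mul (x : ℝ) (n : ℕ) (z : ℂ) : ((x : ℂ) ^ n * z).re = x ^ n * z.re := by
  rw [← ofReal_pow, re_ofReal_mul]

theorem norm_ofReal_pow_mul {x : ℝ} (hx : 0 < x) (n : ℕ) (z : ℂ) :
    ‖(x : ℂ) ^ n * z‖ = x ^ n * ‖z‖ := by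
  rw [norm_mul, norm_pow, norm_real, Real.norm_of_nonneg hx.le]

/-- The characteristic polynomial at `ε⁻³ z`, normalized to be monic, in the scaling
`ν = ν₀ ε⁶`, `κ = κ₀ ε⁶`. -/
def scaledSymb (s c ν₀ κ₀ e w q z : ℂ) : ℂ :=
  (w ^ 2 * (q ^ 2 * e ^ 6 - z ^ 2) + I * w * (ν₀ + κ₀) * (q ^ 2 * e ^ 6 - z ^ 2) ^ 2 -
    ν₀ * κ₀ * (q ^ 2 * e ^ 6 - z ^ 2) ^ 3 + (s * z + I * c * q * e ^ 3) ^ 2) / (ν₀ * κ₀)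

theorem tendsto_scaledSymb {ι : Type*} {l : Filter ι} {e w q : ι → ℂ} {e₁ w₁ q₁ : ℂ}
    (he : Tendsto e l (𝓝 e₁)) (hw : Tendsto w l (𝓝 w₁)) (hq : Tendsto q l (𝓝 q₁))
    (s c ν₀ κ₀ z : ℂ) :
    Tendsto (fun i => scaledSymb s c ν₀ κ₀ (e i) (w i) (q i) z) l
      (𝓝 (scaledSymb s c ν₀ κ₀ e₁ w₁ q₁ z)) := by
  have hc : Continuous fun p : ℂ × ℂ × ℂ => scaledSymb s c ν₀ κ₀ p.1 p.2.1 p.2.2 z := by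
    unfold scaledSymb
    fun_prop
  exact Tendsto.comp (g := fun p : ℂ × ℂ × ℂ => scaledSymb s c ν₀ κ₀ p.1 p.2.1 p.2.2 z)
    (f := fun i => (e i, w i, q i)) (hc.tendsto (e₁, w₁, q₁))
    (he.prodMk_nhds (hw.prodMk_nhds hq))

theorem scaledSymb_eq {s c ν₀ κ₀ e ω k : ℝ} (hν : ν₀ ≠ 0) (hκ : κ₀ ≠ 0) (he : e ≠ 0) (z : ℂ) :
    -((ν₀ * e ^ 6 : ℝ) * (κ₀ * e ^ 6 : ℝ) : ℂ) * scaledSymb s c ν₀ κ₀ e ω k z =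
      (e : ℂ) ^ 18 * symb s c (ν₀ * e ^ 6) (κ₀ * e ^ 6) ω k (((e : ℂ) ^ 3)⁻¹ * z) := by
  have he' : (e : ℂ) ≠ 0 := by exact_mod_cast he
  have hν' : (ν₀ : ℂ) ≠ 0 := by exact_mod_cast hν
  have hκ' : (κ₀ : ℂ) ≠ 0 := by exact_mod_cast hκ
  obtain ⟨y, rfl⟩ : ∃ y, z = (e : ℂ) ^ 3 * y := ⟨((e : ℂ) ^ 3)⁻¹ * z, by field_simp⟩
  rw [inv_mul_cancel_left₀ (pow_ne_zero _ he')]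
  unfold symb scaledSymb
  push_cast
  rw [mul_div_assoc', div_eq_iff (mul_ne_zero hν' hκ')]
  ring_nf
  simp only [I_sq]
  ring

/-- The roots of the characteristic polynomial, multiplied by `ε³`, converge to the roots of the
limit of the rescaled polynomial. -/
theorem exists_tendsto_scaled_roots {ι : Type*} (l : Ultrafilter ι) (s c : ℝ) {ν₀ κ₀ : ℝ}
    (hν : 0 < ν₀) (hκ : 0 < κ₀) {ε ω k : ι → ℝ} {ω₁ k₁ : ℝ} {u v : ι → Fin 3 → ℂ}
    (hε : Tendsto ε l (𝓝[>] 0)) (hω : Tendsto ω l (𝓝 ω₁)) (hk : Tendsto k l (𝓝 k₁))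
    (hF : ∀ᶠ i in (l : Filter ι),
      IsFactorization s c (ν₀ * ε i ^ 6) (κ₀ * ε i ^ 6) (ω i) (k i) (u i) (v i)) :
    ∃ U V : Fin 3 → ℂ, (∀ j, Tendsto (fun i => (ε i : ℂ) ^ 3 * u i j) l (𝓝 (U j))) ∧
      (∀ j, Tendsto (fun i => (ε i : ℂ) ^ 3 * v i j) l (𝓝 (V j))) ∧
      (∀ z, (∏ j, (z - U j)) * ∏ j, (z - V j) =
        z ^ 2 * (z ^ 4 + I * ω₁ * (ν₀ + κ₀) / (ν₀ * κ₀) * z ^ 2 - (ω₁ ^ 2 - s ^ 2) / (ν₀ * κ₀))) ∧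
      (∀ j, 0 ≤ (U j).re) ∧ (∀ j, (V j).re ≤ 0) ∧
      ‖U 0‖ ≤ ‖U 1‖ ∧ ‖U 1‖ ≤ ‖U 2‖ ∧ ‖V 0‖ ≤ ‖V 1‖ ∧ ‖V 1‖ ≤ ‖V 2‖ := by
  have hε0 : ∀ᶠ i in (l : Filter ι), 0 < ε i := hε.eventually self_mem_nhdsWithin
  have hε' := tendsto_ofReal (tendsto_nhdsWithin_iff.1 hε).1
  have hω' := tendsto_ofReal hω
  have hk' := tendsto_ofReal hk
  have hν' : (ν₀ : ℂ) ≠ 0 := by exact_mod_cast hν.ne'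
  have hκ' : (κ₀ : ℂ) ≠ 0 := by exact_mod_cast hκ.ne'
  set r : Fin 3 ⊕ Fin 3 → ι → ℂ := Sum.elim (fun j i => (ε i : ℂ) ^ 3 * u i j)
    (fun j i => (ε i : ℂ) ^ 3 * v i j) with hr
  have hlim : ∀ z, Tendsto (fun i => ∏ j, (z - r j i)) l
      (𝓝 (scaledSymb s c ν₀ κ₀ (0 : ℝ) ω₁ k₁ z)) := by
    intro z
    refine (tendsto_scaledSymb hε' hω' hk' s c ν₀ κ₀ z).congr' ?_
    filter_upwards [hF, hε0] with i hi h0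
    have he : (ε i : ℂ) ≠ 0 := by exact_mod_cast h0.ne'
    have h2 := scaledSymb_eq (s := s) (c := c) (ω := ω i) (k := k i) hν.ne' hκ.ne' h0.ne' z
    rw [hi.eq_prod, mul_left_comm] at h2
    have h5 := mul_left_cancel₀ (neg_ne_zero.2 (mul_ne_zero (ofReal_ne_zero.2 (by positivity))
      (ofReal_ne_zero.2 (by positivity)))) h2
    rw [h5]
    simp only [hr, Fintype.prod_sum_type, Sum.elim_inl, Sum.elim_inr]
    have h3 : ∀ w : ℂ, z - (ε i : ℂ) ^ 3 * w = (ε i : ℂ) ^ 3 * (((ε i : ℂ) ^ 3)⁻¹ * z - w) := by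
      intro w
      field_simp
    simp only [h3, Finset.prod_mul_distrib, Finset.prod_const, Finset.card_univ, Fintype.card_fin]
    ring
  obtain ⟨ρ, hρ, hq⟩ := exists_tendsto_roots l r _ hlim
  have hU : ∀ j, Tendsto (fun i => (ε i : ℂ) ^ 3 * u i j) l (𝓝 (ρ (Sum.inl j))) := fun j =>
    hρ (Sum.inl j)
  have hV : ∀ j, Tendsto (fun i => (ε i : ℂ) ^ 3 * v i j) l (𝓝 (ρ (Sum.inr j))) := fun j =>
    hρ (Sum.inr j)
  refine ⟨fun j => ρ (Sum.inl j), fun j => ρ (Sum.inr j), hU, hV, fun z => ?_, fun j => ?_,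
    fun j => ?_, ?_, ?_, ?_, ?_⟩
  · rw [← Fintype.prod_sum_type fun j => z - ρ j, ← hq]
    simp only [scaledSymb, ofReal_zero]
    field_simp
    ring
  · refine ge_of_tendsto (tendsto_re (hU j)) ?_
    filter_upwards [hF, hε0] with i hi h0
    rw [re_ofReal_pow_mul]
    exact mul_nonneg (by positivity) (hi.re_pos j).le
  · refine le_of_tendsto (tendsto_re (hV j)) ?_
    filter_upwards [hF, hε0] with i hi h0
    rw [re_ofReal_pow_mul]
    exact mul_nonpos_of_nonneg_of_nonpos (by positivity) (hi.re_neg j).le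
  all_goals
    first
      | refine le_of_tendsto_of_tendsto (hU _).norm (hU _).norm ?_
      | refine le_of_tendsto_of_tendsto (hV _).norm (hV _).norm ?_
    filter_upwards [hF, hε0] with i hi h0
    rw [norm_ofReal_pow_mul h0, norm_ofReal_pow_mul h0]
    refine mul_le_mul_of_nonneg_left ?_ (by positivity)
    first
      | exact hi.le₁
      | exact hi.le₂
      | exact hi.le₁'
      | exact hi.le₂'

/-- The square root of `-iρ` in the right half-plane. -/
def sqrtNegI (ρ : ℝ) : ℂ := (√(|ρ| / 2) : ℝ) * (1 - I * (SignType.sign ρ : ℝ))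

theorem sqrtNegI_sq (ρ : ℝ) : sqrtNegI ρ ^ 2 = -(I * ρ) := by
  have h1 : ((√(|ρ| / 2) : ℝ) : ℂ) ^ 2 = ((|ρ| / 2 : ℝ) : ℂ) := by
    rw [← ofReal_pow, Real.sq_sqrt (by positivity)]
  have h2 : ((SignType.sign ρ : ℝ) : ℂ) * ((|ρ| : ℝ) : ℂ) = (ρ : ℂ) := by
    rw [← ofReal_mul, sign_mul_abs]
  have h3 : ((|ρ| : ℝ) : ℂ) * ((SignType.sign ρ : ℝ) : ℂ) ^ 2 = ((|ρ| : ℝ) : ℂ) := by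
    rcases lt_trichotomy ρ 0 with h | h | h <;> simp [h]
  rw [sqrtNegI, mul_pow, h1]
  push_cast
  linear_combination (-I) * h2 + (1 / 2 : ℂ) * I ^ 2 * h3 + ((|ρ| : ℝ) : ℂ) / 2 * I_sq

theorem sqrtNegI_re {ρ : ℝ} (h : ρ ≠ 0) : 0 < (sqrtNegI ρ).re := by
  have : (sqrtNegI ρ).re = √(|ρ| / 2) := by simp [sqrtNegI]
  rw [this]
  positivity

/-! ### The imaginary part of the characteristic equation -/

/-- The imaginary part of the characteristic equation, written so that the factor `z.re` is
visible. If `k ≠ 0`, its right-hand side has the sign of `ω` close to the imaginary axis. -/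
theorem re_mul_eq_of_symb_eq_zero {s c ν κ ω k : ℝ} {z : ℂ} (h : symb s c ν κ ω k z = 0) :
    z.re * (2 * (ω ^ 2 - s ^ 2) * z.im - 2 * s * c * k - 2 * z.im * (ν * κ) *
      (3 * (k ^ 2 - z.re ^ 2 + z.im ^ 2) ^ 2 - (2 * z.re * z.im) ^ 2)) =
    ω * (ν + κ) * ((k ^ 2 - z.re ^ 2 + z.im ^ 2) ^ 2 - (2 * z.re * z.im) ^ 2) := by
  obtain ⟨x, y⟩ := z
  have h1 : symb s c ν κ ω k ⟨x, y⟩ =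
      ((x * (2 * (ω ^ 2 - s ^ 2) * y - 2 * s * c * k - 2 * y * (ν * κ) *
      (3 * (k ^ 2 - x ^ 2 + y ^ 2) ^ 2 - (2 * x * y) ^ 2)) -
      ω * (ν + κ) * ((k ^ 2 - x ^ 2 + y ^ 2) ^ 2 - (2 * x * y) ^ 2) : ℝ) : ℂ) * I +
      ((-ω ^ 2 * (k ^ 2 - x ^ 2 + y ^ 2) - ω * (ν + κ) * (k ^ 2 - x ^ 2 + y ^ 2) * (4 * x * y) +
        ν * κ * (k ^ 2 - x ^ 2 + y ^ 2) * ((k ^ 2 - x ^ 2 + y ^ 2) ^ 2 - 3 * (2 * x * y) ^ 2) -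
        s ^ 2 * (x ^ 2 - y ^ 2) + 2 * s * c * k * y + c ^ 2 * k ^ 2 : ℝ) : ℂ) := by
    have h5 : I ^ 5 = I := by rw [pow_succ, I_pow_four, one_mul]
    have h6 : I ^ 6 = -1 := by rw [pow_succ, h5, I_mul_I]
    rw [mk_eq_add_mul_I, symb]
    push_cast
    ring_nf
    simp only [I_sq, I_pow_three, I_pow_four, h5, h6]
    ring
  rw [h1] at h
  have h2 := congrArg Complex.im h
  rw [add_im, im_ofReal_mul, I_im, ofReal_im, zero_im, mul_one, add_zero] at h2
  linarith

/-- Among the inviscid roots on the imaginary axis, only one of them is the limit of viscous roots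
of positive real part: this is the sign condition it satisfies. -/
theorem le_of_tendsto_imaginary {ι : Type*} {l : Filter ι} [l.NeBot] (s c : ℝ) {ν₀ κ₀ : ℝ}
    (hν : 0 < ν₀) (hκ : 0 < κ₀) {ε ω k : ι → ℝ} {ω₁ k₁ : ℝ} {z : ι → ℂ} {w : ℂ}
    (hε : Tendsto ε l (𝓝[>] 0)) (hω : Tendsto ω l (𝓝 ω₁)) (hk : Tendsto k l (𝓝 k₁))
    (hω1 : ω₁ ≠ 0) (hk1 : k₁ ≠ 0) (hz : Tendsto z l (𝓝 w)) (hw : w.re = 0)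
    (hre : ∀ᶠ i in l, 0 < (z i).re)
    (hroot : ∀ᶠ i in l, symb s c (ν₀ * ε i ^ 6) (κ₀ * ε i ^ 6) (ω i) (k i) (z i) = 0) :
    s * c * ω₁ * k₁ ≤ (ω₁ ^ 2 - s ^ 2) * w.im * ω₁ := by
  have hε0 : ∀ᶠ i in l, 0 < ε i := hε.eventually self_mem_nhdsWithin
  have hε' := (tendsto_nhdsWithin_iff.1 hε).1
  have hx := tendsto_re hz
  have hy := tendsto_im hz
  rw [hw] at hx
  have h1 : Tendsto (fun i => (k i ^ 2 - (z i).re ^ 2 + (z i).im ^ 2) ^ 2 -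
      (2 * (z i).re * (z i).im) ^ 2) l
      (𝓝 ((k₁ ^ 2 - 0 ^ 2 + w.im ^ 2) ^ 2 - (2 * 0 * w.im) ^ 2)) :=
    ((((hk.pow 2).sub (hx.pow 2)).add (hy.pow 2)).pow 2).sub (((hx.const_mul 2).mul hy).pow 2)
  have h2 := h1.eventually_const_lt (u := 0) (by
    have : 0 < k₁ ^ 2 + w.im ^ 2 := by positivity
    ring_nf
    nlinarith [sq_nonneg (k₁ ^ 2 + w.im ^ 2), sq_pos_of_pos this])
  have h3 : Tendsto (fun i => ω i * (2 * (ω i ^ 2 - s ^ 2) * (z i).im - 2 * s * c * k i -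
      2 * (z i).im * ((ν₀ * ε i ^ 6) * (κ₀ * ε i ^ 6)) *
      (3 * (k i ^ 2 - (z i).re ^ 2 + (z i).im ^ 2) ^ 2 - (2 * (z i).re * (z i).im) ^ 2))) l
      (𝓝 (ω₁ * (2 * (ω₁ ^ 2 - s ^ 2) * w.im - 2 * s * c * k₁ -
      2 * w.im * ((ν₀ * 0 ^ 6) * (κ₀ * 0 ^ 6)) *
      (3 * (k₁ ^ 2 - 0 ^ 2 + w.im ^ 2) ^ 2 - (2 * 0 * w.im) ^ 2)))) :=
    hω.mul ((((((hω.pow 2).sub_const _).const_mul 2).mul hy).sub (hk.const_mul (2 * s * c))).sub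
      (((hy.const_mul 2).mul (((hε'.pow 6).const_mul ν₀).mul ((hε'.pow 6).const_mul κ₀))).mul
      (((((((hk.pow 2).sub (hx.pow 2)).add (hy.pow 2)).pow 2).const_mul 3)).sub
        (((hx.const_mul 2).mul hy).pow 2))))
  have h4 := ge_of_tendsto (b := 0) h3 (by
    filter_upwards [h2, hroot, hre, hε0, hω.eventually_ne hω1] with i hi hr hre0 he hw0
    have h5 := re_mul_eq_of_symb_eq_zero hr
    have h6 : 0 < (z i).re * (ω i * (2 * (ω i ^ 2 - s ^ 2) * (z i).im - 2 * s * c * k i -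
      2 * (z i).im * ((ν₀ * ε i ^ 6) * (κ₀ * ε i ^ 6)) *
      (3 * (k i ^ 2 - (z i).re ^ 2 + (z i).im ^ 2) ^ 2 - (2 * (z i).re * (z i).im) ^ 2))) := by
      rw [mul_left_comm, h5, show ∀ a b d : ℝ, a * (a * b * d) = a ^ 2 * b * d by intros; ring]
      positivity
    exact (pos_of_mul_pos_right h6 hre0.le).le)
  nlinarith [h4]

/-! ### Decay rates near the critical frequency -/

/-- The moduli and the signs of the real parts identify the limits of the six roots. -/
theorem eq_of_prod_eq_pow_four_mul {U V : Fin 3 → ℂ} {Y : ℂ} (hY : 0 < Y.re)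
    (h : ∀ z, (∏ j, (z - U j)) * ∏ j, (z - V j) = z ^ 4 * (z ^ 2 - Y ^ 2))
    (hU : ∀ j, 0 ≤ (U j).re) (hV : ∀ j, (V j).re ≤ 0) (h1 : ‖U 0‖ ≤ ‖U 1‖) (h2 : ‖U 1‖ ≤ ‖U 2‖)
    (h3 : ‖V 0‖ ≤ ‖V 1‖) (h4 : ‖V 1‖ ≤ ‖V 2‖) :
    (U 0 = 0 ∧ U 1 = 0 ∧ U 2 = Y) ∧ V 0 = 0 ∧ V 1 = 0 ∧ V 2 = -Y := by
  have hm : ({U 0, U 1, U 2, V 0, V 1, V 2} : Multiset ℂ) = {0, 0, 0, 0, Y, -Y} := by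
    apply multiset_eq_of_prod_sub_eq
    intro z
    have := h z
    simp only [Fin.prod_univ_three] at this
    simp only [Multiset.insert_eq_cons, Multiset.map_cons, Multiset.prod_cons,
      Multiset.map_singleton, Multiset.prod_singleton]
    linear_combination this
  have hUm : ∀ j, U j = 0 ∨ U j = Y := by
    intro j
    have h0 := h (U j)
    rw [Finset.prod_eq_zero (Finset.mem_univ j) (sub_self _), zero_mul, eq_comm, mul_eq_zero,
      sub_eq_zero, sq_eq_sq_iff_eq_or_eq_neg] at h0
    rcases h0 with h0 | h0 | h0
    · exact Or.inl (pow_eq_zero_iff (by norm_num) |>.1 h0)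
    · exact Or.inr h0
    · have := hU j
      rw [h0, neg_re] at this
      linarith
  have hVm : ∀ j, V j = 0 ∨ V j = -Y := by
    intro j
    have h0 := h (V j)
    rw [Finset.prod_eq_zero (f := fun i => V j - V i) (Finset.mem_univ j) (sub_self _), mul_zero,
      eq_comm, mul_eq_zero, sub_eq_zero, sq_eq_sq_iff_eq_or_eq_neg] at h0
    rcases h0 with h0 | h0 | h0
    · exact Or.inl (pow_eq_zero_iff (by norm_num) |>.1 h0)
    · have := hV j
      rw [h0] at this
      linarith
    · exact Or.inr h0
  have hY0 : Y ≠ 0 := fun h => by simp [h] at hY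
  have hn : 0 < ‖Y‖ := norm_pos_iff.2 hY0
  -- `Y` is the only root of positive real part and `-Y` the only one of negative real part
  have c1 := congrArg (Multiset.countP fun z => 0 < z.re) hm
  have c2 := congrArg (Multiset.countP fun z => z.re < 0) hm
  simp only [Multiset.insert_eq_cons, Multiset.countP_cons, ← Multiset.cons_zero,
    Multiset.countP_zero] at c1 c2
  constructor
  · clear c2
    have hVn : ∀ j, ¬ 0 < (V j).re := fun j => not_lt.2 (hV j)
    rcases hUm 0 with e0 | e0 <;> rcases hUm 1 with e1 | e1 <;> rcases hUm 2 with e2 | e2 <;>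
      simp [e0, e1, e2, hVn, hY, hY.not_gt] at c1 h1 h2 ⊢ <;>
      simp_all
  · clear c1
    have hUn : ∀ j, ¬ (U j).re < 0 := fun j => not_lt.2 (hU j)
    rcases hVm 0 with e0 | e0 <;> rcases hVm 1 with e1 | e1 <;> rcases hVm 2 with e2 | e2 <;>
      simp [e0, e1, e2, hUn, hY, hY.not_gt] at c2 h3 h4 ⊢ <;>
      simp_all

/-- The characteristic polynomial at `ε⁻² z`, in the near-critical scaling `ω² - s² = θ ε²`. -/
def criticalSymb (s c ν₀ κ₀ e w q θ z : ℂ) : ℂ :=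
  θ * z ^ 2 - I * w * (ν₀ + κ₀) * (e ^ 4 * q ^ 2 - z ^ 2) ^ 2 +
    ν₀ * κ₀ * e ^ 2 * (e ^ 4 * q ^ 2 - z ^ 2) ^ 3 - 2 * I * s * c * q * z +
    e ^ 2 * (c ^ 2 - w ^ 2) * q ^ 2

theorem tendsto_criticalSymb {ι : Type*} {l : Filter ι} {e w q θ : ι → ℂ} {e₁ w₁ q₁ θ₁ : ℂ}
    (he : Tendsto e l (𝓝 e₁)) (hw : Tendsto w l (𝓝 w₁)) (hq : Tendsto q l (𝓝 q₁))
    (hθ : Tendsto θ l (𝓝 θ₁)) (s c ν₀ κ₀ z : ℂ) :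
    Tendsto (fun i => criticalSymb s c ν₀ κ₀ (e i) (w i) (q i) (θ i) z) l
      (𝓝 (criticalSymb s c ν₀ κ₀ e₁ w₁ q₁ θ₁ z)) := by
  have hc : Continuous fun p : ℂ × ℂ × ℂ × ℂ =>
      criticalSymb s c ν₀ κ₀ p.1 p.2.1 p.2.2.1 p.2.2.2 z := by
    unfold criticalSymb
    fun_prop
  exact Tendsto.comp (g := fun p : ℂ × ℂ × ℂ × ℂ =>
      criticalSymb s c ν₀ κ₀ p.1 p.2.1 p.2.2.1 p.2.2.2 z)
    (f := fun i => (e i, w i, q i, θ i)) (hc.tendsto (e₁, w₁, q₁, θ₁))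
    (he.prodMk_nhds (hw.prodMk_nhds (hq.prodMk_nhds hθ)))

theorem criticalSymb_eq {s c ν₀ κ₀ e ω k : ℝ} (he : e ≠ 0) (z : ℂ) :
    criticalSymb s c ν₀ κ₀ e ω k ((ω ^ 2 - s ^ 2) / e ^ 2 : ℝ) ((e : ℂ) ^ 2 * z) =
      (e : ℂ) ^ 2 * symb s c (ν₀ * e ^ 6) (κ₀ * e ^ 6) ω k z := by
  have he' : (e : ℂ) ≠ 0 := by exact_mod_cast he
  have h : (((ω ^ 2 - s ^ 2) / e ^ 2 : ℝ) : ℂ) * (e : ℂ) ^ 2 = ω ^ 2 - s ^ 2 := by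
    push_cast
    field_simp
  unfold symb criticalSymb
  generalize (((ω ^ 2 - s ^ 2) / e ^ 2 : ℝ) : ℂ) = θ at h
  push_cast
  linear_combination (e ^ 2 * z ^ 2 : ℂ) * h +
    (e ^ 2 * (-ω ^ 2 * (k ^ 2 - z ^ 2) + c ^ 2 * k ^ 2) : ℂ) * I_sq

/-- Near the critical frequency, no decaying mode survives at the scale of the incident wave. -/
theorem false_of_tendsto_zero {ι : Type*} {l : Filter ι} [l.NeBot] {s c ν₀ κ₀ : ℝ} (hs : 0 < s)
    (hc : 0 < c) (hν : 0 < ν₀) (hκ : 0 < κ₀) {ε ω k : ι → ℝ} {ω₁ k₁ θ : ℝ} {z : ι → ℂ}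
    (hε : Tendsto ε l (𝓝[>] 0)) (hω : Tendsto ω l (𝓝 ω₁)) (hk : Tendsto k l (𝓝 k₁))
    (hθ : Tendsto (fun i => (ω i ^ 2 - s ^ 2) / ε i ^ 2) l (𝓝 θ)) (hω1 : ω₁ ^ 2 = s ^ 2)
    (hωk : 0 < ω₁ * k₁) (hz : Tendsto (fun i => (ε i : ℂ) ^ 2 * z i) l (𝓝 0))
    (hre : ∀ᶠ i in l, 0 < (z i).re)
    (hroot : ∀ᶠ i in l, symb s c (ν₀ * ε i ^ 6) (κ₀ * ε i ^ 6) (ω i) (k i) (z i) = 0) : False := by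
  have hε0 : ∀ᶠ i in l, 0 < ε i := hε.eventually self_mem_nhdsWithin
  have hε' := tendsto_ofReal (tendsto_nhdsWithin_iff.1 hε).1
  have hω' := tendsto_ofReal hω
  have hk' := tendsto_ofReal hk
  have hθ' := tendsto_ofReal hθ
  have hω0 : ω₁ ≠ 0 := left_ne_zero_of_mul hωk.ne'
  have hk0 : k₁ ≠ 0 := right_ne_zero_of_mul hωk.ne'
  -- the characteristic equation reads `D * z = -N`, with `D` tending to `-2isck₁`
  set D : ℂ × ℂ × ℂ × ℂ × ℂ → ℂ := fun p =>
    p.2.2.2.1 * p.2.2.2.2 - 2 * I * s * c * p.2.2.1 -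
      I * p.2.1 * (ν₀ + κ₀) * (p.2.2.2.2 ^ 3 - 2 * p.2.2.1 ^ 2 * p.1 ^ 4 * p.2.2.2.2) +
      ν₀ * κ₀ * (-p.1 ^ 2 * p.2.2.2.2 ^ 5 + 3 * p.2.2.1 ^ 2 * p.1 ^ 6 * p.2.2.2.2 ^ 3 -
        3 * p.2.2.1 ^ 4 * p.1 ^ 10 * p.2.2.2.2) with hD
  set N : ℂ × ℂ × ℂ × ℂ × ℂ → ℂ := fun p =>
    (c ^ 2 - p.2.1 ^ 2) * p.2.2.1 ^ 2 - I * p.2.1 * (ν₀ + κ₀) * p.1 ^ 6 * p.2.2.1 ^ 4 +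
      ν₀ * κ₀ * p.1 ^ 12 * p.2.2.1 ^ 6 with hN
  have hDc : Continuous D := by fun_prop
  have hNc : Continuous N := by fun_prop
  set P : ι → ℂ × ℂ × ℂ × ℂ × ℂ := fun i => ((ε i : ℂ), (ω i : ℂ), (k i : ℂ),
    (((ω i ^ 2 - s ^ 2) / ε i ^ 2 : ℝ) : ℂ), (ε i : ℂ) ^ 2 * z i) with hP
  have hPt : Tendsto P l (𝓝 (((0 : ℝ) : ℂ), (ω₁ : ℂ), (k₁ : ℂ), (θ : ℂ), (0 : ℂ))) :=
    hε'.prodMk_nhds (hω'.prodMk_nhds (hk'.prodMk_nhds (hθ'.prodMk_nhds hz)))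
  have hDt := Tendsto.comp (hDc.tendsto _) hPt
  have hNt := Tendsto.comp (hNc.tendsto _) hPt
  have hD1 : D (((0 : ℝ) : ℂ), (ω₁ : ℂ), (k₁ : ℂ), (θ : ℂ), (0 : ℂ)) = -2 * I * s * c * k₁ := by
    simp [hD]
  have hN1 : N (((0 : ℝ) : ℂ), (ω₁ : ℂ), (k₁ : ℂ), (θ : ℂ), (0 : ℂ)) =
      (c ^ 2 - ω₁ ^ 2) * k₁ ^ 2 := by
    simp [hN]
  rw [hD1] at hDt
  rw [hN1] at hNt
  have hD0 : -2 * I * s * c * k₁ ≠ (0 : ℂ) := by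
    simp [hs.ne', hc.ne', hk0]
  have hzt : Tendsto z l (𝓝 (-((c ^ 2 - ω₁ ^ 2) * k₁ ^ 2) / (-2 * I * s * c * k₁))) := by
    refine (hNt.neg.div hDt hD0).congr' ?_
    filter_upwards [hroot, hε0, hDt.eventually_ne hD0] with i hi h0 hne
    have he' : (ε i : ℂ) ≠ 0 := by exact_mod_cast h0.ne'
    have h : (((ω i ^ 2 - s ^ 2) / ε i ^ 2 : ℝ) : ℂ) * (ε i : ℂ) ^ 2 = ω i ^ 2 - s ^ 2 := by
      push_cast
      field_simp
    rw [Pi.div_apply, div_eq_iff hne]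
    simp only [Function.comp_apply, hN, hD, hP]
    unfold symb at hi
    generalize (((ω i ^ 2 - s ^ 2) / ε i ^ 2 : ℝ) : ℂ) = t at h
    push_cast at hi
    linear_combination -hi - (z i ^ 2 : ℂ) * h +
      (ω i ^ 2 * (k i ^ 2 - z i ^ 2) - c ^ 2 * k i ^ 2 : ℂ) * I_sq
  have hw : (-((c ^ 2 - ω₁ ^ 2) * k₁ ^ 2) / (-2 * I * s * c * k₁) : ℂ) =
      ((-((c ^ 2 - ω₁ ^ 2) * k₁ ^ 2) / (2 * s * c * k₁) : ℝ) : ℂ) * I := by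
    have h1 : (s : ℂ) ≠ 0 := by exact_mod_cast hs.ne'
    have h2 : (c : ℂ) ≠ 0 := by exact_mod_cast hc.ne'
    have h3 : (k₁ : ℂ) ≠ 0 := by exact_mod_cast hk0
    push_cast
    field_simp
    rw [I_sq]
    ring
  -- the limit of `z` is purely imaginary, and violates the sign condition of the decaying modes
  have := le_of_tendsto_imaginary s c hν hκ hε hω hk hω0 hk0 hzt
    (by rw [hw, re_ofReal_mul, I_re, mul_zero]) hre hroot
  rw [hω1, sub_self, zero_mul, zero_mul, mul_assoc] at this
  exact absurd this (not_le.2 (by positivity))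

/-- The cubic equation of the near-critical rates has no root on the imaginary axis. -/
theorem re_pos_of_cubic {P Q : ℝ} (hQ : Q ≠ 0) {z : ℂ} (h : z ^ 3 + I * P * z + Q = 0)
    (hz : 0 ≤ z.re) : 0 < z.re := by
  refine lt_of_le_of_ne hz fun h0 => hQ ?_
  obtain ⟨x, y⟩ := z
  simp only at h0
  subst h0
  have h1 : (⟨0, y⟩ : ℂ) = y * I := by
    rw [mk_eq_add_mul_I]
    simp
  rw [h1] at h
  have h2 : ((Q - P * y : ℝ) : ℂ) + ((-y ^ 3 : ℝ) : ℂ) * I = 0 := by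
    push_cast
    linear_combination h - (y : ℂ) ^ 3 * I * I_sq - (P * y : ℂ) * I_sq
  have h3 := congrArg Complex.im h2
  have h4 := congrArg Complex.re h2
  rw [add_im, im_ofReal_mul, ofReal_im, I_im, zero_im] at h3
  rw [add_re, re_ofReal_mul, ofReal_re, I_re, zero_re] at h4
  have hy : y = 0 := by
    have : y ^ 3 = 0 := by linarith
    exact pow_eq_zero_iff (by norm_num) |>.1 this
  rw [hy] at h4
  linarith

/-- The cubic equation of the near-critical rates has no double root. -/
theorem false_of_cubic_double_root {P Q : ℝ} (hQ : 0 < Q) {a b : ℂ}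
    (h : ∀ z : ℂ, (z - a) * (z - a) * z * (z - b) = z * (z ^ 3 + I * P * z + Q)) : False := by
  have h1 := h 1
  have h2 := h (-1)
  have h3 := h 2
  have h4 := h (-2)
  have hb : b = -2 * a := by
    linear_combination (1 / 6 : ℂ) * h1 - (1 / 6 : ℂ) * h2 - (1 / 12 : ℂ) * h3 + (1 / 12 : ℂ) * h4
  subst hb
  have hp : -3 * a ^ 2 = I * P := by linear_combination (1 / 2 : ℂ) * h1 + (1 / 2 : ℂ) * h2
  have hq : 2 * a ^ 3 = Q := by linear_combination (1 / 2 : ℂ) * h1 - (1 / 2 : ℂ) * h2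
  -- then `a⁶` is the square of a nonzero real number and `-i` times the cube of a real number
  have h6 : ((Q ^ 2 * 27 : ℝ) : ℂ) = ((4 * P ^ 3 : ℝ) : ℂ) * I := by
    push_cast
    rw [← hq]
    have : (-3 * a ^ 2) ^ 3 = -(I * P ^ 3) := by rw [hp, mul_pow, I_pow_three]; ring
    linear_combination (-4) * this
  have := congrArg Complex.re h6
  rw [ofReal_re, re_ofReal_mul, I_re, mul_zero] at this
  have : 0 < Q ^ 2 * 27 := by positivity
  linarith

/-- Near the critical frequency, two decay rates have size `ε⁻²`, the third one has size `ε⁻³`. -/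
theorem exists_tendsto_critical_rates {ι : Type*} (l : Ultrafilter ι) {s c ν₀ κ₀ : ℝ} (hs : 0 < s)
    (hc : 0 < c) (hν : 0 < ν₀) (hκ : 0 < κ₀) {ε ω k : ι → ℝ} {ω₁ k₁ θ : ℝ} {u v : ι → Fin 3 → ℂ}
    (hε : Tendsto ε l (𝓝[>] 0)) (hω : Tendsto ω l (𝓝 ω₁)) (hk : Tendsto k l (𝓝 k₁))
    (hθ : Tendsto (fun i => (ω i ^ 2 - s ^ 2) / ε i ^ 2) l (𝓝 θ)) (hω1 : ω₁ ^ 2 = s ^ 2)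
    (hωk : 0 < ω₁ * k₁)
    (hF : ∀ᶠ i in (l : Filter ι),
      IsFactorization s c (ν₀ * ε i ^ 6) (κ₀ * ε i ^ 6) (ω i) (k i) (u i) (v i)) :
    ∃ Z₀ Z₁ Y : ℂ, Tendsto (fun i => (ε i : ℂ) ^ 2 * u i 0) l (𝓝 Z₀) ∧
      Tendsto (fun i => (ε i : ℂ) ^ 2 * u i 1) l (𝓝 Z₁) ∧
      Tendsto (fun i => (ε i : ℂ) ^ 3 * u i 2) l (𝓝 Y) ∧
      0 < Z₀.re ∧ 0 < Z₁.re ∧ 0 < Y.re ∧ Z₀ ≠ Z₁ ∧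
      Y ^ 2 = -(I * ((ω₁ * (ν₀ + κ₀) / (ν₀ * κ₀) : ℝ) : ℂ)) := by
  have hε0 : ∀ᶠ i in (l : Filter ι), 0 < ε i := hε.eventually self_mem_nhdsWithin
  have hε' := tendsto_ofReal (tendsto_nhdsWithin_iff.1 hε).1
  have hω' := tendsto_ofReal hω
  have hk' := tendsto_ofReal hk
  have hθ' := tendsto_ofReal hθ
  have hω0 : ω₁ ≠ 0 := left_ne_zero_of_mul hωk.ne'
  have hν' : (ν₀ : ℂ) ≠ 0 := by exact_mod_cast hν.ne'
  have hκ' : (κ₀ : ℂ) ≠ 0 := by exact_mod_cast hκ.ne'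
  have hω0' : (ω₁ : ℂ) ≠ 0 := by exact_mod_cast hω0
  have hn' : (ν₀ + κ₀ : ℂ) ≠ 0 := by exact_mod_cast (add_pos hν hκ).ne'
  -- at the scale `ε⁻³`, the limits are `0` with multiplicity four and `± Y`
  obtain ⟨U, V, hU, hV, hUV, hUre, hVre, n1, n2, n3, n4⟩ :=
    exists_tendsto_scaled_roots l s c hν hκ hε hω hk hF
  set ρ : ℝ := ω₁ * (ν₀ + κ₀) / (ν₀ * κ₀) with hρ
  set Y := sqrtNegI ρ with hYdef
  have hρ0 : ρ ≠ 0 := div_ne_zero (mul_ne_zero hω0 (add_pos hν hκ).ne') (mul_pos hν hκ).ne'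
  have hYre : 0 < Y.re := sqrtNegI_re hρ0
  have hY2 : Y ^ 2 = -(I * (ρ : ℂ)) := sqrtNegI_sq ρ
  have hY0 : Y ≠ 0 := fun h => by simp [h] at hYre
  obtain ⟨⟨-, -, hU2⟩, -, -, hV2⟩ := eq_of_prod_eq_pow_four_mul hYre (fun z => by
    rw [hUV, hY2, hρ, ← ofReal_pow, hω1]
    push_cast
    ring) hUre hVre n1 n2 n3 n4
  have hu2 := hU 2
  have hv2 := hV 2
  rw [hU2] at hu2
  rw [hV2] at hv2
  -- at the scale `ε⁻²`, the four other roots converge to the roots of `z (z³ + i P z + Q)`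
  set r : Fin 4 → ι → ℂ := ![fun i => (ε i : ℂ) ^ 2 * u i 0, fun i => (ε i : ℂ) ^ 2 * u i 1,
    fun i => (ε i : ℂ) ^ 2 * v i 0, fun i => (ε i : ℂ) ^ 2 * v i 1] with hr
  set P : ℝ := θ / (ω₁ * (ν₀ + κ₀)) with hP
  set Q : ℝ := 2 * s * c * k₁ / (ω₁ * (ν₀ + κ₀)) with hQ
  have hQpos : 0 < Q := by
    have : Q = 2 * s * c * (ω₁ * k₁) / (ω₁ ^ 2 * (ν₀ + κ₀)) := by
      rw [hQ]
      field_simp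
    rw [this]
    positivity
  have hlim : ∀ z, Tendsto (fun i => ∏ j, (z - r j i)) l (𝓝 (z * (z ^ 3 + I * P * z + Q))) := by
    intro z
    have h1 : Tendsto (fun i => -(ν₀ * κ₀ : ℂ) * ((ε i : ℂ) * z - (ε i : ℂ) ^ 3 * u i 2) *
        ((ε i : ℂ) * z - (ε i : ℂ) ^ 3 * v i 2)) l
        (𝓝 (-(ν₀ * κ₀ : ℂ) * (((0 : ℝ) : ℂ) * z - Y) * (((0 : ℝ) : ℂ) * z - -Y))) :=
      (((hε'.mul_const z).sub hu2).const_mul _).mul ((hε'.mul_const z).sub hv2)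
    have h2 : -(ν₀ * κ₀ : ℂ) * (((0 : ℝ) : ℂ) * z - Y) * (((0 : ℝ) : ℂ) * z - -Y) =
        -(I * ω₁ * (ν₀ + κ₀)) := by
      rw [ofReal_zero, zero_mul]
      have : -(ν₀ * κ₀ : ℂ) * (0 - Y) * (0 - -Y) = ν₀ * κ₀ * Y ^ 2 := by ring
      rw [this, hY2, hρ]
      push_cast
      field_simp
    rw [h2] at h1
    have h3 : -(I * ω₁ * (ν₀ + κ₀)) ≠ (0 : ℂ) := by simp [hω0', hn']
    have h4 := (tendsto_criticalSymb hε' hω' hk' hθ' s c ν₀ κ₀ z).div h1 h3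
    have h5 : criticalSymb s c ν₀ κ₀ (0 : ℝ) ω₁ k₁ θ z / -(I * ω₁ * (ν₀ + κ₀)) =
        z * (z ^ 3 + I * P * z + Q) := by
      rw [div_eq_iff h3, hP, hQ]
      unfold criticalSymb
      push_cast
      field_simp
      linear_combination (θ * z ^ 2 : ℂ) * I_sq
    rw [h5] at h4
    refine h4.congr' ?_
    filter_upwards [hF, hε0, h1.eventually_ne h3] with i hi h0 hne
    rw [Pi.div_apply, div_eq_iff hne]
    have he : (ε i : ℂ) ≠ 0 := by exact_mod_cast h0.ne'
    obtain ⟨y, rfl⟩ : ∃ y, z = (ε i : ℂ) ^ 2 * y := ⟨((ε i : ℂ) ^ 2)⁻¹ * z, by field_simp⟩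
    rw [criticalSymb_eq h0.ne', hi.eq_prod, Fin.prod_univ_four, Fin.prod_univ_three,
      Fin.prod_univ_three]
    simp only [hr, Matrix.cons_val]
    push_cast
    ring
  obtain ⟨ζ, hζ, hq⟩ := exists_tendsto_roots l r _ hlim
  have hz0 : Tendsto (fun i => (ε i : ℂ) ^ 2 * u i 0) l (𝓝 (ζ 0)) := hζ 0
  have hz1 : Tendsto (fun i => (ε i : ℂ) ^ 2 * u i 1) l (𝓝 (ζ 1)) := hζ 1
  -- the root `0` of the limit equation belongs to a growing mode
  have hne : ∀ j, ∀ w, Tendsto (fun i => (ε i : ℂ) ^ 2 * u i j) l (𝓝 w) → w ≠ 0 ∧ 0 ≤ w.re := by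
    intro j w hw
    constructor
    · rintro rfl
      exact false_of_tendsto_zero hs hc hν hκ hε hω hk hθ hω1 hωk hw
        (hF.mono fun i hi => hi.re_pos j) (hF.mono fun i hi => hi.symb_eq_zero j)
    · refine ge_of_tendsto (tendsto_re hw) ?_
      filter_upwards [hF, hε0] with i hi h0
      rw [re_ofReal_pow_mul]
      exact mul_nonneg (by positivity) (hi.re_pos j).le
  have hcub : ∀ j, ζ j ≠ 0 → ζ j ^ 3 + I * P * ζ j + Q = 0 := by
    intro j hj
    have := hq (ζ j)
    rw [Finset.prod_eq_zero (Finset.mem_univ j) (sub_self _)] at this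
    exact (mul_eq_zero.1 this).resolve_left hj
  obtain ⟨h00, h01⟩ := hne 0 _ hz0
  obtain ⟨h10, h11⟩ := hne 1 _ hz1
  refine ⟨ζ 0, ζ 1, Y, hz0, hz1, hu2, re_pos_of_cubic hQpos.ne' (hcub 0 h00) h01,
    re_pos_of_cubic hQpos.ne' (hcub 1 h10) h11, hYre, fun h => ?_, hY2⟩
  have h0 := hq 0
  rw [zero_mul, Fin.prod_univ_four] at h0
  have h0 := h0.symm
  simp only [zero_sub, mul_eq_zero, neg_eq_zero, h00, h10, false_or] at h0
  rcases h0 with h0 | h0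
  · refine false_of_cubic_double_root (P := P) hQpos (a := ζ 0) (b := ζ 3) fun z => ?_
    rw [hq, Fin.prod_univ_four, h0, ← h]
    ring
  · refine false_of_cubic_double_root (P := P) hQpos (a := ζ 0) (b := ζ 2) fun z => ?_
    rw [hq, Fin.prod_univ_four, h0, ← h]
    ring

/-! ### Decay rates away from the critical frequency -/

theorem norm_sqrtNegI_sq (ρ : ℝ) : ‖sqrtNegI ρ‖ ^ 2 = |ρ| := by
  rw [← norm_pow, sqrtNegI_sq]
  simp

open Classical in
/-- The moduli and the signs of the real parts identify the limits of the three decaying roots. -/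
theorem eq_of_prod_eq_sq_mul {U V : Fin 3 → ℂ} {Y₁ Y₂ : ℂ} (hY₁ : 0 < Y₁.re) (hY₂ : 0 < Y₂.re)
    (hlt : ‖Y₁‖ < ‖Y₂‖)
    (h : ∀ z, (∏ j, (z - U j)) * ∏ j, (z - V j) = z ^ 2 * ((z ^ 2 - Y₁ ^ 2) * (z ^ 2 - Y₂ ^ 2)))
    (hU : ∀ j, 0 ≤ (U j).re) (hV : ∀ j, (V j).re ≤ 0) (h1 : ‖U 0‖ ≤ ‖U 1‖)
    (h2 : ‖U 1‖ ≤ ‖U 2‖) : U 0 = 0 ∧ U 1 = Y₁ ∧ U 2 = Y₂ := by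
  have hm : ({U 0, U 1, U 2, V 0, V 1, V 2} : Multiset ℂ) = {0, 0, Y₁, -Y₁, Y₂, -Y₂} := by
    apply multiset_eq_of_prod_sub_eq
    intro z
    have := h z
    simp only [Fin.prod_univ_three] at this
    simp only [Multiset.insert_eq_cons, Multiset.map_cons, Multiset.prod_cons,
      Multiset.map_singleton, Multiset.prod_singleton]
    linear_combination this
  have hUm : ∀ j, U j = 0 ∨ U j = Y₁ ∨ U j = Y₂ := by
    intro j
    have hj := hU j
    have h0 := h (U j)
    rw [Finset.prod_eq_zero (Finset.mem_univ j) (sub_self _), zero_mul, eq_comm, mul_eq_zero,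
      mul_eq_zero, sub_eq_zero, sub_eq_zero, sq_eq_sq_iff_eq_or_eq_neg,
      sq_eq_sq_iff_eq_or_eq_neg] at h0
    rcases h0 with h0 | (h0 | h0) | h0 | h0
    · exact Or.inl (pow_eq_zero_iff (by norm_num) |>.1 h0)
    · exact Or.inr (Or.inl h0)
    · rw [h0, neg_re] at hj
      linarith
    · exact Or.inr (Or.inr h0)
    · rw [h0, neg_re] at hj
      linarith
  have hne : Y₁ ≠ Y₂ := fun h => by simp [h] at hlt
  have hn1 : 0 < ‖Y₁‖ := norm_pos_iff.2 fun h => by simp [h] at hY₁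
  have hn2 : 0 < ‖Y₂‖ := hn1.trans hlt
  have e1 : Y₁ ≠ 0 := norm_pos_iff.1 hn1
  have e2 : Y₂ ≠ 0 := norm_pos_iff.1 hn2
  have e3 : -Y₁ ≠ Y₂ := fun h => by
    rw [← h, neg_re] at hY₂
    linarith
  have e4 : -Y₂ ≠ Y₁ := fun h => e3 (by rw [← h, neg_neg])
  have v1 : ∀ j, V j ≠ Y₁ := fun j hj => (hV j).not_gt (hj ▸ hY₁)
  have v2 : ∀ j, V j ≠ Y₂ := fun j hj => (hV j).not_gt (hj ▸ hY₂)
  -- `Y₁` and `Y₂` are roots of multiplicity one, and only the `U j` can be equal to them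
  have c1 := congrArg (Multiset.countP fun z => z = Y₁) hm
  have c2 := congrArg (Multiset.countP fun z => z = Y₂) hm
  simp only [Multiset.insert_eq_cons, Multiset.countP_cons, ← Multiset.cons_zero,
    Multiset.countP_zero, v1, v2, e1.symm, e2.symm, e3, e4, hne, hne.symm, neg_eq_self,
    e1, e2, if_true, if_false] at c1 c2
  rcases hUm 0 with a | a | a <;> rcases hUm 1 with b | b | b <;> rcases hUm 2 with d | d | d <;>
    simp [a, b, d, e1.symm, e2.symm, hne, hne.symm] at c1 c2 <;>
    simp_all [hlt.not_ge, hn1.not_ge, hn2.not_ge]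

/-- The equation of the rates of size `ε⁻³` has two roots `z² = -iρ`, with `ρ` real. -/
theorem exists_rates_sq {s ν₀ κ₀ ω : ℝ} (hs : 0 < s) (hν : 0 < ν₀) (hκ : 0 < κ₀)
    (hω : s ^ 2 < ω ^ 2) :
    ∃ ρ₁ ρ₂ : ℝ, |ρ₁| < |ρ₂| ∧ ρ₁ ≠ 0 ∧ ρ₁ + ρ₂ = ω * (ν₀ + κ₀) / (ν₀ * κ₀) ∧
      ρ₁ * ρ₂ = (ω ^ 2 - s ^ 2) / (ν₀ * κ₀) := by
  set D : ℝ := ω ^ 2 * (ν₀ - κ₀) ^ 2 + 4 * (ν₀ * κ₀) * s ^ 2 with hD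
  have hDpos : 0 < D := by positivity
  set R : ℝ := √D with hR
  have hRpos : 0 < R := Real.sqrt_pos.2 hDpos
  have hR2 : R ^ 2 = D := Real.sq_sqrt hDpos.le
  set a : ℝ := (ω * (ν₀ + κ₀) - R) / (2 * (ν₀ * κ₀)) with ha
  set b : ℝ := (ω * (ν₀ + κ₀) + R) / (2 * (ν₀ * κ₀)) with hb
  have hsum : a + b = ω * (ν₀ + κ₀) / (ν₀ * κ₀) := by
    rw [ha, hb]
    field_simp
    ring
  have hprod : a * b = (ω ^ 2 - s ^ 2) / (ν₀ * κ₀) := by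
    have : a * b = ((ω * (ν₀ + κ₀)) ^ 2 - R ^ 2) / (4 * (ν₀ * κ₀) ^ 2) := by
      rw [ha, hb]
      field_simp
      ring
    rw [this, hR2, hD]
    field_simp
    ring
  have hpos : 0 < a * b := by
    rw [hprod]
    exact div_pos (by linarith) (by positivity)
  have hlt : a < b := by
    rw [ha, hb]
    gcongr
    linarith
  rcases lt_or_gt_of_ne (left_ne_zero_of_mul hpos.ne') with h | h
  · have hb0 : b < 0 := by nlinarith
    refine ⟨b, a, ?_, hb0.ne, by rw [add_comm, hsum], by rw [mul_comm, hprod]⟩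
    rw [abs_of_neg h, abs_of_neg hb0]
    linarith
  · refine ⟨a, b, ?_, h.ne', hsum, hprod⟩
    rw [abs_of_pos h, abs_of_pos (h.trans hlt)]
    exact hlt

/-- Above the critical frequency, one decay rate has size `1` and converges to a root of the
inviscid equation, the two other ones have size `ε⁻³`. -/
theorem exists_tendsto_supercritical_rates {ι : Type*} (l : Ultrafilter ι) {s c ν₀ κ₀ : ℝ}
    (hs : 0 < s) (hc : 0 < c) (hν : 0 < ν₀) (hκ : 0 < κ₀) {ε ω k : ι → ℝ} {ω₁ k₁ : ℝ}
    {u v : ι → Fin 3 → ℂ} (hε : Tendsto ε l (𝓝[>] 0)) (hω : Tendsto ω l (𝓝 ω₁))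
    (hk : Tendsto k l (𝓝 k₁)) (hω1 : s ^ 2 < ω₁ ^ 2) (hωk : 0 < ω₁ * k₁)
    (hF : ∀ᶠ i in (l : Filter ι),
      IsFactorization s c (ν₀ * ε i ^ 6) (κ₀ * ε i ^ 6) (ω i) (k i) (u i) (v i)) :
    ∃ (w Y₁ Y₂ : ℂ) (ρ₁ ρ₂ : ℝ), Tendsto (fun i => u i 0) l (𝓝 w) ∧
      Tendsto (fun i => (ε i : ℂ) ^ 3 * u i 1) l (𝓝 Y₁) ∧
      Tendsto (fun i => (ε i : ℂ) ^ 3 * u i 2) l (𝓝 Y₂) ∧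
      (w ≠ 0 ∧ 0 ≤ w.re ∧
        (ω₁ ^ 2 - s ^ 2) * w ^ 2 - 2 * I * s * c * k₁ * w + (c ^ 2 - ω₁ ^ 2) * k₁ ^ 2 = 0 ∧
        (w.re = 0 → s * c * ω₁ * k₁ ≤ (ω₁ ^ 2 - s ^ 2) * w.im * ω₁)) ∧
      0 < Y₁.re ∧ 0 < Y₂.re ∧ ‖Y₁‖ < ‖Y₂‖ ∧ Y₁ ^ 2 = -(I * ρ₁) ∧ Y₂ ^ 2 = -(I * ρ₂) ∧
      ρ₁ + ρ₂ = ω₁ * (ν₀ + κ₀) / (ν₀ * κ₀) ∧ ρ₁ * ρ₂ = (ω₁ ^ 2 - s ^ 2) / (ν₀ * κ₀) := by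
  have hε0 : ∀ᶠ i in (l : Filter ι), 0 < ε i := hε.eventually self_mem_nhdsWithin
  have hε' := tendsto_ofReal (tendsto_nhdsWithin_iff.1 hε).1
  have hω' := tendsto_ofReal hω
  have hk' := tendsto_ofReal hk
  have hω0 : ω₁ ≠ 0 := left_ne_zero_of_mul hωk.ne'
  have hk0 : k₁ ≠ 0 := right_ne_zero_of_mul hωk.ne'
  have hν' : (ν₀ : ℂ) ≠ 0 := by exact_mod_cast hν.ne'
  have hκ' : (κ₀ : ℂ) ≠ 0 := by exact_mod_cast hκ.ne'
  obtain ⟨U, V, hU, hV, hUV, hUre, hVre, n1, n2, -, -⟩ :=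
    exists_tendsto_scaled_roots l s c hν hκ hε hω hk hF
  obtain ⟨ρ₁, ρ₂, hlt, hρ1, hsum, hprod⟩ := exists_rates_sq hs hν hκ hω1
  have hρ2 : ρ₂ ≠ 0 := abs_pos.1 ((abs_nonneg _).trans_lt hlt)
  have hnorm : ‖sqrtNegI ρ₁‖ < ‖sqrtNegI ρ₂‖ := by
    rw [← sq_lt_sq₀ (norm_nonneg _) (norm_nonneg _), norm_sqrtNegI_sq, norm_sqrtNegI_sq]
    exact hlt
  obtain ⟨hU0, hU1, hU2⟩ := eq_of_prod_eq_sq_mul (sqrtNegI_re hρ1) (sqrtNegI_re hρ2) hnorm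
    (fun z => by
      have h1 : ((ρ₁ : ℂ) + ρ₂) = ω₁ * (ν₀ + κ₀) / (ν₀ * κ₀) := by
        exact_mod_cast congrArg ofReal hsum
      have h2 : ((ρ₁ : ℂ) * ρ₂) = (ω₁ ^ 2 - s ^ 2) / (ν₀ * κ₀) := by
        exact_mod_cast congrArg ofReal hprod
      rw [hUV, sqrtNegI_sq, sqrtNegI_sq, ← h2, mul_assoc I, mul_div_assoc, ← h1]
      linear_combination (-(z ^ 2) * ρ₁ * ρ₂ : ℂ) * I_sq) hUre hVre n1 n2
  have hu0 := hU 0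
  have hu1 := hU 1
  have hu2 := hU 2
  rw [hU0] at hu0
  rw [hU1] at hu1
  rw [hU2] at hu2
  -- the characteristic equation reads `D * z² - 2isck z + N = 0`, with `D` tending to `ω₁² - s²`
  set D : ℂ × ℂ × ℂ × ℂ → ℂ := fun p =>
    (p.2.1 ^ 2 - s ^ 2) - I * p.2.1 * (ν₀ + κ₀) * (p.2.2.2 ^ 2 - 2 * p.2.2.1 ^ 2 * p.1 ^ 6) +
      ν₀ * κ₀ * (-p.2.2.2 ^ 4 + 3 * p.2.2.1 ^ 2 * p.1 ^ 6 * p.2.2.2 ^ 2 -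
        3 * p.2.2.1 ^ 4 * p.1 ^ 12) with hD
  set N : ℂ × ℂ × ℂ × ℂ → ℂ := fun p =>
    (c ^ 2 - p.2.1 ^ 2) * p.2.2.1 ^ 2 - I * p.2.1 * (ν₀ + κ₀) * p.1 ^ 6 * p.2.2.1 ^ 4 +
      ν₀ * κ₀ * p.1 ^ 12 * p.2.2.1 ^ 6 with hN
  have hDc : Continuous D := by fun_prop
  have hNc : Continuous N := by fun_prop
  set P : ι → ℂ × ℂ × ℂ × ℂ := fun i => ((ε i : ℂ), (ω i : ℂ), (k i : ℂ),
    (ε i : ℂ) ^ 3 * u i 0) with hP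
  have hPt : Tendsto P l (𝓝 (((0 : ℝ) : ℂ), (ω₁ : ℂ), (k₁ : ℂ), (0 : ℂ))) :=
    hε'.prodMk_nhds (hω'.prodMk_nhds (hk'.prodMk_nhds hu0))
  have hDt := Tendsto.comp (hDc.tendsto _) hPt
  have hNt := Tendsto.comp (hNc.tendsto _) hPt
  have hD1 : D (((0 : ℝ) : ℂ), (ω₁ : ℂ), (k₁ : ℂ), (0 : ℂ)) = ω₁ ^ 2 - s ^ 2 := by
    simp [hD]
  have hN1 : N (((0 : ℝ) : ℂ), (ω₁ : ℂ), (k₁ : ℂ), (0 : ℂ)) = (c ^ 2 - ω₁ ^ 2) * k₁ ^ 2 := by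
    simp [hN]
  rw [hD1] at hDt
  rw [hN1] at hNt
  have hA : (ω₁ ^ 2 - s ^ 2 : ℂ) ≠ 0 := by
    have : ω₁ ^ 2 - s ^ 2 ≠ 0 := (sub_pos.2 hω1).ne'
    exact_mod_cast this
  have heq : ∀ᶠ i in (l : Filter ι), (D ∘ P) i * u i 0 ^ 2 - 2 * I * s * c * k i * u i 0 +
      (N ∘ P) i = 0 := by
    filter_upwards [hF] with i hi
    have h := hi.symb_eq_zero 0
    unfold symb at h
    simp only [Function.comp_apply, hN, hD, hP]
    push_cast at h
    linear_combination h - (ω i ^ 2 * (k i ^ 2 - u i 0 ^ 2) - c ^ 2 * k i ^ 2 : ℂ) * I_sq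
  -- if `u 0` tended to infinity, the equation divided by `(u 0)²` would yield `ω₁² = s²`
  have hconv : ∃ w, Tendsto (fun i => u i 0) l (𝓝 w) := by
    refine (exists_tendsto_or_tendsto_norm_atTop l fun i => u i 0).resolve_right fun hinf => hA ?_
    have hinv : Tendsto (fun i => (u i 0)⁻¹) l (𝓝 0) :=
      tendsto_inv₀_cobounded.comp (tendsto_norm_atTop_iff_cobounded.1 hinf)
    have h1 := (hDt.sub ((hk'.const_mul (2 * I * s * c)).mul hinv)).add (hNt.mul (hinv.pow 2))
    rw [mul_zero, zero_pow two_ne_zero, mul_zero, sub_zero, add_zero] at h1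
    refine tendsto_nhds_unique h1 (tendsto_const_nhds.congr' ?_)
    filter_upwards [heq, hinf.eventually_gt_atTop 0] with i hi h0
    have h2 : u i 0 ≠ 0 := norm_pos_iff.1 h0
    field_simp
    linear_combination -hi
  obtain ⟨w, hw⟩ := hconv
  have hwre : 0 ≤ w.re := ge_of_tendsto (tendsto_re hw) (hF.mono fun i hi => (hi.re_pos 0).le)
  have hsign : w.re = 0 → s * c * ω₁ * k₁ ≤ (ω₁ ^ 2 - s ^ 2) * w.im * ω₁ := fun h0 =>
    le_of_tendsto_imaginary s c hν hκ hε hω hk hω0 hk0 hw h0 (hF.mono fun i hi => hi.re_pos 0)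
      (hF.mono fun i hi => hi.symb_eq_zero 0)
  refine ⟨w, _, _, ρ₁, ρ₂, hw, hu1, hu2, ⟨?_, hwre, ?_, hsign⟩, sqrtNegI_re hρ1, sqrtNegI_re hρ2,
    hnorm, sqrtNegI_sq ρ₁, sqrtNegI_sq ρ₂, hsum, hprod⟩
  · rintro rfl
    have := hsign rfl
    rw [zero_im, mul_zero, zero_mul, mul_assoc] at this
    exact absurd this (not_le.2 (by positivity))
  · exact tendsto_nhds_unique (((hDt.mul (hw.pow 2)).sub
      ((hk'.const_mul (2 * I * s * c)).mul hw)).add hNt) (tendsto_const_nhds.congr' (by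
        filter_upwards [heq] with i hi
        exact hi.symm))

/-! ### Size of the lifting amplitudes -/

/-- The matrix `liftMatrix` for an arbitrary triple `L` of rates. -/
def liftMat (γ κ ω k : ℝ) (L : Fin 3 → ℂ) : Matrix (Fin 3) (Fin 3) ℂ :=
  Matrix.of ![fun _ => 1, fun j => modeW k (L j), fun j => -(L j) * modeB γ κ ω k (L j)]

theorem liftMatrix_eq (γ ν κ ω k : ℝ) :
    liftMatrix γ ν κ ω k = liftMat γ κ ω k (rate γ ν κ ω k) := rfl

theorem tendsto_det {ι : Type*} {l : Filter ι} {M : ι → Matrix (Fin 3) (Fin 3) ℂ}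
    {M₁ : Matrix (Fin 3) (Fin 3) ℂ} (hM : ∀ a b, Tendsto (fun i => M i a b) l (𝓝 (M₁ a b))) :
    Tendsto (fun i => (M i).det) l (𝓝 M₁.det) :=
  ((continuous_id.matrix_det (A := fun M : Matrix (Fin 3) (Fin 3) ℂ => M)).tendsto M₁).comp
    (tendsto_pi_nhds.2 fun a => tendsto_pi_nhds.2 fun b => hM a b)

theorem tendsto_inv_mulVec {ι : Type*} {l : Filter ι} {M : ι → Matrix (Fin 3) (Fin 3) ℂ}
    {M₁ : Matrix (Fin 3) (Fin 3) ℂ} {d : ι → Fin 3 → ℂ} {d₁ : Fin 3 → ℂ}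
    (hM : ∀ a b, Tendsto (fun i => M i a b) l (𝓝 (M₁ a b)))
    (hd : ∀ a, Tendsto (fun i => d i a) l (𝓝 (d₁ a))) (hdet : M₁.det ≠ 0) (j : Fin 3) :
    Tendsto (fun i => ((M i)⁻¹.mulVec (d i)) j) l (𝓝 ((M₁⁻¹.mulVec d₁) j)) := by
  have hM' : Tendsto M l (𝓝 M₁) := tendsto_pi_nhds.2 fun a => tendsto_pi_nhds.2 fun b => hM a b
  have hadj : Tendsto (fun i => (M i).adjugate) l (𝓝 M₁.adjugate) :=
    ((continuous_id.matrix_adjugate (A := fun M : Matrix (Fin 3) (Fin 3) ℂ => M)).tendsto M₁).comp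
      hM'
  have h1 : ∀ b, Tendsto (fun i => (M i)⁻¹ j b) l (𝓝 (M₁⁻¹ j b)) := by
    intro b
    simp only [Matrix.inv_def, Ring.inverse_eq_inv', Matrix.smul_apply, smul_eq_mul]
    exact ((tendsto_det hM).inv₀ hdet).mul
      (tendsto_pi_nhds.1 (tendsto_pi_nhds.1 hadj j) b)
  simp only [Matrix.mulVec, dotProduct]
  exact tendsto_finsetSum _ fun b _ => (h1 b).mul (hd b)

/-- If the matrices `diag R * M * diag C` converge to an invertible matrix and the vectors
`diag R * d` converge, then the solutions of `M a = d` are such that `diag C⁻¹ * a` converges. -/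
theorem tendsto_scaled_solution {ι : Type*} {l : Filter ι} {M : ι → Matrix (Fin 3) (Fin 3) ℂ}
    {M₁ : Matrix (Fin 3) (Fin 3) ℂ} {R C : ι → Fin 3 → ℂ}
    (hR : ∀ᶠ i in l, ∀ a, R i a ≠ 0) (hC : ∀ᶠ i in l, ∀ a, C i a ≠ 0)
    (hM : ∀ a b, Tendsto (fun i => R i a * M i a b * C i b) l (𝓝 (M₁ a b))) (hdet : M₁.det ≠ 0) :
    (∀ᶠ i in l, (M i).det ≠ 0) ∧ ∀ (d : ι → Fin 3 → ℂ) (d₁ : Fin 3 → ℂ),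
      (∀ a, Tendsto (fun i => R i a * d i a) l (𝓝 (d₁ a))) → ∀ j,
      Tendsto (fun i => (C i j)⁻¹ * ((M i)⁻¹.mulVec (d i)) j) l (𝓝 ((M₁⁻¹.mulVec d₁) j)) := by
  set M' : ι → Matrix (Fin 3) (Fin 3) ℂ :=
    fun i => Matrix.diagonal (R i) * M i * Matrix.diagonal (C i) with hM'
  have hentry : ∀ i a b, M' i a b = R i a * M i a b * C i b := fun i a b => by
    simp [hM', Matrix.mul_diagonal, Matrix.diagonal_mul]
  have ht : ∀ a b, Tendsto (fun i => M' i a b) l (𝓝 (M₁ a b)) := fun a b => by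
    simpa only [hentry] using hM a b
  have hdet' : ∀ᶠ i in l, (M i).det ≠ 0 := by
    filter_upwards [(tendsto_det ht).eventually_ne hdet] with i hi h0
    apply hi
    simp [hM', Matrix.det_mul, h0]
  refine ⟨hdet', fun d d₁ hd j => ?_⟩
  refine (tendsto_inv_mulVec ht hd hdet j).congr' ?_
  filter_upwards [hR, hC, hdet'] with i hRi hCi hi
  have hRu : IsUnit (Matrix.diagonal (R i)).det := by
    rw [Matrix.det_diagonal, isUnit_iff_ne_zero]
    exact Finset.prod_ne_zero_iff.2 fun a _ => hRi a
  have h1 : (fun a => R i a * d i a) = (Matrix.diagonal (R i)).mulVec (d i) := by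
    ext a
    rw [Matrix.mulVec_diagonal]
  have h2 : (Matrix.diagonal (C i))⁻¹ = Matrix.diagonal fun a => (C i a)⁻¹ := by
    refine Matrix.inv_eq_right_inv ?_
    rw [Matrix.diagonal_mul_diagonal, ← Matrix.diagonal_one]
    congr 1
    ext a
    exact mul_inv_cancel₀ (hCi a)
  rw [h1, hM', Matrix.mul_inv_rev, Matrix.mul_inv_rev, Matrix.mulVec_mulVec, Matrix.mul_assoc,
    Matrix.mul_assoc, Matrix.nonsing_inv_mul _ hRu, Matrix.mul_one, h2, ← Matrix.mulVec_mulVec,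
    Matrix.mulVec_diagonal]

theorem tendsto_modeB {ι : Type*} {l : Filter ι} {γ κ₀ ω₁ k₁ : ℝ} {ε ω k : ι → ℝ} {z : ι → ℂ}
    {p q : ℂ} (hω : Tendsto ω l (𝓝 ω₁)) (hk : Tendsto k l (𝓝 k₁)) (hε : Tendsto ε l (𝓝[>] 0))
    (hz : Tendsto (fun i => (z i)⁻¹) l (𝓝 p))
    (hz2 : Tendsto (fun i => (ε i : ℂ) ^ 6 * z i ^ 2) l (𝓝 q)) (hne : I * ω₁ + κ₀ * q ≠ 0) :
    Tendsto (fun i => modeB γ (κ₀ * ε i ^ 6) (ω i) (k i) (z i)) l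
      (𝓝 ((Real.sin γ + I * k₁ * p * Real.cos γ) / (I * ω₁ + κ₀ * q))) := by
  have hε' := tendsto_ofReal (tendsto_nhdsWithin_iff.1 hε).1
  have hω' := tendsto_ofReal hω
  have hk' := tendsto_ofReal hk
  have h1 := ((((hk'.const_mul I).mul hz).mul_const (Real.cos γ : ℂ)).const_add
    (Real.sin γ : ℂ)).div
    (((hω'.const_mul I).sub ((((hε'.pow 6).mul (hk'.pow 2)).sub hz2).const_mul (κ₀ : ℂ)))) (by
      rw [ofReal_zero]
      convert hne using 1
      ring)
  convert h1 using 2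
  · rename_i i
    simp only [modeB, Pi.div_apply, div_eq_mul_inv]
    push_cast
    ring_nf
  · rw [ofReal_zero]
    ring_nf

/-- Along a family of decay rates of size `ε⁻²`. -/
theorem tendsto_of_scaled_sq {ι : Type*} {l : Filter ι} {ε : ι → ℝ} {z : ι → ℂ} {Z : ℂ}
    (hε : Tendsto ε l (𝓝[>] 0)) (hZ : Z ≠ 0)
    (hz : Tendsto (fun i => (ε i : ℂ) ^ 2 * z i) l (𝓝 Z)) :
    Tendsto (fun i => (z i)⁻¹) l (𝓝 0) ∧
      Tendsto (fun i => (ε i : ℂ) ^ 6 * z i ^ 2) l (𝓝 0) := by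
  have hε' := tendsto_ofReal (tendsto_nhdsWithin_iff.1 hε).1
  have hε0 : ∀ᶠ i in l, 0 < ε i := hε.eventually self_mem_nhdsWithin
  have h1 := (hε'.pow 2).mul (hz.inv₀ hZ)
  have h2 := (hε'.pow 2).mul (hz.pow 2)
  rw [ofReal_zero, zero_pow two_ne_zero, zero_mul] at h1 h2
  constructor
  · refine h1.congr' ?_
    filter_upwards [hε0] with i h0
    have he : (ε i : ℂ) ≠ 0 := by exact_mod_cast h0.ne'
    rw [mul_inv, mul_inv_cancel_left₀ (pow_ne_zero 2 he)]
  · exact h2.congr fun i => by ring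

/-- Along a family of decay rates of size `ε⁻³`. -/
theorem tendsto_of_scaled_cube {ι : Type*} {l : Filter ι} {ε : ι → ℝ} {z : ι → ℂ} {Y : ℂ}
    (hε : Tendsto ε l (𝓝[>] 0)) (hY : Y ≠ 0)
    (hz : Tendsto (fun i => (ε i : ℂ) ^ 3 * z i) l (𝓝 Y)) :
    Tendsto (fun i => (z i)⁻¹) l (𝓝 0) ∧
      Tendsto (fun i => (ε i : ℂ) ^ 6 * z i ^ 2) l (𝓝 (Y ^ 2)) := by
  have hε' := tendsto_ofReal (tendsto_nhdsWithin_iff.1 hε).1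
  have hε0 : ∀ᶠ i in l, 0 < ε i := hε.eventually self_mem_nhdsWithin
  have h1 := (hε'.pow 3).mul (hz.inv₀ hY)
  rw [ofReal_zero, zero_pow three_ne_zero, zero_mul] at h1
  constructor
  · refine h1.congr' ?_
    filter_upwards [hε0] with i h0
    have he : (ε i : ℂ) ≠ 0 := by exact_mod_cast h0.ne'
    rw [mul_inv, mul_inv_cancel_left₀ (pow_ne_zero 3 he)]
  · exact (hz.pow 2).congr fun i => by ring

/-- The lifting matrix near the critical frequency. The amplitudes of the two modes of the `ε²`
boundary layer have size at most `ε⁻²`. -/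
theorem tendsto_critical_amplitude {ι : Type*} {l : Filter ι} {γ ν₀ κ₀ ω₁ k₁ : ℝ} {ε ω k : ι → ℝ}
    {L : ι → Fin 3 → ℂ} {Z₀ Z₁ Y : ℂ} (hs : 0 < Real.sin γ) (hν : 0 < ν₀) (hκ : 0 < κ₀)
    (hε : Tendsto ε l (𝓝[>] 0)) (hω : Tendsto ω l (𝓝 ω₁)) (hk : Tendsto k l (𝓝 k₁))
    (hω1 : ω₁ ≠ 0) (hk1 : k₁ ≠ 0)
    (h0 : Tendsto (fun i => (ε i : ℂ) ^ 2 * L i 0) l (𝓝 Z₀))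
    (h1 : Tendsto (fun i => (ε i : ℂ) ^ 2 * L i 1) l (𝓝 Z₁))
    (h2 : Tendsto (fun i => (ε i : ℂ) ^ 3 * L i 2) l (𝓝 Y)) (hZ0 : Z₀ ≠ 0) (hZ1 : Z₁ ≠ 0)
    (hY : Y ≠ 0) (hne : Z₀ ≠ Z₁) (hY2 : Y ^ 2 = -(I * ((ω₁ * (ν₀ + κ₀) / (ν₀ * κ₀) : ℝ) : ℂ))) :
    (∀ᶠ i in l, (liftMat γ (κ₀ * ε i ^ 6) (ω i) (k i) (L i)).det ≠ 0) ∧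
    ∀ (d : ι → Fin 3 → ℂ) (d₁ : Fin 3 → ℂ), (∀ a, Tendsto (fun i => d i a) l (𝓝 (d₁ a))) →
      ∃ A : Fin 3 → ℂ, ∀ j ∈ ({0, 1} : Finset (Fin 3)), Tendsto (fun i => (ε i : ℂ) ^ 2 *
        ((liftMat γ (κ₀ * ε i ^ 6) (ω i) (k i) (L i))⁻¹.mulVec (d i)) j) l (𝓝 (A j)) := by
  have hε' := tendsto_ofReal (tendsto_nhdsWithin_iff.1 hε).1
  have hk' := tendsto_ofReal hk
  have hε0 : ∀ᶠ i in l, (ε i : ℂ) ≠ 0 := by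
    filter_upwards [hε.eventually self_mem_nhdsWithin] with i hi
    exact_mod_cast (ne_of_gt hi)
  have hω0 : (ω₁ : ℂ) ≠ 0 := by exact_mod_cast hω1
  have hk0 : (k₁ : ℂ) ≠ 0 := by exact_mod_cast hk1
  have hν' : (ν₀ : ℂ) ≠ 0 := by exact_mod_cast hν.ne'
  have hκ' : (κ₀ : ℂ) ≠ 0 := by exact_mod_cast hκ.ne'
  have hs' : (Real.sin γ : ℂ) ≠ 0 := by exact_mod_cast hs.ne'
  have hI : I * ω₁ + κ₀ * 0 ≠ 0 := by simp [hω0]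
  have hI2 : I * ω₁ + κ₀ * Y ^ 2 ≠ 0 := by
    have : I * ω₁ + κ₀ * Y ^ 2 = -(I * ω₁ * κ₀ / ν₀) := by
      rw [hY2]
      push_cast
      field_simp
      ring
    rw [this]
    simp [hω0, hκ', hν']
  obtain ⟨i0, q0⟩ := tendsto_of_scaled_sq hε hZ0 h0
  obtain ⟨i1, q1⟩ := tendsto_of_scaled_sq hε hZ1 h1
  obtain ⟨i2, q2⟩ := tendsto_of_scaled_cube hε hY h2
  have B0 := tendsto_modeB (γ := γ) hω hk hε i0 q0 hI
  have B1 := tendsto_modeB (γ := γ) hω hk hε i1 q1 hI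
  have B2 := tendsto_modeB (γ := γ) hω hk hε i2 q2 hI2
  rw [mul_zero, zero_mul, add_zero] at B0 B1 B2
  rw [mul_zero, add_zero] at B0 B1
  set β : ℂ := Real.sin γ / (I * ω₁) with hβ
  set β' : ℂ := Real.sin γ / (I * ω₁ + κ₀ * Y ^ 2) with hβ'
  have hβ0 : β' ≠ 0 := div_ne_zero hs' hI2
  -- the scalings `R` of the rows and `C` of the columns make the limit matrix invertible
  obtain ⟨hdet, hsol⟩ := tendsto_scaled_solution (l := l)
    (M := fun i => liftMat γ (κ₀ * ε i ^ 6) (ω i) (k i) (L i))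
    (M₁ := !![1, 1, 0; I * k₁ * Z₀⁻¹, I * k₁ * Z₁⁻¹, 0; -(Z₀ * β), -(Z₁ * β), -(Y * β')])
    (R := fun i => ![(ε i : ℂ) ^ 2, 1, (ε i : ℂ) ^ 4])
    (C := fun i => ![((ε i : ℂ) ^ 2)⁻¹, ((ε i : ℂ) ^ 2)⁻¹, (ε i : ℂ)⁻¹])
    (by filter_upwards [hε0] with i hi a; fin_cases a <;> simp [hi])
    (by filter_upwards [hε0] with i hi a; fin_cases a <;> simp [hi])
    (by
      have m0 := (hk'.const_mul I).mul (h0.inv₀ hZ0)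
      have m1 := (hk'.const_mul I).mul (h1.inv₀ hZ1)
      have m2 := (hε'.pow 2).mul ((hk'.const_mul I).mul (h2.inv₀ hY))
      rw [ofReal_zero, zero_pow two_ne_zero, zero_mul] at m2
      have b0 := (h0.mul B0).neg
      have b1 := (h1.mul B1).neg
      have b2 := (h2.mul B2).neg
      have e0 := hε'
      rw [ofReal_zero] at e0
      intro a b
      fin_cases a <;> fin_cases b <;>
        simp only [liftMat, modeW, Matrix.of_apply, Matrix.cons_val, Fin.zero_eta, Fin.mk_one,
          Fin.reduceFinMk]
      · exact tendsto_const_nhds.congr' (by filter_upwards [hε0] with i hi; field_simp)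
      · exact tendsto_const_nhds.congr' (by filter_upwards [hε0] with i hi; field_simp)
      · exact e0.congr' (by filter_upwards [hε0] with i hi; field_simp)
      · refine m0.congr' ?_
        filter_upwards [hε0] with i hi
        simp only [div_eq_mul_inv, mul_inv]
        ring
      · refine m1.congr' ?_
        filter_upwards [hε0] with i hi
        simp only [div_eq_mul_inv, mul_inv]
        ring
      · refine m2.congr' ?_
        filter_upwards [hε0] with i hi
        simp only [div_eq_mul_inv, mul_inv]
        field_simp
      · exact b0.congr' (by filter_upwards [hε0] with i hi; field_simp)
      · exact b1.congr' (by filter_upwards [hε0] with i hi; field_simp)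
      · exact b2.congr' (by filter_upwards [hε0] with i hi; field_simp))
    (by
      rw [Matrix.det_fin_three]
      simp only [Matrix.of_apply, Matrix.cons_val', Matrix.cons_val, Matrix.cons_val_zero,
        Matrix.cons_val_one]
      have : Z₀ - Z₁ ≠ 0 := sub_ne_zero.2 hne
      have h3 : 1 * (I * k₁ * Z₁⁻¹) * -(Y * β') - 1 * 0 * -(Z₁ * β) -
          1 * (I * k₁ * Z₀⁻¹) * -(Y * β') +
          1 * 0 * -(Z₀ * β) + 0 * (I * k₁ * Z₀⁻¹) * -(Z₁ * β) - 0 * (I * k₁ * Z₁⁻¹) * -(Z₀ * β) =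
          -(I * k₁ * Y * β' * (Z₀ - Z₁) * (Z₀⁻¹ * Z₁⁻¹)) := by
        field_simp
        ring
      rw [h3]
      simp [hk0, hY, hβ0, this, hZ0, hZ1])
  refine ⟨hdet, fun d d₁ hd => ?_⟩
  have hd' : ∀ a, Tendsto (fun i => ![(ε i : ℂ) ^ 2, 1, (ε i : ℂ) ^ 4] a * d i a) l
      (𝓝 (![(((0 : ℝ) : ℂ)) ^ 2, 1, (((0 : ℝ) : ℂ)) ^ 4] a * d₁ a)) := by
    intro a
    refine Tendsto.mul ?_ (hd a)
    fin_cases a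
    · exact hε'.pow 2
    · exact tendsto_const_nhds
    · exact hε'.pow 4
  have := hsol d _ hd'
  refine ⟨_, fun j hj => (this j).congr fun i => ?_⟩
  fin_cases j
  · simp
  · simp
  · simp at hj

/-- The lifting matrix above the critical frequency, for boundary traces of size
`(ε⁻⁴, ε⁻², ε⁻⁶)`. The amplitude of the mode of size `1` has size at most `ε⁻²`, the amplitudes of
the two modes of size `ε⁻³` have size at most `ε⁻⁴`. -/
theorem tendsto_supercritical_amplitude {ι : Type*} {l : Filter ι} {γ ν₀ κ₀ ω₁ k₁ : ℝ}
    {ε ω k : ι → ℝ} {L : ι → Fin 3 → ℂ} {w Y₁ Y₂ : ℂ} {ρ₁ ρ₂ : ℝ} (hs : 0 < Real.sin γ)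
    (hν : 0 < ν₀) (hκ : 0 < κ₀) (hε : Tendsto ε l (𝓝[>] 0)) (hω : Tendsto ω l (𝓝 ω₁))
    (hk : Tendsto k l (𝓝 k₁)) (hω1 : ω₁ ≠ 0) (hk1 : k₁ ≠ 0)
    (h0 : Tendsto (fun i => L i 0) l (𝓝 w))
    (h1 : Tendsto (fun i => (ε i : ℂ) ^ 3 * L i 1) l (𝓝 Y₁))
    (h2 : Tendsto (fun i => (ε i : ℂ) ^ 3 * L i 2) l (𝓝 Y₂)) (hw : w ≠ 0)
    (hY₁ : 0 < Y₁.re) (hY₂ : 0 < Y₂.re) (hY₁2 : Y₁ ^ 2 = -(I * ρ₁)) (hY₂2 : Y₂ ^ 2 = -(I * ρ₂))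
    (hsum : ρ₁ + ρ₂ = ω₁ * (ν₀ + κ₀) / (ν₀ * κ₀))
    (hprod : ρ₁ * ρ₂ = (ω₁ ^ 2 - Real.sin γ ^ 2) / (ν₀ * κ₀)) :
    (∀ᶠ i in l, (liftMat γ (κ₀ * ε i ^ 6) (ω i) (k i) (L i)).det ≠ 0) ∧
    (∀ j, ∃ B, Tendsto (fun i => modeB γ (κ₀ * ε i ^ 6) (ω i) (k i) (L i j)) l (𝓝 B)) ∧
    (∀ j, ∃ W, Tendsto (fun i => modeW (k i) (L i j)) l (𝓝 W)) ∧
    ∀ (d : ι → Fin 3 → ℂ) (d₁ : Fin 3 → ℂ),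
      Tendsto (fun i => (ε i : ℂ) ^ 4 * d i 0) l (𝓝 (d₁ 0)) →
      Tendsto (fun i => (ε i : ℂ) ^ 2 * d i 1) l (𝓝 (d₁ 1)) →
      Tendsto (fun i => (ε i : ℂ) ^ 6 * d i 2) l (𝓝 (d₁ 2)) →
      ∃ A : Fin 3 → ℂ, ∀ j, Tendsto (fun i => (ε i : ℂ) ^ (![2, 4, 4] j : ℕ) *
        ((liftMat γ (κ₀ * ε i ^ 6) (ω i) (k i) (L i))⁻¹.mulVec (d i)) j) l (𝓝 (A j)) := by
  have hε' := tendsto_ofReal (tendsto_nhdsWithin_iff.1 hε).1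
  have hk' := tendsto_ofReal hk
  have hε0 : ∀ᶠ i in l, (ε i : ℂ) ≠ 0 := by
    filter_upwards [hε.eventually self_mem_nhdsWithin] with i hi
    exact_mod_cast (ne_of_gt hi)
  have hω0 : (ω₁ : ℂ) ≠ 0 := by exact_mod_cast hω1
  have hk0 : (k₁ : ℂ) ≠ 0 := by exact_mod_cast hk1
  have hs' : (Real.sin γ : ℂ) ≠ 0 := by exact_mod_cast hs.ne'
  have hY₁0 : Y₁ ≠ 0 := fun h => by simp [h] at hY₁
  have hY₂0 : Y₂ ≠ 0 := fun h => by simp [h] at hY₂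
  -- the two numbers `ω₁ - κ₀ ρ` have opposite signs
  have hneg : (ω₁ - κ₀ * ρ₁) * (ω₁ - κ₀ * ρ₂) < 0 := by
    have : (ω₁ - κ₀ * ρ₁) * (ω₁ - κ₀ * ρ₂) = -(κ₀ * Real.sin γ ^ 2 / ν₀) := by
      have : (ω₁ - κ₀ * ρ₁) * (ω₁ - κ₀ * ρ₂) =
        ω₁ ^ 2 - κ₀ * ω₁ * (ρ₁ + ρ₂) + κ₀ ^ 2 * (ρ₁ * ρ₂) := by ring
      rw [this, hsum, hprod]
      field_simp
      ring
    rw [this, neg_lt_zero]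
    positivity
  have hI : I * ω₁ + κ₀ * 0 ≠ 0 := by simp [hω0]
  have e1 : I * ω₁ + κ₀ * Y₁ ^ 2 = I * ((ω₁ - κ₀ * ρ₁ : ℝ) : ℂ) := by rw [hY₁2]; push_cast; ring
  have e2 : I * ω₁ + κ₀ * Y₂ ^ 2 = I * ((ω₁ - κ₀ * ρ₂ : ℝ) : ℂ) := by rw [hY₂2]; push_cast; ring
  have n1 : ω₁ - κ₀ * ρ₁ ≠ 0 := left_ne_zero_of_mul hneg.ne
  have n2 : ω₁ - κ₀ * ρ₂ ≠ 0 := right_ne_zero_of_mul hneg.ne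
  have hI1 : I * ω₁ + κ₀ * Y₁ ^ 2 ≠ 0 := by
    rw [e1]
    exact mul_ne_zero I_ne_zero (ofReal_ne_zero.2 n1)
  have hI2 : I * ω₁ + κ₀ * Y₂ ^ 2 ≠ 0 := by
    rw [e2]
    exact mul_ne_zero I_ne_zero (ofReal_ne_zero.2 n2)
  obtain ⟨i1, q1⟩ := tendsto_of_scaled_cube hε hY₁0 h1
  obtain ⟨i2, q2⟩ := tendsto_of_scaled_cube hε hY₂0 h2
  have q0 : Tendsto (fun i => (ε i : ℂ) ^ 6 * L i 0 ^ 2) l (𝓝 0) := by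
    have := (hε'.pow 6).mul (h0.pow 2)
    simpa using this
  have B0 := tendsto_modeB (γ := γ) hω hk hε (h0.inv₀ hw) q0 hI
  have B1 := tendsto_modeB (γ := γ) hω hk hε i1 q1 hI1
  have B2 := tendsto_modeB (γ := γ) hω hk hε i2 q2 hI2
  rw [mul_zero, zero_mul, add_zero] at B1 B2
  set β₁ : ℂ := Real.sin γ / (I * ω₁ + κ₀ * Y₁ ^ 2) with hβ₁
  set β₂ : ℂ := Real.sin γ / (I * ω₁ + κ₀ * Y₂ ^ 2) with hβ₂
  -- the real parts of `Y₁` and `Y₂` are positive, so the opposite signs exclude an equality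
  have hβ : Y₁ * β₁ - Y₂ * β₂ ≠ 0 := by
    intro h
    have h3 : ((ω₁ - κ₀ * ρ₂ : ℝ) : ℂ) * Y₁ = ((ω₁ - κ₀ * ρ₁ : ℝ) : ℂ) * Y₂ := by
      have m1 : ((ω₁ - κ₀ * ρ₁ : ℝ) : ℂ) ≠ 0 := ofReal_ne_zero.2 n1
      have m2 : ((ω₁ - κ₀ * ρ₂ : ℝ) : ℂ) ≠ 0 := ofReal_ne_zero.2 n2
      rw [hβ₁, hβ₂, e1, e2] at h
      generalize ((ω₁ - κ₀ * ρ₁ : ℝ) : ℂ) = x at *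
      generalize ((ω₁ - κ₀ * ρ₂ : ℝ) : ℂ) = y at *
      field_simp at h
      exact mul_left_cancel₀ hs' (by linear_combination h)
    have h4 := congrArg Complex.re h3
    rw [re_ofReal_mul, re_ofReal_mul] at h4
    have h5 : (ω₁ - κ₀ * ρ₁) * (ω₁ - κ₀ * ρ₂) * Y₁.re = (ω₁ - κ₀ * ρ₁) ^ 2 * Y₂.re := by
      linear_combination (ω₁ - κ₀ * ρ₁) * h4
    have h6 : (ω₁ - κ₀ * ρ₁) * (ω₁ - κ₀ * ρ₂) * Y₁.re < 0 := mul_neg_of_neg_of_pos hneg hY₁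
    have h7 : 0 < (ω₁ - κ₀ * ρ₁) ^ 2 * Y₂.re := by positivity
    linarith
  have m0 := (hk'.const_mul I).mul (h0.inv₀ hw)
  -- the scalings `R` of the rows and `C` of the columns make the limit matrix invertible
  obtain ⟨hdet, hsol⟩ := tendsto_scaled_solution (l := l)
    (M := fun i => liftMat γ (κ₀ * ε i ^ 6) (ω i) (k i) (L i))
    (M₁ := !![0, 1, 1; I * k₁ * w⁻¹, 0, 0; 0, -(Y₁ * β₁), -(Y₂ * β₂)])
    (R := fun i => ![(ε i : ℂ) ^ 4, (ε i : ℂ) ^ 2, (ε i : ℂ) ^ 7])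
    (C := fun i => ![((ε i : ℂ) ^ 2)⁻¹, ((ε i : ℂ) ^ 4)⁻¹, ((ε i : ℂ) ^ 4)⁻¹])
    (by filter_upwards [hε0] with i hi a; fin_cases a <;> simp [hi])
    (by filter_upwards [hε0] with i hi a; fin_cases a <;> simp [hi])
    (by
      have m1 := hε'.mul ((hk'.const_mul I).mul (h1.inv₀ hY₁0))
      have m2 := hε'.mul ((hk'.const_mul I).mul (h2.inv₀ hY₂0))
      rw [ofReal_zero, zero_mul] at m1 m2
      have b0 := ((hε'.pow 5).mul (h0.mul B0)).neg
      rw [ofReal_zero, zero_pow (by norm_num), zero_mul, neg_zero] at b0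
      have b1 := (h1.mul B1).neg
      have b2 := (h2.mul B2).neg
      have e0 := hε'.pow 2
      rw [ofReal_zero, zero_pow (by norm_num)] at e0
      intro a b
      fin_cases a <;> fin_cases b <;>
        simp only [liftMat, modeW, Matrix.of_apply, Matrix.cons_val, Fin.zero_eta, Fin.mk_one,
          Fin.reduceFinMk]
      · exact e0.congr' (by filter_upwards [hε0] with i hi; field_simp)
      · exact tendsto_const_nhds.congr' (by filter_upwards [hε0] with i hi; field_simp)
      · exact tendsto_const_nhds.congr' (by filter_upwards [hε0] with i hi; field_simp)
      · exact m0.congr' (by filter_upwards [hε0] with i hi; simp only [div_eq_mul_inv]; field_simp)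
      · refine m1.congr' ?_
        filter_upwards [hε0] with i hi
        simp only [div_eq_mul_inv, mul_inv]
        field_simp
      · refine m2.congr' ?_
        filter_upwards [hε0] with i hi
        simp only [div_eq_mul_inv, mul_inv]
        field_simp
      · exact b0.congr' (by filter_upwards [hε0] with i hi; field_simp)
      · exact b1.congr' (by filter_upwards [hε0] with i hi; field_simp)
      · exact b2.congr' (by filter_upwards [hε0] with i hi; field_simp))
    (by
      rw [Matrix.det_fin_three]
      simp only [Matrix.of_apply, Matrix.cons_val', Matrix.cons_val, Matrix.cons_val_zero,
        Matrix.cons_val_one]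
      have h3 : 0 * 0 * -(Y₂ * β₂) - 0 * 0 * -(Y₁ * β₁) - 1 * (I * k₁ * w⁻¹) * -(Y₂ * β₂) +
          1 * 0 * 0 + 1 * (I * k₁ * w⁻¹) * -(Y₁ * β₁) - 1 * 0 * 0 =
          -(I * k₁ * w⁻¹ * (Y₁ * β₁ - Y₂ * β₂)) := by
        ring
      rw [h3]
      simp [hk0, hw, hβ])
  refine ⟨hdet, fun j => ?_, fun j => ?_, fun d d₁ hd0 hd1 hd2 => ?_⟩
  · fin_cases j
    exacts [⟨_, B0⟩, ⟨_, B1⟩, ⟨_, B2⟩]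
  · simp only [modeW, div_eq_mul_inv]
    fin_cases j
    exacts [⟨_, m0⟩, ⟨_, (hk'.const_mul I).mul i1⟩, ⟨_, (hk'.const_mul I).mul i2⟩]
  have hd' : ∀ a, Tendsto (fun i => ![(ε i : ℂ) ^ 4, (ε i : ℂ) ^ 2, (ε i : ℂ) ^ 7] a * d i a) l
      (𝓝 (![d₁ 0, d₁ 1, ((0 : ℝ) : ℂ) * d₁ 2] a)) := by
    intro a
    fin_cases a
    · exact hd0
    · exact hd1
    · exact (hε'.mul hd2).congr fun i => by
        simp only [Fin.reduceFinMk, Matrix.cons_val]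
        ring
  refine ⟨_, fun j => (hsol d _ hd' j).congr fun i => ?_⟩
  fin_cases j <;> simp

/-! ### The boundary trace generated by the interactions -/

/-- The amplitudes `incAmplitude` for an arbitrary triple `L` of rates. -/
def incAmp (γ κ k m : ℝ) (L : Fin 3 → ℂ) : Fin 3 → ℂ :=
  (liftMat γ κ (freq γ k m) k L)⁻¹.mulVec (incTrace γ k m)

/-- The contribution of one interaction to the boundary trace, as a function of the amplitude `A`
and of the rate `Z` of the boundary layer mode, of its buoyancy `B`, of the rate `M` of the carrier
and of the factor `X` that gathers the amplitude of the carrier and its advection term. -/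
def pairForm (γ : ℝ) (A X M Z B : ℂ) (Ω K : ℝ) : Fin 3 → ℂ :=
  (1 / 2 : ℂ) • ∑ s ∈ ({1, -1} : Finset ℤ),
    (A * (X / (-(Ω : ℂ) + s * Real.sin γ)) * (1 + s * I * B)) •
      ![1, I * K / (M + Z), s * I * (M + Z)]

/-- The boundary trace `sourceTrace` for arbitrary triples `L` and `L'` of rates. -/
def srcTrace (γ κ σ k m k' m' : ℝ) (L L' : Fin 3 → ℂ) : Fin 3 → ℂ :=
  (∑ j ∈ ({0, 1} : Finset (Fin 3)), ∑ j' ∈ ({0, 1} : Finset (Fin 3)),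
    pairForm γ (incAmp γ κ k' m' L' j')
      (incAmp γ κ k m L j * (k' + I * (L' j' * (I * k / L j)))) (L j) (L' j')
      (modeB γ κ (freq γ k' m') k' (L' j')) (freq γ k m + freq γ k' m') (k + k')) +
  ∑ j' ∈ ({0, 1} : Finset (Fin 3)),
    pairForm γ (incAmp γ κ k' m' L' j') (σ * (k' + I * (L' j' * (-(k : ℂ) / m)))) (-I * m) (L' j')
      (modeB γ κ (freq γ k' m') k' (L' j')) (freq γ k m + freq γ k' m') (k + k')

theorem smul_pairTrace (γ ν κ k m k' m' : ℝ) (a μ W : ℂ) (j : Fin 3) :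
    a • pairTrace γ ν κ k m k' m' μ W j =
      pairForm γ (incAmp γ κ k' m' (incRate γ ν κ k' m') j)
        (a * (k' + I * (incRate γ ν κ k' m' j * W))) μ (incRate γ ν κ k' m' j)
        (modeB γ κ (freq γ k' m') k' (incRate γ ν κ k' m' j)) (freq γ k m + freq γ k' m')
        (k + k') := by
  unfold pairTrace pairForm
  rw [smul_comm]
  simp only [Finset.smul_sum, smul_smul]
  congr 2
  funext s
  congr 1
  simp only [incAmplitude, liftAmplitude, incAmp, liftMatrix_eq, incRate]
  ring

theorem sourceTrace_eq (γ ν κ σ k m k' m' : ℝ) :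
    sourceTrace γ ν κ σ k m k' m' =
      srcTrace γ κ σ k m k' m' (incRate γ ν κ k m) (incRate γ ν κ k' m') := by
  unfold sourceTrace srcTrace
  simp only [Finset.smul_sum, smul_pairTrace]
  rfl

/-- The powers of `ε` that bound the three components of the boundary trace from below. -/
def traceExp : Fin 3 → ℕ := ![4, 2, 6]

theorem pow_mul_pairForm (γ : ℝ) {e : ℂ} (he : e ≠ 0) (A X M Z B : ℂ) (Ω K : ℝ) (a : Fin 3) :
    e ^ traceExp a * pairForm γ A X M Z B Ω K a =
      pairForm γ (e ^ 2 * A) (e ^ 2 * X) (e ^ 2 * M) (e ^ 2 * Z) B Ω K a := by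
  have h : (e ^ 2 * M + e ^ 2 * Z)⁻¹ = (e ^ 2)⁻¹ * (M + Z)⁻¹ := by rw [← mul_add, mul_inv]
  have hne : ((1 : ℤ) : ℤ) ≠ -1 := by decide
  unfold pairForm
  simp only [Finset.sum_pair hne, Pi.smul_apply, Pi.add_apply, smul_eq_mul]
  fin_cases a <;>
    simp only [traceExp, Fin.zero_eta, Fin.mk_one, Fin.reduceFinMk, Matrix.cons_val, div_eq_mul_inv,
      h]
  · ring
  · field_simp
  · ring

theorem tendsto_pairForm {ι : Type*} {l : Filter ι} (γ : ℝ) {A X M Z B : ι → ℂ} {Ω K : ι → ℝ}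
    {A₁ X₁ M₁ Z₁ B₁ : ℂ} {Ω₁ K₁ : ℝ} (hA : Tendsto A l (𝓝 A₁)) (hX : Tendsto X l (𝓝 X₁))
    (hM : Tendsto M l (𝓝 M₁)) (hZ : Tendsto Z l (𝓝 Z₁)) (hB : Tendsto B l (𝓝 B₁))
    (hΩ : Tendsto Ω l (𝓝 Ω₁)) (hK : Tendsto K l (𝓝 K₁))
    (hΩ1 : ∀ s ∈ ({1, -1} : Finset ℤ), -(Ω₁ : ℂ) + s * Real.sin γ ≠ 0) (hMZ : M₁ + Z₁ ≠ 0)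
    (a : Fin 3) :
    Tendsto (fun i => pairForm γ (A i) (X i) (M i) (Z i) (B i) (Ω i) (K i) a) l
      (𝓝 (pairForm γ A₁ X₁ M₁ Z₁ B₁ Ω₁ K₁ a)) := by
  unfold pairForm
  simp only [Pi.smul_apply, Finset.sum_apply, smul_eq_mul]
  refine (tendsto_finsetSum _ fun s hs => ?_).const_mul _
  refine Tendsto.mul ((hA.mul (hX.div ((tendsto_ofReal hΩ).neg.add_const _) (hΩ1 s hs))).mul
    ((hB.const_mul _).const_add _)) ?_
  fin_cases a
  · exact tendsto_const_nhds
  · exact ((tendsto_ofReal hK).const_mul I).div (hM.add hZ) hMZ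
  · exact (hM.add hZ).const_mul _

/-- The boundary trace, multiplied by powers of a parameter `e`. For `e = ε` this bounds the trace
as `ε` tends to `0`, for `e = 1` this is its continuity at a fixed value of `ε`. -/
theorem tendsto_srcTrace {ι : Type*} {l : Filter ι} {γ σ : ℝ} {κ k m k' m' : ι → ℝ} {e : ι → ℂ}
    {L L' : ι → Fin 3 → ℂ} {k₁ m₁ k₁' Ω₁ : ℝ} {e₁ : ℂ} {Z Z' A A' B' : Fin 3 → ℂ}
    (he : ∀ᶠ i in l, e i ≠ 0) (he1 : Tendsto e l (𝓝 e₁)) (hk : Tendsto k l (𝓝 k₁))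
    (hk' : Tendsto k' l (𝓝 k₁')) (hm : Tendsto m l (𝓝 m₁)) (hm1 : m₁ ≠ 0)
    (hΩ : Tendsto (fun i => freq γ (k i) (m i) + freq γ (k' i) (m' i)) l (𝓝 Ω₁))
    (hΩ1 : ∀ s ∈ ({1, -1} : Finset ℤ), -(Ω₁ : ℂ) + s * Real.sin γ ≠ 0)
    (hL : ∀ j ∈ ({0, 1} : Finset (Fin 3)), Tendsto (fun i => e i ^ 2 * L i j) l (𝓝 (Z j)))
    (hL' : ∀ j ∈ ({0, 1} : Finset (Fin 3)), Tendsto (fun i => e i ^ 2 * L' i j) l (𝓝 (Z' j)))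
    (hA : ∀ j ∈ ({0, 1} : Finset (Fin 3)),
      Tendsto (fun i => e i ^ 2 * incAmp γ (κ i) (k i) (m i) (L i) j) l (𝓝 (A j)))
    (hA' : ∀ j ∈ ({0, 1} : Finset (Fin 3)),
      Tendsto (fun i => e i ^ 2 * incAmp γ (κ i) (k' i) (m' i) (L' i) j) l (𝓝 (A' j)))
    (hB' : ∀ j ∈ ({0, 1} : Finset (Fin 3)), Tendsto
      (fun i => modeB γ (κ i) (freq γ (k' i) (m' i)) (k' i) (L' i j)) l (𝓝 (B' j)))
    (hZ : ∀ j ∈ ({0, 1} : Finset (Fin 3)), Z j ≠ 0)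
    (hZZ : ∀ j ∈ ({0, 1} : Finset (Fin 3)), ∀ j' ∈ ({0, 1} : Finset (Fin 3)), Z j + Z' j' ≠ 0)
    (hmZ : ∀ j ∈ ({0, 1} : Finset (Fin 3)), e₁ ^ 2 * (-I * m₁) + Z' j ≠ 0) (a : Fin 3) :
    Tendsto (fun i => e i ^ traceExp a *
        srcTrace γ (κ i) σ (k i) (m i) (k' i) (m' i) (L i) (L' i) a) l
      (𝓝 (((∑ j ∈ ({0, 1} : Finset (Fin 3)), ∑ j' ∈ ({0, 1} : Finset (Fin 3)),
        pairForm γ (A' j') (A j * (k₁' + I * (Z' j' * (I * k₁ / Z j)))) (Z j) (Z' j') (B' j') Ω₁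
          (k₁ + k₁')) +
        ∑ j' ∈ ({0, 1} : Finset (Fin 3)),
          pairForm γ (A' j') (σ * (e₁ ^ 2 * k₁' + I * (Z' j' * (-(k₁ : ℂ) / m₁))))
            (e₁ ^ 2 * (-I * m₁)) (Z' j') (B' j') Ω₁ (k₁ + k₁')) a)) := by
  unfold srcTrace
  simp only [Pi.add_apply, Finset.sum_apply, mul_add, Finset.mul_sum]
  refine Tendsto.add (tendsto_finsetSum _ fun j hj => tendsto_finsetSum _ fun j' hj' => ?_)
    (tendsto_finsetSum _ fun j' hj' => ?_)
  · have h1 : Tendsto (fun i => e i ^ 2 * incAmp γ (κ i) (k i) (m i) (L i) j *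
        (k' i + I * ((e i ^ 2 * L' i j') * (I * k i / (e i ^ 2 * L i j))))) l
        (𝓝 (A j * (k₁' + I * (Z' j' * (I * k₁ / Z j))))) :=
      (hA j hj).mul ((tendsto_ofReal hk').add (((hL' j' hj').mul
        (((tendsto_ofReal hk).const_mul I).div (hL j hj) (hZ j hj))).const_mul I))
    have h2 := tendsto_pairForm γ (hA' j' hj') h1 (hL j hj) (hL' j' hj') (hB' j' hj') hΩ
      (hk.add hk') hΩ1 (hZZ j hj j' hj') a
    simp only [mul_add] at h2
    refine h2.congr' ?_
    filter_upwards [he] with i hi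
    rw [pow_mul_pairForm γ hi]
    congr 1
    have : e i ^ 2 * L' i j' * (I * k i / (e i ^ 2 * L i j)) = L' i j' * (I * k i / L i j) := by
      simp only [div_eq_mul_inv, mul_inv]
      field_simp
    rw [this]
    ring
  · have h1 : Tendsto (fun i => (σ : ℂ) * (e i ^ 2 * k' i + I * ((e i ^ 2 * L' i j') *
        (-(k i : ℂ) / m i)))) l (𝓝 (σ * (e₁ ^ 2 * k₁' + I * (Z' j' * (-(k₁ : ℂ) / m₁))))) :=
      ((((he1.pow 2).mul (tendsto_ofReal hk')).add (((hL' j' hj').mul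
        ((tendsto_ofReal hk).neg.div (tendsto_ofReal hm) (ofReal_ne_zero.2 hm1))).const_mul
          I))).const_mul _
    have h2 := tendsto_pairForm γ (hA' j' hj') h1
      ((he1.pow 2).mul ((tendsto_ofReal hm).const_mul (-I))) (hL' j' hj') (hB' j' hj') hΩ
      (hk.add hk') hΩ1 (hmZ j' hj') a
    simp only [mul_add] at h2
    refine h2.congr' ?_
    filter_upwards [he] with i hi
    rw [pow_mul_pairForm γ hi]
    congr 1
    ring

/-! ### Triples of rates -/

theorem exists_perm_of_range_subset {L u : Fin 3 → ℂ} (hL : Function.Injective L)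
    (h : Set.range L ⊆ Set.range u) : ∃ τ : Equiv.Perm (Fin 3), L = u ∘ τ := by
  choose τ hτ using fun j => h (Set.mem_range_self j)
  have hinj : Function.Injective τ := fun a b hab => hL (by rw [← hτ a, ← hτ b, hab])
  exact ⟨Equiv.ofBijective τ (Finite.injective_iff_bijective.1 hinj), funext fun j => (hτ j).symm⟩

theorem IsFactorization.range_eq {γ ν κ ω k : ℝ} {u v : Fin 3 → ℂ} (hν : ν ≠ 0) (hκ : κ ≠ 0)
    (h : IsFactorization (Real.sin γ) (Real.cos γ) ν κ ω k u v) :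
    Set.range u = decayRates γ ν κ ω k := by
  ext z
  simp only [Set.mem_range, decayRates, Set.mem_ofPred_eq, det_waveMatrix]
  constructor
  · rintro ⟨j, rfl⟩
    exact ⟨h.re_pos j, h.symb_eq_zero j⟩
  · rintro ⟨hz, h0⟩
    rw [h.eq_prod, mul_eq_zero, mul_eq_zero, Finset.prod_eq_zero_iff, Finset.prod_eq_zero_iff] at h0
    rcases h0 with h0 | ⟨j, -, hj⟩ | ⟨j, -, hj⟩
    · simp [hν, hκ] at h0
    · exact ⟨j, (sub_eq_zero.1 hj).symm⟩
    · have := h.re_neg j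
      rw [← sub_eq_zero.1 hj] at this
      linarith

theorem IsFactorization.isRateTriple {γ ν κ ω k : ℝ} {u v : Fin 3 → ℂ} (hν : ν ≠ 0) (hκ : κ ≠ 0)
    (h : IsFactorization (Real.sin γ) (Real.cos γ) ν κ ω k u v) (hu : Function.Injective u) :
    IsRateTriple γ ν κ ω k u :=
  ⟨hu, h.range_eq hν hκ, h.le₁, h.le₂⟩

theorem IsRateTriple.isFactorization {γ ν κ ω k : ℝ} {L : Fin 3 → ℂ} (hν : 0 < ν) (hκ : 0 < κ)
    (hω : ω ≠ 0) (hk : k ≠ 0) (h : IsRateTriple γ ν κ ω k L) :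
    ∃ v, IsFactorization (Real.sin γ) (Real.cos γ) ν κ ω k L v := by
  obtain ⟨u, v, huv⟩ := exists_isFactorization (Real.sin γ) (Real.cos γ) hν hκ hω hk
  obtain ⟨τ, hτ⟩ := exists_perm_of_range_subset h.1
    (h.2.1.trans (huv.range_eq hν.ne' hκ.ne').symm).subset
  refine ⟨v, ?_, fun j => ?_, huv.re_neg, h.2.2.1, h.2.2.2, huv.le₁', huv.le₂'⟩
  · intro z
    rw [huv.eq_prod, hτ, ← Equiv.prod_comp τ fun j => z - u j]
    rfl
  · rw [hτ]
    exact huv.re_pos _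

theorem isRateTriple_rate {γ ν κ ω k : ℝ} (h : ∃ L, IsRateTriple γ ν κ ω k L) :
    IsRateTriple γ ν κ ω k (rate γ ν κ ω k) := by
  rw [rate, dif_pos h]
  exact h.choose_spec

theorem tendsto_symb {ι : Type*} {l : Filter ι} (s c ν κ : ℝ) {ω k : ι → ℝ} {ω₁ k₁ : ℝ}
    (hω : Tendsto ω l (𝓝 ω₁)) (hk : Tendsto k l (𝓝 k₁)) (z : ℂ) :
    Tendsto (fun i => symb s c ν κ (ω i) (k i) z) l (𝓝 (symb s c ν κ ω₁ k₁ z)) := by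
  have hc : Continuous fun p : ℝ × ℝ => symb s c ν κ p.1 p.2 z := by
    unfold symb
    fun_prop
  exact Tendsto.comp (g := fun p : ℝ × ℝ => symb s c ν κ p.1 p.2 z)
    (f := fun i => (ω i, k i)) (hc.tendsto (ω₁, k₁)) (hω.prodMk_nhds hk)

/-- The triples of rates at neighbouring parameters only accumulate at triples of rates. -/
theorem exists_tendsto_isRateTriple {ι : Type*} (l : Ultrafilter ι) {γ ν κ : ℝ} {ω k : ι → ℝ}
    {ω₁ k₁ : ℝ} {L : ι → Fin 3 → ℂ} (hν : 0 < ν) (hκ : 0 < κ) (hω : Tendsto ω l (𝓝 ω₁))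
    (hk : Tendsto k l (𝓝 k₁)) (hω1 : ω₁ ≠ 0) (hk1 : k₁ ≠ 0)
    (hL : ∀ᶠ i in (l : Filter ι), IsRateTriple γ ν κ (ω i) (k i) (L i))
    (h1 : ∃ L₁, IsRateTriple γ ν κ ω₁ k₁ L₁) :
    ∃ L₁, IsRateTriple γ ν κ ω₁ k₁ L₁ ∧ ∀ j, Tendsto (fun i => L i j) l (𝓝 (L₁ j)) := by
  have hF : ∀ᶠ i in (l : Filter ι), ∃ v,
      IsFactorization (Real.sin γ) (Real.cos γ) ν κ (ω i) (k i) (L i) v := by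
    filter_upwards [hL, hω.eventually_ne hω1, hk.eventually_ne hk1] with i hi h2 h3
    exact hi.isFactorization hν hκ h2 h3
  obtain ⟨v, hv⟩ := hF.choice
  have hνκ : -(ν * κ : ℂ) ≠ 0 := by simp [hν.ne', hκ.ne']
  set r : Fin 3 ⊕ Fin 3 → ι → ℂ := Sum.elim (fun j i => L i j) fun j i => v i j with hr
  obtain ⟨ρ, hρ, hq⟩ := exists_tendsto_roots l r
    (fun z => symb (Real.sin γ) (Real.cos γ) ν κ ω₁ k₁ z / -(ν * κ : ℂ)) fun z => by
      refine ((tendsto_symb _ _ ν κ hω hk z).div_const (-(ν * κ : ℂ))).congr' ?_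
      filter_upwards [hv] with i hi
      rw [hi.eq_prod, mul_div_cancel_left₀ _ hνκ, Fintype.prod_sum_type]
      rfl
  have hu : ∀ j, Tendsto (fun i => L i j) l (𝓝 (ρ (Sum.inl j))) := fun j => hρ (Sum.inl j)
  have hv' : ∀ j, Tendsto (fun i => v i j) l (𝓝 (ρ (Sum.inr j))) := fun j => hρ (Sum.inr j)
  -- the limits stay off the imaginary axis, so the two triples do not mix
  have hroot : ∀ j, (ρ j).re ≠ 0 := by
    intro j h0
    have h2 := hq (ρ j)
    rw [Finset.prod_eq_zero (Finset.mem_univ j) (sub_self _), div_eq_zero_iff,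
      or_iff_left hνκ] at h2
    have h3 := symb_I_mul_im (Real.sin γ) (Real.cos γ) ν κ ω₁ k₁ (ρ j).im
    rw [show I * ((ρ j).im : ℂ) = ρ j by apply Complex.ext <;> simp [h0], h2, zero_im] at h3
    have : 0 < k₁ ^ 2 + (ρ j).im ^ 2 := by positivity
    exact neg_ne_zero.2 (mul_ne_zero (mul_ne_zero hω1 (by positivity)) (by positivity)) h3.symm
  have hfac : IsFactorization (Real.sin γ) (Real.cos γ) ν κ ω₁ k₁ (fun j => ρ (Sum.inl j))
      fun j => ρ (Sum.inr j) := by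
    refine ⟨fun z => ?_, fun j => ?_, fun j => ?_, ?_, ?_, ?_, ?_⟩
    · rw [← Fintype.prod_sum_type fun j => z - ρ j, ← hq, mul_div_cancel₀ _ hνκ]
    · exact lt_of_le_of_ne (ge_of_tendsto (tendsto_re (hu j)) (hv.mono fun i hi =>
        (hi.re_pos j).le)) (hroot _).symm
    · exact lt_of_le_of_ne (le_of_tendsto (tendsto_re (hv' j)) (hv.mono fun i hi =>
        (hi.re_neg j).le)) (hroot _)
    · exact le_of_tendsto_of_tendsto (hu 0).norm (hu 1).norm (hv.mono fun i hi => hi.le₁)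
    · exact le_of_tendsto_of_tendsto (hu 1).norm (hu 2).norm (hv.mono fun i hi => hi.le₂)
    · exact le_of_tendsto_of_tendsto (hv' 0).norm (hv' 1).norm (hv.mono fun i hi => hi.le₁')
    · exact le_of_tendsto_of_tendsto (hv' 1).norm (hv' 2).norm (hv.mono fun i hi => hi.le₂')
  obtain ⟨L₁, hL₁⟩ := h1
  obtain ⟨τ, hτ⟩ := exists_perm_of_range_subset hL₁.1
    (hL₁.2.1.trans (hfac.range_eq hν.ne' hκ.ne').symm).subset
  refine ⟨_, hfac.isRateTriple hν.ne' hκ.ne' ?_, hu⟩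
  have : (fun j => ρ (Sum.inl j)) = L₁ ∘ τ.symm := by
    funext j
    rw [hτ]
    simp
  rw [this]
  exact hL₁.1.comp τ.symm.injective

/-- A triple of rates is unique up to the exchange of its first two elements, if the third one has
a larger modulus. -/
theorem IsRateTriple.eq_or_eq_swap {γ ν κ ω k : ℝ} {L L' : Fin 3 → ℂ}
    (h : IsRateTriple γ ν κ ω k L) (h' : IsRateTriple γ ν κ ω k L') (hlt : ‖L 1‖ < ‖L 2‖) :
    L' = L ∨ L' = L ∘ Equiv.swap 0 1 := by
  obtain ⟨τ, hτ⟩ := exists_perm_of_range_subset h'.1 (h'.2.1.trans h.2.1.symm).subset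
  have h0 : ∀ j, L' j = L (τ j) := fun j => congrFun hτ j
  have hle : ∀ j, j ≠ 2 → ‖L j‖ < ‖L 2‖ := by
    intro j hj
    have : j = 0 ∨ j = 1 := by omega
    rcases this with rfl | rfl
    · exact h.2.2.1.trans_lt hlt
    · exact hlt
  have h2 : τ 2 = 2 := by
    by_contra hne
    have hm : ∀ j, ‖L' j‖ ≤ ‖L' 2‖ := by
      intro j
      fin_cases j
      exacts [h'.2.2.1.trans h'.2.2.2, h'.2.2.2, le_rfl]
    have := hm (τ.symm 2)
    rw [h0, h0, Equiv.apply_symm_apply] at this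
    exact (hle _ hne).not_ge this
  have hτ' : τ = 1 ∨ τ = Equiv.swap 0 1 := by
    revert h2
    clear * -
    revert τ
    decide
  rcases hτ' with rfl | rfl
  · exact Or.inl hτ
  · exact Or.inr hτ

theorem IsRateTriple.eq_of_lt {γ ν κ ω k : ℝ} {L L' : Fin 3 → ℂ}
    (h : IsRateTriple γ ν κ ω k L) (h' : IsRateTriple γ ν κ ω k L') (h01 : ‖L 0‖ < ‖L 1‖)
    (h12 : ‖L 1‖ < ‖L 2‖) : L' = L := by
  refine (h.eq_or_eq_swap h' h12).resolve_right fun hs => ?_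
  have := h'.2.2.1
  rw [hs] at this
  simp only [Function.comp_apply, Equiv.swap_apply_left, Equiv.swap_apply_right] at this
  exact h01.not_ge this

theorem incAmp_comp (γ κ k m : ℝ) (L : Fin 3 → ℂ) (τ : Equiv.Perm (Fin 3)) :
    incAmp γ κ k m (L ∘ τ) = incAmp γ κ k m L ∘ τ := by
  have h : ∀ ω, liftMat γ κ ω k (L ∘ τ) = (liftMat γ κ ω k L).submatrix (Equiv.refl _) τ := by
    intro ω
    ext a b
    fin_cases a <;> rfl
  unfold incAmp
  rw [h, Matrix.inv_submatrix_equiv, Matrix.submatrix_mulVec_equiv]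
  rfl

/-- The boundary trace does not depend on the order of the two modes of the `ε²` boundary layer. -/
theorem srcTrace_swap (γ κ σ k m k' m' : ℝ) (L L' : Fin 3 → ℂ) :
    srcTrace γ κ σ k m k' m' (L ∘ Equiv.swap 0 1) L' = srcTrace γ κ σ k m k' m' L L' ∧
      srcTrace γ κ σ k m k' m' L (L' ∘ Equiv.swap 0 1) = srcTrace γ κ σ k m k' m' L L' := by
  have h01 : (0 : Fin 3) ≠ 1 := by decide
  unfold srcTrace
  simp only [incAmp_comp, Finset.sum_pair h01, Function.comp_apply, Equiv.swap_apply_left,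
    Equiv.swap_apply_right]
  constructor <;> abel

/-! ### Asymptotics of the rates and of the amplitudes -/

theorem eventually_norm_lt_of_scaled {ι : Type*} {l : Filter ι} {ε : ι → ℝ} {x y : ι → ℂ} {n : ℕ}
    {a b : ℂ} (hε : Tendsto ε l (𝓝[>] 0)) (hx : Tendsto (fun i => (ε i : ℂ) ^ n * x i) l (𝓝 a))
    (hy : Tendsto (fun i => (ε i : ℂ) ^ n * y i) l (𝓝 b)) (hab : ‖a‖ < ‖b‖) :
    ∀ᶠ i in l, ‖x i‖ < ‖y i‖ := by
  filter_upwards [hx.norm.eventually_lt hy.norm hab, hε.eventually self_mem_nhdsWithin] with i h h0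
  rw [norm_ofReal_pow_mul h0, norm_ofReal_pow_mul h0] at h
  exact lt_of_mul_lt_mul_left h (pow_nonneg (le_of_lt h0) n)

theorem tendsto_pow_mul_zero {ι : Type*} {l : Filter ι} {ε : ι → ℝ} {x : ι → ℂ} {n m : ℕ} {a : ℂ}
    (hε : Tendsto ε l (𝓝[>] 0)) (hx : Tendsto (fun i => (ε i : ℂ) ^ n * x i) l (𝓝 a))
    (hnm : n < m) : Tendsto (fun i => (ε i : ℂ) ^ m * x i) l (𝓝 0) := by
  have hε' := tendsto_ofReal (tendsto_nhdsWithin_iff.1 hε).1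
  have h := (hε'.pow (m - n)).mul hx
  rw [ofReal_zero, zero_pow (Nat.sub_ne_zero_of_lt hnm), zero_mul] at h
  refine h.congr fun i => ?_
  rw [← mul_assoc, ← pow_add, Nat.sub_add_cancel hnm.le]

/-- Near the critical frequency, the rates are well defined. -/
theorem eventually_isRateTriple_critical {ι : Type*} (l : Ultrafilter ι) {γ ν₀ κ₀ : ℝ}
    (hs : 0 < Real.sin γ) (hc : 0 < Real.cos γ) (hν : 0 < ν₀) (hκ : 0 < κ₀) {ε ω k : ι → ℝ}
    {ω₁ k₁ θ : ℝ} (hε : Tendsto ε l (𝓝[>] 0)) (hω : Tendsto ω l (𝓝 ω₁)) (hk : Tendsto k l (𝓝 k₁))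
    (hθ : Tendsto (fun i => (ω i ^ 2 - Real.sin γ ^ 2) / ε i ^ 2) l (𝓝 θ))
    (hω1 : ω₁ ^ 2 = Real.sin γ ^ 2) (hωk : 0 < ω₁ * k₁) :
    (∀ᶠ i in (l : Filter ι), IsRateTriple γ (ν₀ * ε i ^ 6) (κ₀ * ε i ^ 6) (ω i) (k i)
        (rate γ (ν₀ * ε i ^ 6) (κ₀ * ε i ^ 6) (ω i) (k i))) ∧
      ∃ Z₀ Z₁ Y : ℂ,
      Tendsto (fun i => (ε i : ℂ) ^ 2 * rate γ (ν₀ * ε i ^ 6) (κ₀ * ε i ^ 6) (ω i) (k i) 0) l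
        (𝓝 Z₀) ∧
      Tendsto (fun i => (ε i : ℂ) ^ 2 * rate γ (ν₀ * ε i ^ 6) (κ₀ * ε i ^ 6) (ω i) (k i) 1) l
        (𝓝 Z₁) ∧
      Tendsto (fun i => (ε i : ℂ) ^ 3 * rate γ (ν₀ * ε i ^ 6) (κ₀ * ε i ^ 6) (ω i) (k i) 2) l
        (𝓝 Y) ∧
      0 < Z₀.re ∧ 0 < Z₁.re ∧ 0 < Y.re ∧ Z₀ ≠ Z₁ ∧
      Y ^ 2 = -(I * ((ω₁ * (ν₀ + κ₀) / (ν₀ * κ₀) : ℝ) : ℂ)) := by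
  have hω0 : ω₁ ≠ 0 := left_ne_zero_of_mul hωk.ne'
  have hk0 : k₁ ≠ 0 := right_ne_zero_of_mul hωk.ne'
  have hε0 : ∀ᶠ i in (l : Filter ι), 0 < ε i := hε.eventually self_mem_nhdsWithin
  have hF : ∀ᶠ i in (l : Filter ι), ∃ p : (Fin 3 → ℂ) × (Fin 3 → ℂ), IsFactorization (Real.sin γ)
      (Real.cos γ) (ν₀ * ε i ^ 6) (κ₀ * ε i ^ 6) (ω i) (k i) p.1 p.2 := by
    filter_upwards [hε0, hω.eventually_ne hω0, hk.eventually_ne hk0] with i h1 h2 h3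
    obtain ⟨u, v, huv⟩ := exists_isFactorization (Real.sin γ) (Real.cos γ)
      (show 0 < ν₀ * ε i ^ 6 by positivity) (show 0 < κ₀ * ε i ^ 6 by positivity) h2 h3
    exact ⟨(u, v), huv⟩
  obtain ⟨p, hp⟩ := hF.choice
  obtain ⟨Z₀, Z₁, Y, h0, h1, h2, -, -, hY, hne, -⟩ :=
    exists_tendsto_critical_rates l hs hc hν hκ hε hω hk hθ hω1 hωk hp
  have hY0 : 0 < ‖Y‖ := norm_pos_iff.2 fun h => by simp [h] at hY
  have hlt := eventually_norm_lt_of_scaled hε (tendsto_pow_mul_zero hε h1 (by norm_num : 2 < 3)) h2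
    (by simpa using hY0)
  have hne' : ∀ᶠ i in (l : Filter ι), (p i).1 0 ≠ (p i).1 1 := by
    filter_upwards [(h0.sub h1).eventually_ne (sub_ne_zero.2 hne)] with i hi h
    exact hi (by rw [h, sub_self])
  have hT : ∀ᶠ i in (l : Filter ι), IsRateTriple γ (ν₀ * ε i ^ 6) (κ₀ * ε i ^ 6) (ω i) (k i)
      (rate γ (ν₀ * ε i ^ 6) (κ₀ * ε i ^ 6) (ω i) (k i)) := by
    filter_upwards [hp, hlt, hne', hε0] with i hi h12 h01 h0
    refine isRateTriple_rate ⟨_, hi.isRateTriple (by positivity) (by positivity) ?_⟩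
    have e1 : (p i).1 1 ≠ (p i).1 2 := fun h => by rw [h] at h12; exact lt_irrefl _ h12
    have e2 : (p i).1 0 ≠ (p i).1 2 := fun h => by
      have := hi.le₁
      rw [h] at this
      exact this.not_gt h12
    intro a b hab
    fin_cases a <;> fin_cases b <;> simp_all
  refine ⟨hT, ?_⟩
  -- the asymptotics hold for every ordered factorization, in particular for the triple `rate`
  have hF' : ∀ᶠ i in (l : Filter ι), ∃ v, IsFactorization (Real.sin γ)
      (Real.cos γ) (ν₀ * ε i ^ 6) (κ₀ * ε i ^ 6) (ω i) (k i)
      (rate γ (ν₀ * ε i ^ 6) (κ₀ * ε i ^ 6) (ω i) (k i)) v := by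
    filter_upwards [hT, hε0, hω.eventually_ne hω0, hk.eventually_ne hk0] with i h h1 h2 h3
    exact h.isFactorization (by positivity) (by positivity) h2 h3
  obtain ⟨v, hv⟩ := hF'.choice
  exact exists_tendsto_critical_rates l hs hc hν hκ hε hω hk hθ hω1 hωk hv

/-- Above the critical frequency, the rates are well defined. -/
theorem eventually_isRateTriple_supercritical {ι : Type*} (l : Ultrafilter ι) {γ ν₀ κ₀ : ℝ}
    (hs : 0 < Real.sin γ) (hc : 0 < Real.cos γ) (hν : 0 < ν₀) (hκ : 0 < κ₀) {ε ω k : ι → ℝ}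
    {ω₁ k₁ : ℝ} (hε : Tendsto ε l (𝓝[>] 0)) (hω : Tendsto ω l (𝓝 ω₁)) (hk : Tendsto k l (𝓝 k₁))
    (hω1 : Real.sin γ ^ 2 < ω₁ ^ 2) (hωk : 0 < ω₁ * k₁) :
    (∀ᶠ i in (l : Filter ι), IsRateTriple γ (ν₀ * ε i ^ 6) (κ₀ * ε i ^ 6) (ω i) (k i)
        (rate γ (ν₀ * ε i ^ 6) (κ₀ * ε i ^ 6) (ω i) (k i))) ∧
      ∃ (w Y₁ Y₂ : ℂ) (ρ₁ ρ₂ : ℝ),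
      Tendsto (fun i => rate γ (ν₀ * ε i ^ 6) (κ₀ * ε i ^ 6) (ω i) (k i) 0) l (𝓝 w) ∧
      Tendsto (fun i => (ε i : ℂ) ^ 3 * rate γ (ν₀ * ε i ^ 6) (κ₀ * ε i ^ 6) (ω i) (k i) 1) l
        (𝓝 Y₁) ∧
      Tendsto (fun i => (ε i : ℂ) ^ 3 * rate γ (ν₀ * ε i ^ 6) (κ₀ * ε i ^ 6) (ω i) (k i) 2) l
        (𝓝 Y₂) ∧
      (w ≠ 0 ∧ 0 ≤ w.re ∧
        (ω₁ ^ 2 - Real.sin γ ^ 2) * w ^ 2 - 2 * I * Real.sin γ * Real.cos γ * k₁ * w +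
          (Real.cos γ ^ 2 - ω₁ ^ 2) * k₁ ^ 2 = 0 ∧
        (w.re = 0 → Real.sin γ * Real.cos γ * ω₁ * k₁ ≤
          (ω₁ ^ 2 - Real.sin γ ^ 2) * w.im * ω₁)) ∧
      0 < Y₁.re ∧ 0 < Y₂.re ∧ ‖Y₁‖ < ‖Y₂‖ ∧ Y₁ ^ 2 = -(I * ρ₁) ∧ Y₂ ^ 2 = -(I * ρ₂) ∧
      ρ₁ + ρ₂ = ω₁ * (ν₀ + κ₀) / (ν₀ * κ₀) ∧
      ρ₁ * ρ₂ = (ω₁ ^ 2 - Real.sin γ ^ 2) / (ν₀ * κ₀) := by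
  have hω0 : ω₁ ≠ 0 := left_ne_zero_of_mul hωk.ne'
  have hk0 : k₁ ≠ 0 := right_ne_zero_of_mul hωk.ne'
  have hε0 : ∀ᶠ i in (l : Filter ι), 0 < ε i := hε.eventually self_mem_nhdsWithin
  have hF : ∀ᶠ i in (l : Filter ι), ∃ p : (Fin 3 → ℂ) × (Fin 3 → ℂ), IsFactorization (Real.sin γ)
      (Real.cos γ) (ν₀ * ε i ^ 6) (κ₀ * ε i ^ 6) (ω i) (k i) p.1 p.2 := by
    filter_upwards [hε0, hω.eventually_ne hω0, hk.eventually_ne hk0] with i h1 h2 h3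
    obtain ⟨u, v, huv⟩ := exists_isFactorization (Real.sin γ) (Real.cos γ)
      (show 0 < ν₀ * ε i ^ 6 by positivity) (show 0 < κ₀ * ε i ^ 6 by positivity) h2 h3
    exact ⟨(u, v), huv⟩
  obtain ⟨p, hp⟩ := hF.choice
  obtain ⟨w, Y₁, Y₂, -, -, h0, h1, h2, -, hY₁, -, hYlt, -⟩ :=
    exists_tendsto_supercritical_rates l hs hc hν hκ hε hω hk hω1 hωk hp
  have hY0 : 0 < ‖Y₁‖ := norm_pos_iff.2 fun h => by simp [h] at hY₁
  have hlt := eventually_norm_lt_of_scaled hε h1 h2 hYlt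
  have hlt' := eventually_norm_lt_of_scaled hε (tendsto_pow_mul_zero (n := 0) hε
    (by simpa using h0) (by norm_num : 0 < 3)) h1 (by simpa using hY0)
  have hT : ∀ᶠ i in (l : Filter ι), IsRateTriple γ (ν₀ * ε i ^ 6) (κ₀ * ε i ^ 6) (ω i) (k i)
      (rate γ (ν₀ * ε i ^ 6) (κ₀ * ε i ^ 6) (ω i) (k i)) := by
    filter_upwards [hp, hlt, hlt', hε0] with i hi h12 h01 h0
    refine isRateTriple_rate ⟨_, hi.isRateTriple (by positivity) (by positivity) ?_⟩
    have e1 : (p i).1 1 ≠ (p i).1 2 := fun h => by rw [h] at h12; exact lt_irrefl _ h12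
    have e0 : (p i).1 0 ≠ (p i).1 1 := fun h => by rw [h] at h01; exact lt_irrefl _ h01
    have e2 : (p i).1 0 ≠ (p i).1 2 := fun h => by
      have := hi.le₁
      rw [h] at this
      exact this.not_gt h12
    intro a b hab
    fin_cases a <;> fin_cases b <;> simp_all
  refine ⟨hT, ?_⟩
  -- the asymptotics hold for every ordered factorization, in particular for the triple `rate`
  have hF' : ∀ᶠ i in (l : Filter ι), ∃ v, IsFactorization (Real.sin γ)
      (Real.cos γ) (ν₀ * ε i ^ 6) (κ₀ * ε i ^ 6) (ω i) (k i)
      (rate γ (ν₀ * ε i ^ 6) (κ₀ * ε i ^ 6) (ω i) (k i)) v := by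
    filter_upwards [hT, hε0, hω.eventually_ne hω0, hk.eventually_ne hk0] with i h h1 h2 h3
    exact h.isFactorization (by positivity) (by positivity) h2 h3
  obtain ⟨v, hv⟩ := hF'.choice
  exact exists_tendsto_supercritical_rates l hs hc hν hκ hε hω hk hω1 hωk hv

/-! ### Frequencies close to the critical one -/

/-- The relation between `k₁` and `m₁` for a critical wave vector. -/
theorem critical_relation {γ k₁ m₁ : ℝ} (hk : k₁ ≠ 0)
    (hcrit : (k₁ * Real.cos γ - m₁ * Real.sin γ) ^ 2 / (k₁ ^ 2 + m₁ ^ 2) = Real.sin γ ^ 2) :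
    2 * Real.cos γ * Real.sin γ * m₁ = k₁ * (Real.cos γ ^ 2 - Real.sin γ ^ 2) := by
  have h0 : 0 < k₁ ^ 2 + m₁ ^ 2 := by positivity
  rw [div_eq_iff h0.ne'] at hcrit
  apply mul_left_cancel₀ hk
  linear_combination -hcrit

theorem freq_neg (γ k m : ℝ) : freq γ (-k) (-m) = -freq γ k m := by
  unfold freq
  rw [show -k * (-m * Real.cos γ + -k * Real.sin γ) = k * (m * Real.cos γ + k * Real.sin γ) by ring,
    neg_sq, neg_sq]
  ring

theorem freq_eq {γ k m : ℝ} (h : 0 < k * (m * Real.cos γ + k * Real.sin γ)) :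
    freq γ k m = (k * Real.cos γ - m * Real.sin γ) / √(k ^ 2 + m ^ 2) := by
  rw [freq, Real.sign_of_pos h, one_mul]

theorem freq_sq_mul {γ k m : ℝ} (h : 0 < k * (m * Real.cos γ + k * Real.sin γ)) :
    freq γ k m ^ 2 * (k ^ 2 + m ^ 2) = (k * Real.cos γ - m * Real.sin γ) ^ 2 := by
  have hk : k ≠ 0 := left_ne_zero_of_mul h.ne'
  have h0 : 0 < k ^ 2 + m ^ 2 := by positivity
  rw [freq_eq h, div_pow, Real.sq_sqrt h0.le, div_mul_cancel₀ _ h0.ne']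

/-- At a critical wave vector, the group velocity of the branch `s = 1` points towards the
boundary. -/
theorem critical_sign {γ k₁ m₁ : ℝ} (hs : 0 < Real.sin γ) (hc : 0 < Real.cos γ) (hk : k₁ ≠ 0)
    (h : 2 * Real.cos γ * Real.sin γ * m₁ = k₁ * (Real.cos γ ^ 2 - Real.sin γ ^ 2)) :
    0 < k₁ * (m₁ * Real.cos γ + k₁ * Real.sin γ) ∧
      0 < k₁ * (k₁ * Real.cos γ - m₁ * Real.sin γ) := by
  have h1 : 2 * Real.sin γ * (k₁ * (m₁ * Real.cos γ + k₁ * Real.sin γ)) = k₁ ^ 2 := by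
    linear_combination k₁ * h + k₁ ^ 2 * Real.sin_sq_add_cos_sq γ
  have h2 : 2 * Real.cos γ * (k₁ * (k₁ * Real.cos γ - m₁ * Real.sin γ)) = k₁ ^ 2 := by
    linear_combination -k₁ * h + k₁ ^ 2 * Real.sin_sq_add_cos_sq γ
  have h3 : 0 < k₁ ^ 2 := by positivity
  constructor
  · exact pos_of_mul_pos_right (h1 ▸ h3) (by positivity)
  · exact pos_of_mul_pos_right (h2 ▸ h3) (by positivity)

theorem critical_freq {γ k₁ m₁ : ℝ} (hs : 0 < Real.sin γ) (hc : 0 < Real.cos γ) (hk : k₁ ≠ 0)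
    (h : 2 * Real.cos γ * Real.sin γ * m₁ = k₁ * (Real.cos γ ^ 2 - Real.sin γ ^ 2)) :
    freq γ k₁ m₁ ^ 2 = Real.sin γ ^ 2 ∧ 0 < freq γ k₁ m₁ * k₁ := by
  obtain ⟨h1, h2⟩ := critical_sign hs hc hk h
  have h0 : 0 < k₁ ^ 2 + m₁ ^ 2 := by positivity
  constructor
  · apply mul_right_cancel₀ h0.ne'
    rw [freq_sq_mul h1]
    linear_combination -k₁ * h
  · rw [freq_eq h1, div_mul_eq_mul_div, mul_comm]
    exact div_pos h2 (Real.sqrt_pos.2 h0)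

theorem tendsto_freq {ι : Type*} {l : Filter ι} {γ k₁ m₁ : ℝ} {k m : ι → ℝ}
    (hk : Tendsto k l (𝓝 k₁)) (hm : Tendsto m l (𝓝 m₁))
    (h : 0 < k₁ * (m₁ * Real.cos γ + k₁ * Real.sin γ)) :
    Tendsto (fun i => freq γ (k i) (m i)) l (𝓝 (freq γ k₁ m₁)) := by
  have hk1 : k₁ ≠ 0 := left_ne_zero_of_mul h.ne'
  have h0 : 0 < k₁ ^ 2 + m₁ ^ 2 := by positivity
  have h1 : Tendsto (fun i => k i * (m i * Real.cos γ + k i * Real.sin γ)) l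
      (𝓝 (k₁ * (m₁ * Real.cos γ + k₁ * Real.sin γ))) :=
    hk.mul ((hm.mul_const _).add (hk.mul_const _))
  have h2 : Tendsto (fun i => (k i * Real.cos γ - m i * Real.sin γ) / √(k i ^ 2 + m i ^ 2)) l
      (𝓝 ((k₁ * Real.cos γ - m₁ * Real.sin γ) / √(k₁ ^ 2 + m₁ ^ 2))) :=
    ((hk.mul_const _).sub (hm.mul_const _)).div ((hk.pow 2).add (hm.pow 2)).sqrt
      (Real.sqrt_pos.2 h0).ne'
  rw [freq_eq h]
  refine h2.congr' ?_
  filter_upwards [h1.eventually_const_lt h] with i hi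
  exact (freq_eq hi).symm

/-! ### The support of the packet as `ε` tends to `0` -/

/-- The physical parameters, and a critical wave vector `(k₁, m₁)`. -/
structure CriticalData (γ ν₀ κ₀ k₁ m₁ : ℝ) : Prop where
  sin_pos : 0 < Real.sin γ
  cos_pos : 0 < Real.cos γ
  nu_pos : 0 < ν₀
  kappa_pos : 0 < κ₀
  k_ne : k₁ ≠ 0
  m_ne : m₁ ≠ 0
  rel : 2 * Real.cos γ * Real.sin γ * m₁ = k₁ * (Real.cos γ ^ 2 - Real.sin γ ^ 2)

/-- The wave vectors `(k, m)` are within `O(ε²)` of `(k₁, m₁)`, and `ε` tends to `0` through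
positive values. -/
structure IsNear {ι : Type*} (f : Filter ι) (ε k m : ι → ℝ) (k₁ m₁ : ℝ) : Prop where
  eps : Tendsto ε f (𝓝[>] 0)
  isBigO_k : (fun i => k i - k₁) =O[f] fun i => ε i ^ 2
  isBigO_m : (fun i => m i - m₁) =O[f] fun i => ε i ^ 2

theorem tendsto_of_isBigO {ι : Type*} {f : Filter ι} {ε x : ι → ℝ} {x₁ : ℝ}
    (hε : Tendsto ε f (𝓝[>] 0)) (h : (fun i => x i - x₁) =O[f] fun i => ε i ^ 2) :
    Tendsto x f (𝓝 x₁) := by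
  have h1 := ((tendsto_nhdsWithin_iff.1 hε).1).pow 2
  rw [zero_pow two_ne_zero] at h1
  exact tendsto_sub_nhds_zero_iff.1 (h.trans_tendsto h1)

namespace IsNear

variable {ι : Type*} {f g : Filter ι} {ε k m : ι → ℝ} {γ ν₀ κ₀ k₁ m₁ : ℝ}

theorem mono (h : IsNear f ε k m k₁ m₁) (hg : g ≤ f) : IsNear g ε k m k₁ m₁ :=
  ⟨h.eps.mono_left hg, h.isBigO_k.mono hg, h.isBigO_m.mono hg⟩

theorem tendsto_k (h : IsNear f ε k m k₁ m₁) : Tendsto k f (𝓝 k₁) :=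
  tendsto_of_isBigO h.eps h.isBigO_k

theorem tendsto_m (h : IsNear f ε k m k₁ m₁) : Tendsto m f (𝓝 m₁) :=
  tendsto_of_isBigO h.eps h.isBigO_m

theorem tendsto_freq (h : IsNear f ε k m k₁ m₁) (hd : CriticalData γ ν₀ κ₀ k₁ m₁) :
    Tendsto (fun i => freq γ (k i) (m i)) f (𝓝 (freq γ k₁ m₁)) :=
  NearCritical.tendsto_freq h.tendsto_k h.tendsto_m
    (critical_sign hd.sin_pos hd.cos_pos hd.k_ne hd.rel).1

/-- The squared frequency vanishes at the first order along the critical direction. -/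
theorem isBigO_freq_sq (h : IsNear f ε k m k₁ m₁) (hd : CriticalData γ ν₀ κ₀ k₁ m₁) :
    (fun i => freq γ (k i) (m i) ^ 2 - Real.sin γ ^ 2) =O[f] fun i => ε i ^ 2 := by
  have hk1 := hd.k_ne
  have h0 := (critical_sign hd.sin_pos hd.cos_pos hd.k_ne hd.rel).1
  have hpos : 0 < k₁ ^ 2 + m₁ ^ 2 := by positivity
  have t1 : Tendsto (fun i => k i * (m i * Real.cos γ + k i * Real.sin γ)) f
      (𝓝 (k₁ * (m₁ * Real.cos γ + k₁ * Real.sin γ))) :=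
    h.tendsto_k.mul ((h.tendsto_m.mul_const _).add (h.tendsto_k.mul_const _))
  have t2 : Tendsto (fun i => k i / (k i ^ 2 + m i ^ 2)) f (𝓝 (k₁ / (k₁ ^ 2 + m₁ ^ 2))) :=
    h.tendsto_k.div ((h.tendsto_k.pow 2).add (h.tendsto_m.pow 2)) hpos.ne'
  have h1 : (fun i => (Real.cos γ ^ 2 - Real.sin γ ^ 2) * (k i - k₁) -
      2 * Real.cos γ * Real.sin γ * (m i - m₁)) =O[f] fun i => ε i ^ 2 :=
    (h.isBigO_k.const_mul_left _).sub (h.isBigO_m.const_mul_left _)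
  have h2 := (t2.isBigO_one ℝ).mul h1
  simp only [one_mul] at h2
  refine h2.congr' ?_ EventuallyEq.rfl
  filter_upwards [t1.eventually_const_lt h0] with i hi
  have hki : k i ≠ 0 := left_ne_zero_of_mul hi.ne'
  have h3 : 0 < k i ^ 2 + m i ^ 2 := by positivity
  have h4 := freq_sq_mul hi
  rw [div_mul_eq_mul_div, div_eq_iff h3.ne']
  linear_combination -h4 + k i * hd.rel

theorem isBigO_freq (h : IsNear f ε k m k₁ m₁) (hd : CriticalData γ ν₀ κ₀ k₁ m₁) :
    (fun i => freq γ (k i) (m i) - freq γ k₁ m₁) =O[f] fun i => ε i ^ 2 := by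
  obtain ⟨hsq, hpos⟩ := critical_freq hd.sin_pos hd.cos_pos hd.k_ne hd.rel
  have h0 : freq γ k₁ m₁ + freq γ k₁ m₁ ≠ 0 := by
    have := left_ne_zero_of_mul hpos.ne'
    rw [← two_mul]
    exact mul_ne_zero two_ne_zero this
  have t := (h.tendsto_freq hd).add_const (freq γ k₁ m₁)
  have h1 := ((t.inv₀ h0).isBigO_one ℝ).mul (h.isBigO_freq_sq hd)
  simp only [one_mul] at h1
  refine h1.congr' ?_ EventuallyEq.rfl
  filter_upwards [t.eventually_ne h0] with i hi
  rw [← hsq]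
  field_simp
  ring

/-- The limits of the rates and of the amplitudes of the boundary layer of the incident packet. -/
theorem incident {l : Ultrafilter ι} (h : IsNear (l : Filter ι) ε k m k₁ m₁)
    (hd : CriticalData γ ν₀ κ₀ k₁ m₁) :
    (∀ᶠ i in (l : Filter ι), IsRateTriple γ (ν₀ * ε i ^ 6) (κ₀ * ε i ^ 6) (freq γ (k i) (m i)) (k i)
        (incRate γ (ν₀ * ε i ^ 6) (κ₀ * ε i ^ 6) (k i) (m i)) ∧
      ‖incRate γ (ν₀ * ε i ^ 6) (κ₀ * ε i ^ 6) (k i) (m i) 1‖ <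
        ‖incRate γ (ν₀ * ε i ^ 6) (κ₀ * ε i ^ 6) (k i) (m i) 2‖ ∧
      (liftMatrix γ (ν₀ * ε i ^ 6) (κ₀ * ε i ^ 6) (freq γ (k i) (m i)) (k i)).det ≠ 0) ∧
    ∃ Z A B : Fin 3 → ℂ, ∀ j ∈ ({0, 1} : Finset (Fin 3)), 0 < (Z j).re ∧
      Tendsto (fun i => (ε i : ℂ) ^ 2 * incRate γ (ν₀ * ε i ^ 6) (κ₀ * ε i ^ 6) (k i) (m i) j) l
        (𝓝 (Z j)) ∧
      Tendsto (fun i => (ε i : ℂ) ^ 2 * incAmp γ (κ₀ * ε i ^ 6) (k i) (m i)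
        (incRate γ (ν₀ * ε i ^ 6) (κ₀ * ε i ^ 6) (k i) (m i)) j) l (𝓝 (A j)) ∧
      Tendsto (fun i => modeB γ (κ₀ * ε i ^ 6) (freq γ (k i) (m i)) (k i)
        (incRate γ (ν₀ * ε i ^ 6) (κ₀ * ε i ^ 6) (k i) (m i) j)) l (𝓝 (B j)) := by
  obtain ⟨hsq, hpos⟩ := critical_freq hd.sin_pos hd.cos_pos hd.k_ne hd.rel
  have hω0 : freq γ k₁ m₁ ≠ 0 := left_ne_zero_of_mul hpos.ne'
  have hε0 : ∀ᶠ i in (l : Filter ι), 0 < ε i := h.eps.eventually self_mem_nhdsWithin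
  obtain ⟨C, hC⟩ := (h.isBigO_freq_sq hd).bound
  -- along the ultrafilter, the bounded detuning `(ω² - s²) / ε²` has a limit `θ`
  obtain ⟨θ, -, hθ⟩ := exists_tendsto_of_norm_le l
    (g := fun i => (freq γ (k i) (m i) ^ 2 - Real.sin γ ^ 2) / ε i ^ 2) (C := C) (by
      filter_upwards [hC, hε0] with i hi h0
      rw [norm_div, div_le_iff₀ (norm_pos_iff.2 (by positivity))]
      exact hi)
  obtain ⟨hT, Z₀, Z₁, Y, h0, h1, h2, r0, r1, rY, hne, hY2⟩ :=
    eventually_isRateTriple_critical l hd.sin_pos hd.cos_pos hd.nu_pos hd.kappa_pos h.eps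
      (h.tendsto_freq hd) h.tendsto_k hθ hsq hpos
  have hZ0 : Z₀ ≠ 0 := fun h => by simp [h] at r0
  have hZ1 : Z₁ ≠ 0 := fun h => by simp [h] at r1
  have hY : Y ≠ 0 := fun h => by simp [h] at rY
  obtain ⟨hdet, hsol⟩ := tendsto_critical_amplitude (γ := γ) (L := fun i => rate γ (ν₀ * ε i ^ 6)
    (κ₀ * ε i ^ 6) (freq γ (k i) (m i)) (k i)) hd.sin_pos hd.nu_pos hd.kappa_pos h.eps
    (h.tendsto_freq hd) h.tendsto_k hω0 hd.k_ne h0 h1 h2 hZ0 hZ1 hY hne hY2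
  obtain ⟨A, hA⟩ := hsol (fun i => incTrace γ (k i) (m i)) (incTrace γ k₁ m₁) (by
    intro a
    unfold incTrace
    fin_cases a
    · exact tendsto_const_nhds
    · exact (tendsto_ofReal h.tendsto_k).neg.div (tendsto_ofReal h.tendsto_m)
        (ofReal_ne_zero.2 hd.m_ne)
    · exact (tendsto_ofReal ((h.tendsto_k.mul_const _).sub (h.tendsto_m.mul_const _))).neg.div
        (tendsto_ofReal (h.tendsto_freq hd)) (ofReal_ne_zero.2 hω0))
  have hlt := eventually_norm_lt_of_scaled h.eps
    (tendsto_pow_mul_zero h.eps h1 (by norm_num : 2 < 3)) h2 (by simpa using norm_pos_iff.2 hY)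
  have hI : I * (freq γ k₁ m₁ : ℂ) + κ₀ * 0 ≠ 0 := by simp [hω0]
  obtain ⟨i0, q0⟩ := tendsto_of_scaled_sq h.eps hZ0 h0
  obtain ⟨i1, q1⟩ := tendsto_of_scaled_sq h.eps hZ1 h1
  have B0 := tendsto_modeB (γ := γ) (h.tendsto_freq hd) h.tendsto_k h.eps i0 q0 hI
  have B1 := tendsto_modeB (γ := γ) (h.tendsto_freq hd) h.tendsto_k h.eps i1 q1 hI
  refine ⟨?_, ![Z₀, Z₁, 0], A, fun _ => (Real.sin γ + I * k₁ * 0 * Real.cos γ) /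
    (I * freq γ k₁ m₁ + κ₀ * 0), fun j hj => ?_⟩
  · filter_upwards [hT, hlt, hdet] with i a b d
    exact ⟨a, b, d⟩
  · refine ⟨?_, ?_, hA j hj, ?_⟩
    · fin_cases j
      exacts [r0, r1, by simp at hj]
    · fin_cases j
      exacts [h0, h1, by simp at hj]
    · fin_cases j
      exacts [B0, B1, by simp at hj]

/-- The boundary trace generated by the interactions has size at most `(ε⁻⁴, ε⁻², ε⁻⁶)`. -/
theorem source {l : Ultrafilter ι} {k' m' : ι → ℝ} (h : IsNear (l : Filter ι) ε k m k₁ m₁)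
    (h' : IsNear (l : Filter ι) ε k' m' k₁ m₁) (hd : CriticalData γ ν₀ κ₀ k₁ m₁) (σ : ℝ) :
    ∃ d : Fin 3 → ℂ, ∀ a, Tendsto (fun i => (ε i : ℂ) ^ traceExp a *
      sourceTrace γ (ν₀ * ε i ^ 6) (κ₀ * ε i ^ 6) σ (k i) (m i) (k' i) (m' i) a) l (𝓝 (d a)) := by
  obtain ⟨hsq, hpos⟩ := critical_freq hd.sin_pos hd.cos_pos hd.k_ne hd.rel
  obtain ⟨-, Z, A, B, hZ⟩ := h.incident hd
  obtain ⟨-, Z', A', B', hZ'⟩ := h'.incident hd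
  have hε0 : ∀ᶠ i in (l : Filter ι), (ε i : ℂ) ≠ 0 := by
    filter_upwards [h.eps.eventually self_mem_nhdsWithin] with i hi
    exact_mod_cast (ne_of_gt hi)
  suffices H : ∀ a, ∃ y, Tendsto (fun i => (ε i : ℂ) ^ traceExp a *
      sourceTrace γ (ν₀ * ε i ^ 6) (κ₀ * ε i ^ 6) σ (k i) (m i) (k' i) (m' i) a) l (𝓝 y) by
    choose d hd using H
    exact ⟨d, hd⟩
  simp only [sourceTrace_eq]
  refine fun a => ⟨_, tendsto_srcTrace (m₁ := m₁) (e₁ := ((0 : ℝ) : ℂ)) (Z := Z) (Z' := Z')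
    (A := A) (A' := A') (B' := B') hε0
    (tendsto_ofReal (tendsto_nhdsWithin_iff.1 h.eps).1) h.tendsto_k h'.tendsto_k
    h.tendsto_m hd.m_ne ((h.tendsto_freq hd).add (h'.tendsto_freq hd)) ?_
    (fun j hj => (hZ j hj).2.1) (fun j hj => (hZ' j hj).2.1) (fun j hj => (hZ j hj).2.2.1)
    (fun j hj => (hZ' j hj).2.2.1) (fun j hj => (hZ' j hj).2.2.2) ?_ ?_ ?_ a⟩
  · -- `2 ω₁` differs from `± sin γ`, because `ω₁ ^ 2 = sin γ ^ 2`
    intro s hs h0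
    have h1 : (s : ℝ) * Real.sin γ = freq γ k₁ m₁ + freq γ k₁ m₁ := by
      have : ((s * Real.sin γ : ℝ) : ℂ) = ((freq γ k₁ m₁ + freq γ k₁ m₁ : ℝ) : ℂ) := by
        push_cast at h0 ⊢
        linear_combination h0
      exact_mod_cast this
    have h2 : (s : ℝ) ^ 2 = 1 := by
      rcases Finset.mem_insert.1 hs with rfl | hs
      · norm_num
      · rw [Finset.mem_singleton.1 hs]
        norm_num
    have h3 : Real.sin γ ^ 2 = 4 * freq γ k₁ m₁ ^ 2 := by
      linear_combination (s * Real.sin γ + (freq γ k₁ m₁ + freq γ k₁ m₁)) * h1 - Real.sin γ ^ 2 * h2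
    have := hd.sin_pos
    nlinarith
  · intro j hj h0
    have := (hZ j hj).1
    simp [h0] at this
  · intro j hj j' hj' h0
    have h1 := (hZ j hj).1
    have h2 := (hZ' j' hj').1
    have h3 := congrArg Complex.re h0
    rw [add_re, zero_re] at h3
    linarith
  · intro j hj h0
    have h2 := (hZ' j hj).1
    simp only [ofReal_zero, ne_eq, OfNat.ofNat_ne_zero, not_false_eq_true, zero_pow, zero_mul,
      zero_add] at h0
    simp [h0] at h2

theorem tendsto_mode {w b : ι → ℂ} {w₁ b₁ : ℂ} (hw : Tendsto w f (𝓝 w₁)) (hb : Tendsto b f (𝓝 b₁)) :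
    Tendsto (fun i => (!₂[1, w i, b i] : State)) f (𝓝 !₂[1, w₁, b₁]) := by
  refine Tendsto.comp (g := WithLp.toLp 2) ((PiLp.continuous_toLp 2 _).tendsto _)
    (tendsto_pi_nhds.2 fun a => ?_)
  fin_cases a
  exacts [tendsto_const_nhds, hw, hb]

/-- The amplitude of the mode `j` of the corrector has size at most `ε ^ (-ampExp j)`. -/
def _root_.NearCritical.ampExp : Fin 3 → ℕ := ![2, 4, 4]

/-- The limits of the rates and of the amplitudes of the modes of the corrector. -/
theorem corrector {l : Ultrafilter ι} {k' m' : ι → ℝ} (h : IsNear (l : Filter ι) ε k m k₁ m₁)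
    (h' : IsNear (l : Filter ι) ε k' m' k₁ m₁) (hd : CriticalData γ ν₀ κ₀ k₁ m₁) (σ : ℝ) :
    (∀ᶠ i in (l : Filter ι), IsRateTriple γ (ν₀ * ε i ^ 6) (κ₀ * ε i ^ 6)
        (freq γ (k i) (m i) + freq γ (k' i) (m' i)) (k i + k' i)
        (rateII γ (ν₀ * ε i ^ 6) (κ₀ * ε i ^ 6) (k i) (m i) (k' i) (m' i)) ∧
      ‖rateII γ (ν₀ * ε i ^ 6) (κ₀ * ε i ^ 6) (k i) (m i) (k' i) (m' i) 0‖ <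
        ‖rateII γ (ν₀ * ε i ^ 6) (κ₀ * ε i ^ 6) (k i) (m i) (k' i) (m' i) 1‖ ∧
      ‖rateII γ (ν₀ * ε i ^ 6) (κ₀ * ε i ^ 6) (k i) (m i) (k' i) (m' i) 1‖ <
        ‖rateII γ (ν₀ * ε i ^ 6) (κ₀ * ε i ^ 6) (k i) (m i) (k' i) (m' i) 2‖ ∧
      (liftMatrix γ (ν₀ * ε i ^ 6) (κ₀ * ε i ^ 6) (freq γ (k i) (m i) + freq γ (k' i) (m' i))
        (k i + k' i)).det ≠ 0) ∧
    (∃ w : ℂ, Tendsto (fun i => rateII γ (ν₀ * ε i ^ 6) (κ₀ * ε i ^ 6) (k i) (m i) (k' i) (m' i) 0)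
        l (𝓝 w) ∧ w ≠ 0 ∧ 0 ≤ w.re ∧
        (((2 * freq γ k₁ m₁) ^ 2 - Real.sin γ ^ 2 : ℝ) : ℂ) * w ^ 2 -
          2 * I * Real.sin γ * Real.cos γ * (2 * k₁ : ℝ) * w +
          ((Real.cos γ ^ 2 - (2 * freq γ k₁ m₁) ^ 2 : ℝ) : ℂ) * (2 * k₁ : ℝ) ^ 2 = 0 ∧
        (w.re = 0 → Real.sin γ * Real.cos γ * (2 * freq γ k₁ m₁) * (2 * k₁) ≤
          ((2 * freq γ k₁ m₁) ^ 2 - Real.sin γ ^ 2) * w.im * (2 * freq γ k₁ m₁))) ∧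
    (∀ j : Fin 3, j ≠ 0 → ∃ Y : ℂ, 0 < Y.re ∧ Tendsto (fun i => (ε i : ℂ) ^ 3 *
      rateII γ (ν₀ * ε i ^ 6) (κ₀ * ε i ^ 6) (k i) (m i) (k' i) (m' i) j) l (𝓝 Y)) ∧
    ∀ j, ∃ v, Tendsto (fun i => ((ε i : ℂ) ^ ampExp j *
      amplitudeII γ (ν₀ * ε i ^ 6) (κ₀ * ε i ^ 6) σ (k i) (m i) (k' i) (m' i) j) •
      mode γ (κ₀ * ε i ^ 6) (freq γ (k i) (m i) + freq γ (k' i) (m' i)) (k i + k' i)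
        (rateII γ (ν₀ * ε i ^ 6) (κ₀ * ε i ^ 6) (k i) (m i) (k' i) (m' i) j)) l (𝓝 v) := by
  obtain ⟨hsq, hpos⟩ := critical_freq hd.sin_pos hd.cos_pos hd.k_ne hd.rel
  have hs := hd.sin_pos
  have hω := (h.tendsto_freq hd).add (h'.tendsto_freq hd)
  have hk := h.tendsto_k.add h'.tendsto_k
  rw [← two_mul] at hω hk
  -- `ω₁² = sin² γ`, so the doubled frequency is supercritical
  have hω1 : Real.sin γ ^ 2 < (2 * freq γ k₁ m₁) ^ 2 := by nlinarith
  have hωk : 0 < 2 * freq γ k₁ m₁ * (2 * k₁) := by nlinarith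
  obtain ⟨hT, w, Y₁, Y₂, ρ₁, ρ₂, h0, h1, h2, ⟨hw, hwre, hquad, hsign⟩, r1, r2, hlt, hY1, hY2, hsum,
    hprod⟩ := eventually_isRateTriple_supercritical l hd.sin_pos hd.cos_pos hd.nu_pos hd.kappa_pos
    h.eps hω hk hω1 hωk
  obtain ⟨hdet, hB, hW, hsol⟩ := tendsto_supercritical_amplitude (γ := γ) (L := fun i =>
    rate γ (ν₀ * ε i ^ 6) (κ₀ * ε i ^ 6) (freq γ (k i) (m i) + freq γ (k' i) (m' i)) (k i + k' i))
    hd.sin_pos hd.nu_pos hd.kappa_pos h.eps hω hk (left_ne_zero_of_mul hωk.ne')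
    (right_ne_zero_of_mul hωk.ne') h0 h1 h2 hw r1 r2 hY1 hY2 hsum hprod
  obtain ⟨d, hdd⟩ := h.source h' hd σ
  obtain ⟨A, hA⟩ := hsol _ d (hdd 0) (hdd 1) (hdd 2)
  have hY0 : 0 < ‖Y₁‖ := norm_pos_iff.2 fun h => by simp [h] at r1
  have hl1 := eventually_norm_lt_of_scaled h.eps h1 h2 hlt
  have hl0 := eventually_norm_lt_of_scaled h.eps (tendsto_pow_mul_zero (n := 0) h.eps
    (by simpa using h0) (by norm_num : 0 < 3)) h1 (by simpa using hY0)
  refine ⟨?_, ⟨w, h0, hw, hwre, ?_, hsign⟩, ?_, fun j => ?_⟩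
  · filter_upwards [hT, hl0, hl1, hdet] with i a b c d
    exact ⟨a, b, c, d⟩
  · push_cast at hquad ⊢
    exact hquad
  · intro j hj
    fin_cases j
    exacts [absurd rfl hj, ⟨Y₁, r1, h1⟩, ⟨Y₂, r2, h2⟩]
  · obtain ⟨b, hb⟩ := hB j
    obtain ⟨v, hv⟩ := hW j
    exact ⟨_, (hA j).smul (tendsto_mode hv hb)⟩

end IsNear

/-! ### The rate of the second harmonic -/

/-- The inviscid equation has no purely imaginary root at frequencies larger than `1`. -/
theorem re_ne_zero_of_one_lt {s c ω k : ℝ} {w : ℂ} (hsc : s ^ 2 + c ^ 2 = 1) (hω : 1 < ω ^ 2)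
    (hk : k ≠ 0) (h : ((ω ^ 2 - s ^ 2 : ℝ) : ℂ) * w ^ 2 - 2 * I * s * c * k * w +
      ((c ^ 2 - ω ^ 2 : ℝ) : ℂ) * k ^ 2 = 0) : w.re ≠ 0 := by
  intro h0
  obtain ⟨y, rfl⟩ : ∃ y : ℝ, w = I * y := ⟨w.im, by apply Complex.ext <;> simp [h0]⟩
  have h1 : (ω ^ 2 - s ^ 2) * -y ^ 2 + 2 * s * c * k * y + (c ^ 2 - ω ^ 2) * k ^ 2 = 0 := by
    have : (((ω ^ 2 - s ^ 2) * -y ^ 2 + 2 * s * c * k * y + (c ^ 2 - ω ^ 2) * k ^ 2 : ℝ) : ℂ) =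
        0 := by
      rw [← h]
      push_cast
      linear_combination (-(ω ^ 2 - s ^ 2) * y ^ 2 + 2 * s * c * k * y : ℂ) * I_sq
    exact_mod_cast this
  have h2 : ((ω ^ 2 - s ^ 2) * y - s * c * k) ^ 2 + k ^ 2 * (ω ^ 2 * (ω ^ 2 - 1)) = 0 := by
    linear_combination -(ω ^ 2 - s ^ 2) * h1 + k ^ 2 * ω ^ 2 * hsc
  have h3 : 0 < k ^ 2 * (ω ^ 2 * (ω ^ 2 - 1)) := by
    have : 0 < ω ^ 2 - 1 := by linarith
    positivity
  nlinarith [sq_nonneg ((ω ^ 2 - s ^ 2) * y - s * c * k)]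

/-- The two real numbers `μ` for which `exp (i (k x - μ y - ω t))` is an inviscid plane wave, for
`τ = 1` and `τ = -1`. If `0 < ω k`, the group velocity points away from the boundary for
`τ = 1`. -/
def waveNum (γ τ ω k : ℝ) : ℝ :=
  k * (Real.sin γ * Real.cos γ + τ * (|ω| * √(1 - ω ^ 2))) / (ω ^ 2 - Real.sin γ ^ 2)

theorem waveNum_mul {γ τ ω k : ℝ} (hω : ω ^ 2 - Real.sin γ ^ 2 ≠ 0) :
    (ω ^ 2 - Real.sin γ ^ 2) * waveNum γ τ ω k =
      Real.sin γ * Real.cos γ * k + τ * (k * |ω| * √(1 - ω ^ 2)) := by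
  unfold waveNum
  field_simp

theorem waveNum_add {γ ω k : ℝ} :
    waveNum γ 1 ω k + waveNum γ (-1) ω k =
      2 * Real.sin γ * Real.cos γ * k / (ω ^ 2 - Real.sin γ ^ 2) := by
  unfold waveNum
  ring

theorem waveNum_mul_waveNum {γ ω k : ℝ} (hω : ω ^ 2 - Real.sin γ ^ 2 ≠ 0) (h1 : ω ^ 2 ≤ 1) :
    (ω ^ 2 - Real.sin γ ^ 2) * (waveNum γ 1 ω k * waveNum γ (-1) ω k) =
      -((Real.cos γ ^ 2 - ω ^ 2) * k ^ 2) := by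
  have h2 := waveNum_mul (τ := 1) (k := k) hω
  have h3 := waveNum_mul (τ := -1) (k := k) hω
  have h4 : √(1 - ω ^ 2) ^ 2 = 1 - ω ^ 2 := Real.sq_sqrt (by linarith)
  have h5 := sq_abs ω
  apply mul_left_cancel₀ hω
  linear_combination (ω ^ 2 - Real.sin γ ^ 2) * waveNum γ (-1) ω k * h2 +
    (Real.sin γ * Real.cos γ * k + 1 * (k * |ω| * √(1 - ω ^ 2))) * h3 -
    k ^ 2 * |ω| ^ 2 * h4 - k ^ 2 * (1 - ω ^ 2) * h5 + k ^ 2 * ω ^ 2 * Real.sin_sq_add_cos_sq γ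

/-- The inviscid dispersion relation. -/
theorem waveNum_rel {γ ω k : ℝ} (hω : ω ^ 2 - Real.sin γ ^ 2 ≠ 0) (h1 : ω ^ 2 ≤ 1) :
    ω ^ 2 * (waveNum γ 1 ω k ^ 2 + k ^ 2) =
      (Real.sin γ * waveNum γ 1 ω k + Real.cos γ * k) ^ 2 := by
  have h2 := waveNum_mul_waveNum (k := k) hω h1
  have h3 : (ω ^ 2 - Real.sin γ ^ 2) * (waveNum γ 1 ω k + waveNum γ (-1) ω k) =
      2 * Real.sin γ * Real.cos γ * k := by
    rw [waveNum_add]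
    field_simp
  linear_combination waveNum γ 1 ω k * h3 - h2

/-- The limit of the rate of the second harmonic at frequencies smaller than `1`. -/
theorem eq_waveNum {γ ω k : ℝ} {w : ℂ} (hω : 0 < ω ^ 2 - Real.sin γ ^ 2) (h1 : ω ^ 2 < 1)
    (hk : 0 < ω * k) (h : ((ω ^ 2 - Real.sin γ ^ 2 : ℝ) : ℂ) * w ^ 2 -
      2 * I * Real.sin γ * Real.cos γ * k * w + ((Real.cos γ ^ 2 - ω ^ 2 : ℝ) : ℂ) * k ^ 2 = 0)
    (hw : w.re = 0 → Real.sin γ * Real.cos γ * ω * k ≤ (ω ^ 2 - Real.sin γ ^ 2) * w.im * ω) :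
    w = I * waveNum γ 1 ω k := by
  have hD : ((ω ^ 2 - Real.sin γ ^ 2 : ℝ) : ℂ) ≠ 0 := ofReal_ne_zero.2 hω.ne'
  have h2 := congrArg (fun x : ℝ => (x : ℂ)) (waveNum_mul_waveNum (k := k) hω.ne' h1.le)
  have h3 : (ω ^ 2 - Real.sin γ ^ 2) * (waveNum γ 1 ω k + waveNum γ (-1) ω k) =
      2 * Real.sin γ * Real.cos γ * k := by
    rw [waveNum_add]
    field_simp
  have h3' := congrArg (fun x : ℝ => (x : ℂ)) h3
  have h4 : (w - I * waveNum γ 1 ω k) * (w - I * waveNum γ (-1) ω k) = 0 := by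
    apply mul_left_cancel₀ hD
    push_cast at h h2 h3' ⊢
    linear_combination h - I * w * h3' - h2 +
      ((ω ^ 2 - Complex.sin γ ^ 2) * (waveNum γ 1 ω k * waveNum γ (-1) ω k)) * I_sq
  rcases mul_eq_zero.1 h4 with h5 | h5
  · exact sub_eq_zero.1 h5
  · exfalso
    have h6 := sub_eq_zero.1 h5
    have h7 := hw (by rw [h6]; simp)
    have h8 : w.im = waveNum γ (-1) ω k := by rw [h6]; simp
    rw [h8, waveNum_mul hω.ne'] at h7
    have h9 : 0 < ω * k * |ω| * √(1 - ω ^ 2) := by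
      have h10 : ω ≠ 0 := left_ne_zero_of_mul hk.ne'
      have : 0 < √(1 - ω ^ 2) := Real.sqrt_pos.2 (by linarith)
      positivity
    nlinarith

theorem isBigO_comp_sub {ι E F : Type*} [NormedAddCommGroup E] [NormedSpace ℝ E]
    [NormedAddCommGroup F] [NormedSpace ℝ F] {f : Filter ι} {ε : ι → ℝ} {G : E → F} {p : ι → E}
    {p₁ : E} (hε : Tendsto ε f (𝓝[>] 0)) (hG : DifferentiableAt ℝ G p₁)
    (hp : (fun i => p i - p₁) =O[f] fun i => ε i ^ 2) :
    (fun i => G (p i) - G p₁) =O[f] fun i => ε i ^ 2 := by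
  have h1 := ((tendsto_nhdsWithin_iff.1 hε).1).pow 2
  rw [zero_pow two_ne_zero] at h1
  exact (hG.isBigO_sub.comp_tendsto (tendsto_sub_nhds_zero_iff.1 (hp.trans_tendsto h1))).trans hp

theorem isBigO_waveNum {ι : Type*} {f : Filter ι} {ε ω k : ι → ℝ} {ω₁ k₁ : ℝ} (γ τ : ℝ)
    (hε : Tendsto ε f (𝓝[>] 0)) (hω : (fun i => ω i - ω₁) =O[f] fun i => ε i ^ 2)
    (hk : (fun i => k i - k₁) =O[f] fun i => ε i ^ 2) (h0 : ω₁ ≠ 0)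
    (hs : ω₁ ^ 2 - Real.sin γ ^ 2 ≠ 0) (h1 : ω₁ ^ 2 < 1) :
    (fun i => waveNum γ τ (ω i) (k i) - waveNum γ τ ω₁ k₁) =O[f] fun i => ε i ^ 2 := by
  refine isBigO_comp_sub (G := fun p : ℝ × ℝ => waveNum γ τ p.1 p.2) (p := fun i => (ω i, k i))
    (p₁ := (ω₁, k₁)) hε ?_ (hω.prod_left hk)
  unfold waveNum
  have h2 : DifferentiableAt ℝ (fun p : ℝ × ℝ => |p.1|) (ω₁, k₁) :=
    DifferentiableAt.abs (f := fun p : ℝ × ℝ => p.1) (by fun_prop) h0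
  have h3 : DifferentiableAt ℝ (fun p : ℝ × ℝ => √(1 - p.1 ^ 2)) (ω₁, k₁) :=
    DifferentiableAt.sqrt (by fun_prop) (by simpa using (sub_pos.2 h1).ne')
  fun_prop (disch := exact hs)

namespace IsNear

variable {ι : Type*} {f g : Filter ι} {ε k m k' m' : ι → ℝ} {γ ν₀ κ₀ k₁ m₁ : ℝ}

/-- In the evanescent case, the rate of the second harmonic has a positive limit. -/
theorem exists_le_re (h : IsNear f ε k m k₁ m₁) (h' : IsNear f ε k' m' k₁ m₁)
    (hd : CriticalData γ ν₀ κ₀ k₁ m₁) (hs : 1 / 2 < Real.sin γ) :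
    ∃ c > 0, ∀ᶠ i in f,
      c ≤ (rateII γ (ν₀ * ε i ^ 6) (κ₀ * ε i ^ 6) (k i) (m i) (k' i) (m' i) 0).re := by
  obtain ⟨hsq, hpos⟩ := critical_freq hd.sin_pos hd.cos_pos hd.k_ne hd.rel
  refine exists_eventually_le fun l hl => ?_
  obtain ⟨-, ⟨w, hw, -, hre, hquad, -⟩, -⟩ := (h.mono hl).corrector (h'.mono hl) hd 0
  refine ⟨w.re, lt_of_le_of_ne hre (Ne.symm ?_), tendsto_re hw⟩
  refine re_ne_zero_of_one_lt (Real.sin_sq_add_cos_sq γ) ?_ (mul_ne_zero two_ne_zero hd.k_ne) hquad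
  nlinarith

/-- In the propagating case, the rate of the second harmonic is known up to `O(ε⁸)`; its real part
is equivalent to a constant times `ε⁶`. -/
theorem exists_isBigO_rate (h : IsNear f ε k m k₁ m₁) (h' : IsNear f ε k' m' k₁ m₁)
    (hd : CriticalData γ ν₀ κ₀ k₁ m₁) (hs : Real.sin γ < 1 / 2) :
    ∃ ρ > 0, (fun i => rateII γ (ν₀ * ε i ^ 6) (κ₀ * ε i ^ 6) (k i) (m i) (k' i) (m' i) 0 -
      (I * waveNum γ 1 (freq γ (k i) (m i) + freq γ (k' i) (m' i)) (k i + k' i) +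
        (ρ * ε i ^ 6 : ℝ))) =O[f] fun i => ε i ^ 8 := by
  obtain ⟨hsq, hpos⟩ := critical_freq hd.sin_pos hd.cos_pos hd.k_ne hd.rel
  have hs0 := hd.sin_pos
  set Ω₁ : ℝ := 2 * freq γ k₁ m₁ with hΩ₁
  set K₁ : ℝ := 2 * k₁ with hK₁
  set Ω : ι → ℝ := fun i => freq γ (k i) (m i) + freq γ (k' i) (m' i) with hΩ
  set K : ι → ℝ := fun i => k i + k' i with hK
  set L : ι → ℂ := fun i => rateII γ (ν₀ * ε i ^ 6) (κ₀ * ε i ^ 6) (k i) (m i) (k' i) (m' i) 0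
    with hL
  have hΩK : 0 < Ω₁ * K₁ := by
    rw [hΩ₁, hK₁]
    nlinarith
  have hΩ0 : Ω₁ ≠ 0 := left_ne_zero_of_mul hΩK.ne'
  have hK0 : K₁ ≠ 0 := right_ne_zero_of_mul hΩK.ne'
  have hΩs : 0 < Ω₁ ^ 2 - Real.sin γ ^ 2 := by
    rw [hΩ₁]
    nlinarith
  have hΩ1 : Ω₁ ^ 2 < 1 := by
    rw [hΩ₁]
    nlinarith
  have bΩ : (fun i => Ω i - Ω₁) =O[f] fun i => ε i ^ 2 :=
    ((h.isBigO_freq hd).add (h'.isBigO_freq hd)).congr_left fun i => by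
      simp only [hΩ, hΩ₁]
      ring
  have bK : (fun i => K i - K₁) =O[f] fun i => ε i ^ 2 :=
    (h.isBigO_k.add h'.isBigO_k).congr_left fun i => by
      simp only [hK, hK₁]
      ring
  have tΩ := tendsto_of_isBigO h.eps bΩ
  have tε := (tendsto_nhdsWithin_iff.1 h.eps).1
  have tL : Tendsto L f (𝓝 (I * waveNum γ 1 Ω₁ K₁)) := by
    refine tendsto_iff_ultrafilter _ _ _ |>.2 fun l hl => ?_
    obtain ⟨-, ⟨w, hw, -, hre, hquad, hsign⟩, -⟩ := (h.mono hl).corrector (h'.mono hl) hd 0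
    rwa [← eq_waveNum hΩs hΩ1 hΩK hquad hsign]
  have hroot : ∀ᶠ i in f, symb (Real.sin γ) (Real.cos γ) (ν₀ * ε i ^ 6) (κ₀ * ε i ^ 6) (Ω i) (K i)
      (L i) = 0 := eventually_of_ultrafilter fun l hl => by
    obtain ⟨hT, -⟩ := (h.mono hl).corrector (h'.mono hl) hd 0
    filter_upwards [hT] with i hi
    have h1 : L i ∈ Set.range (rateII γ (ν₀ * ε i ^ 6) (κ₀ * ε i ^ 6) (k i) (m i) (k' i) (m' i)) :=
      ⟨0, rfl⟩
    rw [hi.1.2.1] at h1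
    have h2 := h1.2
    rwa [det_waveMatrix] at h2
  have bW : ∀ τ, (fun i => waveNum γ τ (Ω i) (K i) - waveNum γ τ Ω₁ K₁) =O[f] fun i => ε i ^ 2 :=
    fun τ => isBigO_waveNum γ τ h.eps bΩ bK hΩ0 hΩs.ne' hΩ1
  -- the characteristic equation reads `L - I * waveNum γ 1 Ω K = ε ^ 6 * G`
  set G : ℂ × ℂ × ℂ × ℂ × ℂ → ℂ := fun p =>
    (I * p.2.1 * (ν₀ + κ₀) * (p.2.2.1 ^ 2 - p.2.2.2.1 ^ 2) ^ 2 -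
      ν₀ * κ₀ * p.1 * (p.2.2.1 ^ 2 - p.2.2.2.1 ^ 2) ^ 3) /
      ((p.2.1 ^ 2 - (Real.sin γ : ℂ) ^ 2) * (p.2.2.2.1 - I * p.2.2.2.2)) with hG
  set p : ι → ℂ × ℂ × ℂ × ℂ × ℂ := fun i =>
    ((ε i : ℂ) ^ 6, (Ω i : ℂ), (K i : ℂ), L i, (waveNum γ (-1) (Ω i) (K i) : ℂ)) with hp
  set p₁ : ℂ × ℂ × ℂ × ℂ × ℂ :=
    (0, (Ω₁ : ℂ), (K₁ : ℂ), I * waveNum γ 1 Ω₁ K₁, (waveNum γ (-1) Ω₁ K₁ : ℂ)) with hp₁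
  have hroot4 : 0 < √(1 - Ω₁ ^ 2) := Real.sqrt_pos.2 (by linarith)
  have hsep : (Ω₁ ^ 2 - Real.sin γ ^ 2) * (waveNum γ 1 Ω₁ K₁ - waveNum γ (-1) Ω₁ K₁) =
      2 * (K₁ * |Ω₁| * √(1 - Ω₁ ^ 2)) := by
    rw [mul_sub, waveNum_mul hΩs.ne', waveNum_mul hΩs.ne']
    ring
  have hsep0 : waveNum γ 1 Ω₁ K₁ - waveNum γ (-1) Ω₁ K₁ ≠ 0 := by
    intro h0
    rw [h0, mul_zero] at hsep
    have : K₁ * |Ω₁| * √(1 - Ω₁ ^ 2) ≠ 0 := by positivity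
    exact this (by linarith)
  have hden : ((Ω₁ : ℂ) ^ 2 - (Real.sin γ : ℂ) ^ 2) *
      (I * waveNum γ 1 Ω₁ K₁ - I * waveNum γ (-1) Ω₁ K₁) ≠ 0 := by
    refine mul_ne_zero (by exact_mod_cast hΩs.ne') ?_
    rw [← mul_sub]
    exact mul_ne_zero I_ne_zero (by exact_mod_cast hsep0)
  have hGd : DifferentiableAt ℝ G p₁ := by
    have h1 : DifferentiableAt ℂ G p₁ := by
      simp only [hG]
      fun_prop (disch := exact hden)
    exact h1.restrictScalars ℝ
  have tp : Tendsto p f (𝓝 p₁) := by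
    have e0 := (tendsto_ofReal tε).pow 6
    rw [ofReal_zero, zero_pow (by norm_num)] at e0
    exact e0.prodMk_nhds ((tendsto_ofReal tΩ).prodMk_nhds ((tendsto_ofReal
      (tendsto_of_isBigO h.eps bK)).prodMk_nhds (tL.prodMk_nhds (tendsto_ofReal
        (tendsto_of_isBigO h.eps (bW (-1)))))))
  have tG : Tendsto (fun i => G (p i)) f (𝓝 (G p₁)) := hGd.continuousAt.tendsto.comp tp
  have hLG : ∀ᶠ i in f, L i - I * waveNum γ 1 (Ω i) (K i) = (ε i : ℂ) ^ 6 * G (p i) := by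
    have t1 : Tendsto (fun i => ((Ω i : ℂ) ^ 2 - (Real.sin γ : ℂ) ^ 2) *
        (L i - I * waveNum γ (-1) (Ω i) (K i))) f (𝓝 (((Ω₁ : ℂ) ^ 2 - (Real.sin γ : ℂ) ^ 2) *
        (I * waveNum γ 1 Ω₁ K₁ - I * waveNum γ (-1) Ω₁ K₁))) :=
      (((tendsto_ofReal tΩ).pow 2).sub_const _).mul (tL.sub ((tendsto_ofReal
        (tendsto_of_isBigO h.eps (bW (-1)))).const_mul I))
    have t2 := (tΩ.pow 2).eventually_lt_const hΩ1
    have t3 := ((tΩ.pow 2).sub_const (Real.sin γ ^ 2)).eventually_const_lt hΩs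
    filter_upwards [t1.eventually_ne hden, t2, t3, hroot] with i h1 h2 h3 h4
    simp only [hG, hp]
    rw [mul_div_assoc', eq_div_iff h1]
    have h5 := congrArg (fun x : ℝ => (x : ℂ)) (waveNum_mul_waveNum (k := K i) h3.ne' h2.le)
    have h6 : (Ω i ^ 2 - Real.sin γ ^ 2) * (waveNum γ 1 (Ω i) (K i) + waveNum γ (-1) (Ω i) (K i)) =
        2 * Real.sin γ * Real.cos γ * K i := by
      rw [waveNum_add, mul_div_cancel₀ _ h3.ne']
    have h6' := congrArg (fun x : ℝ => (x : ℂ)) h6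
    unfold symb at h4
    push_cast at h4 h5 h6' ⊢
    linear_combination h4 - I * L i * h6' - h5 +
      ((Ω i ^ 2 - Complex.sin γ ^ 2) * (waveNum γ 1 (Ω i) (K i) * waveNum γ (-1) (Ω i) (K i)) -
        Ω i ^ 2 * (K i ^ 2 - L i ^ 2) + Complex.cos γ ^ 2 * K i ^ 2 : ℂ) * I_sq
  have hε1 : ∀ᶠ i in f, |ε i| ≤ 1 := by
    have := tε.abs
    rw [abs_zero] at this
    exact (this.eventually_lt_const one_pos).mono fun i hi => hi.le
  have e62 : (fun i => (ε i : ℂ) ^ 6) =O[f] fun i => ε i ^ 2 := by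
    refine Asymptotics.IsBigO.of_bound 1 ?_
    filter_upwards [hε1] with i hi
    rw [norm_pow, norm_real, norm_pow, one_mul, Real.norm_eq_abs]
    exact pow_le_pow_of_le_one (abs_nonneg _) hi (by norm_num)
  have bL : (fun i => L i - I * waveNum γ 1 Ω₁ K₁) =O[f] fun i => ε i ^ 2 := by
    have h1 : (fun i => (ε i : ℂ) ^ 6 * G (p i)) =O[f] fun i => ε i ^ 2 * 1 :=
      e62.mul (tG.isBigO_one ℝ)
    have h2 : (fun i => I * ((waveNum γ 1 (Ω i) (K i) - waveNum γ 1 Ω₁ K₁ : ℝ) : ℂ)) =O[f]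
        fun i => ε i ^ 2 :=
      ((isBigO_ofReal_left).2 (bW 1)).const_mul_left I
    simp only [mul_one] at h1
    refine (h1.add h2).congr' ?_ EventuallyEq.rfl
    filter_upwards [hLG] with i hi
    rw [← hi]
    push_cast
    ring
  have bp : (fun i => p i - p₁) =O[f] fun i => ε i ^ 2 := by
    have b0 : (fun i => (ε i : ℂ) ^ 6 - 0) =O[f] fun i => ε i ^ 2 := by simpa using e62
    have b1 : (fun i => (Ω i : ℂ) - Ω₁) =O[f] fun i => ε i ^ 2 := by
      simpa using isBigO_ofReal_left.2 bΩ
    have b2 : (fun i => (K i : ℂ) - K₁) =O[f] fun i => ε i ^ 2 := by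
      simpa using isBigO_ofReal_left.2 bK
    have b3 : (fun i => (waveNum γ (-1) (Ω i) (K i) : ℂ) - waveNum γ (-1) Ω₁ K₁) =O[f]
        fun i => ε i ^ 2 := by
      simpa using isBigO_ofReal_left.2 (bW (-1))
    exact b0.prod_left (b1.prod_left (b2.prod_left (bL.prod_left b3)))
  have bG := isBigO_comp_sub h.eps hGd bp
  refine ⟨Ω₁ * (ν₀ + κ₀) * (K₁ ^ 2 + waveNum γ 1 Ω₁ K₁ ^ 2) ^ 2 /
    (2 * (K₁ * |Ω₁| * √(1 - Ω₁ ^ 2))), ?_, ?_⟩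
  · have h1 := hd.nu_pos
    have h2 := hd.kappa_pos
    have h3 : Ω₁ * (ν₀ + κ₀) * (K₁ ^ 2 + waveNum γ 1 Ω₁ K₁ ^ 2) ^ 2 /
        (2 * (K₁ * |Ω₁| * √(1 - Ω₁ ^ 2))) =
        (Ω₁ * K₁) * (ν₀ + κ₀) * (K₁ ^ 2 + waveNum γ 1 Ω₁ K₁ ^ 2) ^ 2 /
        (2 * (K₁ ^ 2 * |Ω₁| * √(1 - Ω₁ ^ 2))) := by
      have : 0 < |Ω₁| := abs_pos.2 hΩ0
      field_simp
    rw [h3]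
    have : 0 < |Ω₁| := abs_pos.2 hΩ0
    have : 0 < K₁ ^ 2 + waveNum γ 1 Ω₁ K₁ ^ 2 := by positivity
    positivity
  · have hGp : G p₁ = ((Ω₁ * (ν₀ + κ₀) * (K₁ ^ 2 + waveNum γ 1 Ω₁ K₁ ^ 2) ^ 2 /
        (2 * (K₁ * |Ω₁| * √(1 - Ω₁ ^ 2))) : ℝ) : ℂ) := by
      rw [← hsep]
      simp only [hG, hp₁]
      rw [div_eq_iff hden]
      have h1 : ((Ω₁ ^ 2 - Real.sin γ ^ 2 : ℝ) : ℂ) ≠ 0 := ofReal_ne_zero.2 hΩs.ne'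
      have h2 : ((waveNum γ 1 Ω₁ K₁ - waveNum γ (-1) Ω₁ K₁ : ℝ) : ℂ) ≠ 0 := ofReal_ne_zero.2 hsep0
      have h3 : (((Ω₁ : ℂ) ^ 2 - (Real.sin γ : ℂ) ^ 2) *
          (I * waveNum γ 1 Ω₁ K₁ - I * waveNum γ (-1) Ω₁ K₁)) =
          I * (((Ω₁ ^ 2 - Real.sin γ ^ 2) *
            (waveNum γ 1 Ω₁ K₁ - waveNum γ (-1) Ω₁ K₁) : ℝ) : ℂ) := by
        push_cast
        ring
      rw [h3, mul_left_comm, ← ofReal_mul (_ / _), div_mul_cancel₀ _ (mul_ne_zero hΩs.ne' hsep0)]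
      push_cast
      rw [mul_pow, I_sq]
      ring
    have h1 : (fun i => (ε i : ℂ) ^ 6 * (G (p i) - G p₁)) =O[f] fun i => ε i ^ 6 * ε i ^ 2 := by
      refine Asymptotics.IsBigO.mul ?_ bG
      have : (fun i => ((ε i ^ 6 : ℝ) : ℂ)) =O[f] fun i => ε i ^ 6 :=
        isBigO_ofReal_left.2 (Asymptotics.isBigO_refl _ _)
      simpa using this
    simp only [← pow_add] at h1
    refine h1.congr' ?_ EventuallyEq.rfl
    filter_upwards [hLG] with i hi
    rw [mul_sub, ← hi, hGp]
    push_cast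
    ring

end IsNear

/-- The vertical wave number of the second harmonic is a strictly monotone function of the vertical
wave number of each of the two interacting waves, at the first order. This is what makes the second
harmonic dispersive. -/
theorem IsNear.exists_le_waveNum_sub {ι : Type*} {f : Filter ι} {ε k m k' m' n' : ι → ℝ}
    {γ ν₀ κ₀ k₁ m₁ : ℝ} (h : IsNear f ε k m k₁ m₁) (h' : IsNear f ε k' m' k₁ m₁)
    (h'' : IsNear f ε k' n' k₁ m₁) (hd : CriticalData γ ν₀ κ₀ k₁ m₁) (hs : Real.sin γ < 1 / 2) :
    ∃ C > 0, ∀ᶠ i in f, |m' i - n' i| ≤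
      C * |waveNum γ 1 (freq γ (k i) (m i) + freq γ (k' i) (m' i)) (k i + k' i) -
        waveNum γ 1 (freq γ (k i) (m i) + freq γ (k' i) (n' i)) (k i + k' i)| := by
  obtain ⟨hsq, hpos⟩ := critical_freq hd.sin_pos hd.cos_pos hd.k_ne hd.rel
  have hs0 := hd.sin_pos
  have hc0 := hd.cos_pos
  have hk0 := hd.k_ne
  have hsign := (critical_sign hd.sin_pos hd.cos_pos hd.k_ne hd.rel).1
  set ω₁ : ℝ := freq γ k₁ m₁ with hω₁
  have hω0 : ω₁ ≠ 0 := left_ne_zero_of_mul hpos.ne'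
  set a : ι → ℝ := fun i => freq γ (k' i) (m' i) with ha
  set b : ι → ℝ := fun i => freq γ (k' i) (n' i) with hb
  set A : ι → ℝ := fun i => freq γ (k i) (m i) + a i with hA
  set B : ι → ℝ := fun i => freq γ (k i) (m i) + b i with hB
  set K : ι → ℝ := fun i => k i + k' i with hK
  set x : ι → ℝ := fun i => waveNum γ 1 (A i) (K i) with hx
  set y : ι → ℝ := fun i => waveNum γ 1 (B i) (K i) with hy
  have ta : Tendsto a f (𝓝 ω₁) := h'.tendsto_freq hd
  have tb : Tendsto b f (𝓝 ω₁) := h''.tendsto_freq hd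
  have tA : Tendsto A f (𝓝 (ω₁ + ω₁)) := (h.tendsto_freq hd).add ta
  have tB : Tendsto B f (𝓝 (ω₁ + ω₁)) := (h.tendsto_freq hd).add tb
  have tK : Tendsto K f (𝓝 (k₁ + k₁)) := h.tendsto_k.add h'.tendsto_k
  have hΩs : 0 < (ω₁ + ω₁) ^ 2 - Real.sin γ ^ 2 := by nlinarith
  have hΩ1 : (ω₁ + ω₁) ^ 2 < 1 := by nlinarith
  have tw : ∀ {z : ι → ℝ}, Tendsto z f (𝓝 (ω₁ + ω₁)) →
      Tendsto (fun i => waveNum γ 1 (z i) (K i)) f (𝓝 (waveNum γ 1 (ω₁ + ω₁) (k₁ + k₁))) := by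
    intro z hz
    exact (tK.mul ((((hz.abs.mul ((hz.pow 2).const_sub 1).sqrt)).const_mul 1).const_add _)).div
      ((hz.pow 2).sub_const _) hΩs.ne'
  set μ₁ : ℝ := waveNum γ 1 (ω₁ + ω₁) (k₁ + k₁) with hμ₁
  have tx : Tendsto x f (𝓝 μ₁) := tw tA
  have ty : Tendsto y f (𝓝 μ₁) := tw tB
  set X : ι → ℝ := fun i => Real.sin γ * (Real.sin γ * (m' i + n' i) - 2 * Real.cos γ * k' i) -
    b i ^ 2 * (m' i + n' i) with hX
  set Y : ι → ℝ := fun i => Real.sin γ * (Real.sin γ * x i + Real.sin γ * y i +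
    2 * Real.cos γ * K i) - B i ^ 2 * (x i + y i) with hY
  have tX : Tendsto X f (𝓝 (Real.sin γ * (Real.sin γ * (m₁ + m₁) - 2 * Real.cos γ * k₁) -
      ω₁ ^ 2 * (m₁ + m₁))) :=
    (((((h'.tendsto_m.add h''.tendsto_m).const_mul _).sub (h'.tendsto_k.const_mul _)).const_mul
      _)).sub ((tb.pow 2).mul (h'.tendsto_m.add h''.tendsto_m))
  have tY : Tendsto Y f (𝓝 (Real.sin γ * (Real.sin γ * μ₁ + Real.sin γ * μ₁ +
      2 * Real.cos γ * (k₁ + k₁)) - (ω₁ + ω₁) ^ 2 * (μ₁ + μ₁))) :=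
    ((((tx.const_mul _).add (ty.const_mul _)).add (tK.const_mul _)).const_mul _).sub
      ((tB.pow 2).mul (tx.add ty))
  have hX0 : Real.sin γ * (Real.sin γ * (m₁ + m₁) - 2 * Real.cos γ * k₁) -
      ω₁ ^ 2 * (m₁ + m₁) ≠ 0 := by
    rw [hsq, show Real.sin γ * (Real.sin γ * (m₁ + m₁) - 2 * Real.cos γ * k₁) -
      Real.sin γ ^ 2 * (m₁ + m₁) = -(2 * (Real.sin γ * Real.cos γ * k₁)) by ring]
    exact neg_ne_zero.2 (mul_ne_zero two_ne_zero
      (mul_ne_zero (mul_ne_zero hs0.ne' hc0.ne') hk0))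
  have hd0 : (ω₁ + ω₁ + (ω₁ + ω₁)) * (μ₁ ^ 2 + (k₁ + k₁) ^ 2) ≠ 0 := by
    refine mul_ne_zero (fun h0 => hω0 (by linarith)) ?_
    have : 0 < (k₁ + k₁) ^ 2 := by
      rw [← two_mul]
      positivity
    positivity
  have tden := (tA.add tB).mul ((tx.pow 2).add (tK.pow 2))
  have tQ := (tY.div tden hd0).mul (((ta.add tb).mul
    ((h'.tendsto_k.pow 2).add (h'.tendsto_m.pow 2))).div tX hX0)
  obtain ⟨C, hC, hle⟩ := (tQ.isBigO_one ℝ).exists_pos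
  refine ⟨C, hC, ?_⟩
  have sgn : ∀ {z : ι → ℝ}, Tendsto z f (𝓝 m₁) →
      ∀ᶠ i in f, 0 < k' i * (z i * Real.cos γ + k' i * Real.sin γ) := fun hz =>
    (h'.tendsto_k.mul ((hz.mul_const _).add (h'.tendsto_k.mul_const _))).eventually_const_lt hsign
  filter_upwards [hle.bound, tden.eventually_ne hd0, tX.eventually_ne hX0, sgn h'.tendsto_m,
    sgn h''.tendsto_m, (tA.pow 2).eventually_lt_const hΩ1, (tB.pow 2).eventually_lt_const hΩ1,
    ((tA.pow 2).sub_const _).eventually_const_lt hΩs,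
    ((tB.pow 2).sub_const _).eventually_const_lt hΩs] with i h1 h2 h3 h4 h5 h6 h7 h8 h9
  have e1 := freq_sq_mul h4
  have e2 := freq_sq_mul h5
  have e3 := waveNum_rel (k := K i) h8.ne' h6.le
  have e4 := waveNum_rel (k := K i) h9.ne' h7.le
  -- subtract the dispersion relations of the two frequencies: both differences factorize
  have e5 : (a i - b i) * ((a i + b i) * (k' i ^ 2 + m' i ^ 2)) = (m' i - n' i) * X i := by
    simp only [hX, ha, hb]
    linear_combination e1 - e2
  have e6 : (a i - b i) * ((A i + B i) * (x i ^ 2 + K i ^ 2)) = (x i - y i) * Y i := by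
    have : a i - b i = A i - B i := by simp only [hA, hB]; ring
    rw [this]
    simp only [hY, hx, hy]
    linear_combination e3 - e4
  have e7 : m' i - n' i = (x i - y i) * (Y i / ((A i + B i) * (x i ^ 2 + K i ^ 2)) *
      ((a i + b i) * (k' i ^ 2 + m' i ^ 2) / X i)) := by
    rw [← mul_assoc, mul_div_assoc' (x i - y i), ← e6, mul_div_cancel_right₀ _ h2, mul_div_assoc',
      e5, mul_div_cancel_right₀ _ h3]
  rw [norm_one, mul_one] at h1
  change |m' i - n' i| ≤ C * |x i - y i|
  rw [e7, abs_mul, mul_comm]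
  exact mul_le_mul_of_nonneg_right h1 (abs_nonneg _)

/-! ### Uniform estimates on the support of the packet -/

/-- The filter of the pairs `(ε, p)` such that `ε` tends to `0` through positive values and `p` is
within distance `R ε²` of `p₁`. -/
def boxFilter {E : Type*} [NormedAddCommGroup E] (p₁ : E) (R : ℝ) : Filter (ℝ × E) :=
  comap Prod.fst (𝓝[>] 0) ⊓ 𝓟 {q | ‖q.2 - p₁‖ ≤ R * q.1 ^ 2}

theorem eventually_boxFilter {E : Type*} [NormedAddCommGroup E] {p₁ : E} {R : ℝ}
    {P : ℝ × E → Prop} : (∀ᶠ q in boxFilter p₁ R, P q) ↔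
      ∃ ε₀ > 0, ∀ ε, 0 < ε → ε < ε₀ → ∀ p, ‖p - p₁‖ ≤ R * ε ^ 2 → P (ε, p) := by
  rw [boxFilter, eventually_inf_principal, eventually_comap,
    (nhdsGT_basis (0 : ℝ)).eventually_iff]
  constructor
  · rintro ⟨ε₀, h0, h⟩
    exact ⟨ε₀, h0, fun ε h1 h2 p hp => h ⟨h1, h2⟩ (ε, p) rfl hp⟩
  · rintro ⟨ε₀, h0, h⟩
    refine ⟨ε₀, h0, ?_⟩
    rintro ε ⟨h1, h2⟩ ⟨ε', p⟩ rfl hp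
    exact h _ h1 h2 p hp

theorem isBigO_boxFilter {E : Type*} [NormedAddCommGroup E] (p₁ : E) (R : ℝ) {x : E → ℝ} {x₁ : ℝ}
    (hx : ∀ p, |x p - x₁| ≤ ‖p - p₁‖) :
    (fun q : ℝ × E => x q.2 - x₁) =O[boxFilter p₁ R] fun q => q.1 ^ 2 := by
  refine Asymptotics.IsBigO.of_bound R (mem_inf_of_right fun q hq => ?_)
  rw [Set.mem_ofPred_eq, Real.norm_eq_abs, Real.norm_of_nonneg (sq_nonneg q.1)]
  exact (hx q.2).trans hq

theorem tendsto_fst_boxFilter {E : Type*} [NormedAddCommGroup E] (p₁ : E) (R : ℝ) :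
    Tendsto Prod.fst (boxFilter p₁ R) (𝓝[>] 0) :=
  tendsto_comap.mono_left inf_le_left

theorem abs_coord_sub_le (p q : ℝ × ℝ × ℝ × ℝ) :
    |p.1 - q.1| ≤ ‖p - q‖ ∧ |p.2.1 - q.2.1| ≤ ‖p - q‖ ∧ |p.2.2.1 - q.2.2.1| ≤ ‖p - q‖ ∧
      |p.2.2.2 - q.2.2.2| ≤ ‖p - q‖ := by
  have h1 : ‖(p - q).2‖ ≤ ‖p - q‖ := norm_snd_le _
  have h2 : ‖(p - q).2.2‖ ≤ ‖(p - q).2‖ := norm_snd_le _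
  exact ⟨norm_fst_le (p - q), (norm_fst_le (p - q).2).trans h1,
    (norm_fst_le (p - q).2.2).trans (h2.trans h1), (norm_snd_le (p - q).2.2).trans (h2.trans h1)⟩

/-- The two interacting wave vectors are close to the critical one. -/
theorem isNear_boxFilter (k₁ m₁ R : ℝ) :
    IsNear (boxFilter (k₁, k₁, m₁, m₁) R) Prod.fst (fun q => q.2.1) (fun q => q.2.2.2.1) k₁ m₁ ∧
    IsNear (boxFilter (k₁, k₁, m₁, m₁) R) Prod.fst (fun q => q.2.2.1) (fun q => q.2.2.2.2)
      k₁ m₁ :=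
  ⟨⟨tendsto_fst_boxFilter _ _, isBigO_boxFilter (k₁, k₁, m₁, m₁) R fun p =>
      (abs_coord_sub_le p (k₁, k₁, m₁, m₁)).1, isBigO_boxFilter (k₁, k₁, m₁, m₁) R
        (x := fun p => p.2.2.1) fun p => (abs_coord_sub_le p (k₁, k₁, m₁, m₁)).2.2.1⟩,
    tendsto_fst_boxFilter _ _, isBigO_boxFilter (k₁, k₁, m₁, m₁) R (x := fun p => p.2.1) fun p =>
      (abs_coord_sub_le p (k₁, k₁, m₁, m₁)).2.1, isBigO_boxFilter (k₁, k₁, m₁, m₁) R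
        (x := fun p => p.2.2.2) fun p => (abs_coord_sub_le p (k₁, k₁, m₁, m₁)).2.2.2⟩

/-- All the modes are well defined. -/
theorem eventually_wellDefined {γ ν₀ κ₀ k₁ m₁ : ℝ} (hd : CriticalData γ ν₀ κ₀ k₁ m₁) (R : ℝ) :
    ∀ᶠ q in boxFilter (k₁, k₁, m₁, m₁) R,
      (∀ v ∈ ({(q.2.1, q.2.2.2.1), (q.2.2.1, q.2.2.2.2)} : Set (ℝ × ℝ)),
        IsRateTriple γ (ν₀ * q.1 ^ 6) (κ₀ * q.1 ^ 6) (freq γ v.1 v.2) v.1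
          (incRate γ (ν₀ * q.1 ^ 6) (κ₀ * q.1 ^ 6) v.1 v.2) ∧
        ‖incRate γ (ν₀ * q.1 ^ 6) (κ₀ * q.1 ^ 6) v.1 v.2 1‖ <
          ‖incRate γ (ν₀ * q.1 ^ 6) (κ₀ * q.1 ^ 6) v.1 v.2 2‖ ∧
        (liftMatrix γ (ν₀ * q.1 ^ 6) (κ₀ * q.1 ^ 6) (freq γ v.1 v.2) v.1).det ≠ 0) ∧
      IsRateTriple γ (ν₀ * q.1 ^ 6) (κ₀ * q.1 ^ 6)
        (freq γ q.2.1 q.2.2.2.1 + freq γ q.2.2.1 q.2.2.2.2) (q.2.1 + q.2.2.1)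
        (rateII γ (ν₀ * q.1 ^ 6) (κ₀ * q.1 ^ 6) q.2.1 q.2.2.2.1 q.2.2.1 q.2.2.2.2) ∧
      ‖rateII γ (ν₀ * q.1 ^ 6) (κ₀ * q.1 ^ 6) q.2.1 q.2.2.2.1 q.2.2.1 q.2.2.2.2 0‖ <
        ‖rateII γ (ν₀ * q.1 ^ 6) (κ₀ * q.1 ^ 6) q.2.1 q.2.2.2.1 q.2.2.1 q.2.2.2.2 1‖ ∧
      ‖rateII γ (ν₀ * q.1 ^ 6) (κ₀ * q.1 ^ 6) q.2.1 q.2.2.2.1 q.2.2.1 q.2.2.2.2 1‖ <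
        ‖rateII γ (ν₀ * q.1 ^ 6) (κ₀ * q.1 ^ 6) q.2.1 q.2.2.2.1 q.2.2.1 q.2.2.2.2 2‖ ∧
      (liftMatrix γ (ν₀ * q.1 ^ 6) (κ₀ * q.1 ^ 6)
        (freq γ q.2.1 q.2.2.2.1 + freq γ q.2.2.1 q.2.2.2.2) (q.2.1 + q.2.2.1)).det ≠ 0 := by
  obtain ⟨h, h'⟩ := isNear_boxFilter k₁ m₁ R
  refine eventually_of_ultrafilter fun l hl => ?_
  filter_upwards [((h.mono hl).incident hd).1, ((h'.mono hl).incident hd).1,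
    ((h.mono hl).corrector (h'.mono hl) hd 0).1] with q h1 h2 h3
  refine ⟨?_, h3⟩
  rintro v (rfl | rfl)
  exacts [h1, h2]

/-- The size of the modes of the corrector, uniformly on the support of the packet. -/
theorem exists_norm_amplitude_le {γ ν₀ κ₀ k₁ m₁ : ℝ} (hd : CriticalData γ ν₀ κ₀ k₁ m₁) (R σ : ℝ)
    (j : Fin 3) :
    ∃ C > 0, ∀ᶠ q in boxFilter (k₁, k₁, m₁, m₁) R,
      q.1 ^ ampExp j * (‖amplitudeII γ (ν₀ * q.1 ^ 6) (κ₀ * q.1 ^ 6) σ q.2.1 q.2.2.2.1 q.2.2.1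
        q.2.2.2.2 j‖ * ‖mode γ (κ₀ * q.1 ^ 6)
          (freq γ q.2.1 q.2.2.2.1 + freq γ q.2.2.1 q.2.2.2.2) (q.2.1 + q.2.2.1)
          (rateII γ (ν₀ * q.1 ^ 6) (κ₀ * q.1 ^ 6) q.2.1 q.2.2.2.1 q.2.2.1 q.2.2.2.2 j)‖) ≤ C := by
  obtain ⟨h, h'⟩ := isNear_boxFilter k₁ m₁ R
  obtain ⟨C, hC, hle⟩ := exists_eventually_norm_le (f := boxFilter (k₁, k₁, m₁, m₁) R)
    fun l hl => ((h.mono hl).corrector (h'.mono hl) hd σ).2.2.2 j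
  refine ⟨C, hC, ?_⟩
  filter_upwards [hle, h.eps.eventually self_mem_nhdsWithin] with q hq h0
  rwa [norm_smul, norm_ofReal_pow_mul h0, mul_assoc] at hq

/-- The boundary layers of the corrector have a thickness of order at most `ε³`. -/
theorem exists_le_re_rate {γ ν₀ κ₀ k₁ m₁ : ℝ} (hd : CriticalData γ ν₀ κ₀ k₁ m₁) (R : ℝ)
    {j : Fin 3} (hj : j ≠ 0) :
    ∃ c > 0, ∀ᶠ q in boxFilter (k₁, k₁, m₁, m₁) R, c ≤ q.1 ^ 3 *
      (rateII γ (ν₀ * q.1 ^ 6) (κ₀ * q.1 ^ 6) q.2.1 q.2.2.2.1 q.2.2.1 q.2.2.2.2 j).re := by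
  obtain ⟨h, h'⟩ := isNear_boxFilter k₁ m₁ R
  refine exists_eventually_le fun l hl => ?_
  obtain ⟨Y, hY, ht⟩ := ((h.mono hl).corrector (h'.mono hl) hd 0).2.2.1 j hj
  refine ⟨Y.re, hY, (tendsto_re ht).congr fun q => ?_⟩
  rw [re_ofReal_pow_mul]

/-! ### Continuity of the corrector with respect to the wave vectors -/

theorem tendsto_modeW_of_ne_zero {ι : Type*} {l : Filter ι} {k : ι → ℝ} {z : ι → ℂ} {k₁ : ℝ}
    {z₁ : ℂ} (hk : Tendsto k l (𝓝 k₁)) (hz : Tendsto z l (𝓝 z₁)) (h0 : z₁ ≠ 0) :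
    Tendsto (fun i => modeW (k i) (z i)) l (𝓝 (modeW k₁ z₁)) :=
  ((tendsto_ofReal hk).const_mul I).div hz h0

theorem tendsto_modeB_of_mem {ι : Type*} {l : Filter ι} {γ ν κ : ℝ} {ω k : ι → ℝ} {z : ι → ℂ}
    {ω₁ k₁ : ℝ} {z₁ : ℂ} (hs : 0 < Real.sin γ) (hω : Tendsto ω l (𝓝 ω₁)) (hk : Tendsto k l (𝓝 k₁))
    (hz : Tendsto z l (𝓝 z₁)) (hmem : z₁ ∈ decayRates γ ν κ ω₁ k₁) :
    Tendsto (fun i => modeB γ κ (ω i) (k i) (z i)) l (𝓝 (modeB γ κ ω₁ k₁ z₁)) := by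
  obtain ⟨hre, h0⟩ := hmem
  have hz0 : z₁ ≠ 0 := fun h => by simp [h] at hre
  have hk' := tendsto_ofReal hk
  refine (((((hk'.const_mul I).div hz hz0).mul_const _).const_add _)).div
    (((tendsto_ofReal hω).const_mul I).sub (((hk'.pow 2).sub (hz.pow 2)).const_mul _)) ?_
  -- if the denominator vanishes, then the characteristic equation reduces to a square
  intro h1
  rw [det_waveMatrix, symb, show -I * (ω₁ : ℂ) + κ * ((k₁ : ℂ) ^ 2 - z₁ ^ 2) = 0 by
    linear_combination -h1, mul_zero, zero_mul, zero_sub, neg_eq_zero,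
    pow_eq_zero_iff two_ne_zero] at h0
  have h2 := congrArg Complex.re h0
  rw [add_re, re_ofReal_mul, zero_re, show (I * (Real.cos γ : ℂ) * (k₁ : ℂ)).re = 0 by simp,
    add_zero] at h2
  exact (mul_pos hs hre).ne' h2

theorem det_liftMat_comp_ne_zero {γ κ ω k : ℝ} {L : Fin 3 → ℂ} (τ : Equiv.Perm (Fin 3))
    (h : (liftMat γ κ ω k L).det ≠ 0) : (liftMat γ κ ω k (L ∘ τ)).det ≠ 0 := by
  have h1 : liftMat γ κ ω k (L ∘ τ) = (liftMat γ κ ω k L).submatrix id τ := by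
    ext a b
    fin_cases a <;> rfl
  rw [h1, Matrix.det_permute']
  refine mul_ne_zero ?_ h
  rcases Int.units_eq_one_or (Equiv.Perm.sign τ) with h2 | h2 <;> simp [h2]

theorem tendsto_liftMat {ι : Type*} {l : Filter ι} {γ ν κ : ℝ} {ω k : ι → ℝ} {L : ι → Fin 3 → ℂ}
    {ω₁ k₁ : ℝ} {L₁ : Fin 3 → ℂ} (hs : 0 < Real.sin γ) (hω : Tendsto ω l (𝓝 ω₁))
    (hk : Tendsto k l (𝓝 k₁)) (hL : ∀ j, Tendsto (fun i => L i j) l (𝓝 (L₁ j)))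
    (hmem : ∀ j, L₁ j ∈ decayRates γ ν κ ω₁ k₁) (a b : Fin 3) :
    Tendsto (fun i => liftMat γ κ (ω i) (k i) (L i) a b) l (𝓝 (liftMat γ κ ω₁ k₁ L₁ a b)) := by
  have h0 : L₁ b ≠ 0 := fun h => by
    have := (hmem b).1
    simp [h] at this
  fin_cases a
  · exact tendsto_const_nhds
  · exact tendsto_modeW_of_ne_zero hk (hL b) h0
  · exact (hL b).neg.mul (tendsto_modeB_of_mem hs hω hk (hL b) (hmem b))

theorem IsRateTriple.mem {γ ν κ ω k : ℝ} {L : Fin 3 → ℂ} (h : IsRateTriple γ ν κ ω k L)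
    (j : Fin 3) : L j ∈ decayRates γ ν κ ω k :=
  h.2.1 ▸ Set.mem_range_self j

/-- The rates and the amplitudes attached to a wave vector `(k, m)` are well defined. -/
structure IsRegularWave (γ ν κ k m : ℝ) : Prop where
  sign_pos : 0 < k * (m * Real.cos γ + k * Real.sin γ)
  m_ne : m ≠ 0
  freq_ne : freq γ k m ≠ 0
  triple : IsRateTriple γ ν κ (freq γ k m) k (incRate γ ν κ k m)
  lt : ‖incRate γ ν κ k m 1‖ < ‖incRate γ ν κ k m 2‖
  det_ne : (liftMatrix γ ν κ (freq γ k m) k).det ≠ 0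

theorem IsRegularWave.k_ne {γ ν κ k m : ℝ} (h : IsRegularWave γ ν κ k m) : k ≠ 0 :=
  left_ne_zero_of_mul h.sign_pos.ne'

theorem IsRegularWave.exists_tendsto {ι : Type*} {l : Ultrafilter ι} {γ ν κ : ℝ} {k m : ι → ℝ}
    {k₁ m₁ : ℝ} (hs : 0 < Real.sin γ) (hν : 0 < ν) (hκ : 0 < κ) (hk : Tendsto k l (𝓝 k₁))
    (hm : Tendsto m l (𝓝 m₁)) (h : ∀ᶠ i in (l : Filter ι), IsRegularWave γ ν κ (k i) (m i))
    (h₁ : IsRegularWave γ ν κ k₁ m₁) :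
    ∃ L₁, (L₁ = incRate γ ν κ k₁ m₁ ∨ L₁ = incRate γ ν κ k₁ m₁ ∘ Equiv.swap 0 1) ∧
      ∀ j, 0 < (L₁ j).re ∧ Tendsto (fun i => incRate γ ν κ (k i) (m i) j) l (𝓝 (L₁ j)) ∧
        Tendsto (fun i => incAmp γ κ (k i) (m i) (incRate γ ν κ (k i) (m i)) j) l
          (𝓝 (incAmp γ κ k₁ m₁ L₁ j)) ∧
        Tendsto (fun i => modeB γ κ (freq γ (k i) (m i)) (k i) (incRate γ ν κ (k i) (m i) j)) l
          (𝓝 (modeB γ κ (freq γ k₁ m₁) k₁ (L₁ j))) := by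
  have hω := tendsto_freq hk hm h₁.sign_pos
  obtain ⟨L₁, hT, hL⟩ := exists_tendsto_isRateTriple l hν hκ hω hk h₁.freq_ne h₁.k_ne
    (h.mono fun i hi => hi.triple) ⟨_, h₁.triple⟩
  have hor := h₁.triple.eq_or_eq_swap hT h₁.lt
  refine ⟨L₁, hor, fun j => ⟨(hT.mem j).1, hL j, ?_, tendsto_modeB_of_mem hs hω hk (hL j)
    (hT.mem j)⟩⟩
  have hdet : (liftMat γ κ (freq γ k₁ m₁) k₁ L₁).det ≠ 0 := by
    rcases hor with rfl | rfl
    · exact h₁.det_ne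
    · exact det_liftMat_comp_ne_zero _ h₁.det_ne
  refine tendsto_inv_mulVec (tendsto_liftMat hs hω hk hL hT.mem) (fun a => ?_) hdet j
  unfold incTrace
  fin_cases a
  · exact tendsto_const_nhds
  · exact (tendsto_ofReal hk).neg.div (tendsto_ofReal hm) (ofReal_ne_zero.2 h₁.m_ne)
  · exact (tendsto_ofReal ((hk.mul_const _).sub (hm.mul_const _))).neg.div (tendsto_ofReal hω)
      (ofReal_ne_zero.2 h₁.freq_ne)

/-- The rates and the amplitudes attached to two interacting wave vectors are well defined. -/
structure IsRegularPair (γ ν κ k m k' m' : ℝ) : Prop where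
  left : IsRegularWave γ ν κ k m
  right : IsRegularWave γ ν κ k' m'
  k_ne : k + k' ≠ 0
  freq_ne : freq γ k m + freq γ k' m' ≠ 0
  den_ne : ∀ s ∈ ({1, -1} : Finset ℤ),
    -((freq γ k m + freq γ k' m' : ℝ) : ℂ) + s * Real.sin γ ≠ 0
  triple : IsRateTriple γ ν κ (freq γ k m + freq γ k' m') (k + k') (rateII γ ν κ k m k' m')
  lt₁ : ‖rateII γ ν κ k m k' m' 0‖ < ‖rateII γ ν κ k m k' m' 1‖
  lt₂ : ‖rateII γ ν κ k m k' m' 1‖ < ‖rateII γ ν κ k m k' m' 2‖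
  det_ne : (liftMatrix γ ν κ (freq γ k m + freq γ k' m') (k + k')).det ≠ 0

theorem IsRegularPair.tendsto_sourceTrace {ι : Type*} {l : Ultrafilter ι} {γ ν κ σ : ℝ}
    {k m k' m' : ι → ℝ} {k₁ m₁ k₁' m₁' : ℝ} (hs : 0 < Real.sin γ) (hν : 0 < ν) (hκ : 0 < κ)
    (hk : Tendsto k l (𝓝 k₁)) (hm : Tendsto m l (𝓝 m₁)) (hk' : Tendsto k' l (𝓝 k₁'))
    (hm' : Tendsto m' l (𝓝 m₁'))
    (h : ∀ᶠ i in (l : Filter ι), IsRegularPair γ ν κ (k i) (m i) (k' i) (m' i))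
    (h₁ : IsRegularPair γ ν κ k₁ m₁ k₁' m₁') (a : Fin 3) :
    Tendsto (fun i => sourceTrace γ ν κ σ (k i) (m i) (k' i) (m' i) a) l
      (𝓝 (sourceTrace γ ν κ σ k₁ m₁ k₁' m₁' a)) := by
  obtain ⟨L, hor, hL⟩ := IsRegularWave.exists_tendsto hs hν hκ hk hm (h.mono fun i hi => hi.left)
    h₁.left
  obtain ⟨L', hor', hL'⟩ := IsRegularWave.exists_tendsto hs hν hκ hk' hm'
    (h.mono fun i hi => hi.right) h₁.right
  -- the limits of the rates may be ordered differently from the rates at the limit, but the trace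
  -- does not depend on the order of the first two
  have e1 : sourceTrace γ ν κ σ k₁ m₁ k₁' m₁' = srcTrace γ κ σ k₁ m₁ k₁' m₁' L L' := by
    rw [sourceTrace_eq]
    rcases hor with rfl | rfl <;> rcases hor' with rfl | rfl
    · rfl
    · exact (srcTrace_swap ..).2.symm
    · exact (srcTrace_swap ..).1.symm
    · rw [(srcTrace_swap ..).1, (srcTrace_swap ..).2]
  have key := tendsto_srcTrace (γ := γ) (σ := σ) (l := (l : Filter ι)) (κ := fun _ => κ) (k := k)
    (m := m) (k' := k') (m' := m') (e := fun _ => (1 : ℂ)) (e₁ := 1) (Z := L) (Z' := L')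
    (A := incAmp γ κ k₁ m₁ L) (A' := incAmp γ κ k₁' m₁' L')
    (B' := fun j => modeB γ κ (freq γ k₁' m₁') k₁' (L' j))
    (L := fun i => incRate γ ν κ (k i) (m i)) (L' := fun i => incRate γ ν κ (k' i) (m' i))
    (Eventually.of_forall fun _ => one_ne_zero) tendsto_const_nhds hk hk' hm h₁.left.m_ne
    ((tendsto_freq hk hm h₁.left.sign_pos).add (tendsto_freq hk' hm' h₁.right.sign_pos)) h₁.den_ne
    (fun j _ => by simpa using (hL j).2.1) (fun j _ => by simpa using (hL' j).2.1)
    (fun j _ => by simpa using (hL j).2.2.1) (fun j _ => by simpa using (hL' j).2.2.1)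
    (fun j _ => (hL' j).2.2.2)
    (fun j _ h0 => by
      have := (hL j).1
      simp [h0] at this)
    (fun j _ j' _ h0 => by
      have h1 := (hL j).1
      have h2 := (hL' j').1
      have h3 := congrArg Complex.re h0
      rw [add_re, zero_re] at h3
      linarith)
    (fun j _ h0 => by
      have h1 := (hL' j).1
      have h3 := congrArg Complex.re h0
      simp at h3
      linarith) a
  rw [e1]
  simp only [one_pow, one_mul] at key
  simp only [sourceTrace_eq]
  exact key

/-- The rates and the amplitudes of the corrector depend continuously on the wave vectors. -/
theorem IsRegularPair.continuousOn {γ ν κ σ : ℝ} (hs : 0 < Real.sin γ) (hν : 0 < ν) (hκ : 0 < κ)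
    {U : Set (ℝ × ℝ × ℝ × ℝ)}
    (hU : ∀ p ∈ U, IsRegularPair γ ν κ p.1 p.2.2.1 p.2.1 p.2.2.2) (j : Fin 3) :
    ContinuousOn (fun p : ℝ × ℝ × ℝ × ℝ => rateII γ ν κ p.1 p.2.2.1 p.2.1 p.2.2.2 j) U ∧
    ContinuousOn (fun p : ℝ × ℝ × ℝ × ℝ => freq γ p.1 p.2.2.1 + freq γ p.2.1 p.2.2.2) U ∧
    ContinuousOn (fun p : ℝ × ℝ × ℝ × ℝ =>
      amplitudeII γ ν κ σ p.1 p.2.2.1 p.2.1 p.2.2.2 j) U ∧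
    ContinuousOn (fun p : ℝ × ℝ × ℝ × ℝ =>
      mode γ κ (freq γ p.1 p.2.2.1 + freq γ p.2.1 p.2.2.2) (p.1 + p.2.1)
        (rateII γ ν κ p.1 p.2.2.1 p.2.1 p.2.2.2 j)) U := by
  have key : ∀ p₁ ∈ U, ∀ l : Ultrafilter (ℝ × ℝ × ℝ × ℝ), (l : Filter _) ≤ 𝓝[U] p₁ →
      Tendsto (fun p : ℝ × ℝ × ℝ × ℝ => rateII γ ν κ p.1 p.2.2.1 p.2.1 p.2.2.2 j) l
        (𝓝 (rateII γ ν κ p₁.1 p₁.2.2.1 p₁.2.1 p₁.2.2.2 j)) ∧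
      Tendsto (fun p : ℝ × ℝ × ℝ × ℝ => freq γ p.1 p.2.2.1 + freq γ p.2.1 p.2.2.2) l
        (𝓝 (freq γ p₁.1 p₁.2.2.1 + freq γ p₁.2.1 p₁.2.2.2)) ∧
      Tendsto (fun p : ℝ × ℝ × ℝ × ℝ => amplitudeII γ ν κ σ p.1 p.2.2.1 p.2.1 p.2.2.2 j) l
        (𝓝 (amplitudeII γ ν κ σ p₁.1 p₁.2.2.1 p₁.2.1 p₁.2.2.2 j)) ∧
      Tendsto (fun p : ℝ × ℝ × ℝ × ℝ =>
        mode γ κ (freq γ p.1 p.2.2.1 + freq γ p.2.1 p.2.2.2) (p.1 + p.2.1)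
          (rateII γ ν κ p.1 p.2.2.1 p.2.1 p.2.2.2 j)) l
        (𝓝 (mode γ κ (freq γ p₁.1 p₁.2.2.1 + freq γ p₁.2.1 p₁.2.2.2) (p₁.1 + p₁.2.1)
          (rateII γ ν κ p₁.1 p₁.2.2.1 p₁.2.1 p₁.2.2.2 j))) := by
    intro p₁ hp₁ l hl
    have h₁ := hU p₁ hp₁
    have h : ∀ᶠ p in (l : Filter (ℝ × ℝ × ℝ × ℝ)), IsRegularPair γ ν κ p.1 p.2.2.1 p.2.1 p.2.2.2 :=
      hl (mem_of_superset self_mem_nhdsWithin hU)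
    have hid : Tendsto (fun p : ℝ × ℝ × ℝ × ℝ => p) l (𝓝 p₁) := hl.trans nhdsWithin_le_nhds
    have hk : Tendsto (fun p : ℝ × ℝ × ℝ × ℝ => p.1) l (𝓝 p₁.1) := hid.fst_nhds
    have hk' : Tendsto (fun p : ℝ × ℝ × ℝ × ℝ => p.2.1) l (𝓝 p₁.2.1) := hid.snd_nhds.fst_nhds
    have hm : Tendsto (fun p : ℝ × ℝ × ℝ × ℝ => p.2.2.1) l (𝓝 p₁.2.2.1) :=
      hid.snd_nhds.snd_nhds.fst_nhds
    have hm' : Tendsto (fun p : ℝ × ℝ × ℝ × ℝ => p.2.2.2) l (𝓝 p₁.2.2.2) :=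
      hid.snd_nhds.snd_nhds.snd_nhds
    have hω := (tendsto_freq hk hm h₁.left.sign_pos).add (tendsto_freq hk' hm' h₁.right.sign_pos)
    have hK := hk.add hk'
    obtain ⟨L₁, hT, hL⟩ := exists_tendsto_isRateTriple l hν hκ hω hK h₁.freq_ne h₁.k_ne
      (h.mono fun i hi => hi.triple) ⟨_, h₁.triple⟩
    obtain rfl := h₁.triple.eq_of_lt hT h₁.lt₁ h₁.lt₂
    have h0 : rateII γ ν κ p₁.1 p₁.2.2.1 p₁.2.1 p₁.2.2.2 j ≠ 0 := fun h => by
      have := (hT.mem j).1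
      simp [h] at this
    refine ⟨hL j, hω, ?_, ?_⟩
    · exact tendsto_inv_mulVec (tendsto_liftMat hs hω hK hL hT.mem)
        (IsRegularPair.tendsto_sourceTrace hs hν hκ hk hm hk' hm' h h₁) h₁.det_ne j
    · exact IsNear.tendsto_mode (tendsto_modeW_of_ne_zero hK (hL j) h0)
        (tendsto_modeB_of_mem hs hω hK (hL j) (hT.mem j))
  refine ⟨fun p hp => ?_, fun p hp => ?_, fun p hp => ?_, fun p hp => ?_⟩
  · exact (tendsto_iff_ultrafilter _ _ _).2 fun l hl => (key p hp l hl).1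
  · exact (tendsto_iff_ultrafilter _ _ _).2 fun l hl => (key p hp l hl).2.1
  · exact (tendsto_iff_ultrafilter _ _ _).2 fun l hl => (key p hp l hl).2.2.1
  · exact (tendsto_iff_ultrafilter _ _ _).2 fun l hl => (key p hp l hl).2.2.2

/-- Close to the critical wave vector, all the rates and the amplitudes are well defined. -/
theorem eventually_isRegularPair {γ ν₀ κ₀ k₁ m₁ : ℝ} (hd : CriticalData γ ν₀ κ₀ k₁ m₁) (R : ℝ) :
    ∀ᶠ q in boxFilter (k₁, k₁, m₁, m₁) R, IsRegularPair γ (ν₀ * q.1 ^ 6) (κ₀ * q.1 ^ 6)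
      q.2.1 q.2.2.2.1 q.2.2.1 q.2.2.2.2 := by
  obtain ⟨h, h'⟩ := isNear_boxFilter k₁ m₁ R
  obtain ⟨hsq, hpos⟩ := critical_freq hd.sin_pos hd.cos_pos hd.k_ne hd.rel
  have hs := hd.sin_pos
  have hω0 : freq γ k₁ m₁ ≠ 0 := left_ne_zero_of_mul hpos.ne'
  have hsign := (critical_sign hd.sin_pos hd.cos_pos hd.k_ne hd.rel).1
  have hω := (h.tendsto_freq hd).add (h'.tendsto_freq hd)
  have s1 := (h.tendsto_k.mul ((h.tendsto_m.mul_const (Real.cos γ)).add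
    (h.tendsto_k.mul_const (Real.sin γ)))).eventually_const_lt hsign
  have s2 := (h'.tendsto_k.mul ((h'.tendsto_m.mul_const (Real.cos γ)).add
    (h'.tendsto_k.mul_const (Real.sin γ)))).eventually_const_lt hsign
  have hK := (h.tendsto_k.add h'.tendsto_k).eventually_ne (by
    rw [← two_mul]
    exact mul_ne_zero two_ne_zero hd.k_ne)
  have hΩ := hω.eventually_ne (by
    rw [← two_mul]
    exact mul_ne_zero two_ne_zero hω0)
  have hden := (hω.pow 2).eventually_const_lt (u := Real.sin γ ^ 2) (by nlinarith)
  filter_upwards [eventually_wellDefined hd R, s1, s2, hK, hΩ, hden,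
    (h.tendsto_freq hd).eventually_ne hω0, (h'.tendsto_freq hd).eventually_ne hω0,
    h.tendsto_m.eventually_ne hd.m_ne, h'.tendsto_m.eventually_ne hd.m_ne] with
    q a1 a2 a3 a4 a5 a6 a7 a8 a9 a10
  obtain ⟨b1, b2, b3, b4, b5⟩ := a1
  obtain ⟨c1, c2, c3⟩ := b1 _ (Or.inl rfl)
  obtain ⟨d1, d2, d3⟩ := b1 _ (Or.inr rfl)
  refine ⟨⟨a2, a9, a7, c1, c2, c3⟩, ⟨a3, a10, a8, d1, d2, d3⟩, a4, a5, fun s hs h0 => ?_, b2, b3,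
    b4, b5⟩
  have h1 : (s : ℝ) * Real.sin γ = freq γ q.2.1 q.2.2.2.1 + freq γ q.2.2.1 q.2.2.2.2 := by
    have : ((s * Real.sin γ : ℝ) : ℂ) =
        ((freq γ q.2.1 q.2.2.2.1 + freq γ q.2.2.1 q.2.2.2.2 : ℝ) : ℂ) := by
      push_cast at h0 ⊢
      linear_combination h0
    exact_mod_cast this
  have h2 : (s : ℝ) ^ 2 = 1 := by
    rcases Finset.mem_insert.1 hs with rfl | hs
    · norm_num
    · rw [Finset.mem_singleton.1 hs]
      norm_num
  rw [← h1, mul_pow, h2, one_mul] at a6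
  exact lt_irrefl _ a6

/-! ### Square integrals of oscillating integrals -/

section Oscillating

variable {Z P E : Type*} [MeasurableSpace Z] [MeasurableSpace P] {μ : Measure Z} {π : Measure P}
  [NormedAddCommGroup E]

theorem norm_exp_I_mul_ofReal' (x : ℝ) : ‖cexp (I * x)‖ = 1 := by
  rw [mul_comm, norm_exp_ofReal_mul_I]

theorem integrable_exp_smul [NormedSpace ℂ E] {θ : P → ℝ} (hθ : Measurable θ) {h : P → E}
    (hh : Integrable h π) :
    Integrable (fun p => cexp (I * θ p) • h p) π := by
  refine hh.mono ?_ (Eventually.of_forall fun p => ?_)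
  · exact (Measurable.aestronglyMeasurable (by fun_prop)).smul hh.1
  · rw [norm_smul, norm_exp_I_mul_ofReal', one_mul]

theorem aestronglyMeasurable_integral_exp_smul [SFinite π] [NormedSpace ℂ E]
    {θ : Z → P → ℝ} (hθ : Measurable (Function.uncurry θ)) {h : P → E}
    (hh : AEStronglyMeasurable h π) :
    AEStronglyMeasurable (fun z => ∫ p, cexp (I * θ z p) • h p ∂π) μ := by
  have h1 : AEStronglyMeasurable (fun x : Z × P => cexp (I * (Function.uncurry θ x : ℝ)) • h x.2)
      (μ.prod π) :=
    (Measurable.aestronglyMeasurable (by fun_prop)).smul hh.comp_snd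
  exact h1.integral_prod_right'

/-- The square norm of an integral is a double integral of inner products. -/
theorem norm_sq_integral_eq [SFinite π] [InnerProductSpace ℂ E] [CompleteSpace E] {f : P → E}
    (hf : Integrable f π) :
    Integrable (fun x : P × P => inner ℂ (f x.1) (f x.2)) (π.prod π) ∧
      ((‖∫ p, f p ∂π‖ ^ 2 : ℝ) : ℂ) = ∫ x, inner ℂ (f x.1) (f x.2) ∂(π.prod π) := by
  have hint : Integrable (fun x : P × P => inner ℂ (f x.1) (f x.2)) (π.prod π) :=
    (hf.norm.mul_prod hf.norm).mono (hf.1.comp_fst.inner hf.1.comp_snd)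
      (Eventually.of_forall fun x => by
        rw [norm_mul, norm_norm, norm_norm]
        exact norm_inner_le_norm _ _)
  refine ⟨hint, ?_⟩
  rw [integral_prod _ hint]
  simp only [integral_inner hf]
  have h1 : ∀ p, inner ℂ (f p) (∫ q, f q ∂π) = (starRingEnd ℂ) (inner ℂ (∫ q, f q ∂π) (f p)) :=
    fun p => (inner_conj_symm _ _).symm
  simp only [h1]
  rw [integral_conj, integral_inner hf, inner_conj_symm, inner_self_eq_norm_sq_to_K]
  push_cast
  rfl

/-- The expansion of a square: the square norm of an integral of oscillating exponentials is
controlled by the correlations of the exponentials. -/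
theorem lintegral_mul_sq_norm_integral_le [SFinite μ] [SFinite π] [InnerProductSpace ℂ E]
    [CompleteSpace E] {w : Z → ℝ} (hw0 : ∀ z, 0 ≤ w z) (hw : Integrable w μ)
    {θ : Z → P → ℝ} (hθ : Measurable (Function.uncurry θ)) {h : P → E} (hh : Integrable h π) :
    ∫⁻ z, ENNReal.ofReal (w z) * ‖∫ p, cexp (I * θ z p) • h p ∂π‖ₑ ^ 2 ∂μ ≤
      ∫⁻ x, ‖h x.1‖ₑ * ‖h x.2‖ₑ * ‖∫ z, (w z : ℂ) * cexp (I * (θ z x.2 - θ z x.1 : ℝ)) ∂μ‖ₑ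
        ∂(π.prod π) := by
  -- expand the square and exchange the integrals
  set G : Z × (P × P) → ℂ := fun y => (w y.1 : ℂ) * cexp (I * (θ y.1 y.2.2 - θ y.1 y.2.1 : ℝ)) *
    inner ℂ (h y.2.1) (h y.2.2) with hG
  have hθ1 : Measurable fun y : Z × (P × P) => θ y.1 y.2.2 - θ y.1 y.2.1 :=
    (hθ.comp (measurable_fst.prodMk (measurable_snd.comp measurable_snd))).sub
      (hθ.comp (measurable_fst.prodMk (measurable_fst.comp measurable_snd)))
  have hθz : ∀ z, Measurable (θ z) := fun z => hθ.comp (measurable_const.prodMk measurable_id)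
  obtain ⟨hi, -⟩ := norm_sq_integral_eq hh
  have hGi : Integrable G (μ.prod (π.prod π)) := by
    refine (hw.mul_prod hi.norm).mono ?_ (Eventually.of_forall fun y => ?_)
    · refine AEStronglyMeasurable.mul (AEStronglyMeasurable.mul ?_ ?_) hi.1.comp_snd
      · exact (continuous_ofReal.comp_aestronglyMeasurable hw.1).comp_fst
      · exact Measurable.aestronglyMeasurable (by fun_prop)
    · simp only [hG]
      rw [norm_mul, norm_mul, norm_exp_I_mul_ofReal', mul_one, norm_mul, norm_norm, norm_real]
  have hsq : ∀ z, ((w z * ‖∫ p, cexp (I * θ z p) • h p ∂π‖ ^ 2 : ℝ) : ℂ) =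
      ∫ x, G (z, x) ∂(π.prod π) := by
    intro z
    rw [ofReal_mul, (norm_sq_integral_eq (integrable_exp_smul (hθz z) hh)).2,
      ← integral_const_mul]
    refine integral_congr_ae (Eventually.of_forall fun x => ?_)
    simp only [hG, inner_smul_left, inner_smul_right]
    rw [← exp_conj, map_mul, conj_I, conj_ofReal, ofReal_sub, mul_sub, sub_eq_add_neg, ← neg_mul,
      Complex.exp_add]
    ring
  have hint1 : Integrable (fun z => ((w z * ‖∫ p, cexp (I * θ z p) • h p ∂π‖ ^ 2 : ℝ) : ℂ)) μ := by
    simp only [hsq]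
    exact hGi.integral_prod_left
  have hint2 : Integrable (fun z => w z * ‖∫ p, cexp (I * θ z p) • h p ∂π‖ ^ 2) μ := by
    exact hint1.re.congr (Eventually.of_forall fun z => ofReal_re _)
  have e1 : ∫⁻ z, ENNReal.ofReal (w z) * ‖∫ p, cexp (I * θ z p) • h p ∂π‖ₑ ^ 2 ∂μ =
      ENNReal.ofReal (∫ z, w z * ‖∫ p, cexp (I * θ z p) • h p ∂π‖ ^ 2 ∂μ) := by
    rw [ofReal_integral_eq_lintegral_ofReal hint2 (Eventually.of_forall fun z => mul_nonneg (hw0 z)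
      (sq_nonneg _))]
    refine lintegral_congr fun z => ?_
    rw [ENNReal.ofReal_mul (hw0 z), ENNReal.ofReal_pow (norm_nonneg _), ofReal_norm]
  have e2 : ((∫ z, w z * ‖∫ p, cexp (I * θ z p) • h p ∂π‖ ^ 2 ∂μ : ℝ) : ℂ) =
      ∫ x, ∫ z, G (z, x) ∂μ ∂(π.prod π) := by
    rw [← integral_complex_ofReal, ← integral_integral_swap (f := fun z x => G (z, x)) hGi]
    exact integral_congr_ae (Eventually.of_forall hsq)
  rw [e1]
  calc ENNReal.ofReal (∫ z, w z * ‖∫ p, cexp (I * θ z p) • h p ∂π‖ ^ 2 ∂μ)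
      ≤ ‖((∫ z, w z * ‖∫ p, cexp (I * θ z p) • h p ∂π‖ ^ 2 ∂μ : ℝ) : ℂ)‖ₑ := by
        rw [← ofReal_norm, norm_real]
        exact ENNReal.ofReal_le_ofReal (Real.le_norm_self _)
    _ ≤ ∫⁻ x, ‖∫ z, G (z, x) ∂μ‖ₑ ∂(π.prod π) := by
        rw [e2]
        exact enorm_integral_le_lintegral_enorm _
    _ ≤ _ := by
        refine lintegral_mono fun x => ?_
        simp only [hG]
        rw [integral_mul_const, enorm_mul, mul_comm]
        gcongr
        rw [← ofReal_norm, ← ofReal_norm, ← ofReal_norm, ← ENNReal.ofReal_mul (norm_nonneg _)]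
        exact ENNReal.ofReal_le_ofReal (norm_inner_le_norm _ _)

/-- Removal of a regularizing weight by Fatou's lemma. -/
theorem lintegral_le_of_tendsto_one {w : ℕ → Z → ℝ} {f : Z → ENNReal} {M : ENNReal}
    (hw : ∀ n, Measurable (w n)) (h1 : ∀ z, Tendsto (fun n => w n z) atTop (𝓝 1))
    (hf : AEMeasurable f μ) (h : ∀ n, ∫⁻ z, ENNReal.ofReal (w n z) * f z ∂μ ≤ M) :
    ∫⁻ z, f z ∂μ ≤ M := by
  have h2 : ∀ z, Tendsto (fun n => ENNReal.ofReal (w n z) * f z) atTop (𝓝 (f z)) := by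
    intro z
    have := ENNReal.Tendsto.mul_const (b := f z) (ENNReal.tendsto_ofReal (h1 z))
      (Or.inl (by simp))
    simpa using this
  calc ∫⁻ z, f z ∂μ = ∫⁻ z, liminf (fun n => ENNReal.ofReal (w n z) * f z) atTop ∂μ :=
        lintegral_congr fun z => (h2 z).liminf_eq.symm
    _ ≤ liminf (fun n => ∫⁻ z, ENNReal.ofReal (w n z) * f z ∂μ) atTop :=
        lintegral_liminf_le' fun n => (hw n).ennreal_ofReal.aemeasurable.mul hf
    _ ≤ M := liminf_le_of_frequently_le' (Eventually.of_forall h).frequently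

theorem lintegral_correlation_le [SFinite π] {h : P → E} {N : ℝ} {S : Set P} (hS : MeasurableSet S)
    (hN : ∀ p, ‖h p‖ ≤ S.indicator (fun _ => N) p) {k : P → P → ENNReal}
    (hk : Measurable (Function.uncurry k)) {M : ENNReal}
    (hM : ∀ p ∈ S, ∫⁻ q in S, k p q ∂π ≤ M) :
    ∫⁻ x, ‖h x.1‖ₑ * ‖h x.2‖ₑ * k x.1 x.2 ∂(π.prod π) ≤ ENNReal.ofReal N ^ 2 * (π S * M) := by
  have h0 : ∀ p, ‖h p‖ₑ ≤ S.indicator (fun _ => ENNReal.ofReal N) p := by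
    intro p
    have := hN p
    rw [← ofReal_norm]
    by_cases hp : p ∈ S
    · simp only [hp, Set.indicator_of_mem] at this ⊢
      exact ENNReal.ofReal_le_ofReal this
    · simp only [hp, not_false_eq_true, Set.indicator_of_notMem] at this ⊢
      simp [le_antisymm this (norm_nonneg _)]
  calc ∫⁻ x, ‖h x.1‖ₑ * ‖h x.2‖ₑ * k x.1 x.2 ∂(π.prod π)
      ≤ ∫⁻ x, (S.indicator (fun _ => ENNReal.ofReal N) x.1 *
          S.indicator (fun _ => ENNReal.ofReal N) x.2) * k x.1 x.2 ∂(π.prod π) :=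
        lintegral_mono fun x => by gcongr <;> exact h0 _
    _ = ∫⁻ p, ∫⁻ q, (S.indicator (fun _ => ENNReal.ofReal N) p *
          S.indicator (fun _ => ENNReal.ofReal N) q) * k p q ∂π ∂π := by
        refine lintegral_prod _ (Measurable.aemeasurable ?_)
        have hi : Measurable (S.indicator fun _ => ENNReal.ofReal N) :=
          measurable_const.indicator hS
        exact ((hi.comp measurable_fst).mul (hi.comp measurable_snd)).mul hk
    _ ≤ ∫⁻ p, S.indicator (fun _ => ENNReal.ofReal N ^ 2 * M) p ∂π := by
        refine lintegral_mono fun p => ?_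
        by_cases hp : p ∈ S
        · simp only [hp, Set.indicator_of_mem]
          calc ∫⁻ q, ENNReal.ofReal N * S.indicator (fun _ => ENNReal.ofReal N) q * k p q ∂π
              = ∫⁻ q, ENNReal.ofReal N ^ 2 * S.indicator (k p) q ∂π := by
                refine lintegral_congr fun q => ?_
                by_cases hq : q ∈ S <;> simp [hq, sq]
            _ = ENNReal.ofReal N ^ 2 * ∫⁻ q in S, k p q ∂π := by
                rw [lintegral_const_mul' _ _ (by simp), lintegral_indicator hS]
            _ ≤ _ := by gcongr; exact hM p hp
        · simp [hp]
    _ = ENNReal.ofReal N ^ 2 * (π S * M) := by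
        rw [lintegral_indicator hS, lintegral_const, Measure.restrict_apply_univ]
        ring

end Oscillating

/-- The Fourier transform of the Gaussian `exp (-η x²)`. -/
def gaussKernel (η a : ℝ) : ℝ := √(Real.pi / η) * Real.exp (-a ^ 2 / (4 * η))

theorem gaussKernel_nonneg (η a : ℝ) : 0 ≤ gaussKernel η a := by
  unfold gaussKernel
  positivity

theorem measurable_gaussKernel (η : ℝ) : Measurable (gaussKernel η) := by
  unfold gaussKernel
  fun_prop

theorem integral_gaussian_mul_exp {η : ℝ} (hη : 0 < η) (a : ℝ) :
    ∫ x : ℝ, (Real.exp (-η * x ^ 2) : ℂ) * cexp (I * (a * x : ℝ)) = gaussKernel η a := by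
  have h := fourierIntegral_gaussian (b := η) (by simpa using hη) a
  have h1 : ((Real.pi : ℂ) / η) ^ (1 / 2 : ℂ) = (√(Real.pi / η) : ℝ) := by
    rw [Real.sqrt_eq_rpow, ofReal_cpow (by positivity)]
    push_cast
    rfl
  rw [h1] at h
  rw [gaussKernel, ofReal_mul, ofReal_exp]
  push_cast at h ⊢
  rw [← h]
  refine integral_congr_ae (Eventually.of_forall fun x => ?_)
  simp only
  ring_nf

theorem tendsto_exp_neg_div (x : ℝ) :
    Tendsto (fun n : ℕ => Real.exp (-(1 / ((n : ℝ) + 1)) * x ^ 2)) atTop (𝓝 1) := by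
  have h := ((tendsto_one_div_add_atTop_nhds_zero_nat (𝕜 := ℝ)).neg.mul_const (x ^ 2))
  rw [neg_zero, zero_mul] at h
  simpa [Function.comp_def] using (Real.continuous_exp.tendsto 0).comp h

theorem enorm_ofReal_of_nonneg {x : ℝ} (hx : 0 ≤ x) : ‖(x : ℂ)‖ₑ = ENNReal.ofReal x := by
  rw [← ofReal_norm, norm_real, Real.norm_of_nonneg hx]

section Plancherel

variable {P E : Type*} [MeasurableSpace P] {π : Measure P} [SFinite π] [NormedAddCommGroup E]
  [InnerProductSpace ℂ E] [CompleteSpace E]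

/-- A bound on the `L²` norm of an oscillating integral in one variable. -/
theorem lintegral_sq_exp_le {Φ : P → ℝ} (hΦ : Measurable Φ) {h : P → E} (hh : Integrable h π)
    {N : ℝ} {S : Set P} (hS : MeasurableSet S) (hN : ∀ p, ‖h p‖ ≤ S.indicator (fun _ => N) p)
    {M : ENNReal} (hM : ∀ η > 0, ∀ p ∈ S,
      ∫⁻ q in S, ENNReal.ofReal (gaussKernel η (Φ q - Φ p)) ∂π ≤ M) :
    ∫⁻ x : ℝ, ‖∫ p, cexp (I * (Φ p * x : ℝ)) • h p ∂π‖ₑ ^ 2 ≤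
      ENNReal.ofReal N ^ 2 * (π S * M) := by
  have hθ : Measurable (Function.uncurry fun (x : ℝ) (p : P) => Φ p * x) := by
    unfold Function.uncurry
    fun_prop
  refine lintegral_le_of_tendsto_one (w := fun n x => Real.exp (-(1 / ((n : ℝ) + 1)) * x ^ 2))
    (fun n => by fun_prop) tendsto_exp_neg_div
    ((aestronglyMeasurable_integral_exp_smul hθ hh.1).enorm.pow_const 2) fun n => ?_
  have hη : (0 : ℝ) < 1 / ((n : ℝ) + 1) := by positivity
  refine (lintegral_mul_sq_norm_integral_le (fun z => (Real.exp_pos _).le)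
    (integrable_exp_neg_mul_sq hη) hθ hh).trans ?_
  refine le_trans (le_of_eq ?_) (lintegral_correlation_le hS hN
    (k := fun p q => ENNReal.ofReal (gaussKernel (1 / ((n : ℝ) + 1)) (Φ q - Φ p))) ?_ (hM _ hη))
  · refine lintegral_congr fun x => ?_
    simp only [← sub_mul]
    rw [integral_gaussian_mul_exp hη, enorm_ofReal_of_nonneg (gaussKernel_nonneg _ _)]
  · have := measurable_gaussKernel (1 / ((n : ℝ) + 1))
    unfold Function.uncurry
    fun_prop

/-- A bound on the `L²` norm of an oscillating integral in two variables. -/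
theorem lintegral_sq_exp_le₂ {Φ Ψ : P → ℝ} (hΦ : Measurable Φ) (hΨ : Measurable Ψ) {h : P → E}
    (hh : Integrable h π) {N : ℝ} {S : Set P} (hS : MeasurableSet S)
    (hN : ∀ p, ‖h p‖ ≤ S.indicator (fun _ => N) p) {M : ENNReal} (hM : ∀ η > 0, ∀ p ∈ S,
      ∫⁻ q in S, ENNReal.ofReal (gaussKernel η (Φ q - Φ p) * gaussKernel η (Ψ q - Ψ p)) ∂π ≤ M) :
    ∫⁻ z : ℝ × ℝ, ‖∫ p, cexp (I * (Φ p * z.1 + Ψ p * z.2 : ℝ)) • h p ∂π‖ₑ ^ 2 ≤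
      ENNReal.ofReal N ^ 2 * (π S * M) := by
  have hθ : Measurable (Function.uncurry fun (z : ℝ × ℝ) (p : P) => Φ p * z.1 + Ψ p * z.2) := by
    unfold Function.uncurry
    fun_prop
  refine lintegral_le_of_tendsto_one (w := fun n z => Real.exp (-(1 / ((n : ℝ) + 1)) * z.1 ^ 2) *
    Real.exp (-(1 / ((n : ℝ) + 1)) * z.2 ^ 2)) (fun n => by fun_prop) (fun z => by
      simpa using (tendsto_exp_neg_div z.1).mul (tendsto_exp_neg_div z.2))
    ((aestronglyMeasurable_integral_exp_smul hθ hh.1).enorm.pow_const 2) fun n => ?_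
  have hη : (0 : ℝ) < 1 / ((n : ℝ) + 1) := by positivity
  have hg := integrable_exp_neg_mul_sq hη
  refine (lintegral_mul_sq_norm_integral_le (fun z => by positivity) (hg.mul_prod hg) hθ
    hh).trans ?_
  refine le_trans (le_of_eq ?_) (lintegral_correlation_le hS hN
    (k := fun p q => ENNReal.ofReal (gaussKernel (1 / ((n : ℝ) + 1)) (Φ q - Φ p) *
      gaussKernel (1 / ((n : ℝ) + 1)) (Ψ q - Ψ p))) ?_ (hM _ hη))
  · refine lintegral_congr fun x => ?_
    have e1 : ∫ z : ℝ × ℝ, ((Real.exp (-(1 / ((n : ℝ) + 1)) * z.1 ^ 2) *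
        Real.exp (-(1 / ((n : ℝ) + 1)) * z.2 ^ 2) : ℝ) : ℂ) *
        cexp (I * (Φ x.2 * z.1 + Ψ x.2 * z.2 - (Φ x.1 * z.1 + Ψ x.1 * z.2) : ℝ)) =
        (gaussKernel (1 / ((n : ℝ) + 1)) (Φ x.2 - Φ x.1) : ℂ) *
          gaussKernel (1 / ((n : ℝ) + 1)) (Ψ x.2 - Ψ x.1) := by
      rw [← integral_gaussian_mul_exp hη, ← integral_gaussian_mul_exp hη, ← integral_prod_mul]
      refine integral_congr_ae (Eventually.of_forall fun z => ?_)
      simp only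
      rw [mul_mul_mul_comm, ← Complex.exp_add]
      push_cast
      ring_nf
    rw [← Measure.volume_eq_prod, e1, ← ofReal_mul,
      enorm_ofReal_of_nonneg (mul_nonneg (gaussKernel_nonneg _ _) (gaussKernel_nonneg _ _))]
  · have := measurable_gaussKernel (1 / ((n : ℝ) + 1))
    unfold Function.uncurry
    fun_prop

end Plancherel

/-! ### Gaussian integrals over the support of the packet -/

theorem lintegral_gaussKernel {η : ℝ} (hη : 0 < η) (a : ℝ) :
    ∫⁻ x : ℝ, ENNReal.ofReal (gaussKernel η (x - a)) = ENNReal.ofReal (2 * Real.pi) := by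
  rw [lintegral_sub_right_eq_self (fun x => ENNReal.ofReal (gaussKernel η x)) a]
  have e : gaussKernel η = fun x => √(Real.pi / η) * Real.exp (-(1 / (4 * η)) * x ^ 2) := by
    funext x
    unfold gaussKernel
    ring_nf
  have hb : 0 < 1 / (4 * η) := by positivity
  have hi : Integrable (gaussKernel η) := by
    rw [e]
    exact (integrable_exp_neg_mul_sq hb).const_mul _
  rw [← ofReal_integral_eq_lintegral_ofReal hi (Eventually.of_forall (gaussKernel_nonneg η)), e,
    integral_const_mul, integral_gaussian, ← Real.sqrt_mul (by positivity)]
  congr 1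
  rw [show Real.pi / η * (Real.pi / (1 / (4 * η))) = (2 * Real.pi) ^ 2 by field_simp; ring,
    Real.sqrt_sq (by positivity)]

/-- If `T` expands the distances, then the integral of a Gaussian of `T - a` is bounded uniformly
with respect to `a` and to the width of the Gaussian. -/
theorem lintegral_gaussKernel_comp_le {η : ℝ} (hη : 0 < η) {S : Set ℝ} {T : ℝ → ℝ} {C : ℝ}
    (hC : 0 < C) (hT : ∀ x ∈ S, ∀ y ∈ S, |x - y| ≤ C * |T x - T y|) (hS : MeasurableSet S) (a : ℝ) :
    ∫⁻ x in S, ENNReal.ofReal (gaussKernel η (T x - a)) ≤ ENNReal.ofReal (18 * Real.pi * C) := by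
  rcases S.eq_empty_or_nonempty with rfl | hne
  · simp
  -- `y` almost minimizes the distance from `T` to `a` on `S`
  obtain ⟨y, hy, hmin⟩ : ∃ y ∈ S, ∀ x ∈ S, |T y - a| ≤ |T x - a| + √η := by
    have hbdd : BddBelow ((fun x => |T x - a|) '' S) := ⟨0, by rintro _ ⟨x, -, rfl⟩; positivity⟩
    obtain ⟨_, ⟨y, hy, rfl⟩, hlt⟩ := Real.lt_sInf_add_pos (hne.image fun x => |T x - a|)
      (Real.sqrt_pos.2 hη)
    exact ⟨y, hy, fun x hx => hlt.le.trans (by gcongr; exact csInf_le hbdd ⟨x, hx, rfl⟩)⟩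
  have key : ∀ x ∈ S, gaussKernel η (T x - a) ≤ (3 * C) * Real.exp (1 / 8) *
      gaussKernel ((3 * C) ^ 2 * η) (x - y) := by
    intro x hx
    have h1 : |x - y| ≤ C * (2 * |T x - a| + √η) := by
      refine (hT x hx y hy).trans (mul_le_mul_of_nonneg_left ?_ hC.le)
      have h2 := abs_sub_le (T x) a (T y)
      rw [abs_sub_comm a (T y)] at h2
      linarith [hmin x hx]
    have h3 : (x - y) ^ 2 ≤ C ^ 2 * (8 * (T x - a) ^ 2 + 2 * η) := by
      have h4 : (x - y) ^ 2 ≤ (C * (2 * |T x - a| + √η)) ^ 2 := by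
        rw [← sq_abs (x - y)]
        gcongr
      refine h4.trans ?_
      rw [mul_pow]
      refine mul_le_mul_of_nonneg_left ?_ (by positivity)
      have h5 := Real.sq_sqrt hη.le
      have h6 := sq_abs (T x - a)
      nlinarith [sq_nonneg (2 * |T x - a| - √η)]
    unfold gaussKernel
    have h7 : √(Real.pi / η) = (3 * C) * √(Real.pi / ((3 * C) ^ 2 * η)) := by
      rw [show Real.pi / ((3 * C) ^ 2 * η) = (Real.pi / η) / (3 * C) ^ 2 by field_simp,
        Real.sqrt_div (x := Real.pi / η) (by positivity), Real.sqrt_sq (by positivity)]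
      field_simp
    rw [h7, show ∀ A B D F : ℝ, A * B * (D * F) = A * D * (B * F) by intros; ring, ← Real.exp_add]
    refine mul_le_mul_of_nonneg_left (Real.exp_le_exp.2 ?_) (by positivity)
    have h8 : (x - y) ^ 2 / (4 * ((3 * C) ^ 2 * η)) ≤ (8 * (T x - a) ^ 2 + 2 * η) / (36 * η) := by
      rw [div_le_div_iff₀ (by positivity) (by positivity)]
      nlinarith [mul_le_mul_of_nonneg_right h3 hη.le]
    have h9 : (8 * (T x - a) ^ 2 + 2 * η) / (36 * η) ≤ 1 / 8 + (T x - a) ^ 2 / (4 * η) := by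
      rw [div_add_div _ _ (by norm_num) (by positivity), div_le_div_iff₀ (by positivity)
        (by positivity)]
      nlinarith [mul_nonneg (sq_nonneg (T x - a)) hη.le, mul_pos hη hη]
    rw [neg_div, neg_div]
    linarith
  calc ∫⁻ x in S, ENNReal.ofReal (gaussKernel η (T x - a))
      ≤ ∫⁻ x in S, ENNReal.ofReal ((3 * C) * Real.exp (1 / 8)) *
          ENNReal.ofReal (gaussKernel ((3 * C) ^ 2 * η) (x - y)) := by
        refine setLIntegral_mono' hS fun x hx => ?_
        rw [← ENNReal.ofReal_mul (by positivity)]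
        exact ENNReal.ofReal_le_ofReal (key x hx)
    _ ≤ ∫⁻ x, ENNReal.ofReal ((3 * C) * Real.exp (1 / 8)) *
          ENNReal.ofReal (gaussKernel ((3 * C) ^ 2 * η) (x - y)) := setLIntegral_le_lintegral _ _
    _ = ENNReal.ofReal ((3 * C) * Real.exp (1 / 8) * (2 * Real.pi)) := by
        rw [lintegral_const_mul' _ _ (by simp), lintegral_gaussKernel (by positivity),
          ← ENNReal.ofReal_mul (by positivity)]
    _ ≤ ENNReal.ofReal (18 * Real.pi * C) := by
        refine ENNReal.ofReal_le_ofReal ?_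
        have h1 : Real.exp (1 / 8) ≤ 3 :=
          (Real.exp_le_exp.2 (by norm_num : (1 / 8 : ℝ) ≤ 1)).trans (by
            linarith [Real.exp_one_lt_d9])
        have := Real.pi_pos
        nlinarith [mul_pos this hC]

theorem setLIntegral_prod_le {X Y : Type*} [MeasureSpace X] [MeasureSpace Y]
    [SFinite (volume : Measure X)] [SFinite (volume : Measure Y)] {s : Set X} {t : Set Y}
    (hs : MeasurableSet s) {f : X × Y → ENNReal} (hf : Measurable f) {g : X → ENNReal}
    (h : ∀ x ∈ s, ∫⁻ y in t, f (x, y) ≤ g x) :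
    ∫⁻ z in s ×ˢ t, f z ≤ ∫⁻ x in s, g x := by
  rw [Measure.volume_eq_prod, ← Measure.prod_restrict, lintegral_prod _ hf.aemeasurable]
  exact setLIntegral_mono' hs h

theorem closedBall_eq_prod (p : ℝ × ℝ × ℝ × ℝ) (r : ℝ) :
    Metric.closedBall p r = Metric.closedBall p.1 r ×ˢ (Metric.closedBall p.2.1 r ×ˢ
      (Metric.closedBall p.2.2.1 r ×ˢ Metric.closedBall p.2.2.2 r)) := by
  rw [closedBall_prod_same, closedBall_prod_same, closedBall_prod_same]

theorem volume_closedBall (p : ℝ × ℝ × ℝ × ℝ) (r : ℝ) :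
    volume (Metric.closedBall p r) = ENNReal.ofReal (2 * r) ^ 4 := by
  simp only [closedBall_eq_prod, Measure.volume_eq_prod, Measure.prod_prod, Real.volume_closedBall]
  ring

/-- The kernel estimate that yields the decay of the `L²` norm in the direction `x` only. -/
theorem lintegral_closedBall_gaussKernel_le {η : ℝ} (hη : 0 < η) (p : ℝ × ℝ × ℝ × ℝ) (r a : ℝ) :
    ∫⁻ q in Metric.closedBall p r, ENNReal.ofReal (gaussKernel η (q.1 + q.2.1 - a)) ≤
      ENNReal.ofReal (2 * r) ^ 3 * ENNReal.ofReal (2 * Real.pi) := by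
  have hg := measurable_gaussKernel η
  rw [closedBall_eq_prod]
  refine (setLIntegral_prod_le (g := fun _ => ENNReal.ofReal (2 * Real.pi) *
    ENNReal.ofReal (2 * r) ^ 2) Metric.isClosed_closedBall.measurableSet (by fun_prop)
    fun k _ => ?_).trans (le_of_eq ?_)
  · refine (setLIntegral_prod_le (g := fun k' => ENNReal.ofReal (gaussKernel η (k + k' - a)) *
      ENNReal.ofReal (2 * r) ^ 2) Metric.isClosed_closedBall.measurableSet (by fun_prop)
      fun k' _ => ?_).trans ?_
    · simp only [lintegral_const, Measure.restrict_apply_univ, Measure.volume_eq_prod,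
        Measure.prod_prod, Real.volume_closedBall, sq, le_refl]
    · rw [lintegral_mul_const' _ _ (by finiteness)]
      gcongr
      refine (setLIntegral_le_lintegral _ _).trans (le_of_eq ?_)
      rw [← lintegral_gaussKernel hη (a - k)]
      refine lintegral_congr fun x => ?_
      ring_nf
  · rw [lintegral_const, Measure.restrict_apply_univ, Real.volume_closedBall]
    ring

/-- The kernel estimate that yields the dispersion in both directions. -/
theorem lintegral_closedBall_gaussKernel_mul_le {η : ℝ} (hη : 0 < η) (p : ℝ × ℝ × ℝ × ℝ) {r C : ℝ}
    (hC : 0 < C) {T : ℝ × ℝ × ℝ × ℝ → ℝ} (hT : Measurable T)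
    (h : ∀ k k' m x y, (k, k', m, x) ∈ Metric.closedBall p r →
      (k, k', m, y) ∈ Metric.closedBall p r →
      |x - y| ≤ C * |T (k, k', m, x) - T (k, k', m, y)|) (a b : ℝ) :
    ∫⁻ q in Metric.closedBall p r,
      ENNReal.ofReal (gaussKernel η (q.1 + q.2.1 - a) * gaussKernel η (T q - b)) ≤
      ENNReal.ofReal (2 * r) ^ 2 * (ENNReal.ofReal (2 * Real.pi) *
        ENNReal.ofReal (18 * Real.pi * C)) := by
  have hg := measurable_gaussKernel η
  simp only [closedBall_eq_prod, Set.mem_prod] at h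
  rw [closedBall_eq_prod]
  simp only [ENNReal.ofReal_mul (gaussKernel_nonneg _ _)]
  refine (setLIntegral_prod_le (g := fun _ => ENNReal.ofReal (2 * Real.pi) *
    (ENNReal.ofReal (18 * Real.pi * C) * ENNReal.ofReal (2 * r)))
    Metric.isClosed_closedBall.measurableSet (by fun_prop) fun k hk => ?_).trans (le_of_eq ?_)
  · refine (setLIntegral_prod_le (g := fun k' => ENNReal.ofReal (gaussKernel η (k + k' - a)) *
      (ENNReal.ofReal (18 * Real.pi * C) * ENNReal.ofReal (2 * r)))
      Metric.isClosed_closedBall.measurableSet (by fun_prop) fun k' hk' => ?_).trans ?_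
    · dsimp only
      rw [lintegral_const_mul' _ _ (by finiteness)]
      gcongr
      refine (setLIntegral_prod_le (g := fun _ => ENNReal.ofReal (18 * Real.pi * C))
        Metric.isClosed_closedBall.measurableSet (by fun_prop) fun m hm => ?_).trans (le_of_eq ?_)
      · exact lintegral_gaussKernel_comp_le hη hC
          (fun x hx y hy => h k k' m x y ⟨hk, hk', hm, hx⟩ ⟨hk, hk', hm, hy⟩)
          Metric.isClosed_closedBall.measurableSet b
      · rw [lintegral_const, Measure.restrict_apply_univ, Real.volume_closedBall]
    · rw [lintegral_mul_const' _ _ (by finiteness)]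
      gcongr
      refine (setLIntegral_le_lintegral _ _).trans (le_of_eq ?_)
      rw [← lintegral_gaussKernel hη (a - k)]
      refine lintegral_congr fun x => ?_
      ring_nf
  · rw [lintegral_const, Measure.restrict_apply_univ, Real.volume_closedBall]
    ring

/-! ### Fields on the half-plane -/

/-- An integral over the half-plane is bounded one horizontal line at a time. -/
theorem lintegral_halfPlane_le {F : ℝ × ℝ → ENNReal} {B : ℝ → ENNReal} (hF : AEMeasurable F)
    (h : ∀ y, 0 < y → ∫⁻ x, F (x, y) ≤ B y) :
    ∫⁻ z, F z ∂halfPlane ≤ ∫⁻ y in Set.Ioi 0, B y := by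
  have e : halfPlane = (volume : Measure ℝ).prod (volume.restrict (Set.Ioi 0)) := by
    have : {z : ℝ × ℝ | 0 < z.2} = Set.univ ×ˢ Set.Ioi 0 := by
      ext z
      simp
    rw [halfPlane, this, Measure.volume_eq_prod, ← Measure.prod_restrict, Measure.restrict_univ]
  have hF' : AEMeasurable F ((volume : Measure ℝ).prod (volume.restrict (Set.Ioi 0))) := by
    rw [← e]
    exact hF.restrict
  rw [e, lintegral_prod_symm _ hF']
  exact setLIntegral_mono' measurableSet_Ioi h

theorem lintegral_exp_neg_mul {c : ℝ} (hc : 0 < c) :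
    ∫⁻ y in Set.Ioi (0 : ℝ), ENNReal.ofReal (Real.exp (-(c * y))) = ENNReal.ofReal c⁻¹ := by
  have hi : IntegrableOn (fun y : ℝ => Real.exp (-(c * y))) (Set.Ioi 0) := by
    simpa only [neg_mul] using exp_neg_integrableOn_Ioi 0 hc
  rw [← ofReal_integral_eq_lintegral_ofReal hi (Eventually.of_forall fun y => (Real.exp_pos _).le)]
  congr 1
  have := integral_exp_mul_Ioi (neg_neg_of_pos hc) 0
  simp only [neg_mul, mul_zero, Real.exp_zero] at this
  rw [this, neg_div_neg_eq, one_div]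

theorem eLpNorm_two_le {μ : Measure (ℝ × ℝ)} {F : ℝ × ℝ → State} {R : ℝ}
    (h : ∫⁻ z, ‖F z‖ₑ ^ 2 ∂μ ≤ ENNReal.ofReal R ^ 2) : eLpNorm F 2 μ ≤ ENNReal.ofReal R := by
  rw [eLpNorm_eq_lintegral_rpow_enorm_toReal (by norm_num) (by norm_num)]
  simp only [ENNReal.toReal_ofNat, ENNReal.rpow_ofNat]
  calc _ ≤ (ENNReal.ofReal R ^ 2) ^ (1 / 2 : ℝ) := by gcongr
    _ = ENNReal.ofReal R := by
      rw [← ENNReal.rpow_natCast, ← ENNReal.rpow_mul]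
      norm_num

/-! ### The packets near `(2 k₁, 2 m₁)` -/

/-- The part of the weight `weightII` supported near `(k₁, k₁, m₁, m₁)`, as a function of
`p = (k, k', m, m')`. -/
def packetWeight (χ : ℝ → ℝ) (ε k₁ m₁ : ℝ) (p : ℝ × ℝ × ℝ × ℝ) : ℝ :=
  1 / ε ^ 4 * ((χ ((p.1 - k₁) / ε ^ 2) * χ ((p.2.2.1 - m₁) / ε ^ 2)) *
    (χ ((p.2.1 - k₁) / ε ^ 2) * χ ((p.2.2.2 - m₁) / ε ^ 2)))

theorem weightII_eq (k₀ m₀ : ℝ) (χ : ℝ → ℝ) (ε : ℝ) (p : ℝ × ℝ × ℝ × ℝ) :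
    weightII k₀ m₀ χ ε p.1 p.2.2.1 p.2.1 p.2.2.2 =
      packetWeight χ ε (-k₀) (-m₀) p + packetWeight χ ε k₀ m₀ p := by
  have hne : (1 : ℤ) ≠ -1 := by decide
  unfold weightII packetWeight
  rw [Finset.sum_pair hne, mul_add]
  push_cast
  simp only [one_mul, sub_neg_eq_add, neg_one_mul, ← sub_eq_add_neg]

/-- The contribution to the integrand `integrandII` of the wave vectors close to `(k₁, m₁)`. -/
def packet (γ ν₀ κ₀ k₁ m₁ : ℝ) (χ : ℝ → ℝ) (σ ε t x y : ℝ) (j : Fin 3) (p : ℝ × ℝ × ℝ × ℝ) :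
    State :=
  ((packetWeight χ ε k₁ m₁ p : ℂ) *
      amplitudeII γ (ν₀ * ε ^ 6) (κ₀ * ε ^ 6) σ p.1 p.2.2.1 p.2.1 p.2.2.2 j *
      cexp (I * (((p.1 + p.2.1) * x - (freq γ p.1 p.2.2.1 + freq γ p.2.1 p.2.2.2) * t : ℝ) : ℂ) -
        rateII γ (ν₀ * ε ^ 6) (κ₀ * ε ^ 6) p.1 p.2.2.1 p.2.1 p.2.2.2 j * y)) •
    mode γ (κ₀ * ε ^ 6) (freq γ p.1 p.2.2.1 + freq γ p.2.1 p.2.2.2) (p.1 + p.2.1)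
      (rateII γ (ν₀ * ε ^ 6) (κ₀ * ε ^ 6) p.1 p.2.2.1 p.2.1 p.2.2.2 j)

theorem integrandII_eq (γ ν₀ κ₀ k₀ m₀ : ℝ) (χ : ℝ → ℝ) (σ ε t x y : ℝ) (j : Fin 3)
    (p : ℝ × ℝ × ℝ × ℝ) : integrandII γ ν₀ κ₀ k₀ m₀ χ σ ε t x y j p =
      packet γ ν₀ κ₀ (-k₀) (-m₀) χ σ ε t x y j p + packet γ ν₀ κ₀ k₀ m₀ χ σ ε t x y j p := by
  unfold integrandII packet
  simp only [weightII_eq]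
  rw [← add_smul]
  push_cast
  ring_nf

theorem packet_eq (γ ν₀ κ₀ k₁ m₁ : ℝ) (χ : ℝ → ℝ) (σ ε t x y : ℝ) (j : Fin 3)
    (p : ℝ × ℝ × ℝ × ℝ) : packet γ ν₀ κ₀ k₁ m₁ χ σ ε t x y j p =
      cexp (I * ((p.1 + p.2.1) * x : ℝ)) •
        (cexp (-(rateII γ (ν₀ * ε ^ 6) (κ₀ * ε ^ 6) p.1 p.2.2.1 p.2.1 p.2.2.2 j * y)) •
          packet γ ν₀ κ₀ k₁ m₁ χ σ ε t 0 0 j p) := by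
  unfold packet
  simp only [smul_smul]
  have hexp : I * (((p.1 + p.2.1) * x - (freq γ p.1 p.2.2.1 + freq γ p.2.1 p.2.2.2) * t : ℝ) : ℂ) -
        rateII γ (ν₀ * ε ^ 6) (κ₀ * ε ^ 6) p.1 p.2.2.1 p.2.1 p.2.2.2 j * y =
      I * ((p.1 + p.2.1) * x : ℝ) +
        (-(rateII γ (ν₀ * ε ^ 6) (κ₀ * ε ^ 6) p.1 p.2.2.1 p.2.1 p.2.2.2 j * y) +
        (I * (((p.1 + p.2.1) * 0 - (freq γ p.1 p.2.2.1 + freq γ p.2.1 p.2.2.2) * t : ℝ) : ℂ) -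
          rateII γ (ν₀ * ε ^ 6) (κ₀ * ε ^ 6) p.1 p.2.2.1 p.2.1 p.2.2.2 j * (0 : ℝ))) := by
    push_cast
    ring
  rw [hexp, Complex.exp_add, Complex.exp_add]
  congr 1
  ring

/-- The rates and the amplitudes are well defined and bounded on the support of the packet. -/
structure IsAdmissible (γ ν₀ κ₀ k₁ m₁ σ R C ε : ℝ) : Prop where
  sin_pos : 0 < Real.sin γ
  nu_pos : 0 < ν₀
  kappa_pos : 0 < κ₀
  eps_pos : 0 < ε
  bound_pos : 0 < C
  regular : ∀ p ∈ Metric.closedBall (k₁, k₁, m₁, m₁) (R * ε ^ 2),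
    IsRegularPair γ (ν₀ * ε ^ 6) (κ₀ * ε ^ 6) p.1 p.2.2.1 p.2.1 p.2.2.2
  amplitude_le : ∀ j, ∀ p ∈ Metric.closedBall (k₁, k₁, m₁, m₁) (R * ε ^ 2), ε ^ ampExp j *
    (‖amplitudeII γ (ν₀ * ε ^ 6) (κ₀ * ε ^ 6) σ p.1 p.2.2.1 p.2.1 p.2.2.2 j‖ *
      ‖mode γ (κ₀ * ε ^ 6) (freq γ p.1 p.2.2.1 + freq γ p.2.1 p.2.2.2) (p.1 + p.2.1)
          (rateII γ (ν₀ * ε ^ 6) (κ₀ * ε ^ 6) p.1 p.2.2.1 p.2.1 p.2.2.2 j)‖) ≤ C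

/-- The cut-off function is supported in `[-R, R]` and bounded by `A`. -/
structure IsCutoff (χ : ℝ → ℝ) (R A : ℝ) : Prop where
  continuous : Continuous χ
  radius_pos : 0 < R
  bound_pos : 0 < A
  abs_le : ∀ x, |χ x| ≤ A
  mem : ∀ x, χ x ≠ 0 → |x| ≤ R

theorem exists_isCutoff {χ : ℝ → ℝ} (hχ : Continuous χ) (hc : HasCompactSupport χ) :
    ∃ R A, IsCutoff χ R A := by
  obtain ⟨A, hA⟩ := hχ.bounded_above_of_compact_support hc
  obtain ⟨R, hR⟩ := hc.isBounded.subset_closedBall 0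
  refine ⟨max R 1, max A 1, hχ, by positivity, by positivity, fun x => ?_, fun x hx => ?_⟩
  · exact (hA x).trans (le_max_left _ _)
  · have := hR (subset_tsupport _ hx)
    rw [mem_closedBall_zero_iff, Real.norm_eq_abs] at this
    exact this.trans (le_max_left _ _)

section Packets

variable {γ ν₀ κ₀ k₁ m₁ σ R A C ε : ℝ} {χ : ℝ → ℝ}

theorem continuous_packetWeight (hχ : Continuous χ) (ε k₁ m₁ : ℝ) :
    Continuous (packetWeight χ ε k₁ m₁) := by
  unfold packetWeight
  fun_prop

theorem IsCutoff.mem_closedBall (h : IsCutoff χ R A) (hε : 0 < ε) {p : ℝ × ℝ × ℝ × ℝ}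
    (hp : packetWeight χ ε k₁ m₁ p ≠ 0) :
    p ∈ Metric.closedBall (k₁, k₁, m₁, m₁) (R * ε ^ 2) := by
  have key : ∀ {a b : ℝ}, χ ((a - b) / ε ^ 2) ≠ 0 → a ∈ Metric.closedBall b (R * ε ^ 2) := by
    intro a b hab
    have h1 := h.mem _ hab
    rw [abs_div, abs_of_pos (show 0 < ε ^ 2 by positivity), div_le_iff₀ (by positivity)] at h1
    rwa [Metric.mem_closedBall, Real.dist_eq]
  unfold packetWeight at hp
  have h1 := right_ne_zero_of_mul hp
  have h2 := left_ne_zero_of_mul h1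
  have h3 := right_ne_zero_of_mul h1
  rw [closedBall_eq_prod]
  exact ⟨key (left_ne_zero_of_mul h2), key (left_ne_zero_of_mul h3), key (right_ne_zero_of_mul h2),
    key (right_ne_zero_of_mul h3)⟩

theorem IsCutoff.abs_packetWeight_le (h : IsCutoff χ R A) (hε : 0 < ε) (p : ℝ × ℝ × ℝ × ℝ) :
    |packetWeight χ ε k₁ m₁ p| ≤ A ^ 4 / ε ^ 4 := by
  have hA := h.bound_pos.le
  unfold packetWeight
  rw [abs_mul, abs_mul, abs_mul, abs_mul, abs_of_pos (show 0 < 1 / ε ^ 4 by positivity)]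
  calc 1 / ε ^ 4 * (|χ ((p.1 - k₁) / ε ^ 2)| * |χ ((p.2.2.1 - m₁) / ε ^ 2)| *
        (|χ ((p.2.1 - k₁) / ε ^ 2)| * |χ ((p.2.2.2 - m₁) / ε ^ 2)|))
      ≤ 1 / ε ^ 4 * (A * A * (A * A)) := by
        gcongr <;> exact h.abs_le _
    _ = A ^ 4 / ε ^ 4 := by ring

namespace IsAdmissible

theorem continuousOn (h : IsAdmissible γ ν₀ κ₀ k₁ m₁ σ R C ε) (hχ : IsCutoff χ R A) (t : ℝ)
    (j : Fin 3) : ContinuousOn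
      (fun q : (ℝ × ℝ) × (ℝ × ℝ × ℝ × ℝ) => packet γ ν₀ κ₀ k₁ m₁ χ σ ε t q.1.1 q.1.2 j q.2)
      (Set.univ ×ˢ {p | packetWeight χ ε k₁ m₁ p ≠ 0}) := by
  have hε := h.eps_pos
  obtain ⟨c1, c2, c3, c4⟩ := IsRegularPair.continuousOn (σ := σ) h.sin_pos
    (show 0 < ν₀ * ε ^ 6 by have := h.nu_pos; positivity)
    (show 0 < κ₀ * ε ^ 6 by have := h.kappa_pos; positivity)
    (U := {p | packetWeight χ ε k₁ m₁ p ≠ 0})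
    (fun p hp => h.regular p (hχ.mem_closedBall hε hp)) j
  have hmaps : Set.MapsTo Prod.snd (Set.univ ×ˢ {p | packetWeight χ ε k₁ m₁ p ≠ 0} :
    Set ((ℝ × ℝ) × (ℝ × ℝ × ℝ × ℝ))) {p | packetWeight χ ε k₁ m₁ p ≠ 0} := fun q hq => hq.2
  have d1 := c1.comp continuousOn_snd hmaps
  have d2 := c2.comp continuousOn_snd hmaps
  have d3 := c3.comp continuousOn_snd hmaps
  have d4 := c4.comp continuousOn_snd hmaps
  have d5 := (continuous_packetWeight hχ.continuous ε k₁ m₁).continuousOn.comp continuousOn_snd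
    hmaps
  simp only [Function.comp_def] at d1 d2 d3 d4 d5
  unfold packet
  refine ContinuousOn.smul (ContinuousOn.mul (ContinuousOn.mul ?_ d3) ?_) d4
  · exact continuous_ofReal.comp_continuousOn d5
  · refine ContinuousOn.cexp (ContinuousOn.sub (continuousOn_const.mul
      (continuous_ofReal.comp_continuousOn (ContinuousOn.sub (by fun_prop)
        (d2.mul continuousOn_const)))) (d1.mul (by fun_prop)))

theorem aestronglyMeasurable (h : IsAdmissible γ ν₀ κ₀ k₁ m₁ σ R C ε) (hχ : IsCutoff χ R A) (t : ℝ)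
    (j : Fin 3) : AEStronglyMeasurable
      (fun q : (ℝ × ℝ) × (ℝ × ℝ × ℝ × ℝ) => packet γ ν₀ κ₀ k₁ m₁ χ σ ε t q.1.1 q.1.2 j q.2) := by
  have hmeas : MeasurableSet (Set.univ ×ˢ {p | packetWeight χ ε k₁ m₁ p ≠ 0} :
      Set ((ℝ × ℝ) × (ℝ × ℝ × ℝ × ℝ))) :=
    MeasurableSet.univ.prod (isOpen_ne_fun (continuous_packetWeight hχ.continuous ε k₁ m₁)
      continuous_const).measurableSet
  have h1 := (aestronglyMeasurable_indicator_iff (μ := volume) hmeas).2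
    ((h.continuousOn hχ t j).aestronglyMeasurable hmeas)
  refine h1.congr (Eventually.of_forall fun q => ?_)
  by_cases hq : packetWeight χ ε k₁ m₁ q.2 = 0
  · rw [Set.indicator_of_notMem (fun hm => hm.2 hq)]
    simp [packet, hq]
  · exact Set.indicator_of_mem (s := Set.univ ×ˢ {p | packetWeight χ ε k₁ m₁ p ≠ 0})
      ⟨Set.mem_univ _, hq⟩ _

theorem aestronglyMeasurable_apply (h : IsAdmissible γ ν₀ κ₀ k₁ m₁ σ R C ε) (hχ : IsCutoff χ R A)
    (t x y : ℝ) (j : Fin 3) :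
    AEStronglyMeasurable (packet γ ν₀ κ₀ k₁ m₁ χ σ ε t x y j) := by
  have hmeas : MeasurableSet {p | packetWeight χ ε k₁ m₁ p ≠ 0} :=
    (isOpen_ne_fun (continuous_packetWeight hχ.continuous ε k₁ m₁) continuous_const).measurableSet
  have hc : ContinuousOn (packet γ ν₀ κ₀ k₁ m₁ χ σ ε t x y j)
      {p | packetWeight χ ε k₁ m₁ p ≠ 0} :=
    (h.continuousOn hχ t j).comp (f := fun p : ℝ × ℝ × ℝ × ℝ => ((x, y), p)) (by fun_prop)
      fun p hp => ⟨Set.mem_univ _, hp⟩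
  refine ((aestronglyMeasurable_indicator_iff (μ := volume) hmeas).2
    (hc.aestronglyMeasurable hmeas)).congr (Eventually.of_forall fun p => ?_)
  by_cases hq : packetWeight χ ε k₁ m₁ p = 0
  · rw [Set.indicator_of_notMem (s := {p | packetWeight χ ε k₁ m₁ p ≠ 0}) fun hm => hm hq]
    simp [packet, hq]
  · exact Set.indicator_of_mem (s := {p | packetWeight χ ε k₁ m₁ p ≠ 0}) hq _

theorem norm_packet_le (h : IsAdmissible γ ν₀ κ₀ k₁ m₁ σ R C ε) (hχ : IsCutoff χ R A) (t : ℝ)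
    (j : Fin 3) (p : ℝ × ℝ × ℝ × ℝ) : ‖packet γ ν₀ κ₀ k₁ m₁ χ σ ε t 0 0 j p‖ ≤
      (Metric.closedBall (k₁, k₁, m₁, m₁) (R * ε ^ 2)).indicator
        (fun _ => A ^ 4 * C / ε ^ (4 + ampExp j)) p := by
  have hε := h.eps_pos
  by_cases hp : packetWeight χ ε k₁ m₁ p = 0
  · have hC := h.bound_pos
    simp only [packet, hp, ofReal_zero, zero_mul, zero_smul, norm_zero]
    exact Set.indicator_nonneg (fun _ _ => by positivity) _
  · have hmem := hχ.mem_closedBall hε hp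
    rw [Set.indicator_of_mem hmem, packet, norm_smul, norm_mul, norm_mul, norm_real,
      Real.norm_eq_abs, show ∀ u v : ℝ, ‖cexp (I * (((p.1 + p.2.1) * 0 - u * v : ℝ) : ℂ) -
        rateII γ (ν₀ * ε ^ 6) (κ₀ * ε ^ 6) p.1 p.2.2.1 p.2.1 p.2.2.2 j * (0 : ℝ))‖ = 1 by
          intro u v
          rw [ofReal_zero, mul_zero (rateII _ _ _ _ _ _ _ _), sub_zero, norm_exp_I_mul_ofReal'],
      mul_one, mul_assoc]
    have h1 := h.amplitude_le j p hmem
    rw [← le_div_iff₀' (by positivity)] at h1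
    calc _ ≤ A ^ 4 / ε ^ 4 * (C / ε ^ ampExp j) :=
          mul_le_mul (hχ.abs_packetWeight_le hε p) h1 (by positivity) (by positivity)
      _ = _ := by rw [div_mul_div_comm, pow_add]

theorem integrable_packet_zero (h : IsAdmissible γ ν₀ κ₀ k₁ m₁ σ R C ε) (hχ : IsCutoff χ R A)
    (t : ℝ) (j : Fin 3) : Integrable (packet γ ν₀ κ₀ k₁ m₁ χ σ ε t 0 0 j) := by
  refine Integrable.mono' (g := (Metric.closedBall (k₁, k₁, m₁, m₁) (R * ε ^ 2)).indicator
    fun _ => A ^ 4 * C / ε ^ (4 + ampExp j)) ?_ (h.aestronglyMeasurable_apply hχ t 0 0 j)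
    (Eventually.of_forall (h.norm_packet_le hχ t j))
  rw [integrable_indicator_iff Metric.isClosed_closedBall.measurableSet]
  exact integrableOn_const (isCompact_closedBall _ _).measure_ne_top

theorem norm_exp_smul_packet_le (h : IsAdmissible γ ν₀ κ₀ k₁ m₁ σ R C ε) (hχ : IsCutoff χ R A)
    (t : ℝ) (j : Fin 3) {z : ℝ × ℝ × ℝ × ℝ → ℂ} {N : ℝ}
    (hz : ∀ p ∈ Metric.closedBall (k₁, k₁, m₁, m₁) (R * ε ^ 2), ‖z p‖ ≤ N)
    (p : ℝ × ℝ × ℝ × ℝ) : ‖z p • packet γ ν₀ κ₀ k₁ m₁ χ σ ε t 0 0 j p‖ ≤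
      (Metric.closedBall (k₁, k₁, m₁, m₁) (R * ε ^ 2)).indicator
        (fun _ => A ^ 4 * C / ε ^ (4 + ampExp j) * N) p := by
  have h1 := h.norm_packet_le hχ t j p
  rw [norm_smul, mul_comm]
  by_cases hp : p ∈ Metric.closedBall (k₁, k₁, m₁, m₁) (R * ε ^ 2)
  · rw [Set.indicator_of_mem hp] at h1 ⊢
    have := hz p hp
    exact mul_le_mul h1 this (norm_nonneg _) ((norm_nonneg _).trans h1)
  · rw [Set.indicator_of_notMem hp] at h1 ⊢
    rw [le_antisymm h1 (norm_nonneg _), zero_mul]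

theorem re_rate_pos (h : IsAdmissible γ ν₀ κ₀ k₁ m₁ σ R C ε) (j : Fin 3) {p : ℝ × ℝ × ℝ × ℝ}
    (hp : p ∈ Metric.closedBall (k₁, k₁, m₁, m₁) (R * ε ^ 2)) :
    0 < (rateII γ (ν₀ * ε ^ 6) (κ₀ * ε ^ 6) p.1 p.2.2.1 p.2.1 p.2.2.2 j).re :=
  ((h.regular p hp).triple.mem j).1

theorem norm_exp_rate_le {b y : ℝ} {L : ℂ} (hy : 0 ≤ y) (hb : b ≤ L.re) :
    ‖cexp (-(L * y))‖ ≤ Real.exp (-(b * y)) := by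
  rw [norm_exp, neg_re, re_mul_ofReal]
  gcongr

theorem integrable_packet (h : IsAdmissible γ ν₀ κ₀ k₁ m₁ σ R C ε) (hχ : IsCutoff χ R A)
    (t x : ℝ) {y : ℝ} (hy : 0 ≤ y) (j : Fin 3) :
    Integrable (packet γ ν₀ κ₀ k₁ m₁ χ σ ε t x y j) := by
  refine (h.integrable_packet_zero hχ t j).norm.mono' (h.aestronglyMeasurable_apply hχ t x y j)
    (Eventually.of_forall fun p => ?_)
  by_cases hp : packetWeight χ ε k₁ m₁ p = 0
  · simp [packet, hp]
  · rw [packet_eq, norm_smul, norm_exp_I_mul_ofReal', one_mul, norm_smul]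
    have h1 := norm_exp_rate_le hy (h.re_rate_pos j (hχ.mem_closedBall h.eps_pos hp)).le
    rw [zero_mul, neg_zero, Real.exp_zero] at h1
    exact mul_le_of_le_one_left (norm_nonneg _) h1

/-- The pointwise bound on a packet. -/
theorem norm_integral_packet_le (h : IsAdmissible γ ν₀ κ₀ k₁ m₁ σ R C ε) (hχ : IsCutoff χ R A)
    (t x : ℝ) {y b : ℝ} (hy : 0 ≤ y) (j : Fin 3)
    (hb : ∀ p ∈ Metric.closedBall (k₁, k₁, m₁, m₁) (R * ε ^ 2),
      b ≤ (rateII γ (ν₀ * ε ^ 6) (κ₀ * ε ^ 6) p.1 p.2.2.1 p.2.1 p.2.2.2 j).re) :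
    ‖∫ p, packet γ ν₀ κ₀ k₁ m₁ χ σ ε t x y j p‖ ≤
      16 * A ^ 4 * R ^ 4 * C * ε ^ 4 / ε ^ ampExp j * Real.exp (-(b * y)) := by
  have hε := h.eps_pos
  have hR := hχ.radius_pos
  have hC := h.bound_pos
  have hA := hχ.bound_pos
  have hi : Integrable ((Metric.closedBall (k₁, k₁, m₁, m₁) (R * ε ^ 2)).indicator
      fun _ => A ^ 4 * C / ε ^ (4 + ampExp j) * Real.exp (-(b * y))) := by
    rw [integrable_indicator_iff Metric.isClosed_closedBall.measurableSet]
    exact integrableOn_const (isCompact_closedBall _ _).measure_ne_top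
  refine (norm_integral_le_of_norm_le hi (Eventually.of_forall fun p => ?_)).trans (le_of_eq ?_)
  · rw [packet_eq, norm_smul, norm_exp_I_mul_ofReal', one_mul]
    exact h.norm_exp_smul_packet_le hχ t j (fun q hq => norm_exp_rate_le hy (hb q hq)) p
  · rw [integral_indicator Metric.isClosed_closedBall.measurableSet, setIntegral_const, smul_eq_mul,
      Measure.real, volume_closedBall, ENNReal.toReal_pow, ENNReal.toReal_ofReal (by positivity),
      pow_add]
    field_simp
    ring

end IsAdmissible

end Packets

/-! ### The `L²` norm of a packet -/

namespace NormLE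

variable {F G : ℝ → ℝ → State} {p : ENNReal} {R S : ℝ}

theorem mono (h : NormLE F p R) (hRS : R ≤ S) : NormLE F p S :=
  ⟨h.1, h.2.trans (ENNReal.ofReal_le_ofReal hRS)⟩

theorem add (hF : NormLE F p R) (hG : NormLE G p S) (hp : 1 ≤ p) (hR : 0 ≤ R) (hS : 0 ≤ S) :
    NormLE (fun x y => F x y + G x y) p (R + S) := by
  refine ⟨hF.1.add hG.1, (eLpNorm_add_le hF.1 hG.1 hp).trans ?_⟩
  rw [ENNReal.ofReal_add hR hS]
  exact add_le_add hF.2 hG.2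

theorem const_smul (h : NormLE F p R) {δ : ℝ} (hδ : 0 ≤ δ) :
    NormLE (fun x y => δ • F x y) p (δ * R) := by
  refine ⟨h.1.const_smul δ, (eLpNorm_const_smul_le (c := δ)).trans ?_⟩
  rw [ENNReal.ofReal_mul hδ, Real.enorm_of_nonneg hδ]
  gcongr
  exact h.2

theorem congr (h : NormLE F p R) (hFG : ∀ x y, 0 < y → F x y = G x y) : NormLE G p R := by
  have h1 : (fun z : ℝ × ℝ => F z.1 z.2) =ᵐ[halfPlane] fun z => G z.1 z.2 :=
    ae_restrict_of_forall_mem (measurableSet_lt measurable_const measurable_snd)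
      fun z hz => hFG z.1 z.2 hz
  exact ⟨h.1.congr h1, (eLpNorm_congr_ae h1).symm.le.trans h.2⟩

theorem top_of_norm_le (hF : AEStronglyMeasurable (fun z : ℝ × ℝ => F z.1 z.2) halfPlane)
    (h : ∀ x y, 0 < y → ‖F x y‖ ≤ R) : NormLE F ⊤ R := by
  refine ⟨hF, ?_⟩
  rw [eLpNorm_exponent_top]
  exact eLpNormEssSup_le_of_ae_bound (ae_restrict_of_forall_mem
    (measurableSet_lt measurable_const measurable_snd) fun z hz => h z.1 z.2 hz)

end NormLE

/-- A packet of waves decaying like `exp (-b y)`, with an amplitude of size `N` on a box of size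
`r`. The dispersion in the direction `x` only is used. -/
theorem normLE_integral {G : (ℝ × ℝ) × (ℝ × ℝ × ℝ × ℝ) → State} (hG : AEStronglyMeasurable G)
    {H : ℝ → ℝ × ℝ × ℝ × ℝ → State} (hGH : ∀ x y p, 0 < y →
      G ((x, y), p) = cexp (I * ((p.1 + p.2.1) * x : ℝ)) • H y p)
    (hi : ∀ y, 0 < y → Integrable (H y)) {p₁ : ℝ × ℝ × ℝ × ℝ} {r N b : ℝ} (hr : 0 < r) (hN : 0 ≤ N)
    (hb : 0 < b) (hH : ∀ y, 0 < y → ∀ p, ‖H y p‖ ≤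
      (Metric.closedBall p₁ r).indicator (fun _ => N * Real.exp (-(b * y))) p) :
    NormLE (fun x y => ∫ p, G ((x, y), p)) 2 (N * √(128 * Real.pi * r ^ 7 / b)) := by
  have hm : AEStronglyMeasurable fun z : ℝ × ℝ => ∫ p, G (z, p) := hG.integral_prod_right'
  refine ⟨hm.restrict, eLpNorm_two_le ?_⟩
  refine (lintegral_halfPlane_le (B := fun y =>
    ENNReal.ofReal (N ^ 2 * (128 * Real.pi * 2 * r ^ 7)) *
      ENNReal.ofReal (Real.exp (-(2 * b * y)))) (hm.enorm.pow_const 2) fun y hy => ?_).trans ?_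
  · simp only [hGH _ y _ hy]
    refine (lintegral_sq_exp_le (Φ := fun p : ℝ × ℝ × ℝ × ℝ => p.1 + p.2.1) (by fun_prop) (hi y hy)
      Metric.isClosed_closedBall.measurableSet (hH y hy)
      fun η hη p _ => lintegral_closedBall_gaussKernel_le hη p₁ r (p.1 + p.2.1)).trans (le_of_eq ?_)
    have h1 : Real.exp (-(2 * b * y)) = Real.exp (-(b * y)) ^ 2 := by
      rw [← Real.exp_nat_mul]
      ring_nf
    rw [volume_closedBall, ← ENNReal.ofReal_pow (by positivity),
      ← ENNReal.ofReal_pow (by positivity), ← ENNReal.ofReal_pow (by positivity),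
      ← ENNReal.ofReal_mul (by positivity), ← ENNReal.ofReal_mul (by positivity),
      ← ENNReal.ofReal_mul (by positivity), ← ENNReal.ofReal_mul (by positivity), h1]
    congr 1
    ring
  · rw [lintegral_const_mul _ (by fun_prop), lintegral_exp_neg_mul (by positivity),
      ← ENNReal.ofReal_mul (by positivity), ← ENNReal.ofReal_pow (by positivity), mul_pow,
      Real.sq_sqrt (by positivity)]
    refine ENNReal.ofReal_le_ofReal (le_of_eq ?_)
    field_simp

/-- A packet of dispersive waves, multiplied by a decaying factor. -/
theorem normLE_exp_smul_integral {Q : ℝ × ℝ × ℝ × ℝ → State} (hQ : Integrable Q)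
    {p₁ : ℝ × ℝ × ℝ × ℝ} {r N a K : ℝ} (hr : 0 < r) (hN : 0 ≤ N) (ha : 0 ≤ a)
    (hle : ∀ p, ‖Q p‖ ≤ (Metric.closedBall p₁ r).indicator (fun _ => N) p) (hK : 0 < K)
    {T : ℝ × ℝ × ℝ × ℝ → ℝ} (hT : Measurable T)
    (hdisp : ∀ k k' m x y, (k, k', m, x) ∈ Metric.closedBall p₁ r →
      (k, k', m, y) ∈ Metric.closedBall p₁ r → |x - y| ≤ K * |T (k, k', m, x) - T (k, k', m, y)|) :
    NormLE (fun x y => Real.exp (-(a * y)) •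
      ∫ p, cexp (I * ((p.1 + p.2.1) * x + T p * y : ℝ)) • Q p) 2
      (N * √(2304 * Real.pi ^ 2 * K * r ^ 6)) := by
  have hθm : Measurable (Function.uncurry fun (z : ℝ × ℝ) (p : ℝ × ℝ × ℝ × ℝ) =>
      (p.1 + p.2.1) * z.1 + T p * z.2) := by
    simp only [Function.uncurry_def]
    fun_prop
  have h1 : AEStronglyMeasurable fun z : ℝ × ℝ =>
      ∫ p, cexp (I * ((p.1 + p.2.1) * z.1 + T p * z.2 : ℝ)) • Q p :=
    aestronglyMeasurable_integral_exp_smul hθm hQ.1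
  have h2 : AEStronglyMeasurable (fun z : ℝ × ℝ => Real.exp (-(a * z.2))) halfPlane :=
    Continuous.aestronglyMeasurable (by fun_prop)
  refine ⟨h2.smul h1.restrict,
    (eLpNorm_mono_ae (g := fun z : ℝ × ℝ =>
      ∫ p, cexp (I * ((p.1 + p.2.1) * z.1 + T p * z.2 : ℝ)) • Q p) ?_).trans
      ((eLpNorm_mono_measure _ Measure.restrict_le_self).trans (eLpNorm_two_le ?_))⟩
  · refine ae_restrict_of_forall_mem (measurableSet_lt measurable_const measurable_snd)
      fun z hz => ?_
    have hz' : 0 < z.2 := hz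
    rw [norm_smul, Real.norm_of_nonneg (Real.exp_pos _).le]
    exact mul_le_of_le_one_left (norm_nonneg _) (Real.exp_le_one_iff.2 (by
      rw [neg_nonpos]
      positivity))
  · refine (lintegral_sq_exp_le₂ (Φ := fun p : ℝ × ℝ × ℝ × ℝ => p.1 + p.2.1)
      (Ψ := T) (by fun_prop) hT hQ Metric.isClosed_closedBall.measurableSet hle
      fun η hη p _ => lintegral_closedBall_gaussKernel_mul_le hη p₁ hK hT hdisp (p.1 + p.2.1)
        (T p)).trans (le_of_eq ?_)
    rw [volume_closedBall, ← ENNReal.ofReal_pow (by positivity),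
      ← ENNReal.ofReal_pow (by positivity), ← ENNReal.ofReal_pow (by positivity),
      ← ENNReal.ofReal_mul (by positivity), ← ENNReal.ofReal_mul (by positivity),
      ← ENNReal.ofReal_mul (by positivity), ← ENNReal.ofReal_mul (by positivity),
      ← ENNReal.ofReal_pow (by positivity), mul_pow N, Real.sq_sqrt (by positivity)]
    congr 1
    ring

theorem measurable_freq (γ : ℝ) : Measurable fun p : ℝ × ℝ => freq γ p.1 p.2 := by
  have h1 : Measurable Real.sign := by
    unfold Real.sign
    exact Measurable.ite measurableSet_Iio measurable_const
      (Measurable.ite measurableSet_Ioi measurable_const measurable_const)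
  unfold freq
  fun_prop

/-- The vertical wave number of the inviscid second harmonic, as a function of
`p = (k, k', m, m')`. -/
def harmonicNum (γ : ℝ) (p : ℝ × ℝ × ℝ × ℝ) : ℝ :=
  waveNum γ 1 (freq γ p.1 p.2.2.1 + freq γ p.2.1 p.2.2.2) (p.1 + p.2.1)

theorem measurable_harmonicNum (γ : ℝ) : Measurable (harmonicNum γ) := by
  have h1 : Measurable fun p : ℝ × ℝ × ℝ × ℝ => freq γ p.1 p.2.2.1 :=
    (measurable_freq γ).comp (f := fun p : ℝ × ℝ × ℝ × ℝ => (p.1, p.2.2.1)) (by fun_prop)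
  have h2 : Measurable fun p : ℝ × ℝ × ℝ × ℝ => freq γ p.2.1 p.2.2.2 :=
    (measurable_freq γ).comp (f := fun p : ℝ × ℝ × ℝ × ℝ => (p.2.1, p.2.2.2)) (by fun_prop)
  unfold harmonicNum waveNum
  fun_prop

/-- The error made when replacing the rate `L` by an approximation `z`. -/
theorem norm_exp_sub_exp_le {L z : ℂ} {a D y : ℝ} (ha : 0 < a) (hy : 0 < y) (hz : z.re = a)
    (hL : ‖L - z‖ ≤ D) (hD : D ≤ a / 2) :
    ‖cexp (-(L * y)) - cexp (-(z * y))‖ ≤ 4 * D / a * Real.exp (-(a / 4 * y)) := by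
  have hD0 : 0 ≤ D := (norm_nonneg _).trans hL
  have h1 : cexp (-(L * y)) - cexp (-(z * y)) = cexp (-(z * y)) * (cexp (-((L - z) * y)) - 1) := by
    rw [mul_sub, ← Complex.exp_add, mul_one]
    ring_nf
  have h2 : ‖-((L - z) * y)‖ ≤ D * y := by
    rw [norm_neg, norm_mul, norm_real, Real.norm_of_nonneg hy.le]
    gcongr
  have h3 : ‖cexp (-((L - z) * y)) - 1‖ ≤ D * y * Real.exp (a / 2 * y) := by
    have := norm_exp_sub_sum_le_norm_mul_exp (-((L - z) * y)) 1
    simp only [Finset.range_one, Finset.sum_singleton, pow_zero, Nat.factorial_zero, Nat.cast_one,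
      div_one, pow_one] at this
    refine this.trans ?_
    gcongr
    exact h2.trans (by gcongr)
  have h4 : ‖cexp (-(z * y))‖ = Real.exp (-(a * y)) := by
    rw [norm_exp, neg_re, re_mul_ofReal, hz]
  have h5 : a / 4 * y ≤ Real.exp (a / 4 * y) := (Real.add_one_le_exp _).trans' (by linarith)
  rw [h1, norm_mul, h4]
  calc Real.exp (-(a * y)) * ‖cexp (-((L - z) * y)) - 1‖
      ≤ Real.exp (-(a * y)) * (D * y * Real.exp (a / 2 * y)) := by gcongr
    _ = 4 * D / a * (Real.exp (-(a * y)) * Real.exp (a / 2 * y)) * (a / 4 * y) := by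
        field_simp
    _ ≤ 4 * D / a * (Real.exp (-(a * y)) * Real.exp (a / 2 * y)) * Real.exp (a / 4 * y) := by
        gcongr
    _ = 4 * D / a * Real.exp (-(a / 4 * y)) := by
        rw [mul_assoc, ← Real.exp_add, ← Real.exp_add]
        ring_nf

namespace IsAdmissible

variable {γ ν₀ κ₀ k₁ m₁ σ R A C ε : ℝ} {χ : ℝ → ℝ}

theorem aestronglyMeasurable_integral (h : IsAdmissible γ ν₀ κ₀ k₁ m₁ σ R C ε) (hχ : IsCutoff χ R A)
    (t : ℝ) (j : Fin 3) : AEStronglyMeasurable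
      (fun z : ℝ × ℝ => ∫ p, packet γ ν₀ κ₀ k₁ m₁ χ σ ε t z.1 z.2 j p) halfPlane :=
  (AEStronglyMeasurable.integral_prod_right' (h.aestronglyMeasurable hχ t j)).restrict

/-- The `L²` norm of a packet of waves with rates larger than `b`. -/
theorem normLE_packet (h : IsAdmissible γ ν₀ κ₀ k₁ m₁ σ R C ε) (hχ : IsCutoff χ R A) (t : ℝ)
    (j : Fin 3) {b : ℝ} (hb : 0 < b) (hle : ∀ p ∈ Metric.closedBall (k₁, k₁, m₁, m₁) (R * ε ^ 2),
      b ≤ (rateII γ (ν₀ * ε ^ 6) (κ₀ * ε ^ 6) p.1 p.2.2.1 p.2.1 p.2.2.2 j).re) :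
    NormLE (fun x y => ∫ p, packet γ ν₀ κ₀ k₁ m₁ χ σ ε t x y j p) 2
      (A ^ 4 * C / ε ^ (4 + ampExp j) * √(128 * Real.pi * (R * ε ^ 2) ^ 7 / b)) := by
  have hε := h.eps_pos
  have hR := hχ.radius_pos
  have hA := hχ.bound_pos
  have hC := h.bound_pos
  refine normLE_integral (h.aestronglyMeasurable hχ t j)
    (H := fun y p => packet γ ν₀ κ₀ k₁ m₁ χ σ ε t 0 y j p) (fun x y p _ => ?_)
    (fun y hy => h.integrable_packet hχ t 0 hy.le j) (p₁ := (k₁, k₁, m₁, m₁)) (by positivity)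
    (by positivity) hb fun y hy p => ?_
  · rw [packet_eq γ ν₀ κ₀ k₁ m₁ χ σ ε t x y, packet_eq γ ν₀ κ₀ k₁ m₁ χ σ ε t 0 y, mul_zero,
      ofReal_zero, mul_zero, Complex.exp_zero, one_smul]
  · rw [packet_eq, norm_smul, norm_exp_I_mul_ofReal', one_mul]
    exact h.norm_exp_smul_packet_le hχ t j (fun q hq => norm_exp_rate_le hy.le (hle q hq)) p

/-- The `L²` norm of a packet of waves propagating in the interior. Its rates being equal to
`I * harmonicNum γ p + a` up to an error `D`, the dispersion in both directions is used for the main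
term, while the decay is used for the error term. -/
theorem normLE_packet_of_dispersive (h : IsAdmissible γ ν₀ κ₀ k₁ m₁ σ R C ε) (hχ : IsCutoff χ R A)
    (t : ℝ) {a D K : ℝ} (ha : 0 < a) (hD : 0 ≤ D) (hDa : D ≤ a / 2) (hK : 0 < K)
    (hrate : ∀ p ∈ Metric.closedBall (k₁, k₁, m₁, m₁) (R * ε ^ 2),
      ‖rateII γ (ν₀ * ε ^ 6) (κ₀ * ε ^ 6) p.1 p.2.2.1 p.2.1 p.2.2.2 0 -
        (I * harmonicNum γ p + (a : ℝ))‖ ≤ D)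
    (hdisp : ∀ k k' m x y, (k, k', m, x) ∈ Metric.closedBall (k₁, k₁, m₁, m₁) (R * ε ^ 2) →
      (k, k', m, y) ∈ Metric.closedBall (k₁, k₁, m₁, m₁) (R * ε ^ 2) →
      |x - y| ≤ K * |harmonicNum γ (k, k', m, x) - harmonicNum γ (k, k', m, y)|) :
    NormLE (fun x y => ∫ p, packet γ ν₀ κ₀ k₁ m₁ χ σ ε t x y 0 p) 2
      (A ^ 4 * C / ε ^ 6 * (4 * D / a) * √(128 * Real.pi * (R * ε ^ 2) ^ 7 / (a / 4)) +
        A ^ 4 * C / ε ^ 6 * √(2304 * Real.pi ^ 2 * K * (R * ε ^ 2) ^ 6)) := by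
  have hε := h.eps_pos
  have hR := hχ.radius_pos
  have hA := hχ.bound_pos
  have hC := h.bound_pos
  have hμ := measurable_harmonicNum γ
  have h0 := h.integrable_packet_zero hχ t 0
  set Q : ℝ × ℝ × ℝ × ℝ → State := packet γ ν₀ κ₀ k₁ m₁ χ σ ε t 0 0 0 with hQ
  set L : ℝ × ℝ × ℝ × ℝ → ℂ := fun p =>
    rateII γ (ν₀ * ε ^ 6) (κ₀ * ε ^ 6) p.1 p.2.2.1 p.2.1 p.2.2.2 0 with hL
  set θ : ℝ × ℝ → ℝ × ℝ × ℝ × ℝ → ℝ := fun z p =>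
    (p.1 + p.2.1) * z.1 + -harmonicNum γ p * z.2 with hθ
  have hθm : Measurable (Function.uncurry θ) := by
    simp only [hθ, Function.uncurry_def]
    fun_prop
  have hθi : ∀ z, Integrable fun p => cexp (I * θ z p) • Q p := fun z =>
    integrable_exp_smul (by simp only [hθ]; fun_prop) h0
  -- the error term
  set G : (ℝ × ℝ) × (ℝ × ℝ × ℝ × ℝ) → State := fun q =>
    packet γ ν₀ κ₀ k₁ m₁ χ σ ε t q.1.1 q.1.2 0 q.2 -
      Real.exp (-(a * q.1.2)) • (cexp (I * θ q.1 q.2) • Q q.2) with hG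
  have hGm : AEStronglyMeasurable G := by
    have m1 : AEStronglyMeasurable fun q : (ℝ × ℝ) × (ℝ × ℝ × ℝ × ℝ) => Real.exp (-(a * q.1.2)) :=
      Continuous.aestronglyMeasurable (by fun_prop)
    have m2 : AEStronglyMeasurable fun q : (ℝ × ℝ) × (ℝ × ℝ × ℝ × ℝ) => cexp (I * θ q.1 q.2) := by
      have : Measurable fun q : (ℝ × ℝ) × (ℝ × ℝ × ℝ × ℝ) => θ q.1 q.2 := hθm
      exact Measurable.aestronglyMeasurable (by fun_prop)
    have m3 : AEStronglyMeasurable fun q : (ℝ × ℝ) × (ℝ × ℝ × ℝ × ℝ) => Q q.2 := h0.1.comp_snd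
    exact (h.aestronglyMeasurable hχ t 0).sub (m1.smul (m2.smul m3))
  have hGH : ∀ x y p, G ((x, y), p) = cexp (I * ((p.1 + p.2.1) * x : ℝ)) •
      ((cexp (-(L p * y)) - cexp (-((I * harmonicNum γ p + (a : ℝ)) * y))) • Q p) := by
    intro x y p
    have e1 : Real.exp (-(a * y)) • (cexp (I * θ (x, y) p) • Q p) =
        cexp (I * ((p.1 + p.2.1) * x : ℝ)) •
          (cexp (-((I * harmonicNum γ p + (a : ℝ)) * y)) • Q p) := by
      rw [← Complex.coe_smul, smul_smul, smul_smul, ofReal_exp, ← Complex.exp_add,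
        ← Complex.exp_add]
      congr 2
      simp only [hθ]
      push_cast
      ring
    simp only [hG]
    rw [e1, packet_eq, sub_smul, smul_sub]
  have herr : NormLE (fun x y => ∫ p, G ((x, y), p)) 2
      (A ^ 4 * C / ε ^ 6 * (4 * D / a) * √(128 * Real.pi * (R * ε ^ 2) ^ 7 / (a / 4))) := by
    refine normLE_integral hGm (fun x y p _ => hGH x y p) (fun y hy => ?_)
      (p₁ := (k₁, k₁, m₁, m₁)) (by positivity) (by positivity) (by positivity) fun y hy p => ?_
    · have h1 := (h.integrable_packet hχ t 0 hy.le 0).sub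
        ((hθi (0, y)).smul (Real.exp (-(a * y))))
      refine h1.congr (Eventually.of_forall fun p => ?_)
      have := hGH 0 y p
      rw [mul_zero, ofReal_zero, mul_zero, Complex.exp_zero, one_smul] at this
      exact this
    · have h1 := h.norm_exp_smul_packet_le hχ t 0
        (z := fun p => cexp (-(L p * y)) - cexp (-((I * harmonicNum γ p + (a : ℝ)) * y)))
        (fun q hq => norm_exp_sub_exp_le ha hy (by simp) (hrate q hq) hDa) p
      simpa only [mul_assoc, ampExp, Matrix.cons_val_zero] using h1
  -- the main term
  have hmain : NormLE (fun x y => Real.exp (-(a * y)) • ∫ p, cexp (I * θ (x, y) p) • Q p) 2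
      (A ^ 4 * C / ε ^ 6 * √(2304 * Real.pi ^ 2 * K * (R * ε ^ 2) ^ 6)) :=
    normLE_exp_smul_integral h0 (p₁ := (k₁, k₁, m₁, m₁)) (by positivity) (by positivity) ha.le
      (h.norm_packet_le hχ t 0) hK hμ.neg fun k k' m x y hx hy => by
        rw [neg_sub_neg, abs_sub_comm (harmonicNum γ _)]
        exact hdisp k k' m x y hx hy
  refine (herr.add hmain (by norm_num) (by positivity) (by positivity)).congr fun x y hy => ?_
  have h1 : Integrable fun p => Real.exp (-(a * y)) • (cexp (I * θ (x, y) p) • Q p) :=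
    (hθi (x, y)).smul (Real.exp (-(a * y)))
  simp only [hG]
  rw [integral_sub (h.integrable_packet hχ t x hy.le 0) h1, integral_smul, sub_add_cancel]

end IsAdmissible

/-! ### The estimates of a single packet -/

theorem eventually_nhdsGT_zero {P : ℝ → Prop} : (∀ᶠ ε in 𝓝[>] (0 : ℝ), P ε) ↔
    ∃ ε₀ > 0, ∀ ε, 0 < ε → ε < ε₀ → P ε := by
  rw [(nhdsGT_basis (0 : ℝ)).eventually_iff]
  simp only [Set.mem_Ioo, and_imp]

theorem eventually_closedBall {E : Type*} [NormedAddCommGroup E] {p₁ : E} {R : ℝ}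
    {P : ℝ × E → Prop} (h : ∀ᶠ q in boxFilter p₁ R, P q) :
    ∀ᶠ ε in 𝓝[>] (0 : ℝ), ∀ p ∈ Metric.closedBall p₁ (R * ε ^ 2), P (ε, p) := by
  obtain ⟨ε₀, h0, h1⟩ := eventually_boxFilter.1 h
  exact eventually_nhdsGT_zero.2 ⟨ε₀, h0, fun ε ha hb p hp =>
    h1 ε ha hb p (by rwa [← dist_eq_norm, ← Metric.mem_closedBall])⟩

theorem CriticalData.neg {γ ν₀ κ₀ k₁ m₁ : ℝ} (hd : CriticalData γ ν₀ κ₀ k₁ m₁) :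
    CriticalData γ ν₀ κ₀ (-k₁) (-m₁) :=
  { hd with
    k_ne := neg_ne_zero.2 hd.k_ne
    m_ne := neg_ne_zero.2 hd.m_ne
    rel := by linear_combination -hd.rel }

section Packet

variable {γ ν₀ κ₀ k₁ m₁ R A : ℝ} {χ : ℝ → ℝ}

theorem eventually_isAdmissible (hd : CriticalData γ ν₀ κ₀ k₁ m₁) (R σ : ℝ) :
    ∃ C > 0, ∀ᶠ ε in 𝓝[>] (0 : ℝ), IsAdmissible γ ν₀ κ₀ k₁ m₁ σ R C ε := by
  choose C hC hle using fun j => exists_norm_amplitude_le hd R σ j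
  have hle' : ∀ᶠ ε in 𝓝[>] (0 : ℝ), ∀ j, ∀ p ∈ Metric.closedBall (k₁, k₁, m₁, m₁) (R * ε ^ 2),
      _ := eventually_all.2 fun j => eventually_closedBall (hle j)
  have hpos : 0 < ∑ j, C j := Finset.sum_pos (fun j _ => hC j) Finset.univ_nonempty
  refine ⟨∑ j, C j, hpos, ?_⟩
  filter_upwards [eventually_closedBall (eventually_isRegularPair hd R), hle', self_mem_nhdsWithin]
    with ε h1 h2 h3
  exact ⟨hd.sin_pos, hd.nu_pos, hd.kappa_pos, h3, hpos, h1, fun j p hp => (h2 j p hp).trans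
    (Finset.single_le_sum (fun i _ => (hC i).le) (Finset.mem_univ j))⟩

theorem IsAdmissible.normLE_top {σ C ε : ℝ} (h : IsAdmissible γ ν₀ κ₀ k₁ m₁ σ R C ε)
    (hχ : IsCutoff χ R A) (t : ℝ) (j : Fin 3) :
    NormLE (fun x y => ∫ p, packet γ ν₀ κ₀ k₁ m₁ χ σ ε t x y j p) ⊤
      (16 * A ^ 4 * R ^ 4 * C * (ε ^ 4 / ε ^ ampExp j)) := by
  refine NormLE.top_of_norm_le (h.aestronglyMeasurable_integral hχ t j) fun x y hy => ?_
  have h1 := h.norm_integral_packet_le hχ t x hy.le j (b := 0) fun p hp => (h.re_rate_pos j hp).le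
  rwa [zero_mul, neg_zero, Real.exp_zero, mul_one, mul_div_assoc] at h1

theorem ampExp_of_ne_zero {j : Fin 3} (hj : j ≠ 0) : ampExp j = 4 := by
  fin_cases j
  exacts [(hj rfl).elim, rfl, rfl]

/-- A packet of boundary layers of thickness `ε³`. -/
theorem exists_normLE_layer (hd : CriticalData γ ν₀ κ₀ k₁ m₁) (hχ : IsCutoff χ R A) (σ : ℝ)
    {j : Fin 3} (hj : j ≠ 0) : ∃ C > 0, ∀ᶠ ε in 𝓝[>] (0 : ℝ), ∀ t,
      NormLE (fun x y => ∫ p, packet γ ν₀ κ₀ k₁ m₁ χ σ ε t x y j p) 2 (C * ε ^ (1 / 2 : ℝ)) ∧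
      NormLE (fun x y => ∫ p, packet γ ν₀ κ₀ k₁ m₁ χ σ ε t x y j p) ⊤ C := by
  obtain ⟨C, hC, hadm⟩ := eventually_isAdmissible hd R σ
  obtain ⟨c, hc, hre⟩ := exists_le_re_rate hd R hj
  have hR := hχ.radius_pos
  have hA := hχ.bound_pos
  refine ⟨A ^ 4 * C * √(128 * Real.pi * R ^ 7 / c) + 16 * A ^ 4 * R ^ 4 * C, by positivity, ?_⟩
  filter_upwards [hadm, eventually_closedBall hre, self_mem_nhdsWithin] with ε h h1 hε t
  replace hε : 0 < ε := hε
  constructor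
  · refine (h.normLE_packet hχ t j (b := c / ε ^ 3) (by positivity) fun p hp => ?_).mono ?_
    · rw [div_le_iff₀' (by positivity)]
      exact h1 p hp
    · have e1 : 128 * Real.pi * (R * ε ^ 2) ^ 7 / (c / ε ^ 3) =
          128 * Real.pi * R ^ 7 / c * ((ε ^ 8) ^ 2 * ε) := by
        field_simp
      rw [ampExp_of_ne_zero hj, e1, Real.sqrt_mul (by positivity), Real.sqrt_mul (by positivity),
        Real.sqrt_sq (by positivity), ← Real.sqrt_eq_rpow]
      calc _ = A ^ 4 * C * √(128 * Real.pi * R ^ 7 / c) * √ε := by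
            field_simp
        _ ≤ _ := by
            gcongr
            exact le_add_of_nonneg_right (by positivity)
  · refine (h.normLE_top hχ t j).mono ?_
    rw [ampExp_of_ne_zero hj, div_self (by positivity), mul_one]
    exact le_add_of_nonneg_left (by positivity)

theorem exists_normLE_top_harmonic (hd : CriticalData γ ν₀ κ₀ k₁ m₁) (hχ : IsCutoff χ R A) (σ : ℝ) :
    ∃ C > 0, ∀ᶠ ε in 𝓝[>] (0 : ℝ), ∀ t,
      NormLE (fun x y => ∫ p, packet γ ν₀ κ₀ k₁ m₁ χ σ ε t x y 0 p) ⊤ (C * ε ^ 2) := by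
  obtain ⟨C, hC, hadm⟩ := eventually_isAdmissible hd R σ
  have hR := hχ.radius_pos
  have hA := hχ.bound_pos
  refine ⟨16 * A ^ 4 * R ^ 4 * C, by positivity, ?_⟩
  filter_upwards [hadm, self_mem_nhdsWithin] with ε h hε t
  replace hε : 0 < ε := hε
  refine (h.normLE_top hχ t 0).mono (le_of_eq ?_)
  simp only [ampExp, Matrix.cons_val_zero]
  field_simp

/-- A packet of evanescent waves. -/
theorem exists_normLE_evanescent (hd : CriticalData γ ν₀ κ₀ k₁ m₁) (hχ : IsCutoff χ R A) (σ : ℝ)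
    (hs : 1 / 2 < Real.sin γ) : ∃ C > 0, ∃ c > 0, ∀ᶠ ε in 𝓝[>] (0 : ℝ), ∀ t,
      (∀ x y, 0 ≤ y → ‖∫ p, packet γ ν₀ κ₀ k₁ m₁ χ σ ε t x y 0 p‖ ≤
        C * ε ^ 2 * Real.exp (-(c * y))) ∧
      NormLE (fun x y => ∫ p, packet γ ν₀ κ₀ k₁ m₁ χ σ ε t x y 0 p) 2 (C * ε) := by
  obtain ⟨C, hC, hadm⟩ := eventually_isAdmissible hd R σ
  obtain ⟨hn, hn'⟩ := isNear_boxFilter k₁ m₁ R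
  obtain ⟨c, hc, hre⟩ := hn.exists_le_re hn' hd hs
  have hR := hχ.radius_pos
  have hA := hχ.bound_pos
  refine ⟨A ^ 4 * C * √(128 * Real.pi * R ^ 7 / c) + 16 * A ^ 4 * R ^ 4 * C, by positivity, c, hc,
    ?_⟩
  filter_upwards [hadm, eventually_closedBall hre, self_mem_nhdsWithin] with ε h h1 hε t
  replace hε : 0 < ε := hε
  constructor
  · intro x y hy
    refine (h.norm_integral_packet_le hχ t x hy 0 h1).trans ?_
    simp only [ampExp, Matrix.cons_val_zero]
    calc _ = 16 * A ^ 4 * R ^ 4 * C * ε ^ 2 * Real.exp (-(c * y)) := by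
          field_simp
      _ ≤ _ := by
          gcongr
          exact le_add_of_nonneg_left (by positivity)
  · refine (h.normLE_packet hχ t 0 hc h1).mono ?_
    have e1 : 128 * Real.pi * (R * ε ^ 2) ^ 7 / c =
        128 * Real.pi * R ^ 7 / c * (ε ^ 7) ^ 2 := by
      field_simp
    simp only [ampExp, Matrix.cons_val_zero]
    rw [e1, Real.sqrt_mul (by positivity), Real.sqrt_sq (by positivity)]
    calc _ = A ^ 4 * C * √(128 * Real.pi * R ^ 7 / c) * ε := by
          field_simp
      _ ≤ _ := by
          gcongr
          exact le_add_of_nonneg_right (by positivity)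

/-- The variations of the last coordinate are controlled by those of the vertical wave number of the
second harmonic, uniformly on the support of the packet. -/
theorem exists_le_harmonicNum_sub (hd : CriticalData γ ν₀ κ₀ k₁ m₁) (R : ℝ)
    (hs : Real.sin γ < 1 / 2) : ∃ K > 0, ∀ᶠ ε in 𝓝[>] (0 : ℝ), ∀ k k' m x y,
      (k, k', m, x) ∈ Metric.closedBall (k₁, k₁, m₁, m₁) (R * ε ^ 2) →
      (k, k', m, y) ∈ Metric.closedBall (k₁, k₁, m₁, m₁) (R * ε ^ 2) →
      |x - y| ≤ K * |harmonicNum γ (k, k', m, x) - harmonicNum γ (k, k', m, y)| := by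
  set p₁ : (ℝ × ℝ × ℝ × ℝ) × (ℝ × ℝ × ℝ × ℝ) := ((k₁, k₁, m₁, m₁), (k₁, k₁, m₁, m₁)) with hp₁
  have hc := fun p : (ℝ × ℝ × ℝ × ℝ) × (ℝ × ℝ × ℝ × ℝ) => abs_coord_sub_le p.1 p₁.1
  have hc' := fun p : (ℝ × ℝ × ℝ × ℝ) × (ℝ × ℝ × ℝ × ℝ) => abs_coord_sub_le p.2 p₁.2
  have hl : ∀ p : (ℝ × ℝ × ℝ × ℝ) × (ℝ × ℝ × ℝ × ℝ), ‖p.1 - p₁.1‖ ≤ ‖p - p₁‖ := fun p =>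
    norm_fst_le (p - p₁)
  have hr : ∀ p : (ℝ × ℝ × ℝ × ℝ) × (ℝ × ℝ × ℝ × ℝ), ‖p.2 - p₁.2‖ ≤ ‖p - p₁‖ := fun p =>
    norm_snd_le (p - p₁)
  have hε := tendsto_fst_boxFilter p₁ R
  have n1 : IsNear (boxFilter p₁ R) Prod.fst (fun q => q.2.1.1) (fun q => q.2.1.2.2.1) k₁ m₁ :=
    ⟨hε, isBigO_boxFilter p₁ R (x := fun p => p.1.1) fun p => (hc p).1.trans (hl p),
      isBigO_boxFilter p₁ R (x := fun p => p.1.2.2.1) fun p => (hc p).2.2.1.trans (hl p)⟩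
  have n2 : IsNear (boxFilter p₁ R) Prod.fst (fun q => q.2.1.2.1) (fun q => q.2.1.2.2.2) k₁ m₁ :=
    ⟨hε, isBigO_boxFilter p₁ R (x := fun p => p.1.2.1) fun p => (hc p).2.1.trans (hl p),
      isBigO_boxFilter p₁ R (x := fun p => p.1.2.2.2) fun p => (hc p).2.2.2.trans (hl p)⟩
  have n3 : IsNear (boxFilter p₁ R) Prod.fst (fun q => q.2.1.2.1) (fun q => q.2.2.2.2.2) k₁ m₁ :=
    ⟨hε, n2.isBigO_k,
      isBigO_boxFilter p₁ R (x := fun p => p.2.2.2.2) fun p => (hc' p).2.2.2.trans (hr p)⟩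
  obtain ⟨K, hK, h⟩ := n1.exists_le_waveNum_sub n2 n3 hd hs
  refine ⟨K, hK, ?_⟩
  filter_upwards [eventually_closedBall h] with ε h1 k k' m x y hx hy
  refine h1 ((k, k', m, x), (k, k', m, y)) ?_
  rw [← closedBall_prod_same]
  exact ⟨hx, hy⟩

/-- A packet of propagating waves. -/
theorem exists_normLE_propagating (hd : CriticalData γ ν₀ κ₀ k₁ m₁) (hχ : IsCutoff χ R A) (σ : ℝ)
    (hs : Real.sin γ < 1 / 2) : ∃ C > 0, ∀ᶠ ε in 𝓝[>] (0 : ℝ), ∀ t,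
      NormLE (fun x y => ∫ p, packet γ ν₀ κ₀ k₁ m₁ χ σ ε t x y 0 p) 2 C := by
  obtain ⟨C, hC, hadm⟩ := eventually_isAdmissible hd R σ
  obtain ⟨hn, hn'⟩ := isNear_boxFilter k₁ m₁ R
  obtain ⟨ρ, hρ, hO⟩ := hn.exists_isBigO_rate hn' hd hs
  obtain ⟨D, hD, hle⟩ := hO.exists_pos
  obtain ⟨K, hK, hdisp⟩ := exists_le_harmonicNum_sub hd R hs
  have hR := hχ.radius_pos
  have hA := hχ.bound_pos
  have hsmall : ∀ᶠ ε in 𝓝[>] (0 : ℝ), D * ε ^ 2 ≤ ρ / 2 := by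
    have h1 : Tendsto (fun ε : ℝ => D * ε ^ 2) (𝓝[>] 0) (𝓝 (D * 0 ^ 2)) :=
      ((continuous_const.mul (continuous_pow 2)).tendsto 0).mono_left nhdsWithin_le_nhds
    exact (h1.eventually_lt_const (by simpa using by positivity)).mono fun ε hε => hε.le
  refine ⟨A ^ 4 * C * (4 * D / ρ) * √(128 * Real.pi * R ^ 7 / (ρ / 4)) +
    A ^ 4 * C * √(2304 * Real.pi ^ 2 * K * R ^ 6), by positivity, ?_⟩
  filter_upwards [hadm, eventually_closedBall hle.bound, hdisp, hsmall, self_mem_nhdsWithin]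
    with ε h h1 h2 h3 hε t
  replace hε : 0 < ε := hε
  refine (h.normLE_packet_of_dispersive hχ t (a := ρ * ε ^ 6) (D := D * ε ^ 8) (by positivity)
    (by positivity) ?_ hK (fun p hp => ?_) h2).mono (le_of_eq ?_)
  · calc D * ε ^ 8 = D * ε ^ 2 * ε ^ 6 := by ring
      _ ≤ ρ / 2 * ε ^ 6 := by gcongr
      _ = ρ * ε ^ 6 / 2 := by ring
  · have h4 := h1 p hp
    rwa [Real.norm_of_nonneg (by positivity)] at h4
  · have e1 : 128 * Real.pi * (R * ε ^ 2) ^ 7 / (ρ * ε ^ 6 / 4) =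
        128 * Real.pi * R ^ 7 / (ρ / 4) * (ε ^ 4) ^ 2 := by
      field_simp
    have e2 : 2304 * Real.pi ^ 2 * K * (R * ε ^ 2) ^ 6 =
        2304 * Real.pi ^ 2 * K * R ^ 6 * (ε ^ 6) ^ 2 := by
      ring
    rw [e1, e2, Real.sqrt_mul (by positivity), Real.sqrt_sq (by positivity),
      Real.sqrt_mul (by positivity), Real.sqrt_sq (by positivity)]
    field_simp

/-- The wave vectors, the frequencies and the rates of a packet of propagating waves. -/
theorem exists_rate_le (hd : CriticalData γ ν₀ κ₀ k₁ m₁) (R : ℝ) (hs : Real.sin γ < 1 / 2) :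
    ∃ C > 0, ∀ᶠ ε in 𝓝[>] (0 : ℝ), ∀ p ∈ Metric.closedBall (k₁, k₁, m₁, m₁) (R * ε ^ 2),
      0 < (rateII γ (ν₀ * ε ^ 6) (κ₀ * ε ^ 6) p.1 p.2.2.1 p.2.1 p.2.2.2 0).re ∧
      (rateII γ (ν₀ * ε ^ 6) (κ₀ * ε ^ 6) p.1 p.2.2.1 p.2.1 p.2.2.2 0).re ≤ C * ε ^ 4 ∧
      |p.1 + p.2.1 - 2 * k₁| ≤ C * ε ^ 2 ∧
      |freq γ p.1 p.2.2.1 + freq γ p.2.1 p.2.2.2 - 2 * freq γ k₁ m₁| ≤ C * ε ^ 2 ∧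
      ‖rateII γ (ν₀ * ε ^ 6) (κ₀ * ε ^ 6) p.1 p.2.2.1 p.2.1 p.2.2.2 0 -
        I * waveNum γ 1 (2 * freq γ k₁ m₁) (2 * k₁)‖ ≤ C * ε ^ 2 := by
  obtain ⟨C, hC, hadm⟩ := eventually_isAdmissible hd R 1
  obtain ⟨hn, hn'⟩ := isNear_boxFilter k₁ m₁ R
  obtain ⟨ρ, hρ, hO⟩ := hn.exists_isBigO_rate hn' hd hs
  obtain ⟨D, hD, hle⟩ := hO.exists_pos
  obtain ⟨hsq, hpos⟩ := critical_freq hd.sin_pos hd.cos_pos hd.k_ne hd.rel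
  have hs0 := hd.sin_pos
  have bk : (fun q : ℝ × ℝ × ℝ × ℝ × ℝ => q.2.1 + q.2.2.1 - 2 * k₁) =O[boxFilter (k₁, k₁, m₁, m₁) R]
      fun q => q.1 ^ 2 :=
    (hn.isBigO_k.add hn'.isBigO_k).congr_left fun q => by ring
  have bω : (fun q : ℝ × ℝ × ℝ × ℝ × ℝ => freq γ q.2.1 q.2.2.2.1 + freq γ q.2.2.1 q.2.2.2.2 -
      2 * freq γ k₁ m₁) =O[boxFilter (k₁, k₁, m₁, m₁) R] fun q => q.1 ^ 2 :=
    ((hn.isBigO_freq hd).add (hn'.isBigO_freq hd)).congr_left fun q => by ring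
  have bμ := isBigO_waveNum γ 1 hn.eps bω bk
    (mul_ne_zero two_ne_zero (left_ne_zero_of_mul hpos.ne'))
    (by rw [mul_pow, hsq]; nlinarith) (by rw [mul_pow, hsq]; nlinarith)
  obtain ⟨C', hC', hle'⟩ := (bk.prod_left (bω.prod_left bμ)).exists_pos
  refine ⟨C' + ρ + D, by positivity, ?_⟩
  filter_upwards [hadm, eventually_closedBall hle.bound, eventually_closedBall hle'.bound,
    self_mem_nhdsWithin, (eventually_nhdsGT_zero (P := fun ε => ε ≤ 1)).2
      ⟨1, one_pos, fun ε _ h => h.le⟩] with ε h h1 h2 hε hε1 p hp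
  replace hε : 0 < ε := hε
  have a1 := h1 p hp
  have a2 := h2 p hp
  rw [Real.norm_of_nonneg (by positivity)] at a1 a2
  have a3 := (norm_fst_le _).trans a2
  have a4 := (norm_fst_le _).trans ((norm_snd_le _).trans a2)
  have a5 := (norm_snd_le _).trans ((norm_snd_le _).trans a2)
  rw [Real.norm_eq_abs] at a3 a4
  have p62 : ε ^ 6 ≤ ε ^ 2 := pow_le_pow_of_le_one hε.le hε1 (by norm_num)
  have p82 : ε ^ 8 ≤ ε ^ 2 := pow_le_pow_of_le_one hε.le hε1 (by norm_num)
  have p64 : ε ^ 6 ≤ ε ^ 4 := pow_le_pow_of_le_one hε.le hε1 (by norm_num)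
  have p84 : ε ^ 8 ≤ ε ^ 4 := pow_le_pow_of_le_one hε.le hε1 (by norm_num)
  have hmono : C' * ε ^ 2 ≤ (C' + ρ + D) * ε ^ 2 := by
    gcongr
    linarith
  refine ⟨h.re_rate_pos 0 hp, ?_, a3.trans hmono, a4.trans hmono, ?_⟩
  · have h3 := (re_le_norm _).trans a1
    simp only [sub_re, add_re, ofReal_re, I_mul_re, ofReal_im, neg_zero, zero_add] at h3
    have h4 : 0 ≤ C' * ε ^ 4 := by positivity
    nlinarith
  · set L := rateII γ (ν₀ * ε ^ 6) (κ₀ * ε ^ 6) p.1 p.2.2.1 p.2.1 p.2.2.2 0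
    set μ := waveNum γ 1 (freq γ p.1 p.2.2.1 + freq γ p.2.1 p.2.2.2) (p.1 + p.2.1)
    set μ₁ := waveNum γ 1 (2 * freq γ k₁ m₁) (2 * k₁)
    have e1 : L - I * μ₁ = (L - (I * μ + (ρ * ε ^ 6 : ℝ))) + (I * ((μ - μ₁ : ℝ) : ℂ)) +
        ((ρ * ε ^ 6 : ℝ) : ℂ) := by
      push_cast
      ring
    have e2 : ‖I * ((μ - μ₁ : ℝ) : ℂ)‖ = ‖μ - μ₁‖ := by
      rw [norm_mul, norm_I, one_mul, norm_real]
    rw [e1]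
    refine (norm_add₃_le).trans ?_
    rw [e2, norm_real, Real.norm_of_nonneg (show 0 ≤ ρ * ε ^ 6 by positivity)]
    have a6 : ‖L - (I * μ + (ρ * ε ^ 6 : ℝ))‖ ≤ D * ε ^ 8 := a1
    have a7 : ‖μ - μ₁‖ ≤ C' * ε ^ 2 := a5
    nlinarith

end Packet

/-! ### The group velocity of the second harmonic -/

/-- The vertical wave number of the second harmonic satisfies
`3 sin γ * μ = 2 k₁ (cos γ + 2 √(1 - 4 ω₁ ^ 2))`. -/
theorem waveNum_critical {γ ω₁ k₁ : ℝ} (hs : 0 < Real.sin γ) (hω : ω₁ ^ 2 = Real.sin γ ^ 2) :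
    3 * Real.sin γ * waveNum γ 1 (2 * ω₁) (2 * k₁) =
      2 * k₁ * (Real.cos γ + 2 * √(1 - (2 * ω₁) ^ 2)) := by
  have h1 : |ω₁| = Real.sin γ := by
    rw [← Real.sqrt_sq_eq_abs, hω, Real.sqrt_sq hs.le]
  have h2 : (2 * ω₁) ^ 2 - Real.sin γ ^ 2 = 3 * Real.sin γ ^ 2 := by
    linear_combination 4 * hω
  have h3 := waveNum_mul (γ := γ) (τ := 1) (ω := 2 * ω₁) (k := 2 * k₁) (by rw [h2]; positivity)
  rw [abs_mul, abs_two, h1, h2] at h3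
  apply mul_left_cancel₀ hs.ne'
  linear_combination h3

/-- The second harmonic satisfies the inviscid dispersion relation, and its group velocity points
away from the boundary. -/
theorem exists_hasDerivAt_dispersion {γ ω₁ k₁ : ℝ} (hs : 0 < Real.sin γ) (hc : 0 < Real.cos γ)
    (hs1 : Real.sin γ < 1 / 2) (hω : ω₁ ^ 2 = Real.sin γ ^ 2) (hωk : 0 < ω₁ * k₁) {M : ℝ}
    (hM : M = -waveNum γ 1 (2 * ω₁) (2 * k₁)) :
    (2 * k₁ * Real.cos γ - M * Real.sin γ) / √((2 * k₁) ^ 2 + M ^ 2) = 2 * ω₁ ∧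
    ∃ v > 0, HasDerivAt
      (fun n : ℝ => (2 * k₁ * Real.cos γ - n * Real.sin γ) / √((2 * k₁) ^ 2 + n ^ 2)) v M := by
  have hk : k₁ ≠ 0 := right_ne_zero_of_mul hωk.ne'
  have hN : 0 < (2 * k₁) ^ 2 + M ^ 2 := by positivity
  have hlt : 0 < 1 - (2 * ω₁) ^ 2 := by nlinarith
  set Q : ℝ := √(1 - (2 * ω₁) ^ 2) with hQ
  have hQ0 : 0 < Q := Real.sqrt_pos.2 hlt
  have hQ2 : Q ^ 2 = 1 - (2 * ω₁) ^ 2 := Real.sq_sqrt hlt.le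
  have h1 : 3 * Real.sin γ * M = -(2 * k₁ * (Real.cos γ + 2 * Q)) := by
    rw [hM, mul_neg, waveNum_critical hs hω]
  have hsc := Real.sin_sq_add_cos_sq γ
  set r : ℝ := √((2 * k₁) ^ 2 + M ^ 2) with hr
  have hr0 : 0 < r := Real.sqrt_pos.2 hN
  have hr2 : r ^ 2 = (2 * k₁) ^ 2 + M ^ 2 := Real.sq_sqrt hN.le
  have h2 : 2 * k₁ * Real.cos γ - M * Real.sin γ = 2 * k₁ * (4 * Real.cos γ + 2 * Q) / 3 := by
    linear_combination -h1 / 3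
  refine ⟨?_, ?_⟩
  · have h3 := waveNum_rel (γ := γ) (ω := 2 * ω₁) (k := 2 * k₁) (by nlinarith) (by linarith)
    rw [show waveNum γ 1 (2 * ω₁) (2 * k₁) = -M by rw [hM, neg_neg]] at h3
    have h4 : (2 * ω₁ * r) ^ 2 = (2 * k₁ * Real.cos γ - M * Real.sin γ) ^ 2 := by
      rw [mul_pow, hr2]
      linear_combination h3
    rw [div_eq_iff hr0.ne']
    -- the sign is determined by `0 < ω₁ k₁`
    rcases sq_eq_sq_iff_eq_or_eq_neg.1 h4 with h5 | h5
    · exact h5.symm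
    · exfalso
      rw [h2] at h5
      have h6 : 0 < (2 * ω₁ * r) * (2 * k₁) := by
        rw [show 2 * ω₁ * r * (2 * k₁) = 4 * r * (ω₁ * k₁) by ring]
        positivity
      have h7 : 0 ≤ (2 * k₁ * (4 * Real.cos γ + 2 * Q) / 3) * (2 * k₁) := by
        rw [show 2 * k₁ * (4 * Real.cos γ + 2 * Q) / 3 * (2 * k₁) =
          4 * k₁ ^ 2 * (4 * Real.cos γ + 2 * Q) / 3 by ring]
        positivity
      rw [h5] at h6
      linarith
  · refine ⟨-(2 * k₁) * (2 * k₁ * Real.sin γ + Real.cos γ * M) / r ^ 3, ?_, ?_⟩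
    · refine div_pos ?_ (by positivity)
      -- the derivative has the sign of `Q² + 2 cos γ Q`, which is positive
      have h3 : 3 * Real.sin γ * (-(2 * k₁) * (2 * k₁ * Real.sin γ + Real.cos γ * M)) =
          4 * k₁ ^ 2 * (Q ^ 2 + 2 * Real.cos γ * Q) := by
        linear_combination -(2 * k₁) * Real.cos γ * h1 - 4 * k₁ ^ 2 * hQ2 +
          4 * k₁ ^ 2 * hsc + 16 * k₁ ^ 2 * hω
      have h4 : 0 < 4 * k₁ ^ 2 * (Q ^ 2 + 2 * Real.cos γ * Q) := by positivity
      rw [← h3] at h4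
      exact pos_of_mul_pos_right h4 (by positivity)
    · have d1 : HasDerivAt (fun n : ℝ => 2 * k₁ * Real.cos γ - n * Real.sin γ) (-Real.sin γ) M := by
        simpa using ((hasDerivAt_id M).mul_const (Real.sin γ)).const_sub (2 * k₁ * Real.cos γ)
      have d2 : HasDerivAt (fun n : ℝ => √((2 * k₁) ^ 2 + n ^ 2)) (2 * M / (2 * r)) M := by
        have : HasDerivAt (fun n : ℝ => (2 * k₁) ^ 2 + n ^ 2) (2 * M) M := by
          simpa using ((hasDerivAt_id M).pow 2).const_add ((2 * k₁) ^ 2)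
        exact this.sqrt hN.ne'
      refine (d1.div d2 hr0.ne').congr_deriv ?_
      rw [← hr]
      field_simp
      linear_combination -Real.sin γ * hr2

theorem waveNum_neg (γ τ ω k : ℝ) : waveNum γ τ (-ω) (-k) = -waveNum γ τ ω k := by
  unfold waveNum
  rw [abs_neg, neg_sq]
  ring

/-! ### Superposition of the two packets -/

section Superposition

variable {γ ν₀ κ₀ k₀ m₀ σ R A C₁ C₂ ε : ℝ} {χ : ℝ → ℝ}

theorem criticalData_of_relation {γ ν₀ κ₀ k₀ m₀ : ℝ} (hγ0 : 0 < γ) (hγ1 : γ < Real.pi / 2)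
    (hγ2 : Real.cos γ ^ 2 ≠ Real.sin γ ^ 2) (hν : 0 < ν₀) (hκ : 0 < κ₀) (hk : k₀ ≠ 0)
    (hcrit : (k₀ * Real.cos γ - m₀ * Real.sin γ) ^ 2 / (k₀ ^ 2 + m₀ ^ 2) = Real.sin γ ^ 2) :
    CriticalData γ ν₀ κ₀ k₀ m₀ := by
  have hrel := critical_relation hk hcrit
  refine ⟨Real.sin_pos_of_pos_of_lt_pi hγ0 (by linarith [Real.pi_pos]),
    Real.cos_pos_of_mem_Ioo ⟨by linarith [Real.pi_pos], hγ1⟩, hν, hκ, hk, ?_, hrel⟩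
  rintro rfl
  rw [mul_zero] at hrel
  exact mul_ne_zero hk (sub_ne_zero.2 hγ2) hrel.symm

/-- A wave vector in the support of the weight is close to one of the two critical ones. -/
theorem IsCutoff.mem_closedBall_or (hχ : IsCutoff χ R A) (hε : 0 < ε) {k m k' m' : ℝ}
    (h : weightII k₀ m₀ χ ε k m k' m' ≠ 0) :
    ((k, k', m, m') : ℝ × ℝ × ℝ × ℝ) ∈ Metric.closedBall (-k₀, -k₀, -m₀, -m₀) (R * ε ^ 2) ∨
      ((k, k', m, m') : ℝ × ℝ × ℝ × ℝ) ∈ Metric.closedBall (k₀, k₀, m₀, m₀) (R * ε ^ 2) := by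
  have h1 := weightII_eq k₀ m₀ χ ε (k, k', m, m')
  by_cases h2 : packetWeight χ ε (-k₀) (-m₀) (k, k', m, m') = 0
  · right
    refine hχ.mem_closedBall hε fun h3 => h ?_
    rw [h2, h3, add_zero] at h1
    exact h1
  · exact Or.inl (hχ.mem_closedBall hε h2)

theorem integral_integrandII (h₁ : IsAdmissible γ ν₀ κ₀ (-k₀) (-m₀) σ R C₁ ε)
    (h₂ : IsAdmissible γ ν₀ κ₀ k₀ m₀ σ R C₂ ε) (hχ : IsCutoff χ R A) (t x : ℝ) {y : ℝ}
    (hy : 0 ≤ y) (j : Fin 3) :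
    Integrable (integrandII γ ν₀ κ₀ k₀ m₀ χ σ ε t x y j) ∧
      ∫ p, integrandII γ ν₀ κ₀ k₀ m₀ χ σ ε t x y j p =
        (∫ p, packet γ ν₀ κ₀ (-k₀) (-m₀) χ σ ε t x y j p) +
          ∫ p, packet γ ν₀ κ₀ k₀ m₀ χ σ ε t x y j p := by
  have i1 := h₁.integrable_packet hχ t x hy j
  have i2 := h₂.integrable_packet hχ t x hy j
  rw [← integral_add i1 i2, show integrandII γ ν₀ κ₀ k₀ m₀ χ σ ε t x y j = fun p =>
    packet γ ν₀ κ₀ (-k₀) (-m₀) χ σ ε t x y j p + packet γ ν₀ κ₀ k₀ m₀ χ σ ε t x y j p from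
      funext fun p => integrandII_eq ..]
  exact ⟨i1.add i2, rfl⟩

theorem normLE_integrandII (h₁ : IsAdmissible γ ν₀ κ₀ (-k₀) (-m₀) σ R C₁ ε)
    (h₂ : IsAdmissible γ ν₀ κ₀ k₀ m₀ σ R C₂ ε) (hχ : IsCutoff χ R A) {t : ℝ} {j : Fin 3}
    {q : ENNReal} (hq : 1 ≤ q) {B₁ B₂ : ℝ} (hB₁ : 0 ≤ B₁) (hB₂ : 0 ≤ B₂)
    (n₁ : NormLE (fun x y => ∫ p, packet γ ν₀ κ₀ (-k₀) (-m₀) χ σ ε t x y j p) q B₁)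
    (n₂ : NormLE (fun x y => ∫ p, packet γ ν₀ κ₀ k₀ m₀ χ σ ε t x y j p) q B₂) :
    NormLE (fun x y => ∫ p, integrandII γ ν₀ κ₀ k₀ m₀ χ σ ε t x y j p) q (B₁ + B₂) :=
  (n₁.add n₂ hq hB₁ hB₂).congr fun x _ hy => (integral_integrandII h₁ h₂ hχ t x hy.le j).2.symm

theorem eventually_isAdmissible_pair (hd : CriticalData γ ν₀ κ₀ k₀ m₀) (R σ : ℝ) :
    ∃ C₁ C₂, ∀ᶠ ε in 𝓝[>] (0 : ℝ), IsAdmissible γ ν₀ κ₀ (-k₀) (-m₀) σ R C₁ ε ∧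
      IsAdmissible γ ν₀ κ₀ k₀ m₀ σ R C₂ ε := by
  obtain ⟨C₁, -, h₁⟩ := eventually_isAdmissible hd.neg R σ
  obtain ⟨C₂, -, h₂⟩ := eventually_isAdmissible hd R σ
  exact ⟨C₁, C₂, h₁.and h₂⟩

theorem eventually_modesWellDefined (hd : CriticalData γ ν₀ κ₀ k₀ m₀) (hχ : IsCutoff χ R A) :
    ∀ᶠ ε in 𝓝[>] (0 : ℝ), ModesWellDefined γ ν₀ κ₀ k₀ m₀ χ ε := by
  filter_upwards [eventually_closedBall (eventually_wellDefined hd.neg R),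
    eventually_closedBall (eventually_wellDefined hd R), self_mem_nhdsWithin] with ε h₁ h₂ hε
  intro k m k' m' hw
  rcases hχ.mem_closedBall_or hε hw with hp | hp
  · obtain ⟨a1, a2, a3, -, a4⟩ := h₁ _ hp
    exact ⟨a1, a2, a3, a4⟩
  · obtain ⟨a1, a2, a3, -, a4⟩ := h₂ _ hp
    exact ⟨a1, a2, a3, a4⟩

theorem exists_normLE_layer_integrandII (hd : CriticalData γ ν₀ κ₀ k₀ m₀) (hχ : IsCutoff χ R A)
    (σ : ℝ) {j : Fin 3} (hj : j ≠ 0) : ∃ C > 0, ∀ᶠ ε in 𝓝[>] (0 : ℝ), ∀ t,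
      NormLE (fun x y => ∫ p, integrandII γ ν₀ κ₀ k₀ m₀ χ σ ε t x y j p) 2 (C * ε ^ (1 / 2 : ℝ)) ∧
      NormLE (fun x y => ∫ p, integrandII γ ν₀ κ₀ k₀ m₀ χ σ ε t x y j p) ⊤ C := by
  obtain ⟨D₁, D₂, hadm⟩ := eventually_isAdmissible_pair hd R σ
  obtain ⟨C₁, hC₁, h₁⟩ := exists_normLE_layer hd.neg hχ σ hj
  obtain ⟨C₂, hC₂, h₂⟩ := exists_normLE_layer hd hχ σ hj
  refine ⟨C₁ + C₂, by positivity, ?_⟩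
  filter_upwards [hadm, h₁, h₂, self_mem_nhdsWithin] with ε hadm h₁ h₂ hε t
  have hε' : 0 < ε := hε
  rw [add_mul]
  exact ⟨normLE_integrandII hadm.1 hadm.2 hχ (by norm_num) (by positivity) (by positivity)
      (h₁ t).1 (h₂ t).1,
    normLE_integrandII hadm.1 hadm.2 hχ le_top hC₁.le hC₂.le (h₁ t).2 (h₂ t).2⟩

/-- The boundary layer corrector. -/
theorem exists_normLE_layerII (hd : CriticalData γ ν₀ κ₀ k₀ m₀) (hχ : IsCutoff χ R A) (σ : ℝ) :
    ∃ C > 0, ∀ᶠ ε in 𝓝[>] (0 : ℝ), ∀ δ t, 0 < δ →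
      NormLE (layerII γ ν₀ κ₀ k₀ m₀ χ σ ε δ t) 2 (C * (δ * ε ^ (1 / 2 : ℝ))) ∧
      NormLE (layerII γ ν₀ κ₀ k₀ m₀ χ σ ε δ t) ⊤ (C * δ) := by
  obtain ⟨C₁, hC₁, h₁⟩ := exists_normLE_layer_integrandII hd hχ σ (j := 1) (by decide)
  obtain ⟨C₂, hC₂, h₂⟩ := exists_normLE_layer_integrandII hd hχ σ (j := 2) (by decide)
  refine ⟨C₁ + C₂, by positivity, ?_⟩
  filter_upwards [h₁, h₂, self_mem_nhdsWithin] with ε h₁ h₂ hε δ t hδ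
  have hε' : 0 < ε := hε
  have e : layerII γ ν₀ κ₀ k₀ m₀ χ σ ε δ t = fun x y =>
      δ • ((∫ p, integrandII γ ν₀ κ₀ k₀ m₀ χ σ ε t x y 1 p) +
        ∫ p, integrandII γ ν₀ κ₀ k₀ m₀ χ σ ε t x y 2 p) := by
    funext x y
    rw [layerII, Finset.sum_pair (by decide)]
  rw [e]
  exact ⟨(((h₁ t).1.add (h₂ t).1 (by norm_num) (by positivity) (by positivity)).const_smul
      hδ.le).mono (le_of_eq (by ring)),
    (((h₁ t).2.add (h₂ t).2 le_top hC₁.le hC₂.le).const_smul hδ.le).mono (le_of_eq (by ring))⟩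

theorem exists_normLE_top_secondHarmonic (hd : CriticalData γ ν₀ κ₀ k₀ m₀) (hχ : IsCutoff χ R A)
    (σ : ℝ) : ∃ C > 0, ∀ᶠ ε in 𝓝[>] (0 : ℝ), ∀ δ t, 0 < δ →
      NormLE (secondHarmonic γ ν₀ κ₀ k₀ m₀ χ σ ε δ t) ⊤ (C * (δ * ε ^ 2)) := by
  obtain ⟨D₁, D₂, hadm⟩ := eventually_isAdmissible_pair hd R σ
  obtain ⟨C₁, hC₁, h₁⟩ := exists_normLE_top_harmonic hd.neg hχ σ
  obtain ⟨C₂, hC₂, h₂⟩ := exists_normLE_top_harmonic hd hχ σ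
  refine ⟨C₁ + C₂, by positivity, ?_⟩
  filter_upwards [hadm, h₁, h₂] with ε hadm h₁ h₂ δ t hδ
  exact ((normLE_integrandII hadm.1 hadm.2 hχ le_top (by positivity) (by positivity) (h₁ t)
    (h₂ t)).const_smul hδ.le).mono (le_of_eq (by ring))

/-- The second harmonic in the evanescent case. -/
theorem exists_secondHarmonic_evanescent (hd : CriticalData γ ν₀ κ₀ k₀ m₀) (hχ : IsCutoff χ R A)
    (σ : ℝ) (hs : 1 / 2 < Real.sin γ) :
    ∃ C > 0, ∃ c > 0, ∀ᶠ ε in 𝓝[>] (0 : ℝ), ∀ δ t, 0 < δ →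
      (∀ x y : ℝ, 0 ≤ y → ‖secondHarmonic γ ν₀ κ₀ k₀ m₀ χ σ ε δ t x y‖ ≤
        C * (δ * ε ^ 2) * Real.exp (-(c * y))) ∧
      NormLE (secondHarmonic γ ν₀ κ₀ k₀ m₀ χ σ ε δ t) 2 (C * (δ * ε)) := by
  obtain ⟨D₁, D₂, hadm⟩ := eventually_isAdmissible_pair hd R σ
  obtain ⟨C₁, hC₁, c₁, hc₁, h₁⟩ := exists_normLE_evanescent hd.neg hχ σ hs
  obtain ⟨C₂, hC₂, c₂, hc₂, h₂⟩ := exists_normLE_evanescent hd hχ σ hs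
  refine ⟨C₁ + C₂, by positivity, min c₁ c₂, lt_min hc₁ hc₂, ?_⟩
  filter_upwards [hadm, h₁, h₂, self_mem_nhdsWithin] with ε hadm h₁ h₂ hε δ t hδ
  have hε' : 0 < ε := hε
  constructor
  · intro x y hy
    rw [secondHarmonic, (integral_integrandII hadm.1 hadm.2 hχ t x hy 0).2, norm_smul,
      Real.norm_of_nonneg hδ.le]
    calc δ * ‖(∫ p, packet γ ν₀ κ₀ (-k₀) (-m₀) χ σ ε t x y 0 p) +
          ∫ p, packet γ ν₀ κ₀ k₀ m₀ χ σ ε t x y 0 p‖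
        ≤ δ * (C₁ * ε ^ 2 * Real.exp (-(min c₁ c₂ * y)) +
            C₂ * ε ^ 2 * Real.exp (-(min c₁ c₂ * y))) := by
          gcongr
          refine norm_add_le_of_le (((h₁ t).1 x y hy).trans ?_) (((h₂ t).1 x y hy).trans ?_)
          · gcongr
            exact min_le_left _ _
          · gcongr
            exact min_le_right _ _
      _ = _ := by ring
  · exact ((normLE_integrandII hadm.1 hadm.2 hχ (by norm_num) (by positivity) (by positivity)
      (h₁ t).2 (h₂ t).2).const_smul hδ.le).mono (le_of_eq (by ring))

/-- The second harmonic in the propagating case. -/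
theorem exists_normLE_secondHarmonic (hd : CriticalData γ ν₀ κ₀ k₀ m₀) (hχ : IsCutoff χ R A)
    (σ : ℝ) (hs : Real.sin γ < 1 / 2) : ∃ C > 0, ∀ᶠ ε in 𝓝[>] (0 : ℝ), ∀ δ t, 0 < δ →
      NormLE (secondHarmonic γ ν₀ κ₀ k₀ m₀ χ σ ε δ t) 2 (C * δ) := by
  obtain ⟨D₁, D₂, hadm⟩ := eventually_isAdmissible_pair hd R σ
  obtain ⟨C₁, hC₁, h₁⟩ := exists_normLE_propagating hd.neg hχ σ hs
  obtain ⟨C₂, hC₂, h₂⟩ := exists_normLE_propagating hd hχ σ hs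
  refine ⟨C₁ + C₂, by positivity, ?_⟩
  filter_upwards [hadm, h₁, h₂] with ε hadm h₁ h₂ δ t hδ
  exact ((normLE_integrandII hadm.1 hadm.2 hχ (by norm_num) hC₁.le hC₂.le (h₁ t)
    (h₂ t)).const_smul hδ.le).mono (le_of_eq (by ring))

/-- The propagating second harmonic. The convention `exp (-Λ y)` makes `M` the opposite of the wave
number `μ` of the rate `Λ ≈ i μ`. The frequencies and the wave numbers change sign between the
packets around `(k₀, m₀)` and `(-k₀, -m₀)`. -/
theorem isOutgoingPacket (hd : CriticalData γ ν₀ κ₀ k₀ m₀) (hχ : IsCutoff χ R A)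
    (hs : Real.sin γ < 1 / 2) : IsOutgoingPacket γ ν₀ κ₀ k₀ m₀ χ := by
  obtain ⟨hsq, hpos⟩ := critical_freq hd.sin_pos hd.cos_pos hd.k_ne hd.rel
  obtain ⟨h1, v, hv, h2⟩ := exists_hasDerivAt_dispersion hd.sin_pos hd.cos_pos hs hsq hpos rfl
  obtain ⟨C₁, hC₁, h₁⟩ := exists_rate_le hd.neg R hs
  obtain ⟨C₂, hC₂, h₂⟩ := exists_rate_le hd R hs
  obtain ⟨ε₀, hε₀, hε⟩ := eventually_nhdsGT_zero.1 (h₁.and h₂)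
  refine ⟨1, -waveNum γ 1 (2 * freq γ k₀ m₀) (2 * k₀), v, Or.inl rfl, hv, ?_, ?_, C₁ + C₂,
    by positivity, ε₀, hε₀, fun ε he1 he2 k m k' m' hw => ?_⟩
  · rw [one_mul, h1]
  · simpa only [one_mul] using h2
  · obtain ⟨g₁, g₂⟩ := hε ε he1 he2
    have hl : ∀ n : ℕ, C₁ * ε ^ n ≤ (C₁ + C₂) * ε ^ n := fun n => by
      gcongr
      linarith
    have hr : ∀ n : ℕ, C₂ * ε ^ n ≤ (C₁ + C₂) * ε ^ n := fun n => by
      gcongr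
      linarith
    rcases hχ.mem_closedBall_or he1 hw with hp | hp
    · obtain ⟨a1, a2, a3, a4, a5⟩ := g₁ _ hp
      rw [freq_neg, mul_neg] at a4 a5
      rw [mul_neg] at a3 a5
      rw [waveNum_neg] at a5
      refine ⟨a1, a2.trans (hl 4), -1, Or.inr rfl, ?_, ?_, ?_⟩
      · rw [neg_one_mul]
        exact a3.trans (hl 2)
      · rw [neg_one_mul]
        exact a4.trans (hl 2)
      · rw [neg_one_mul, neg_neg, ← mul_neg, ← ofReal_neg]
        exact a5.trans (hl 2)
    · obtain ⟨a1, a2, a3, a4, a5⟩ := g₂ _ hp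
      refine ⟨a1, a2.trans (hr 4), 1, Or.inl rfl, ?_, ?_, ?_⟩
      · rw [one_mul]
        exact a3.trans (hr 2)
      · rw [one_mul]
        exact a4.trans (hr 2)
      · rw [one_mul, ofReal_neg, mul_neg, neg_neg]
        exact a5.trans (hr 2)

end Superposition

end NearCritical

end

theorem mainTheorem7 (γ ν₀ κ₀ k₀ m₀ σ : ℝ) (χ : ℝ → ℝ)
    (hγ0 : 0 < γ) (hγ1 : γ < Real.pi / 2) (hγ2 : Real.cos γ ^ 2 ≠ Real.sin γ ^ 2)
    (hν : 0 < ν₀) (hκ : 0 < κ₀) (hk : k₀ ≠ 0)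
    (hcrit : (k₀ * Real.cos γ - m₀ * Real.sin γ) ^ 2 / (k₀ ^ 2 + m₀ ^ 2) = Real.sin γ ^ 2)
    (hχ : ContDiff ℝ (⊤ : ℕ∞) χ) (hχc : HasCompactSupport χ) (hσ : σ = 1 ∨ σ = -1) :
    -- the correctors are well defined for small `ε`
    (∃ ε₀ > 0, ∀ ε : ℝ, 0 < ε → ε < ε₀ →
      NearCritical.ModesWellDefined γ ν₀ κ₀ k₀ m₀ χ ε ∧
      ∀ t x y : ℝ, 0 ≤ y → ∀ j : Fin 3,
        MeasureTheory.Integrable (NearCritical.integrandII γ ν₀ κ₀ k₀ m₀ χ σ ε t x y j)) ∧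
    -- the boundary layer corrector
    (∃ C > 0, ∃ ε₀ > 0, ∀ ε δ t : ℝ, 0 < ε → ε < ε₀ → 0 < δ →
      NearCritical.NormLE (NearCritical.layerII γ ν₀ κ₀ k₀ m₀ χ σ ε δ t) 2
        (C * (δ * ε ^ (1 / 2 : ℝ))) ∧
      NearCritical.NormLE (NearCritical.layerII γ ν₀ κ₀ k₀ m₀ χ σ ε δ t) ⊤ (C * δ)) ∧
    -- the second harmonic, evanescent case
    (1 / 2 < Real.sin γ →
      ∃ C > 0, ∃ c > 0, ∃ ε₀ > 0, ∀ ε δ t : ℝ, 0 < ε → ε < ε₀ → 0 < δ →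
        (∀ x y : ℝ, 0 ≤ y →
          ‖NearCritical.secondHarmonic γ ν₀ κ₀ k₀ m₀ χ σ ε δ t x y‖ ≤
            C * (δ * ε ^ 2) * Real.exp (-(c * y))) ∧
        NearCritical.NormLE (NearCritical.secondHarmonic γ ν₀ κ₀ k₀ m₀ χ σ ε δ t) 2
          (C * (δ * ε)) ∧
        NearCritical.NormLE (NearCritical.secondHarmonic γ ν₀ κ₀ k₀ m₀ χ σ ε δ t) ⊤
          (C * (δ * ε ^ 2))) ∧
    -- the second harmonic, propagating case
    (Real.sin γ < 1 / 2 →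
      NearCritical.IsOutgoingPacket γ ν₀ κ₀ k₀ m₀ χ ∧
      ∃ C > 0, ∃ ε₀ > 0, ∀ ε δ t : ℝ, 0 < ε → ε < ε₀ → 0 < δ →
        NearCritical.NormLE (NearCritical.secondHarmonic γ ν₀ κ₀ k₀ m₀ χ σ ε δ t) 2
          (C * δ) ∧
        NearCritical.NormLE (NearCritical.secondHarmonic γ ν₀ κ₀ k₀ m₀ χ σ ε δ t) ⊤
          (C * (δ * ε ^ 2))) := by
  have hd := NearCritical.criticalData_of_relation hγ0 hγ1 hγ2 hν hκ hk hcrit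
  obtain ⟨R, A, hcut⟩ := NearCritical.exists_isCutoff hχ.continuous hχc
  obtain ⟨Ct, hCt, htop⟩ := NearCritical.exists_normLE_top_secondHarmonic hd hcut σ
  refine ⟨?_, ?_, fun hs => ?_, fun hs => ⟨NearCritical.isOutgoingPacket hd hcut hs, ?_⟩⟩
  · obtain ⟨C₁, C₂, hadm⟩ := NearCritical.eventually_isAdmissible_pair hd R σ
    obtain ⟨ε₀, hε₀, h⟩ := NearCritical.eventually_nhdsGT_zero.1
      ((NearCritical.eventually_modesWellDefined hd hcut).and hadm)
    exact ⟨ε₀, hε₀, fun ε h1 h2 => ⟨(h ε h1 h2).1, fun t x y hy j =>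
      (NearCritical.integral_integrandII (h ε h1 h2).2.1 (h ε h1 h2).2.2 hcut t x hy j).1⟩⟩
  · obtain ⟨C, hC, hlayer⟩ := NearCritical.exists_normLE_layerII hd hcut σ
    obtain ⟨ε₀, hε₀, h⟩ := NearCritical.eventually_nhdsGT_zero.1 hlayer
    exact ⟨C, hC, ε₀, hε₀, fun ε δ t h1 h2 hδ => h ε h1 h2 δ t hδ⟩
  · obtain ⟨C, hC, c, hc, hev⟩ := NearCritical.exists_secondHarmonic_evanescent hd hcut σ hs
    obtain ⟨ε₀, hε₀, h⟩ := NearCritical.eventually_nhdsGT_zero.1 (hev.and htop)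
    refine ⟨C + Ct, by positivity, c, hc, ε₀, hε₀, fun ε δ t h1 h2 hδ => ?_⟩
    obtain ⟨g1, g2⟩ := h ε h1 h2
    refine ⟨fun x y hy => ((g1 δ t hδ).1 x y hy).trans ?_, (g1 δ t hδ).2.mono ?_,
      (g2 δ t hδ).mono ?_⟩
    · gcongr
      exact le_add_of_nonneg_right hCt.le
    · gcongr
      exact le_add_of_nonneg_right hCt.le
    · gcongr
      exact le_add_of_nonneg_left hC.le
  · obtain ⟨C, hC, hprop⟩ := NearCritical.exists_normLE_secondHarmonic hd hcut σ hs
    obtain ⟨ε₀, hε₀, h⟩ := NearCritical.eventually_nhdsGT_zero.1 (hprop.and htop)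
    refine ⟨C + Ct, by positivity, ε₀, hε₀, fun ε δ t h1 h2 hδ => ?_⟩
    obtain ⟨g1, g2⟩ := h ε h1 h2
    refine ⟨(g1 δ t hδ).mono ?_, (g2 δ t hδ).mono ?_⟩
    · gcongr
      exact le_add_of_nonneg_right hCt.le
    · gcongr
      exact le_add_of_nonneg_left hC.le
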